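/- Let $a,b\in\mathbb R$ satisfy $0<a+b<2$ and $-1<a-b<1$. Write $\dot{\mathbb C}=\mathbb C\setminus\{0,1\}$, and for complex $\alpha,\alpha'$ with $\alpha-\alpha'\in\mathbb Z$ put $z^{\alpha|\alpha'}=z^{\alpha}\bar z^{\,\alpha'}=|z|^{\alpha+\alpha'}(z/|z|)^{\alpha-\alpha'}$ and $\Gamma^{\mathbb C}(\alpha|\alpha')=i^{\alpha-\alpha'}\Gamma(\alpha)/\Gamma(1-\alpha')=i^{\alpha'-\alpha}\Gamma(\alpha')/\Gamma(1-\alpha)$. Pairs $\alpha|\alpha'$ are added componentwise. Let $\Lambda$ be the set of pairs $\lambda|{-\bar\lambda}$ with $\lambda=\frac12(k+is)$, $k\in\mathbb Z$, $s\in\mathbb R$ (so $\Lambda\simeq\mathbb Z\times\mathbb R$), with the measure $\int_\Lambda\varphi(\lambda)\,\tilde d\lambda=\sum_{k\in\mathbb Z}\int_{\mathbb R}\varphi(\frac{k+is}2)\,ds$. For $\lambda\in\Lambda\setminus\{0\}$ and $z\in\dot{\mathbb C}$ let $$\mathcal K_{a,b}(z,\lambda)=\frac1{\Gamma^{\mathbb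 C}(a+b|a+b)}\,{}_2F_1^{\mathbb C}\!\left[\begin{matrix}a+\lambda|a-\bar\lambda,\ a-\lambda|a+\bar\lambda\\ a+b|a+b\end{matrix};z\right],$$ that is, for $0<a,b<1$, $$\mathcal K_{a,b}(z,\lambda)=\frac{1}{\pi\,\Gamma^{\mathbb C}(a-\lambda|a+\bar\lambda)\,\Gamma^{\mathbb C}(b+\lambda|b-\bar\lambda)}\int_{\mathbb C}t^{a-\lambda-1|a+\bar\lambda-1}(1-t)^{b+\lambda-1|b-\bar\lambda-1}(1-zt)^{-a-\lambda|-a+\bar\lambda}\,d^2t,$$ and for the remaining $(a,b)$ the value at $(a,b)$ of the holomorphic continuation of this expression in $(a,b)$ to the complex domain $\{(a,b)\in\mathbb C^2: 0<\mathrm{Re}(a+b)<2,\ -1<\mathrm{Re}(a-b)<1\}$ with the points removed at which one of the four pairs $a\pm\lambda|a\mp\bar\lambda$, $b\pm\lambda|b\mp\bar\lambda$ consists of two positive integers. Let $$\varkappa_{a,b}(\lambda)=\frac1{4\pi^2}\bigl|\lambda\,\Gamma^{\mathbb C}(a-\lambda|a+\bar\lambda)\,\Gamma^{\mathbb C}(b+\lambda|b-\bar\lambda)\bigr|^2,\qquad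 J^*_{a,b}F(z)=\int_\Lambda F(\lambda)\,\mathcal K_{a,b}(z,\lambda)\,\varkappa_{a,b}(\lambda)\,\tilde d\lambda .$$ **Theorem.** Let $F$ be a smooth compactly supported function on $\Lambda$ which is even ($F(-\lambda)=F(\lambda)$) and vanishes in a neighborhood of $0|0$. Then $J^*_{a,b}F$ is well defined on $\dot{\mathbb C}$ (for all $z\in\dot{\mathbb C}$ and $\lambda\in\Lambda\setminus\{0\}$ the continuation defining the kernel exists, and the integrand is absolutely integrable in $s$ for each $z\in\dot{\mathbb C}$ and each $k$, only finitely many $k$ contributing), and $J^*_{a,b}F$ belongs to the space $\mathcal R_{a,b}$, i.e. $f=J^*_{a,b}F$ lies in $L^2\bigl(\mathbb C,|z|^{2a+2b-2}|1-z|^{2a-2b}\,d^2z\bigr)$, is $C^\infty$ on $\dot{\mathbb C}$, and 1. in a punctured neighborhood of $z=0$, $f(z)=\alpha(z)+\beta(z)|z|^{2-2a-2b}$ if $a+b\ne1$, and $f(z)=\alpha(z)+\beta(z)\ln|z|$ if $a+b=1$, where $\alpha,\beta$ are $C^\infty$ near $0$; 2. in a punctured neighborhood of $z=1$, $f(z)=\gamma(z)+\delta(z)|z-1|^{2b-2a}$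 if $a\ne b$, and $f(z)=\gamma(z)+\delta(z)\ln|z-1|$ if $a=b$, where $\gamma,\delta$ are $C^\infty$ near $1$; 3. for all integers $p,q,N\ge0$, $\ \dfrac{\partial^{p+q}f}{\partial z^p\,\partial\bar z^q}=O\bigl(|z|^{-2a-p-q}(\ln|z|)^{-N}\bigr)$ as $z\to\infty$. -/

import Mathlib

open scoped ContDiff Topology

noncomputable section

namespace ComplexHypergeometric

/-- The group of pairs `a|a'` of complex numbers with `a - a' ∈ ℤ`.
The pair `a|a'` is stored as `(k, σ) = (a - a', a + a')`, so that
`a = (k + σ) / 2`, `a' = (-k + σ) / 2`, and addition of pairs is addition in `ℤ × ℂ`. -/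
abbrev ExpPair : Type := ℤ × ℂ

/-- The first member `a` of the pair `a|a'`. -/
def ExpPair.fst' (p : ExpPair) : ℂ := ((p.1 : ℂ) + p.2) / 2

/-- The second member `a'` of the pair `a|a'`. -/
def ExpPair.snd' (p : ExpPair) : ℂ := (-(p.1 : ℂ) + p.2) / 2

/-- The pair `α|α` for a complex number `α`. -/
def diagPair (α : ℂ) : ExpPair := (0, 2 * α)

/-- The pair `λ|-conj λ` for `λ = (k + i s) / 2`, that is,
`(k + i s)/2 | (-k + i s)/2`; these pairs form the set `Λ`, which is identified with `ℤ × ℝ`. -/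
def lamPair (k : ℤ) (s : ℝ) : ExpPair := (k, Complex.I * (s : ℂ))

/-- The generalized power `z^{a|a'} = z^a (conj z)^{a'} = |z|^{a + a'} (z / |z|)^{a - a'}`
(for `z ≠ 0`). -/
def gpow (z : ℂ) (p : ExpPair) : ℂ := ((‖z‖ : ℂ) ^ p.2) * (z / (‖z‖ : ℂ)) ^ p.1

open Classical in
/-- The gamma function of the complex field,
`Γ^ℂ(a|a') = i^{a-a'} Γ(a) / Γ(1-a') = i^{a'-a} Γ(a') / Γ(1-a)`.
The second expression is used where `a` is a pole of the numerator of the first one.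
At the poles of `Γ^ℂ` (both `a` and `a'` nonpositive integers) the value is `0`. -/
def gammaC (p : ExpPair) : ℂ :=
  if ∃ n : ℕ, p.fst' = -(n : ℂ) then
    Complex.I ^ (-p.1) * Complex.Gamma p.snd' / Complex.Gamma (1 - p.fst')
  else
    Complex.I ^ p.1 * Complex.Gamma p.fst' / Complex.Gamma (1 - p.snd')

/-- The Euler type integral for the hypergeometric function of the complex field, with the
normalization `Γ^ℂ(c)⁻¹ ₂F₁^ℂ[a, b; c; z]`.  As `B^ℂ(b, c-b) = Γ^ℂ(b) Γ^ℂ(c-b) / Γ^ℂ(c)`, it is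
`(π Γ^ℂ(b) Γ^ℂ(c-b))⁻¹ ∫ t^{b-1} (1-t)^{c-b-1} (1-zt)^{-a} dt`. -/
def eulerIntegral (a b c : ExpPair) (z : ℂ) : ℂ :=
  ((Real.pi : ℂ) * gammaC b * gammaC (c - b))⁻¹ *
    ∫ t : ℂ, gpow t (b - diagPair 1) * gpow (1 - t) (c - b - diagPair 1) * gpow (1 - z * t) (-a)

/-- `a` and `a'` are both positive integers. -/
def IsPosIntPair (p : ExpPair) : Prop :=
  ∃ m n : ℕ, 0 < m ∧ 0 < n ∧ p.fst' = (m : ℂ) ∧ p.snd' = (n : ℂ)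

/-- The square `Π : 0 < a + b < 2, -1 < a - b < 1`. -/
def InSquare (a b : ℝ) : Prop := 0 < a + b ∧ a + b < 2 ∧ -1 < a - b ∧ a - b < 1

/-- For `λ = (k + i s)/2`: the complex pairs `(α, β)` with `(Re α, Re β) ∈ Π` for which none of the
pairs `a`, `b`, `c - a`, `c - b` lies in `ℕ × ℕ` (with `ℕ = {1, 2, …}`), where
`a = α + λ|α - conj λ`, `b = α - λ|α + conj λ`, `c = α + β|α + β`. -/
def kernelDomain (k : ℤ) (s : ℝ) : Set (ℂ × ℂ) :=
  {w | InSquare w.1.re w.2.re ∧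
    ¬ IsPosIntPair (diagPair w.1 + lamPair k s) ∧
    ¬ IsPosIntPair (diagPair w.1 - lamPair k s) ∧
    ¬ IsPosIntPair (diagPair (w.1 + w.2) - (diagPair w.1 + lamPair k s)) ∧
    ¬ IsPosIntPair (diagPair (w.1 + w.2) - (diagPair w.1 - lamPair k s))}

/-- `G` is the holomorphic continuation in `(α, β)` of
`Γ^ℂ(c)⁻¹ ₂F₁^ℂ[α + λ|α - conj λ, α - λ|α + conj λ; c; z]`, `c = α + β|α + β`,
from the domain `0 < Re α < 1`, `0 < Re β < 1`, where the Euler type integral converges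
absolutely, to the domain `kernelDomain`. -/
def IsKernelContinuation (z : ℂ) (k : ℤ) (s : ℝ) (G : ℂ × ℂ → ℂ) : Prop :=
  DifferentiableOn ℂ G (kernelDomain k s) ∧
  ∀ α β : ℂ, 0 < α.re → α.re < 1 → 0 < β.re → β.re < 1 →
    G (α, β) = eulerIntegral (diagPair α + lamPair k s) (diagPair α - lamPair k s)
      (diagPair (α + β)) z

/-- The kernel
`K_{a,b}(z, λ) = Γ^ℂ(a+b|a+b)⁻¹ ₂F₁^ℂ[a + λ|a - conj λ, a - λ|a + conj λ; a+b|a+b; z]`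
for `λ = (k + i s)/2`, the value at `(a, b)` of the holomorphic continuation
(which is unique on `kernelDomain`). -/
def kernel (a b : ℝ) (z : ℂ) (k : ℤ) (s : ℝ) : ℂ :=
  Classical.epsilon (IsKernelContinuation z k s) ((a : ℂ), (b : ℂ))

/-- The Plancherel density
`ϰ_{a,b}(λ) = (4π²)⁻¹ |λ Γ^ℂ(a - λ|a + conj λ) Γ^ℂ(b + λ|b - conj λ)|²`, `λ = (k + i s)/2`. -/
def plancherelDensity (a b : ℝ) (k : ℤ) (s : ℝ) : ℝ :=
  1 / (4 * Real.pi ^ 2) *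
    ‖(lamPair k s).fst' * gammaC (diagPair a - lamPair k s) *
      gammaC (diagPair b + lamPair k s)‖ ^ 2

/-- The integrand of `J*_{a,b} F`. -/
def adjointIntegrand (a b : ℝ) (F : ℤ × ℝ → ℂ) (z : ℂ) (k : ℤ) (s : ℝ) : ℂ :=
  F (k, s) * kernel a b z k s * (plancherelDensity a b k s : ℂ)

/-- `J*_{a,b} F(z) = ∫_Λ F(λ) K_{a,b}(z, λ) ϰ_{a,b}(λ) dλ`, where the measure on `Λ` is given by
`∫_Λ φ(λ) dλ = ∑_k ∫_ℝ φ((k + i s)/2) ds`. -/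
def adjointJ (a b : ℝ) (F : ℤ × ℝ → ℂ) (z : ℂ) : ℂ :=
  ∑' k : ℤ, ∫ s : ℝ, adjointIntegrand a b F z k s

/-- The even smooth compactly supported functions on `Λ = ℤ × ℝ` that vanish in a neighborhood of
the point `0|0`. -/
def EvenTestFunctions : Set (ℤ × ℝ → ℂ) :=
  {F | (∀ k s, F (-k, -s) = F (k, s)) ∧
    (∀ k, ContDiff ℝ ∞ fun s : ℝ => F (k, s)) ∧
    HasCompactSupport F ∧
    ∀ᶠ x in 𝓝 ((0 : ℤ), (0 : ℝ)), F x = 0}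

/-- `∂/∂z = (∂/∂x - i ∂/∂y) / 2`. -/
def dz (f : ℂ → ℂ) (z : ℂ) : ℂ := (fderiv ℝ f z 1 - Complex.I * fderiv ℝ f z Complex.I) / 2

/-- `∂/∂(conj z) = (∂/∂x + i ∂/∂y) / 2`. -/
def dzbar (f : ℂ → ℂ) (z : ℂ) : ℂ := (fderiv ℝ f z 1 + Complex.I * fderiv ℝ f z Complex.I) / 2

/-- The complex plane without the points `0` and `1`. -/
def dotC : Set ℂ := {z | z ≠ 0 ∧ z ≠ 1}

/-- The measure `|z|^{2a+2b-2} |1-z|^{2a-2b} dz`. -/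
def muMeasure (a b : ℝ) : MeasureTheory.Measure ℂ :=
  MeasureTheory.volume.withDensity fun z =>
    ENNReal.ofReal (‖z‖ ^ (2 * a + 2 * b - 2) * ‖1 - z‖ ^ (2 * a - 2 * b))

/-- Near `z₀`, `f(z) = α(z) + β(z) |z - z₀|^κ` if `κ ≠ 0` and
`f(z) = α(z) + β(z) ln |z - z₀|` if `κ = 0`, with smooth `α`, `β`. -/
def HasExpansionAt (f : ℂ → ℂ) (z₀ : ℂ) (κ : ℝ) : Prop :=
  ∃ r > 0, ∃ α β : ℂ → ℂ,
    ContDiffOn ℝ ∞ α (Metric.ball z₀ r) ∧ ContDiffOn ℝ ∞ β (Metric.ball z₀ r) ∧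
    ∀ z ∈ Metric.ball z₀ r, z ≠ z₀ →
      f z = α z + β z *
        ((if κ = 0 then Real.log ‖z - z₀‖ else ‖z - z₀‖ ^ κ : ℝ) : ℂ)

/-- The space `R_{a,b}` of functions on `ℂ \ {0, 1}` (the values at `0` and `1` are irrelevant). -/
def SpaceR (a b : ℝ) : Set (ℂ → ℂ) :=
  {f | MeasureTheory.MemLp f 2 (muMeasure a b) ∧
    ContDiffOn ℝ ∞ f dotC ∧
    HasExpansionAt f 0 (2 - 2 * a - 2 * b) ∧
    HasExpansionAt f 1 (2 * b - 2 * a) ∧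
    ∀ p q N : ℕ, (dz^[p] (dzbar^[q] f)) =O[Bornology.cobounded ℂ]
      fun z => ‖z‖ ^ (-2 * a - p - q) * (Real.log ‖z‖ ^ N)⁻¹}

end ComplexHypergeometric

end

noncomputable section
namespace ComplexHypergeometric
open MeasureTheory

/-! ### Generalized powers -/

/-! Up to gamma factors the kernel is the integral of `t^P (1-t)^Q (1-zt)^S`, singular at 0, 1, 1/z
and ∞, with exponents of real part 2a-2, 2b-2, -2a and -2b. Absolute convergence needs real parts
above -2, that is 0 < a, b < 1; on the whole square they are only above -3. One integration by parts
at each singular point closes the gap (`integral_gpow_mul_ibp`): along the radial field if the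
angular character is trivial, and along the rotation field otherwise, the power density is an
eigenvector with eigenvalue `ibpConst`, while the derivative of the amplitude along a linear field
vanishes at the singular point. With a partition of unity the integral becomes an expression
holomorphic in the exponents, whose only possible poles are the zeros of `ibpConst`. The poles
coming from t = 0 and t = 1 are cancelled by zeros of the reciprocal gamma factors, and those from
1/z and ∞ are removed from the domain; this gives `exists_isKernelContinuation`. At real (a, b) and
λ ≠ 0 no pole is met, and by `eq_of_eq_on_tube` the kernel may be computed from any regularization
that is correct where the integral converges. Hence every region of z can use its own partition of
unity (`adjointIntegrand_eq`). The gamma factors of kernel and Plancherel density merge into a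
smooth compactly supported weight, `density`.

Away from 0 and 1 the four singular points stay apart, the regularized integral is jointly smooth in
z and s (`contDiff_mul_regEuler`), and so is its integral over s (`interior_smooth`).

Near z = 0, 1 and ∞ the singular points merge in pairs. Möbius substitutions bring all three cases
to the points 0, 1 and 1/w, ∞ with w = z, 1-z, 1/z tending to 0. The two pairs contribute a smooth
function and a power of w times a smooth function. What remains is the annulus |w| ≪ |u| ≪ 1 with
integrand `(1-u)^Q (1-w/u)^S` against a power of u. With y = w/u, Cauchy's formula on a torus splits
the holomorphic half of the product into C(w) + u D(u,w) + y E(y,w), and similarly for the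
antiholomorphic half (`hpow_mul_hpow`).

For w = z and w = 1-z the weight is radial, |u|^(κ-2) with |κ| < 2. Averaging over angles leaves
only CC', |u|² DD' and |y|² EE' (`integral_midWt_gpow`), and these give α + β|w|^κ, or a logarithm
if κ = 0 (`HasMidExpansion.integral_gpow`).

For w = 1/z the weight has the oscillating exponent attached to 2λ, with λ ≠ 0 on the support of the
density. Terms in u alone or in y alone are again integrated by parts (`exists_regular_expansion`);
they yield |z|^(-2a) times an oscillation in s log|z| times a smooth amplitude, and integrating by
parts in s gains any power of log|z|. The mixed terms carry an additional factor of size |w| and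
decay by a power faster. Both sorts of terms form `DecayClass`, on which each Wirtinger derivative
raises the decay exponent by one; this gives the estimates at infinity. Square integrability follows
from the three asymptotics (`memLp_adjointJ`), with the borderline case at infinity saved by the
logarithm. -/

lemma gpow_zero (z : ℂ) : gpow z 0 = 1 := by simp [gpow]

lemma gpow_one (p : ExpPair) : gpow 1 p = 1 := by simp [gpow]

lemma gpow_mul (x y : ℂ) (p : ExpPair) : gpow (x * y) p = gpow x p * gpow y p := by
  unfold gpow
  rw [norm_mul, Complex.ofReal_mul, Complex.mul_cpow_ofReal_nonneg (norm_nonneg _) (norm_nonneg _),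
    mul_div_mul_comm, mul_zpow]
  ring

lemma gpow_inv (x : ℂ) (p : ExpPair) : gpow x⁻¹ p = (gpow x p)⁻¹ := by
  unfold gpow
  rw [norm_inv, Complex.ofReal_inv, Complex.inv_cpow, ← inv_div_inv, inv_inv, mul_inv, ← inv_zpow,
    inv_div]
  · congr 2
    rw [div_eq_mul_inv, div_eq_mul_inv, inv_inv, mul_comm]
  · rw [Complex.arg_ofReal_of_nonneg (norm_nonneg _)]
    exact Real.pi_pos.ne

lemma gpow_neg (x : ℂ) (p : ExpPair) : gpow x (-p) = (gpow x p)⁻¹ := by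
  simp [gpow, Complex.cpow_neg, mul_comm]

lemma gpow_div (x y : ℂ) (p : ExpPair) : gpow (x / y) p = gpow x p * (gpow y p)⁻¹ := by
  rw [div_eq_mul_inv, gpow_mul, gpow_inv]

lemma gpow_add {x : ℂ} (hx : x ≠ 0) (p q : ExpPair) :
    gpow x (p + q) = gpow x p * gpow x q := by
  have h : (‖x‖ : ℂ) ≠ 0 := by simpa using hx
  unfold gpow
  rw [Prod.snd_add, Prod.fst_add, Complex.cpow_add _ _ h, zpow_add₀ (div_ne_zero hx h)]
  ring

lemma gpow_sub {x : ℂ} (hx : x ≠ 0) (p q : ExpPair) :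
    gpow x (p - q) = gpow x p * (gpow x q)⁻¹ := by
  rw [sub_eq_add_neg, gpow_add hx, gpow_neg]

lemma gpow_ne_zero {x : ℂ} (hx : x ≠ 0) (p : ExpPair) : gpow x p ≠ 0 := by
  have h : (‖x‖ : ℂ) ≠ 0 := by simpa using hx
  exact mul_ne_zero (by simp [Complex.cpow_eq_zero_iff, hx]) (zpow_ne_zero _ (div_ne_zero hx h))

lemma norm_gpow {x : ℂ} (hx : x ≠ 0) (p : ExpPair) : ‖gpow x p‖ = ‖x‖ ^ p.2.re := by
  unfold gpow
  rw [norm_mul, Complex.norm_cpow_eq_rpow_re_of_pos (norm_pos_iff.2 hx), norm_zpow, norm_div]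
  simp [div_self (norm_ne_zero_iff.2 hx)]

lemma gpow_neg_one (p : ExpPair) : gpow (-1) p = (-1) ^ p.1 := by simp [gpow]

/-- No branch of the argument enters: the non-integral part of the exponent multiplies only the real
number log|z|. Smoothness in z off the origin and holomorphy in the exponent are both read off from
this form. -/
lemma gpow_eq_exp {z : ℂ} (hz : z ≠ 0) (p : ExpPair) :
    gpow z p = z ^ p.1 * Complex.exp ((p.2 - p.1) * (Real.log ‖z‖ : ℝ)) := by
  have h : (‖z‖ : ℂ) ≠ 0 := by simpa using hz
  unfold gpow
  rw [Complex.cpow_def_of_ne_zero h, div_zpow, ← Complex.ofReal_log (norm_nonneg _), sub_mul,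
    Complex.exp_sub, Complex.exp_int_mul, ← Complex.ofReal_exp, Real.exp_log (norm_pos_iff.2 hz)]
  rw [mul_comm p.2]
  field_simp

lemma gpow_ofReal (z : ℂ) (r : ℝ) : gpow z (0, (r : ℂ)) = ((‖z‖ ^ r : ℝ) : ℂ) := by
  simp [gpow, Complex.ofReal_cpow (norm_nonneg z)]

/-- This identity and its conjugate trade a factor vanishing at the origin for an exponent with real
part larger by one. -/
lemma gpow_add_one {z : ℂ} (hz : z ≠ 0) (k : ℤ) (σ : ℂ) :
    gpow z (k + 1, σ + 1) = gpow z (k, σ) * z := by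
  rw [gpow_eq_exp hz, gpow_eq_exp hz, zpow_add_one₀ hz]
  push_cast
  rw [show σ + 1 - ((k : ℂ) + 1) = σ - k by ring]
  ring

lemma gpow_conj_add_one {z : ℂ} (hz : z ≠ 0) (k : ℤ) (σ : ℂ) :
    gpow z (k - 1, σ + 1) = gpow z (k, σ) * (starRingEnd ℂ) z := by
  have h : (‖z‖ : ℂ) ≠ 0 := by simpa using hz
  unfold gpow
  have h2 : (‖z‖ : ℂ) * (z / ‖z‖)⁻¹ = (starRingEnd ℂ) z := by
    rw [inv_div, ← mul_div_assoc, div_eq_iff hz, mul_comm _ z, Complex.mul_conj,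
      Complex.normSq_eq_norm_sq]
    push_cast
    ring
  rw [Complex.cpow_add _ _ h, zpow_sub_one₀ (div_ne_zero hz h), Complex.cpow_one, ← h2]
  ring

/-- The logarithmic derivative of `gpow`. -/
lemma hasFDerivAt_gpow {z : ℂ} (hz : z ≠ 0) (p : ExpPair) :
    HasFDerivAt (𝕜 := ℝ) (fun z => gpow z p)
      (gpow z p • (((p.fst' / z) • (1 : ℂ →L[ℝ] ℂ)) +
        (p.snd' / (starRingEnd ℂ) z) • (Complex.conjCLE : ℂ →L[ℝ] ℂ))) z := by
  have h1 : HasFDerivAt (𝕜 := ℝ) (fun z : ℂ => z ^ p.1)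
      (((p.1 : ℂ) * z ^ (p.1 - 1)) • (1 : ℂ →L[ℝ] ℂ)) z :=
    ((hasDerivAt_zpow p.1 z (Or.inl hz)).hasFDerivAt.restrictScalars ℝ).congr_fderiv (by
      ext <;> simp [mul_comm])
  have h0 : ‖z‖ ^ 2 ≠ 0 := by simpa using hz
  have h2 : HasFDerivAt (𝕜 := ℝ) (fun z : ℂ => Real.log ‖z‖)
      ((‖z‖ ^ 2)⁻¹ • innerSL ℝ z) z := by
    have h3 := ((hasStrictFDerivAt_norm_sq z).hasFDerivAt.log h0).const_smul (1 / 2 : ℝ)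
    have e : (fun z : ℂ => Real.log ‖z‖) = fun z => (1 / 2 : ℝ) • Real.log (‖z‖ ^ 2) := by
      ext z; rw [Real.log_pow]; simp
    rw [e]
    refine h3.congr_fderiv ?_
    ext <;> simp <;> ring
  have h4 := (Complex.ofRealCLM.hasFDerivAt.comp z h2).const_mul (p.2 - p.1)
  have h5 := h1.mul h4.cexp
  have e : (fun z => gpow z p) =ᶠ[𝓝 z] fun z : ℂ => z ^ p.1 *
      Complex.exp ((p.2 - p.1) * (Real.log ‖z‖ : ℝ)) := by
    filter_upwards [isOpen_ne.mem_nhds hz] with y hy using gpow_eq_exp hy p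
  refine (h5.congr_of_eventuallyEq e).congr_fderiv ?_
  have hc : (starRingEnd ℂ) z ≠ 0 := by simpa using hz
  have hn : ((‖z‖ : ℂ)) ^ 2 = z * (starRingEnd ℂ) z := by
    rw [Complex.mul_conj, Complex.normSq_eq_norm_sq]; push_cast; ring
  ext v
  have hin : (v.re : ℂ) * z.re + v.im * z.im =
      (v * (starRingEnd ℂ) z + (starRingEnd ℂ) v * z) / 2 := by
    apply Complex.ext <;> simp <;> ring
  simp only [gpow_eq_exp hz, zpow_sub_one₀ hz, ExpPair.fst', ExpPair.snd', Function.comp]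
  simp [hn]
  field_simp
  linear_combination (2 * (p.2 - p.1)) * hin

lemma contDiffAt_gpow_comp {E : Type*} [NormedAddCommGroup E] [NormedSpace ℝ E]
    {g : E → ℂ} {σ : E → ℂ} {x : E} (k : ℤ) (hg : ContDiffAt ℝ ∞ g x) (hσ : ContDiffAt ℝ ∞ σ x)
    (h0 : g x ≠ 0) : ContDiffAt ℝ ∞ (fun e => gpow (g e) (k, σ e)) x := by
  have e : (fun e => gpow (g e) (k, σ e)) =ᶠ[𝓝 x] fun e => g e ^ k *
      Complex.exp ((σ e - k) * (Real.log ‖g e‖ : ℝ)) := by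
    filter_upwards [hg.continuousAt.eventually_ne h0] with y hy using gpow_eq_exp hy (k, σ y)
  refine ContDiffAt.congr_of_eventuallyEq ?_ e
  refine ContDiffAt.mul ?_ (ContDiffAt.cexp (ContDiffAt.mul (hσ.sub contDiffAt_const) ?_))
  · have : ContDiffAt ℝ ∞ (fun z : ℂ => z ^ k) (g x) := by
      have : ContDiffAt ℂ ∞ (fun z : ℂ => z ^ k) (g x) :=
        (analyticAt_id.zpow h0).contDiffAt
      exact this.restrict_scalars ℝ
    exact this.comp x hg
  · exact Complex.ofRealCLM.contDiff.contDiffAt.comp x ((hg.norm ℝ h0).log (by simpa using h0))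

/-- A smooth function times a power of a function without zeros on its support is smooth. -/
lemma contDiff_mul_gpow {E : Type*} [NormedAddCommGroup E] [NormedSpace ℝ E]
    {B g σ : E → ℂ} (k : ℤ) (hB : ContDiff ℝ ∞ B) (hg : ∀ x ∈ tsupport B, ContDiffAt ℝ ∞ g x)
    (hσ : ContDiff ℝ ∞ σ) (h0 : ∀ x ∈ tsupport B, g x ≠ 0) :
    ContDiff ℝ ∞ (fun e => B e * gpow (g e) (k, σ e)) := by
  rw [contDiff_iff_contDiffAt]
  intro x
  by_cases hx : x ∈ tsupport B
  · exact hB.contDiffAt.mul (contDiffAt_gpow_comp k (hg x hx) hσ.contDiffAt (h0 x hx))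
  · have : (fun e => B e * gpow (g e) (k, σ e)) =ᶠ[𝓝 x] fun _ => 0 := by
      filter_upwards [(isClosed_tsupport B).isOpen_compl.mem_nhds hx] with y hy
      rw [image_eq_zero_of_notMem_tsupport hy, zero_mul]
    exact contDiffAt_const.congr_of_eventuallyEq this

lemma measurable_gpow {X : Type*} [MeasurableSpace X] {g σ : X → ℂ} (k : ℤ) (hg : Measurable g)
    (hσ : Measurable σ) : Measurable (fun x => gpow (g x) (k, σ x)) := by
  unfold gpow
  exact (Measurable.pow (by fun_prop) hσ).mul ((hg.div (by fun_prop)).pow_const k)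

/-! ### The cutoff function -/

/-- A radial smooth cutoff function with `cut u⁻¹ = 1 - cut u`. -/
def cut (u : ℂ) : ℝ := Real.smoothTransition (1 / 2 + (1 - ‖u‖ ^ 2) / (1 + ‖u‖ ^ 2))

lemma contDiff_cut : ContDiff ℝ ∞ cut := by
  unfold cut
  refine Real.smoothTransition.contDiff.comp (contDiff_const.add (ContDiff.div ?_ ?_ ?_))
  · exact contDiff_const.sub (contDiff_norm_sq ℝ)
  · exact contDiff_const.add (contDiff_norm_sq ℝ)
  · intro x; positivity

lemma cut_eq_one {u : ℂ} (h : ‖u‖ ≤ 1 / 2) : cut u = 1 := by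
  apply Real.smoothTransition.one_of_one_le
  have : (1 / 2 : ℝ) ≤ (1 - ‖u‖ ^ 2) / (1 + ‖u‖ ^ 2) := by
    rw [le_div_iff₀ (by positivity)]
    nlinarith [norm_nonneg u]
  linarith

lemma cut_eq_zero {u : ℂ} (h : 7 / 4 ≤ ‖u‖) : cut u = 0 := by
  apply Real.smoothTransition.zero_of_nonpos
  -- At |u| = 7/4 the quotient equals -33/65, just below -1/2.
  have : (1 - ‖u‖ ^ 2) / (1 + ‖u‖ ^ 2) ≤ - (1 / 2 : ℝ) := by
    rw [div_le_iff₀ (by positivity)]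
    nlinarith [norm_nonneg u]
  linarith

/-- Replacing r by 1/r changes the sign of (1 - r²)/(1 + r²), and the smooth transition is symmetric
about 1/2. This makes the cutoff at infinity the inversion of a cutoff at the origin, so all four
singular points share one local theory. -/
lemma cut_inv {u : ℂ} (hu : u ≠ 0) : cut u⁻¹ = 1 - cut u := by
  have h1 : ∀ x : ℝ, Real.smoothTransition (1 - x) = 1 - Real.smoothTransition x := by
    intro x
    have := Real.smoothTransition.pos_denom x
    unfold Real.smoothTransition
    rw [sub_sub_cancel, add_comm (expNegInvGlue (1 - x))]
    field_simp
    ring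
  unfold cut
  rw [← h1, norm_inv]
  congr 1
  have : ‖u‖ ≠ 0 := by simpa using hu
  field_simp
  ring

lemma cut_zero : cut 0 = 1 := cut_eq_one (by norm_num)

lemma cut_congr {u v : ℂ} (h : ‖u‖ = ‖v‖) : cut u = cut v := by simp [cut, h]

/-! ### Integration on the complex plane -/

lemma integrableOn_norm_rpow {σ : ℝ} (hσ : -2 < σ) (R : ℝ) :
    IntegrableOn (fun u : ℂ => ‖u‖ ^ σ) (Metric.closedBall 0 R) := by
  refine IntegrableOn.mono_set (t := Metric.ball 0 (|R| + 1)) ?_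
    (Metric.closedBall_subset_ball (by linarith [le_abs_self R]))
  rw [integrableOn_fun_norm_addHaar (μ := (volume : Measure ℂ)) (f := fun y => y ^ σ)]
  have h : IntegrableOn (fun y : ℝ => y ^ (σ + 1)) (Set.Ioo 0 (|R| + 1)) := by
    rw [intervalIntegral.integrableOn_Ioo_rpow_iff (by positivity)]
    linarith
  refine h.congr_fun (fun y hy => ?_) measurableSet_Ioo
  simp only [Complex.finrank_real_complex, smul_eq_mul]
  rw [Real.rpow_add hy.1, Real.rpow_one]
  simp [mul_comm]

lemma det_mul_left (c : ℂ) : LinearMap.det (LinearMap.mul ℝ ℂ c) = ‖c‖ ^ 2 := by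
  rw [← Complex.normSq_eq_norm_sq, ← Algebra.norm_complex_apply, Algebra.norm_apply]
  rfl

lemma map_mul_left_volume {c : ℂ} (hc : c ≠ 0) :
    Measure.map (fun u => c * u) (volume : Measure ℂ) =
      ENNReal.ofReal ((‖c‖ ^ 2)⁻¹) • volume := by
  have := Measure.map_linearMap_addHaar_eq_smul_addHaar (volume : Measure ℂ)
    (f := LinearMap.mul ℝ ℂ c) (by rw [det_mul_left]; simpa using hc)
  rw [det_mul_left] at this
  rw [abs_of_nonneg (by positivity)] at this
  exact this

lemma integral_comp_mul (g : ℂ → ℂ) {c : ℂ} (hc : c ≠ 0) :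
    ∫ u, g (c * u) = ((‖c‖ : ℂ) ^ 2)⁻¹ * ∫ u, g u := by
  have h := (Homeomorph.mulLeft₀ c hc).measurableEmbedding.integral_map (μ := volume) g
  simp only [Homeomorph.coe_mulLeft₀] at h
  rw [← h, map_mul_left_volume hc, integral_smul_measure, ENNReal.toReal_ofReal (by positivity)]
  simp

lemma integrable_comp_mul {g : ℂ → ℂ} (hg : Integrable g) {c : ℂ} (hc : c ≠ 0) :
    Integrable (fun u => g (c * u)) := by
  have h := (Homeomorph.mulLeft₀ c hc).measurableEmbedding.integrable_map_iff (μ := volume) (g := g)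
  simp only [Homeomorph.coe_mulLeft₀, Function.comp_def] at h
  rw [← h, map_mul_left_volume hc]
  exact hg.smul_measure ENNReal.ofReal_ne_top

lemma hasFDerivAt_inv_real {t : ℂ} (ht : t ≠ 0) :
    HasFDerivAt (𝕜 := ℝ) (fun t : ℂ => t⁻¹)
      (LinearMap.mul ℝ ℂ (-(t ^ 2)⁻¹)).toContinuousLinearMap t := by
  refine ((hasDerivAt_inv ht).hasFDerivAt.restrictScalars ℝ).congr_fderiv ?_
  ext; simp [mul_comm]

lemma image_inv_compl_zero : (fun t : ℂ => t⁻¹) '' {0}ᶜ = {0}ᶜ := by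
  ext x
  constructor
  · rintro ⟨y, hy, rfl⟩; simpa using hy
  · intro hx; exact ⟨x⁻¹, by simpa using hx, by simp⟩

lemma det_inv_real (t : ℂ) :
    |(LinearMap.mul ℝ ℂ (-(t ^ 2)⁻¹)).toContinuousLinearMap.det| = (‖t‖ ^ 4)⁻¹ := by
  have : (LinearMap.mul ℝ ℂ (-(t ^ 2)⁻¹)).toContinuousLinearMap.det =
      LinearMap.det (LinearMap.mul ℝ ℂ (-(t ^ 2)⁻¹)) := rfl
  rw [this, det_mul_left, abs_of_nonneg (by positivity), norm_neg, norm_inv, norm_pow]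
  ring

lemma integral_comp_inv (g : ℂ → ℂ) :
    ∫ u, g u = ∫ t, ((‖t‖ : ℂ) ^ 4)⁻¹ * g t⁻¹ := by
  have h := integral_image_eq_integral_abs_det_fderiv_smul (volume : Measure ℂ)
    (s := {0}ᶜ) (measurableSet_singleton 0).compl
    (fun t ht => (hasFDerivAt_inv_real ht).hasFDerivWithinAt) (inv_injective.injOn) g
  rw [image_inv_compl_zero, restrict_compl_singleton] at h
  rw [h]
  congr 1
  ext t
  rw [det_inv_real]
  simp

lemma integrable_comp_inv {g : ℂ → ℂ} (hg : Integrable g) :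
    Integrable (fun t : ℂ => ((‖t‖ : ℂ) ^ 4)⁻¹ * g t⁻¹) := by
  have h := integrableOn_image_iff_integrableOn_abs_det_fderiv_smul (volume : Measure ℂ)
    (s := {0}ᶜ) (measurableSet_singleton 0).compl
    (fun t ht => (hasFDerivAt_inv_real ht).hasFDerivWithinAt) (inv_injective.injOn) g
  rw [image_inv_compl_zero, IntegrableOn, IntegrableOn, restrict_compl_singleton] at h
  refine (h.1 hg).congr (ae_of_all _ fun t => ?_)
  dsimp only
  rw [det_inv_real]
  simp

/-! ### Integration by parts against a generalized power -/

/-- The direction of the vector field `u ↦ e u` along which one integrates by parts: radial for the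
trivial angular character, and angular otherwise. -/
def ibpDir (k : ℤ) : ℂ := if k = 0 then 1 else Complex.I

/-- The constant `c` with `L (u^p d²u) = c u^p d²u` for the vector field `u ↦ ibpDir k * u`. -/
def ibpConst (k : ℤ) (σ : ℂ) : ℂ := if k = 0 then σ + 2 else k * Complex.I

/-- The flow of the chosen field multiplies the density `u^p d²u` by an exponential in τ. Dilations
see the homogeneity σ + 2; rotations see only the angular character k, which is why they are useful
exactly when k ≠ 0. -/
lemma gpow_exp (k : ℤ) (σ : ℂ) (τ : ℝ) :
    gpow (Complex.exp (τ * ibpDir k)) (k, σ) * (‖Complex.exp (τ * ibpDir k)‖ : ℂ) ^ 2 =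
      Complex.exp (τ * ibpConst k σ) := by
  rw [gpow_eq_exp (Complex.exp_ne_zero _)]
  unfold ibpDir ibpConst
  split_ifs with h
  · subst h
    rw [Complex.norm_exp]
    simp only [mul_one, Complex.ofReal_re, Real.log_exp, zpow_zero, one_mul]
    rw [← Complex.ofReal_pow, ← Real.exp_nat_mul]
    push_cast
    rw [← Complex.exp_add]
    congr 1; ring
  · rw [Complex.norm_exp]
    simp only [Complex.mul_re, Complex.ofReal_re, Complex.I_re, Complex.ofReal_im, Complex.I_im]
    simp only [mul_zero, zero_mul, sub_zero, Real.exp_zero, Real.log_one]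
    rw [← Complex.exp_int_mul]
    simp
    congr 1; ring

/-- Integration by parts against a generalized power. -/
theorem integral_gpow_mul_ibp (k : ℤ) {σ : ℂ} (hσ : -2 < σ.re) {φ : ℂ → ℂ}
    (hφ : ContDiff ℝ 1 φ) (hc : HasCompactSupport φ) :
    ibpConst k σ * ∫ u, gpow u (k, σ) * φ u =
      -∫ u, gpow u (k, σ) * fderiv ℝ φ u (ibpDir k * u) := by
  set e := ibpDir k with he
  have hen : ‖e‖ = 1 := by rw [he]; unfold ibpDir; split_ifs <;> simp
  set m : ℝ → ℂ := fun τ => Complex.exp (τ * e) with hm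
  have hm0 : ∀ τ, m τ ≠ 0 := fun τ => Complex.exp_ne_zero _
  set I0 := ∫ u, gpow u (k, σ) * φ u with hI0
  -- The integral against the transported amplitude is an explicit exponential in τ. Comparing its
  -- derivative at τ = 0 with differentiation under the integral sign gives the formula, without any
  -- boundary term at the origin.
  have hI : ∀ τ : ℝ, ∫ u, gpow u (k, σ) * φ (m τ * u) =
      Complex.exp (τ * -ibpConst k σ) * I0 := by
    intro τ
    have h1 := integral_comp_mul (fun u => gpow u (k, σ) * φ u) (hm0 τ)
    simp only [gpow_mul, mul_assoc] at h1
    rw [integral_const_mul] at h1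
    have h2 := gpow_exp k σ τ
    rw [mul_neg, Complex.exp_neg, ← h2]
    have h3 : gpow (m τ) (k, σ) ≠ 0 := gpow_ne_zero (hm0 τ) _
    have h4 : (‖m τ‖ : ℂ) ≠ 0 := by simpa using hm0 τ
    rw [mul_inv, mul_assoc, ← h1, ← mul_assoc, inv_mul_cancel₀ h3, one_mul]
  obtain ⟨R, hR0, hR⟩ : ∃ R : ℝ, 0 < R ∧ ∀ u, R < ‖u‖ → φ u = 0 ∧ fderiv ℝ φ u = 0 := by
    obtain ⟨R, hR⟩ := (hc.isCompact.union (hc.fderiv (𝕜 := ℝ)).isCompact).isBounded.subset_closedBall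
      (0 : ℂ)
    refine ⟨max R 1, by positivity, fun u hu => ?_⟩
    have : u ∉ tsupport φ ∪ tsupport (fderiv ℝ φ) := fun h => by
      have := hR h
      rw [Metric.mem_closedBall, dist_zero_right] at this
      exact absurd (le_max_left R 1) (by linarith)
    rw [Set.mem_union, not_or] at this
    exact ⟨image_eq_zero_of_notMem_tsupport this.1, image_eq_zero_of_notMem_tsupport this.2⟩
  obtain ⟨C, hC⟩ : ∃ C, ∀ u, ‖fderiv ℝ φ u‖ ≤ C :=
    (hc.fderiv (𝕜 := ℝ)).exists_bound_of_continuous (hφ.continuous_fderiv one_ne_zero)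
  obtain ⟨C0, hC0⟩ : ∃ C, ∀ u, ‖φ u‖ ≤ C := hc.exists_bound_of_continuous hφ.continuous
  have hmn : ∀ τ : ℝ, τ ∈ Metric.ball (0 : ℝ) 1 →
      Real.exp (-1) ≤ ‖m τ‖ ∧ ‖m τ‖ ≤ Real.exp 1 := by
    intro τ hτ
    rw [Metric.mem_ball, dist_zero_right, Real.norm_eq_abs] at hτ
    have h1 : |((τ : ℂ) * e).re| ≤ 1 := by
      refine (Complex.abs_re_le_norm _).trans ?_
      rw [norm_mul, hen, mul_one, Complex.norm_real, Real.norm_eq_abs]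
      exact hτ.le
    simp only [hm, Complex.norm_exp]
    exact ⟨Real.exp_le_exp.2 (abs_le.1 h1).1, Real.exp_le_exp.2 (abs_le.1 h1).2⟩
  set R' := Real.exp 1 * R with hR'
  have hmeas : Measurable fun u : ℂ => gpow u (k, σ) :=
    measurable_gpow k measurable_id measurable_const
  have hd : HasDerivAt (fun τ : ℝ => ∫ u, gpow u (k, σ) * φ (m τ * u))
      (∫ u, gpow u (k, σ) * fderiv ℝ φ (m 0 * u) (m 0 * e * u)) 0 := by
    refine (hasDerivAt_integral_of_dominated_loc_of_deriv_le (μ := volume)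
      (s := Metric.ball (0 : ℝ) 1)
      (F := fun τ u => gpow u (k, σ) * φ (m τ * u))
      (F' := fun τ u => gpow u (k, σ) * fderiv ℝ φ (m τ * u) (m τ * e * u))
      (bound := (Metric.closedBall (0 : ℂ) R').indicator
        fun u => ‖u‖ ^ σ.re * (C * (Real.exp 1 * R')))
      (Metric.ball_mem_nhds _ one_pos) ?_ ?_ ?_ ?_ ?_ ?_).2
    · refine Filter.Eventually.of_forall fun τ => ?_
      exact (hmeas.mul (hφ.continuous.measurable.comp (measurable_const_mul _))).aestronglyMeasurable
    · have hb : Integrable ((Metric.closedBall (0 : ℂ) R).indicator fun u => ‖u‖ ^ σ.re * C0) := by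
        rw [integrable_indicator_iff Metric.isClosed_closedBall.measurableSet]
        exact (integrableOn_norm_rpow hσ R).mul_const _
      refine hb.mono' (hmeas.mul (hφ.continuous.measurable.comp
        (measurable_const_mul _))).aestronglyMeasurable ?_
      filter_upwards [compl_mem_ae_iff.2 (measure_singleton (0 : ℂ))] with u hu
      have hm00 : m 0 = 1 := by simp [hm]
      rw [hm00, one_mul]
      by_cases h : ‖u‖ ≤ R
      · rw [Set.indicator_of_mem (by simpa using h), norm_mul, norm_gpow hu]
        gcongr
        exact hC0 u
      · rw [(hR u (not_le.1 h)).1, Set.indicator_of_notMem (by simpa using h)]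
        simp
    · refine (hmeas.mul ?_).aestronglyMeasurable
      have : Continuous fun u : ℂ => fderiv ℝ φ (m 0 * u) (m 0 * e * u) :=
        ((hφ.continuous_fderiv one_ne_zero).comp (by fun_prop)).clm_apply (by fun_prop)
      exact this.measurable
    · filter_upwards [compl_mem_ae_iff.2 (measure_singleton (0 : ℂ))] with u hu τ hτ
      obtain ⟨h1, h2⟩ := hmn τ hτ
      by_cases h : ‖u‖ ≤ R'
      · rw [Set.indicator_of_mem (by simpa using h), norm_mul, norm_gpow hu]
        gcongr
        refine (ContinuousLinearMap.le_opNorm _ _).trans ?_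
        gcongr
        · exact (norm_nonneg _).trans (hC u)
        · exact hC _
        · rw [norm_mul, norm_mul, hen, mul_one]
          gcongr
      · rw [Set.indicator_of_notMem (by simpa using h), (hR (m τ * u) ?_).2]
        · simp
        · rw [norm_mul]
          calc R = Real.exp (-1) * R' := by
                rw [hR', ← mul_assoc, ← Real.exp_add]; simp
            _ < Real.exp (-1) * ‖u‖ := by gcongr; exact not_le.1 h
            _ ≤ _ := by gcongr
    · rw [integrable_indicator_iff Metric.isClosed_closedBall.measurableSet]
      exact (integrableOn_norm_rpow hσ R').mul_const _
    · refine ae_of_all _ fun u τ _ => ?_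
      refine HasDerivAt.const_mul _ ?_
      have h1 : HasDerivAt (fun τ : ℝ => m τ * u) (m τ * e * u) τ := by
        have h2 : HasDerivAt (fun τ : ℝ => (τ : ℂ) * e) e τ := by
          simpa using (Complex.ofRealCLM.hasDerivAt (x := τ)).mul_const e
        exact (h2.cexp).mul_const u
      exact (hφ.differentiable one_ne_zero _).hasFDerivAt.comp_hasDerivAt τ h1
  have hd2 : HasDerivAt (fun τ : ℝ => ∫ u, gpow u (k, σ) * φ (m τ * u))
      (-ibpConst k σ * I0) 0 := by
    simp only [hI]
    have h2 : HasDerivAt (fun τ : ℝ => (τ : ℂ) * -ibpConst k σ) (-ibpConst k σ) 0 := by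
      simpa using (Complex.ofRealCLM.hasDerivAt (x := 0)).mul_const (-ibpConst k σ)
    simpa using h2.cexp.mul_const I0
  have := hd.unique hd2
  simp only [show m 0 = 1 by simp [hm], one_mul] at this
  rw [this]
  ring

/-! ### Holomorphic dependence on parameters -/

/-- Cauchy's estimate on the complex line through x in direction v, on the circle of radius δ/(2‖v‖)
that keeps the argument within δ/2 of x. -/
lemma norm_fderiv_le_of_bounded {E : Type*} [NormedAddCommGroup E] [NormedSpace ℂ E]
    {f : E → ℂ} {x : E} {δ M : ℝ} (hδ : 0 < δ) (hf : DifferentiableOn ℂ f (Metric.ball x δ))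
    (hM : ∀ y ∈ Metric.ball x δ, ‖f y‖ ≤ M) : ‖fderiv ℂ f x‖ ≤ M * (2 / δ) := by
  have hM0 : 0 ≤ M := (norm_nonneg _).trans (hM x (Metric.mem_ball_self hδ))
  refine ContinuousLinearMap.opNorm_le_bound _ (by positivity) fun v => ?_
  by_cases hv : v = 0
  · simp [hv]
  have hv' : 0 < ‖v‖ := norm_pos_iff.2 hv
  set r := δ / (2 * ‖v‖) with hr
  have hr0 : 0 < r := by positivity
  have hmem : ∀ t ∈ Metric.closedBall (0 : ℂ) r, x + t • v ∈ Metric.ball x δ := by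
    intro t ht
    rw [Metric.mem_closedBall, dist_zero_right] at ht
    rw [Metric.mem_ball, dist_self_add_left, norm_smul]
    calc ‖t‖ * ‖v‖ ≤ r * ‖v‖ := by gcongr
      _ = δ / 2 := by rw [hr]; field_simp
      _ < δ := by linarith
  have hl : Differentiable ℂ fun t : ℂ => x + t • v := by fun_prop
  have hd : DifferentiableOn ℂ (fun t : ℂ => f (x + t • v)) (Metric.closedBall 0 r) :=
    hf.comp hl.differentiableOn hmem
  have h1 := Complex.norm_deriv_le_of_forall_mem_sphere_norm_le (c := 0) (C := M) hr0
    (hd.diffContOnCl_ball subset_rfl)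
    (fun t ht => hM _ (hmem t (Metric.sphere_subset_closedBall ht)))
  have h2 : deriv (fun t : ℂ => f (x + t • v)) 0 = fderiv ℂ f x v := by
    have h3 : HasFDerivAt f (fderiv ℂ f x) (x + (0 : ℂ) • v) := by
      simpa using ((hf x (Metric.mem_ball_self hδ)).differentiableAt
        (Metric.ball_mem_nhds x hδ)).hasFDerivAt
    have h4 : HasDerivAt (fun t : ℂ => x + t • v) v 0 := by
      simpa using ((hasDerivAt_id (0 : ℂ)).smul_const v).const_add x
    exact (h3.comp_hasDerivAt 0 h4).deriv
  rw [h2] at h1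
  refine h1.trans (le_of_eq ?_)
  rw [hr]; field_simp

/-- Holomorphic dependence of an integral on two complex parameters. -/
theorem differentiableOn_integral {X : Type*} [MeasurableSpace X] {μ : Measure X}
    {F : ℂ × ℂ → X → ℂ} {U : Set (ℂ × ℂ)} (hU : IsOpen U)
    (hF : ∀ᵐ x ∂μ, DifferentiableOn ℂ (fun w => F w x) U)
    (hm : ∀ w ∈ U, AEStronglyMeasurable (F w) μ)
    (hb : ∀ w₀ ∈ U, ∃ V ∈ 𝓝 w₀, ∃ bound : X → ℝ, Integrable bound μ ∧
      ∀ᵐ x ∂μ, ∀ w ∈ V, ‖F w x‖ ≤ bound x) :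
    DifferentiableOn ℂ (fun w => ∫ x, F w x ∂μ) U := by
  intro w₀ hw₀
  obtain ⟨V, hV, bound, hbi, hbd⟩ := hb w₀ hw₀
  obtain ⟨δ, hδ, hδV⟩ := Metric.mem_nhds_iff.1 (Filter.inter_mem hV (hU.mem_nhds hw₀))
  -- Measurability of the derivative is not assumed: it is a limit of difference quotients, along a
  -- sequence shifted by `n0` so that all its points lie in `U`.
  have hdir : ∀ v : ℂ × ℂ, AEStronglyMeasurable (fun x => fderiv ℂ (fun w => F w x) w₀ v) μ := by
    intro v
    have hlim : Filter.Tendsto (fun n : ℕ => w₀ + ((n : ℂ) + 1)⁻¹ • v) Filter.atTop (𝓝 w₀) := by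
      have : Filter.Tendsto (fun n : ℕ => ((n : ℂ) + 1)⁻¹) Filter.atTop (𝓝 0) := by
        simpa using tendsto_one_div_add_atTop_nhds_zero_nat (𝕜 := ℂ)
      simpa using (this.smul_const v).const_add w₀
    obtain ⟨n0, hn0⟩ := Filter.eventually_atTop.1 (hlim.eventually (hU.mem_nhds hw₀))
    refine aestronglyMeasurable_of_tendsto_ae (u := Filter.atTop) (f := fun (n : ℕ) x =>
      (((n + n0 : ℕ) : ℂ) + 1) * (F (w₀ + (((n + n0 : ℕ) : ℂ) + 1)⁻¹ • v) x - F w₀ x)) ?_ ?_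
    · intro n
      exact ((hm _ (hn0 _ (by omega))).sub (hm _ hw₀)).const_mul _
    · filter_upwards [hF] with x hx
      have h1 : HasFDerivAt (fun w => F w x) (fderiv ℂ (fun w => F w x) w₀) w₀ :=
        ((hx w₀ hw₀).differentiableAt (hU.mem_nhds hw₀)).hasFDerivAt
      have hc : Filter.Tendsto (fun n : ℕ => ‖(((n + n0 : ℕ) : ℂ) + 1)‖) Filter.atTop
          Filter.atTop := by
        have h2 : ∀ n : ℕ, ‖(((n + n0 : ℕ) : ℂ) + 1)‖ = n + (n0 + 1) := by
          intro n
          rw [← Nat.cast_add_one, Complex.norm_natCast]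
          push_cast; ring
        simp only [h2]
        exact Filter.tendsto_atTop_add_const_right _ _ tendsto_natCast_atTop_atTop
      simpa only [smul_eq_mul] using h1.lim v hc
  have hmeas : AEStronglyMeasurable (fun x => fderiv ℂ (fun w => F w x) w₀) μ := by
    have e : (fun x => fderiv ℂ (fun w => F w x) w₀) = fun x =>
        fderiv ℂ (fun w => F w x) w₀ (1, 0) • ContinuousLinearMap.fst ℂ ℂ ℂ +
        fderiv ℂ (fun w => F w x) w₀ (0, 1) • ContinuousLinearMap.snd ℂ ℂ ℂ := by
      ext x <;> simp
    rw [e]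
    exact ((hdir _).smul_const _).add ((hdir _).smul_const _)
  have hball : Metric.ball w₀ (δ / 2) ∈ 𝓝 w₀ := Metric.ball_mem_nhds _ (by positivity)
  refine HasFDerivAt.differentiableAt (f' := ∫ x, fderiv ℂ (fun w => F w x) w₀ ∂μ)
    ?_ |>.differentiableWithinAt
  refine hasFDerivAt_integral_of_dominated_of_fderiv_le (𝕜 := ℂ) (F := F)
    (F' := fun w x => fderiv ℂ (fun w => F w x) w)
    (bound := fun x => bound x * (2 / (δ / 2))) hball ?_ ?_ hmeas ?_ ?_ ?_
  · filter_upwards [hU.mem_nhds hw₀] with w hw using hm w hw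
  · refine hbi.mono' (hm _ hw₀) ?_
    filter_upwards [hbd] with x hx using hx _ (mem_of_mem_nhds hV)
  -- A ball of radius δ/2 about w stays where `bound` applies, so Cauchy's estimate dominates the
  -- derivative by a multiple of `bound` itself.
  · filter_upwards [hbd, hF] with x hx hFx w hw
    have hsub : Metric.ball w (δ / 2) ⊆ Metric.ball w₀ δ := by
      refine Metric.ball_subset_ball' ?_
      have := Metric.mem_ball.1 hw
      linarith
    exact norm_fderiv_le_of_bounded (by positivity)
      (hFx.mono fun y hy => (hδV (hsub hy)).2) (fun y hy => hx y (hδV (hsub hy)).1)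
  · exact hbi.mul_const _
  · filter_upwards [hF] with x hx w hw
    have hwU : w ∈ U := (hδV (Metric.ball_subset_ball (by linarith) hw)).2
    exact ((hx w hwU).differentiableAt (hU.mem_nhds hwU)).hasFDerivAt

/-! ### Local pieces of the Euler type integral -/

/-- The smooth factor of the localized integrand at the origin. -/
def locPhi (Q S : ExpPair) (w : ℂ) (ε : ℝ) (u : ℂ) : ℂ :=
  cut (u / ε) * gpow (1 - u) Q * gpow (1 - w * u) S

/-- The integral obtained from `∫ cut (u/ε) u^P (1-u)^Q (1-wu)^S` by integration by parts; it
converges for `Re P > -3`. -/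
def core (P Q S : ExpPair) (w : ℂ) (ε : ℝ) : ℂ :=
  -∫ u, gpow u P * fderiv ℝ (locPhi Q S w ε) u (ibpDir P.1 * u)

/-- The Euler type integral with an additional factor. -/
def rest (B : ℂ → ℂ) (P Q S : ExpPair) (w : ℂ) : ℂ :=
  ∫ t, B t * gpow t P * gpow (1 - t) Q * gpow (1 - w * t) S

lemma tsupport_mul_gpow_subset {E : Type*} [TopologicalSpace E] {B g σ : E → ℂ} (k : ℤ) :
    tsupport (fun e => B e * gpow (g e) (k, σ e)) ⊆ tsupport B :=
  tsupport_mul_subset_left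

lemma cut_div_eq_zero {u : ℂ} {ε : ℝ} (hε : 0 < ε) (h : 7 / 4 * ε ≤ ‖u‖) : cut (u / ε) = 0 := by
  apply cut_eq_zero
  rw [norm_div, Complex.norm_real, Real.norm_eq_abs, abs_of_pos hε, le_div_iff₀ hε]
  exact h

lemma cut_div_eq_one {u : ℂ} {ε : ℝ} (hε : 0 < ε) (h : ‖u‖ ≤ 1 / 2 * ε) : cut (u / ε) = 1 := by
  apply cut_eq_one
  rw [norm_div, Complex.norm_real, Real.norm_eq_abs, abs_of_pos hε, div_le_iff₀ hε]
  exact h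

lemma tsupport_cut_comp_subset {E : Type*} [TopologicalSpace E] {g : E → ℂ} (hg : Continuous g)
    {ε : ℝ} (hε : 0 < ε) :
    tsupport (fun e => (cut (g e / ε) : ℂ)) ⊆ {e | ‖g e‖ ≤ 7 / 4 * ε} := by
  refine closure_minimal ?_ (isClosed_le (by fun_prop) (by fun_prop))
  intro e he
  by_contra h
  exact he (by simp [cut_div_eq_zero hε (not_le.1 h).le])

lemma contDiff_cut_comp {E : Type*} [NormedAddCommGroup E] [NormedSpace ℝ E] {g : E → ℂ}
    (hg : ContDiff ℝ ∞ g) (ε : ℝ) : ContDiff ℝ ∞ (fun e => (cut (g e / ε) : ℂ)) :=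
  Complex.ofRealCLM.contDiff.comp (contDiff_cut.comp (hg.div_const _))

lemma locPhi_eq_zero (Q S : ExpPair) (w : ℂ) {ε : ℝ} (hε : 0 < ε) {u : ℂ} (h : 7 / 4 * ε ≤ ‖u‖) :
    locPhi Q S w ε u = 0 := by
  simp [locPhi, cut_div_eq_zero hε h]

lemma one_sub_ne_zero_of_norm_lt {u : ℂ} (h : ‖u‖ < 1) : 1 - u ≠ 0 := by
  intro h1
  rw [sub_eq_zero] at h1
  rw [← h1, norm_one] at h
  exact lt_irrefl _ h

lemma norm_mul_lt_one {w u : ℂ} {ε : ℝ} (hε : 0 < ε) (hw : ‖w‖ * ε ≤ 1 / 2)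
    (hu : ‖u‖ ≤ 15 / 8 * ε) : ‖w * u‖ < 1 := by
  rw [norm_mul]
  nlinarith [norm_nonneg w, norm_nonneg u]

section Smooth

variable {E : Type*} [NormedAddCommGroup E] [NormedSpace ℝ E]

lemma contDiff_fderiv_snd {Φ : E × ℂ → ℂ} (h : ContDiff ℝ ∞ Φ) :
    ContDiff ℝ ∞ (fun e : E × ℂ => fderiv ℝ (fun u => Φ (e.1, u)) e.2) := by
  have e : (fun e : E × ℂ => fderiv ℝ (fun u => Φ (e.1, u)) e.2) =
      fun e => (fderiv ℝ Φ e).comp (ContinuousLinearMap.inr ℝ E ℂ) := by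
    ext1 e
    have h1 : HasFDerivAt Φ (fderiv ℝ Φ e) (e.1, e.2) := (h.differentiable (by simp) e).hasFDerivAt
    exact (h1.comp e.2 (hasFDerivAt_prodMk_right e.1 e.2)).fderiv
  rw [e]
  exact (h.fderiv_right (m := ∞) (by simp)).clm_comp contDiff_const

/-- The factor `b` localizes in the parameter: `w` has to be smooth and small only on its support,
so functions such as w/(w-1) may be inserted although they have poles elsewhere. -/
lemma contDiff_locPhi {b w σQ σS : E → ℂ} (kQ kS : ℤ) {ε : ℝ} (hε : 0 < ε) (hε2 : ε ≤ 1 / 2)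
    (hb : ContDiff ℝ ∞ b) (hw : ∀ e ∈ tsupport b, ContDiffAt ℝ ∞ w e)
    (hwε : ∀ e ∈ tsupport b, ‖w e‖ * ε ≤ 1 / 2)
    (hσQ : ContDiff ℝ ∞ σQ) (hσS : ContDiff ℝ ∞ σS) :
    ContDiff ℝ ∞ (fun e : E × ℂ =>
      b e.1 * locPhi (kQ, σQ e.1) (kS, σS e.1) (w e.1) ε e.2) := by
  set B : E × ℂ → ℂ := fun e => b e.1 * cut (e.2 / ε) with hBdef
  have hB : ContDiff ℝ ∞ B := (hb.comp contDiff_fst).mul (contDiff_cut_comp contDiff_snd ε)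
  have hsupp : ∀ e ∈ tsupport B, e.1 ∈ tsupport b ∧ ‖e.2‖ ≤ 7 / 4 * ε := by
    intro e he
    refine ⟨?_, tsupport_cut_comp_subset continuous_snd hε (tsupport_mul_subset_right he)⟩
    exact (tsupport_comp_subset_preimage b continuous_fst) (tsupport_mul_subset_left he)
  have h1 := contDiff_mul_gpow (g := fun e : E × ℂ => 1 - e.2) (σ := fun e => σQ e.1) kQ hB
    (fun e _ => by fun_prop) (hσQ.comp contDiff_fst) (fun e he =>
      one_sub_ne_zero_of_norm_lt (by linarith [(hsupp e he).2]))
  have h2 := contDiff_mul_gpow (g := fun e : E × ℂ => 1 - w e.1 * e.2) (σ := fun e => σS e.1) kS h1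
    (fun e he => ?_) (hσS.comp contDiff_fst) (fun e he => ?_)
  · have e : (fun e : E × ℂ => b e.1 * locPhi (kQ, σQ e.1) (kS, σS e.1) (w e.1) ε e.2) =
        fun e => B e * gpow (1 - e.2) (kQ, σQ e.1) * gpow (1 - w e.1 * e.2) (kS, σS e.1) := by
      ext e; simp only [hBdef, locPhi]; ring
    rw [e]
    exact h2
  · have h := hsupp e (tsupport_mul_gpow_subset _ he)
    exact contDiffAt_const.sub (((hw _ h.1).comp e contDiffAt_fst).mul contDiffAt_snd)
  · have h := hsupp e (tsupport_mul_gpow_subset _ he)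
    exact one_sub_ne_zero_of_norm_lt (norm_mul_lt_one hε (hwε _ h.1) (by linarith [h.2]))

lemma contDiff_rest {B : E × ℂ → ℂ} {w σP σQ σS : E → ℂ} (kP kQ kS : ℤ)
    (hB : ContDiff ℝ ∞ B) (hw : ∀ e ∈ tsupport B, ContDiffAt ℝ ∞ w e.1)
    (h0 : ∀ e ∈ tsupport B, e.2 ≠ 0 ∧ 1 - e.2 ≠ 0 ∧ 1 - w e.1 * e.2 ≠ 0)
    (hσP : ContDiff ℝ ∞ σP) (hσQ : ContDiff ℝ ∞ σQ) (hσS : ContDiff ℝ ∞ σS) :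
    ContDiff ℝ ∞ (fun e : E × ℂ => B e * gpow e.2 (kP, σP e.1) * gpow (1 - e.2) (kQ, σQ e.1) *
      gpow (1 - w e.1 * e.2) (kS, σS e.1)) := by
  have h1 := contDiff_mul_gpow (g := fun e : E × ℂ => e.2) (σ := fun e => σP e.1) kP hB
    (fun e _ => by fun_prop) (hσP.comp contDiff_fst) (fun e he => (h0 e he).1)
  have h2 := contDiff_mul_gpow (g := fun e : E × ℂ => 1 - e.2) (σ := fun e => σQ e.1) kQ h1
    (fun e _ => by fun_prop) (hσQ.comp contDiff_fst)
    (fun e he => (h0 e (tsupport_mul_gpow_subset _ he)).2.1)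
  refine contDiff_mul_gpow (g := fun e : E × ℂ => 1 - w e.1 * e.2) (σ := fun e => σS e.1) kS h2
    (fun e he => ?_) (hσS.comp contDiff_fst) (fun e he => ?_)
  · have h := tsupport_mul_gpow_subset _ (tsupport_mul_gpow_subset _ he)
    exact contDiffAt_const.sub (((hw _ h).comp e contDiffAt_fst).mul contDiffAt_snd)
  · exact (h0 e (tsupport_mul_gpow_subset _ (tsupport_mul_gpow_subset _ he))).2.2

end Smooth

lemma contDiff_locPhi_single (Q S : ExpPair) {w : ℂ} {ε : ℝ} (hε : 0 < ε) (hε2 : ε ≤ 1 / 2)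
    (hw : ‖w‖ * ε ≤ 1 / 2) : ContDiff ℝ ∞ (locPhi Q S w ε) := by
  have h := contDiff_locPhi (E := ℝ) (b := fun _ => 1) (w := fun _ => w) (σQ := fun _ => Q.2)
    (σS := fun _ => S.2) Q.1 S.1 hε hε2 contDiff_const (fun _ _ => contDiffAt_const)
    (fun _ _ => hw) contDiff_const contDiff_const
  have h2 : ContDiff ℝ ∞ (fun u : ℂ => ((0 : ℝ), u)) := by fun_prop
  simpa [Function.comp_def] using h.comp h2

lemma hasCompactSupport_locPhi (Q S : ExpPair) (w : ℂ) {ε : ℝ} (hε : 0 < ε) :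
    HasCompactSupport (locPhi Q S w ε) := by
  refine HasCompactSupport.intro (isCompact_closedBall (0 : ℂ) (7 / 4 * ε)) fun u hu => ?_
  rw [Metric.mem_closedBall, dist_zero_right, not_le] at hu
  exact locPhi_eq_zero _ _ _ hε hu.le

/-- The localized integral in terms of `core`, in the domain of absolute convergence. -/
lemma integral_locPhi (P Q S : ExpPair) {w : ℂ} {ε : ℝ} (hε : 0 < ε) (hε2 : ε ≤ 1 / 2)
    (hw : ‖w‖ * ε ≤ 1 / 2) (hP : -2 < P.2.re) (hc : ibpConst P.1 P.2 ≠ 0) :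
    ∫ u, gpow u P * locPhi Q S w ε u = (ibpConst P.1 P.2)⁻¹ * core P Q S w ε := by
  rw [eq_inv_mul_iff_mul_eq₀ hc]
  exact integral_gpow_mul_ibp P.1 hP ((contDiff_locPhi_single Q S hε hε2 hw).of_le (by simp))
    (hasCompactSupport_locPhi Q S w hε)

lemma differentiable_gpow_exponent {z : ℂ} (hz : z ≠ 0) (k : ℤ) {σ : ℂ × ℂ → ℂ}
    (hσ : Differentiable ℂ σ) : Differentiable ℂ (fun x => gpow z (k, σ x)) := by
  have : (fun x => gpow z (k, σ x)) = fun x => z ^ k *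
      Complex.exp ((σ x - k) * (Real.log ‖z‖ : ℝ)) := by
    ext x; exact gpow_eq_exp hz _
  rw [this]
  fun_prop

/-- The real derivative in u is written out so that its holomorphic dependence on the exponents
becomes visible. -/
lemma fderiv_locPhi_apply (Q S : ExpPair) {w : ℂ} {ε : ℝ} {u : ℂ}
    (h1 : 1 - u ≠ 0) (h2 : 1 - w * u ≠ 0) (v : ℂ) :
    fderiv ℝ (locPhi Q S w ε) u v =
      fderiv ℝ (fun u : ℂ => (cut (u / ε) : ℂ)) u v * gpow (1 - u) Q * gpow (1 - w * u) S +
      cut (u / ε) * gpow (1 - u) Q * gpow (1 - w * u) S *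
        ((Q.fst' / (1 - u) * -v + Q.snd' / (starRingEnd ℂ) (1 - u) * (starRingEnd ℂ) (-v)) +
        (S.fst' / (1 - w * u) * -(w * v) +
          S.snd' / (starRingEnd ℂ) (1 - w * u) * (starRingEnd ℂ) (-(w * v)))) := by
  have hc : HasFDerivAt (𝕜 := ℝ) (fun u : ℂ => (cut (u / ε) : ℂ))
      (fderiv ℝ (fun u : ℂ => (cut (u / ε) : ℂ)) u) u :=
    ((contDiff_cut_comp contDiff_id ε).differentiable (by simp) u).hasFDerivAt
  have hl1 : HasFDerivAt (𝕜 := ℝ) (fun u : ℂ => 1 - u) (-(1 : ℂ →L[ℝ] ℂ)) u :=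
    (hasFDerivAt_id (𝕜 := ℝ) u).const_sub 1
  have hl2 : HasFDerivAt (𝕜 := ℝ) (fun u : ℂ => 1 - w * u) (-(w • (1 : ℂ →L[ℝ] ℂ))) u :=
    ((hasFDerivAt_id (𝕜 := ℝ) u).const_mul w).const_sub 1
  have hg1 := (hasFDerivAt_gpow h1 Q).comp u hl1
  have hg2 := (hasFDerivAt_gpow h2 S).comp u hl2
  have := ((hc.mul hg1).mul hg2).fderiv
  have e : locPhi Q S w ε = (fun u : ℂ => (cut (u / ε) : ℂ)) *
      ((fun z => gpow z Q) ∘ fun u => 1 - u) * ((fun z => gpow z S) ∘ fun u => 1 - w * u) := by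
    ext u; simp [locPhi]
  rw [e, this]
  simp
  ring

/-- The derivative is taken along a linear field and therefore carries a factor |u|. The integrand
is O(|u|^(Re σP + 1)), integrable in the plane as soon as Re σP > -3: this is the gain of one unit
over the original integral. -/
theorem differentiableOn_core {kP kQ kS : ℤ} {σP σQ σS : ℂ × ℂ → ℂ} (hσP : ContDiff ℂ ∞ σP)
    (hσQ : ContDiff ℂ ∞ σQ) (hσS : ContDiff ℂ ∞ σS) {w : ℂ} {ε : ℝ} (hε : 0 < ε)
    (hε2 : ε ≤ 1 / 2) (hw : ‖w‖ * ε ≤ 1 / 2) :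
    DifferentiableOn ℂ (fun x => core (kP, σP x) (kQ, σQ x) (kS, σS x) w ε)
      {x | -3 < (σP x).re} := by
  have hdP := hσP.differentiable (by simp)
  have hdQ := hσQ.differentiable (by simp)
  have hdS := hσS.differentiable (by simp)
  unfold core
  refine DifferentiableOn.neg (differentiableOn_integral
    (isOpen_lt continuous_const (Complex.continuous_re.comp hσP.continuous)) ?_ ?_ ?_)
  · filter_upwards [compl_mem_ae_iff.2 (measure_singleton (0 : ℂ))] with u hu
    refine Differentiable.differentiableOn ?_
    refine (differentiable_gpow_exponent hu kP hdP).mul ?_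
    by_cases h : ‖u‖ ≤ 15 / 8 * ε
    · have h1 : 1 - u ≠ 0 := one_sub_ne_zero_of_norm_lt (by linarith)
      have h2 : 1 - w * u ≠ 0 := one_sub_ne_zero_of_norm_lt (norm_mul_lt_one hε hw h)
      simp only [fderiv_locPhi_apply _ _ h1 h2, ExpPair.fst', ExpPair.snd']
      have d1 := differentiable_gpow_exponent h1 kQ hdQ
      have d2 := differentiable_gpow_exponent h2 kS hdS
      fun_prop
    · have : ∀ x, fderiv ℝ (locPhi (kQ, σQ x) (kS, σS x) w ε) u = 0 := by
        intro x
        have : locPhi (kQ, σQ x) (kS, σS x) w ε =ᶠ[𝓝 u] fun _ => 0 := by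
          filter_upwards [(isOpen_lt continuous_const continuous_norm).mem_nhds (not_le.1 h)]
            with y hy
          exact locPhi_eq_zero _ _ _ hε (by have : 15 / 8 * ε < ‖y‖ := hy; linarith)
        rw [this.fderiv_eq]; simp
      simp [this]
  · intro x _
    refine ((measurable_gpow kP measurable_id measurable_const).mul ?_).aestronglyMeasurable
    have h := contDiff_locPhi_single (kQ, σQ x) (kS, σS x) hε hε2 hw
    exact ((h.continuous_fderiv (by simp)).clm_apply (by fun_prop)).measurable
  · intro x₀ hx₀
    have hΦ := contDiff_locPhi (E := ℂ × ℂ) (b := fun _ => 1) (w := fun _ => w) (σQ := σQ)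
      (σS := σS) kQ kS hε hε2 contDiff_const (fun _ _ => contDiffAt_const)
      (fun _ _ => hw) (hσQ.restrict_scalars ℝ) (hσS.restrict_scalars ℝ)
    simp only [one_mul] at hΦ
    have hcont : Continuous fun e : (ℂ × ℂ) × ℂ =>
        fderiv ℝ (locPhi (kQ, σQ e.1) (kS, σS e.1) w ε) e.2 :=
      (contDiff_fderiv_snd hΦ).continuous
    obtain ⟨C, hC⟩ := ((isCompact_closedBall x₀ 1).prod
      (isCompact_closedBall (0 : ℂ) 1)).exists_bound_of_continuousOn hcont.continuousOn
    -- `m - 1` is the midpoint between -3 and the real part at `x₀`; hence m > -2, and m - 1 still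
    -- lies below the real parts at nearby points.
    set m := ((σP x₀).re - 3) / 2 + 1 with hm
    have hx₀' : -3 < (σP x₀).re := hx₀
    have hV : {x | m - 1 < (σP x).re} ∈ 𝓝 x₀ :=
      (isOpen_lt continuous_const (Complex.continuous_re.comp hσP.continuous)).mem_nhds
        (show m - 1 < (σP x₀).re by linarith)
    refine ⟨_, Filter.inter_mem hV (Metric.closedBall_mem_nhds x₀ one_pos),
      (Metric.closedBall (0 : ℂ) 1).indicator fun u => ‖u‖ ^ m * C, ?_, ?_⟩
    · rw [integrable_indicator_iff Metric.isClosed_closedBall.measurableSet]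
      exact (integrableOn_norm_rpow (by linarith) 1).mul_const _
    · filter_upwards [compl_mem_ae_iff.2 (measure_singleton (0 : ℂ))] with u hu x hx
      have hu' : 0 < ‖u‖ := norm_pos_iff.2 hu
      by_cases h : ‖u‖ ≤ 1
      · rw [Set.indicator_of_mem (by simpa using h), norm_mul, norm_gpow hu]
        have hb := hC (x, u) ⟨hx.2, by simpa using h⟩
        have hC0 : 0 ≤ C := (norm_nonneg _).trans hb
        have hen : ‖ibpDir kP‖ = 1 := by unfold ibpDir; split_ifs <;> simp
        calc ‖u‖ ^ (σP x).re * ‖fderiv ℝ (locPhi (kQ, σQ x) (kS, σS x) w ε) u (ibpDir kP * u)‖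
            ≤ ‖u‖ ^ (σP x).re * (C * ‖u‖) := by
              gcongr
              refine (ContinuousLinearMap.le_opNorm _ _).trans ?_
              rw [norm_mul, hen, one_mul]
              gcongr
          _ = ‖u‖ ^ ((σP x).re + 1) * C := by rw [Real.rpow_add_one hu'.ne']; ring
          _ ≤ ‖u‖ ^ m * C := by
              gcongr ?_ * C
              refine Real.rpow_le_rpow_of_exponent_ge hu' h ?_
              have : m - 1 < (σP x).re := hx.1
              linarith
      · rw [Set.indicator_of_notMem (by simpa using h)]
        have : locPhi (kQ, σQ x) (kS, σS x) w ε =ᶠ[𝓝 u] fun _ => 0 := by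
          filter_upwards [(isOpen_lt continuous_const continuous_norm).mem_nhds (not_le.1 h)]
            with y hy
          exact locPhi_eq_zero _ _ _ hε (by have : 1 < ‖y‖ := hy; linarith)
        rw [this.fderiv_eq]; simp

/-- The cutoff confines t to a compact set on which no base vanishes, so the exponents are
unrestricted. -/
theorem differentiableOn_rest {B : ℂ → ℂ} {kP kQ kS : ℤ} {σP σQ σS : ℂ × ℂ → ℂ}
    (hσP : ContDiff ℂ ∞ σP) (hσQ : ContDiff ℂ ∞ σQ) (hσS : ContDiff ℂ ∞ σS) {w : ℂ}
    (hB : ContDiff ℝ ∞ B) (hBc : HasCompactSupport B)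
    (h0 : ∀ t ∈ tsupport B, t ≠ 0 ∧ 1 - t ≠ 0 ∧ 1 - w * t ≠ 0) :
    Differentiable ℂ (fun x => rest B (kP, σP x) (kQ, σQ x) (kS, σS x) w) := by
  rw [← differentiableOn_univ]
  have hΦ := contDiff_rest (E := ℂ × ℂ) (B := fun e => B e.2) (w := fun _ => w) (σP := σP)
    (σQ := σQ) (σS := σS) kP kQ kS (hB.comp contDiff_snd) (fun _ _ => contDiffAt_const)
    (fun e he => h0 e.2 (tsupport_comp_subset_preimage B continuous_snd he))
    (hσP.restrict_scalars ℝ) (hσQ.restrict_scalars ℝ) (hσS.restrict_scalars ℝ)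
  unfold rest
  refine differentiableOn_integral isOpen_univ (ae_of_all _ fun t => ?_) (fun x _ => ?_)
    (fun x₀ _ => ?_)
  · by_cases ht : t ∈ tsupport B
    · obtain ⟨h1, h2, h3⟩ := h0 t ht
      have d0 := differentiable_gpow_exponent h1 kP (hσP.differentiable (by simp))
      have d1 := differentiable_gpow_exponent h2 kQ (hσQ.differentiable (by simp))
      have d2 := differentiable_gpow_exponent h3 kS (hσS.differentiable (by simp))
      exact (by fun_prop : Differentiable ℂ _).differentiableOn
    · simp only [image_eq_zero_of_notMem_tsupport ht, zero_mul]
      exact differentiableOn_const _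
  · have : Continuous fun t : ℂ => (x, t) := by fun_prop
    exact (hΦ.continuous.comp this).aestronglyMeasurable
  · obtain ⟨C, hC⟩ := ((isCompact_closedBall x₀ 1).prod
      hBc.isCompact).exists_bound_of_continuousOn hΦ.continuous.continuousOn
    refine ⟨_, Metric.closedBall_mem_nhds x₀ one_pos, (tsupport B).indicator fun _ => C, ?_, ?_⟩
    · rw [integrable_indicator_iff (isClosed_tsupport B).measurableSet]
      exact integrableOn_const hBc.isCompact.measure_lt_top.ne
    · refine ae_of_all _ fun t x hx => ?_
      by_cases ht : t ∈ tsupport B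
      · rw [Set.indicator_of_mem ht]
        exact hC (x, t) ⟨hx, ht⟩
      · rw [Set.indicator_of_notMem ht, image_eq_zero_of_notMem_tsupport ht]
        simp

/-! ### Decomposition of the Euler type integral -/

lemma ibpConst_ne_zero (k : ℤ) {σ : ℂ} (hσ : -2 < σ.re) : ibpConst k σ ≠ 0 := by
  unfold ibpConst
  split_ifs with h
  · intro h0
    have := congrArg Complex.re h0
    simp at this
    linarith
  · simp [h]

/-- The pair `1|1`. -/
def pairOne : ExpPair := (0, 2)

/-- The exponent at infinity of `t^P (1-t)^Q (1-wt)^S d²t`. -/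
def pairInf (P Q S : ExpPair) : ExpPair := -P - Q - S - pairOne - pairOne

lemma gpow_pairOne (t : ℂ) : gpow t pairOne = (‖t‖ : ℂ) ^ 2 := by
  simp [gpow, pairOne]

/-- The integrand of the Euler type integral with an additional factor. -/
def euInt (B : ℂ → ℂ) (P Q S : ExpPair) (w t : ℂ) : ℂ :=
  B t * gpow t P * gpow (1 - t) Q * gpow (1 - w * t) S

lemma rest_eq (B : ℂ → ℂ) (P Q S : ExpPair) (w : ℂ) :
    rest B P Q S w = ∫ t, euInt B P Q S w t := rfl

/-- The regularized local integral at the origin. -/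
def regLoc (P Q S : ExpPair) (w : ℂ) (ε : ℝ) : ℂ :=
  (ibpConst P.1 P.2)⁻¹ * core P Q S w ε

lemma integrable_gpow_mul {P : ExpPair} (hP : -2 < P.2.re) {φ : ℂ → ℂ} (hφ : Continuous φ)
    (hc : HasCompactSupport φ) : Integrable (fun u => gpow u P * φ u) := by
  obtain ⟨C, hC⟩ := hc.exists_bound_of_continuous hφ
  obtain ⟨R, hR⟩ := hc.isCompact.isBounded.subset_closedBall (0 : ℂ)
  have hb : Integrable ((Metric.closedBall (0 : ℂ) R).indicator fun u => ‖u‖ ^ P.2.re * C) := by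
    rw [integrable_indicator_iff Metric.isClosed_closedBall.measurableSet]
    exact (integrableOn_norm_rpow hP R).mul_const _
  refine hb.mono' ((measurable_gpow P.1 measurable_id measurable_const).mul
    hφ.measurable).aestronglyMeasurable ?_
  filter_upwards [compl_mem_ae_iff.2 (measure_singleton (0 : ℂ))] with u hu
  by_cases h : u ∈ Metric.closedBall 0 R
  · rw [Set.indicator_of_mem h, norm_mul]
    change ‖gpow u P‖ * _ ≤ _
    rw [norm_gpow hu]
    gcongr
    exact hC u
  · rw [Set.indicator_of_notMem h, image_eq_zero_of_notMem_tsupport fun h' => h (hR h')]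
    simp

lemma integrable_gpow_mul_locPhi {P Q S : ExpPair} {w : ℂ} {ε : ℝ} (hε : 0 < ε) (hε2 : ε ≤ 1 / 2)
    (hw : ‖w‖ * ε ≤ 1 / 2) (hP : -2 < P.2.re) :
    Integrable (fun u => gpow u P * locPhi Q S w ε u) :=
  integrable_gpow_mul hP (contDiff_locPhi_single Q S hε hε2 hw).continuous
    (hasCompactSupport_locPhi Q S w hε)

section Pieces

variable {P Q S : ExpPair} {w : ℂ} {ε : ℝ}

lemma euInt_zero_piece (hε : 0 < ε) (hε2 : ε ≤ 1 / 2) (hw : ‖w‖ * ε ≤ 1 / 2) (hP : -2 < P.2.re) :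
    Integrable (euInt (fun t => cut (t / ε)) P Q S w) ∧
      ∫ t, euInt (fun t => cut (t / ε)) P Q S w t = regLoc P Q S w ε := by
  have e : euInt (fun t => cut (t / ε)) P Q S w = fun u => gpow u P * locPhi Q S w ε u := by
    ext u; simp only [euInt, locPhi]; ring
  rw [e]
  exact ⟨integrable_gpow_mul_locPhi hε hε2 hw hP,
    integral_locPhi P Q S hε hε2 hw hP (ibpConst_ne_zero _ hP)⟩

/-- The reflection t ↦ 1 - t moves the singular point 1 to the origin; 1 - wt becomes (1-w) times 1
- w/(w-1) u, again of the standard shape. -/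
lemma euInt_one_piece (hε : 0 < ε) (hε2 : ε ≤ 1 / 2) (hw1 : w ≠ 1)
    (hw : ‖w / (w - 1)‖ * ε ≤ 1 / 2) (hQ : -2 < Q.2.re) :
    Integrable (euInt (fun t => cut ((1 - t) / ε)) P Q S w) ∧
      ∫ t, euInt (fun t => cut ((1 - t) / ε)) P Q S w t =
        gpow (1 - w) S * regLoc Q P S (w / (w - 1)) ε := by
  have hw1' : w - 1 ≠ 0 := sub_ne_zero.2 hw1
  have e : euInt (fun t => cut ((1 - t) / ε)) P Q S w = fun t => gpow (1 - w) S *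
      (fun u => gpow u Q * locPhi P S (w / (w - 1)) ε u) (1 - t) := by
    ext t
    have h : 1 - w * t = (1 - w) * (1 - w / (w - 1) * (1 - t)) := by field_simp; ring
    simp only [euInt, locPhi]
    rw [h, gpow_mul, sub_sub_cancel]
    ring
  rw [e]
  refine ⟨((integrable_gpow_mul_locPhi hε hε2 hw hQ).comp_sub_left 1).const_mul _, ?_⟩
  rw [integral_const_mul, integral_sub_left_eq_self
    (fun u => gpow u Q * locPhi P S (w / (w - 1)) ε u) volume 1, regLoc,
    integral_locPhi Q P S hε hε2 hw hQ (ibpConst_ne_zero _ hQ)]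

/-- Here u = 1 - wt is the new variable, and 1 - t = ((w-1)/w)(1 - u/(1-w)). -/
lemma euInt_third_piece (hε : 0 < ε) (hε2 : ε ≤ 1 / 2) (hw0 : w ≠ 0) (hw1 : w ≠ 1)
    (hw : ‖1 / (1 - w)‖ * ε ≤ 1 / 2) (hS : -2 < S.2.re) :
    Integrable (euInt (fun t => cut ((1 - w * t) / ε)) P Q S w) ∧
      ∫ t, euInt (fun t => cut ((1 - w * t) / ε)) P Q S w t =
        gpow w (-P - pairOne) * gpow ((w - 1) / w) Q * regLoc S P Q (1 / (1 - w)) ε := by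
  have hw1' : 1 - w ≠ 0 := sub_ne_zero.2 hw1.symm
  have e : euInt (fun t => cut ((1 - w * t) / ε)) P Q S w = fun t =>
      (gpow w (-P) * gpow ((w - 1) / w) Q) *
      (fun u => gpow u S * locPhi P Q (1 / (1 - w)) ε u) (1 - w * t) := by
    ext t
    have h : 1 - t = ((w - 1) / w) * (1 - 1 / (1 - w) * (1 - w * t)) := by
      field_simp; ring
    simp only [euInt, locPhi]
    rw [h, gpow_mul, show 1 - (1 - w * t) = w * t by ring, gpow_mul w t, gpow_neg]
    have := gpow_ne_zero hw0 P
    field_simp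
  have hI := integrable_gpow_mul_locPhi (Q := P) (S := Q) hε hε2 hw hS
  rw [e]
  refine ⟨(integrable_comp_mul (hI.comp_sub_left 1) hw0).const_mul _, ?_⟩
  rw [integral_const_mul, integral_comp_mul
    (fun t => (fun u => gpow u S * locPhi P Q (1 / (1 - w)) ε u) (1 - t)) hw0,
    integral_sub_left_eq_self (fun u => gpow u S * locPhi P Q (1 / (1 - w)) ε u) volume 1, regLoc,
    integral_locPhi S P Q hε hε2 hw hS (ibpConst_ne_zero _ hS), gpow_sub hw0, gpow_pairOne]
  ring

lemma gpow_pairInf {u : ℂ} (hu : u ≠ 0) : gpow u (pairInf P Q S) =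
    (gpow u P)⁻¹ * (gpow u Q)⁻¹ * (gpow u S)⁻¹ * ((‖u‖ : ℂ) ^ 4)⁻¹ := by
  rw [pairInf, gpow_sub hu, gpow_sub hu, gpow_sub hu, gpow_sub hu, gpow_neg, gpow_pairOne]
  rw [show ((‖u‖ : ℂ) ^ 4)⁻¹ = ((‖u‖ : ℂ) ^ 2)⁻¹ * ((‖u‖ : ℂ) ^ 2)⁻¹ by
    rw [← mul_inv, ← pow_add]]
  ring

/-- Inversion moves ∞ to the origin. By `cut_inv` the cutoff becomes the standard one, and the
Jacobian |t|⁻⁴ accounts for the two copies of `pairOne` in `pairInf`. -/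
lemma euInt_inf_piece (hε : 0 < ε) (hε2 : ε ≤ 1 / 2) (hw0 : w ≠ 0)
    (hw : ‖1 / w‖ * ε ≤ 1 / 2) (hO : -2 < (pairInf P Q S).2.re) :
    Integrable (euInt (fun t => 1 - cut (ε * t)) P Q S w) ∧
      ∫ t, euInt (fun t => 1 - cut (ε * t)) P Q S w t =
        gpow (-1) Q * gpow (-w) S * regLoc (pairInf P Q S) Q S (1 / w) ε := by
  set g : ℂ → ℂ := fun u => gpow u (pairInf P Q S) * locPhi Q S (1 / w) ε u with hg
  have e : (fun t => ((‖t‖ : ℂ) ^ 4)⁻¹ * (gpow (-1) Q * gpow (-w) S * g t⁻¹)) =ᵐ[volume]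
      euInt (fun t => 1 - cut (ε * t)) P Q S w := by
    filter_upwards [compl_mem_ae_iff.2 (measure_singleton (0 : ℂ))] with t ht
    have ht' : t ≠ 0 := ht
    have hε' : (ε : ℂ) ≠ 0 := by exact_mod_cast hε.ne'
    have hn : (‖t‖ : ℂ) ≠ 0 := by simpa using ht'
    have h1 : 1 - t = (-1) * (t * (1 - t⁻¹)) := by field_simp; ring
    have h2 : 1 - w * t = (-w) * (t * (1 - 1 / w * t⁻¹)) := by field_simp; ring
    have h3 : cut (t⁻¹ / ε) = 1 - cut (ε * t) := by
      rw [← cut_inv (mul_ne_zero hε' ht')]; congr 1; field_simp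
    simp only [euInt, locPhi, hg]
    rw [gpow_pairInf (inv_ne_zero ht'), h3, h1, h2, gpow_mul (-1), gpow_mul t, gpow_mul (-w),
      gpow_mul t, gpow_inv, gpow_inv, gpow_inv, norm_inv]
    push_cast
    field_simp
  have hI : Integrable (fun u => gpow (-1) Q * gpow (-w) S * g u) :=
    (integrable_gpow_mul_locPhi hε hε2 hw hO).const_mul _
  refine ⟨(integrable_comp_inv hI).congr e, ?_⟩
  rw [← integral_congr_ae e,
    ← integral_comp_inv (fun u => gpow (-1) Q * gpow (-w) S * g u), integral_const_mul, regLoc,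
    integral_locPhi _ Q S hε hε2 hw hO (ibpConst_ne_zero _ hO)]

/-- The substitution `t = 1/(wv)`. -/
lemma euInt_comp_inv {B : ℂ → ℂ} (hw0 : w ≠ 0)
    (hI : Integrable (euInt B (pairInf P Q S) S Q w)) :
    Integrable (euInt (fun t => B (w * t)⁻¹) P Q S w) ∧
      ∫ t, euInt (fun t => B (w * t)⁻¹) P Q S w t =
        gpow (-1) (Q + S) * gpow w (-P - Q - pairOne) *
          ∫ t, euInt B (pairInf P Q S) S Q w t := by
  have e : (fun t => ((‖w * t‖ : ℂ) ^ 4)⁻¹ * (gpow (-1) (Q + S) * gpow w (-P - Q) *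
        euInt B (pairInf P Q S) S Q w (w * t)⁻¹)) =ᵐ[volume]
      euInt (fun t => B (w * t)⁻¹) P Q S w := by
    filter_upwards [compl_mem_ae_iff.2 (measure_singleton (0 : ℂ))] with t ht
    have ht' : t ≠ 0 := ht
    have hwt : w * t ≠ 0 := mul_ne_zero hw0 ht'
    have hn : (‖w * t‖ : ℂ) ≠ 0 := by simpa using hwt
    have h1 : 1 - t = (-1) * (t * (1 - w * (w * t)⁻¹)) := by field_simp; ring
    have h2 : 1 - w * t = (-1) * ((w * t) * (1 - (w * t)⁻¹)) := by field_simp; ring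
    simp only [euInt]
    rw [gpow_pairInf (inv_ne_zero hwt), h1, h2, gpow_mul (-1), gpow_mul t (1 - w * (w * t)⁻¹),
      gpow_mul (-1) (w * t * (1 - (w * t)⁻¹)), gpow_mul (w * t) (1 - (w * t)⁻¹), gpow_inv, gpow_inv,
      gpow_inv, norm_inv, gpow_add (by norm_num : (-1 : ℂ) ≠ 0), gpow_sub hw0, gpow_neg]
    rw [gpow_mul w t P, gpow_mul w t Q]
    have := gpow_ne_zero hw0 P
    have := gpow_ne_zero hw0 Q
    have := gpow_ne_zero hwt S
    push_cast
    field_simp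
  have hI2 := hI.const_mul (gpow (-1) (Q + S) * gpow w (-P - Q))
  have hI3 := integrable_comp_mul (integrable_comp_inv hI2) hw0
  refine ⟨hI3.congr e, ?_⟩
  rw [← integral_congr_ae e, integral_comp_mul (fun t => ((‖t‖ : ℂ) ^ 4)⁻¹ *
    (gpow (-1) (Q + S) * gpow w (-P - Q) * euInt B (pairInf P Q S) S Q w t⁻¹)) hw0,
    ← integral_comp_inv (fun u => gpow (-1) (Q + S) * gpow w (-P - Q) *
      euInt B (pairInf P Q S) S Q w u), integral_const_mul, gpow_sub hw0 _ pairOne, gpow_pairOne]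
  ring

lemma integrable_euInt {B : ℂ → ℂ} (hB : ContDiff ℝ ∞ B) (hBc : HasCompactSupport B)
    (h0 : ∀ t ∈ tsupport B, t ≠ 0 ∧ 1 - t ≠ 0 ∧ 1 - w * t ≠ 0) :
    Integrable (euInt B P Q S w) := by
  have h := contDiff_rest (E := ℝ) (B := fun e => B e.2) (w := fun _ => w) (σP := fun _ => P.2)
    (σQ := fun _ => Q.2) (σS := fun _ => S.2) P.1 Q.1 S.1 (hB.comp contDiff_snd)
    (fun _ _ => contDiffAt_const)
    (fun e he => h0 e.2 (tsupport_comp_subset_preimage B continuous_snd he))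
    contDiff_const contDiff_const contDiff_const
  have h2 : Continuous (fun u : ℂ => ((0 : ℝ), u)) := by fun_prop
  have h3 : Continuous (euInt B P Q S w) := h.continuous.comp h2
  refine h3.integrable_of_hasCompactSupport ?_
  exact ((hBc.mul_right).mul_right).mul_right

end Pieces

/-! ### The decomposition at an interior point -/

/-- The part of the partition of unity away from the singular points `0, 1, 1/w, ∞`. -/
def rhoInt (w : ℂ) (ε : ℝ) (t : ℂ) : ℂ :=
  cut (ε * t) - cut (t / ε) - cut ((1 - t) / ε) - cut ((1 - w * t) / ε)

/-- The regularized Euler type integral, computed by means of a partition of unity. -/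
def regEuler (P Q S : ExpPair) (w : ℂ) (ε : ℝ) : ℂ :=
  regLoc P Q S w ε + gpow (1 - w) S * regLoc Q P S (w / (w - 1)) ε +
  gpow w (-P - pairOne) * gpow ((w - 1) / w) Q * regLoc S P Q (1 / (1 - w)) ε +
  gpow (-1) Q * gpow (-w) S * regLoc (pairInf P Q S) Q S (1 / w) ε +
  rest (rhoInt w ε) P Q S w

/-- The size of the cutoffs is admissible for `w`. -/
structure Admissible (w : ℂ) (ε : ℝ) : Prop where
  pos : 0 < ε
  le_half : ε ≤ 1 / 8
  ne_zero : w ≠ 0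
  ne_one : w ≠ 1
  norm_le : ‖w‖ * ε ≤ 1 / 8
  norm_inv_le : ε ≤ 1 / 8 * ‖w‖
  norm_sub_le : ε ≤ 1 / 8 * ‖1 - w‖
  norm_div_le : ‖w‖ * ε ≤ 1 / 8 * ‖1 - w‖

lemma contDiff_rhoInt (w : ℂ) (ε : ℝ) : ContDiff ℝ ∞ (rhoInt w ε) := by
  unfold rhoInt
  refine (((Complex.ofRealCLM.contDiff.comp (contDiff_cut.comp ?_)).sub ?_).sub ?_).sub ?_
  · fun_prop
  · exact contDiff_cut_comp (by fun_prop) ε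
  · exact contDiff_cut_comp (by fun_prop) ε
  · exact contDiff_cut_comp (by fun_prop) ε

/-- All conditions hold strictly at z₀ for small ε, hence persist nearby. A single ε for a whole
neighbourhood is what allows differentiation in z with the cutoffs fixed. -/
lemma exists_admissible {z₀ : ℂ} (h : z₀ ∈ dotC) : ∃ ε, ∀ᶠ z in 𝓝 z₀, Admissible z ε := by
  have hn0 : 0 < ‖z₀‖ := norm_pos_iff.2 h.1
  have hn1 : 0 < ‖1 - z₀‖ := norm_pos_iff.2 (sub_ne_zero.2 (Ne.symm h.2))
  have key : ∀ c d : ℝ, 0 < d → ∀ᶠ ε : ℝ in 𝓝[>] 0, c * ε < d := by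
    intro c d hd
    have : Filter.Tendsto (fun ε : ℝ => c * ε) (𝓝[>] 0) (𝓝 0) := by
      have h1 : Filter.Tendsto (fun ε : ℝ => c * ε) (𝓝 0) (𝓝 (c * 0)) :=
        (continuous_const_mul c).tendsto 0
      rw [mul_zero] at h1
      exact h1.mono_left nhdsWithin_le_nhds
    exact this.eventually (gt_mem_nhds hd)
  obtain ⟨ε, ⟨⟨⟨⟨⟨h1, h2⟩, h3⟩, h4⟩, h5⟩, h6⟩⟩ :=
    ((((((key 1 (1 / 8) (by norm_num)).and (key ‖z₀‖ (1 / 8) (by norm_num))).and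
    (key 1 (1 / 8 * ‖z₀‖) (by positivity))).and (key 1 (1 / 8 * ‖1 - z₀‖) (by positivity))).and
    (key ‖z₀‖ (1 / 8 * ‖1 - z₀‖) (by positivity))).and self_mem_nhdsWithin).exists
  rw [one_mul] at h1 h3 h4
  refine ⟨ε, ?_⟩
  have e2 : ∀ᶠ z in 𝓝 z₀, ‖z‖ * ε < 1 / 8 :=
    ContinuousAt.eventually_lt (by fun_prop) (by fun_prop) h2
  have e3 : ∀ᶠ z in 𝓝 z₀, ε < 1 / 8 * ‖z‖ :=
    ContinuousAt.eventually_lt (by fun_prop) (by fun_prop) h3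
  have e4 : ∀ᶠ z in 𝓝 z₀, ε < 1 / 8 * ‖1 - z‖ :=
    ContinuousAt.eventually_lt (by fun_prop) (by fun_prop) h4
  have e5 : ∀ᶠ z in 𝓝 z₀, ‖z‖ * ε < 1 / 8 * ‖1 - z‖ :=
    ContinuousAt.eventually_lt (by fun_prop) (by fun_prop) h5
  filter_upwards [e2, e3, e4, e5, isOpen_ne.mem_nhds h.1, isOpen_ne.mem_nhds h.2]
    with z h2 h3 h4 h5 h7 h8
  exact ⟨h6, h1.le, h7, h8, h2.le, h3.le, h4.le, h5.le⟩

/-- The region containing the support of `rhoInt`. -/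
def rhoIntRegion (w : ℂ) (ε : ℝ) : Set ℂ :=
  {t | ε / 2 ≤ ‖t‖ ∧ ε / 2 ≤ ‖1 - t‖ ∧ ε / 2 ≤ ‖1 - w * t‖ ∧ ‖t‖ ≤ 7 / (4 * ε)}

/-- Near each of the points 0, 1 and 1/w the large cutoff and exactly one small cutoff equal 1 and
cancel; near infinity all four vanish. The constants in `Admissible` guarantee that the small discs
do not meet. -/
lemma rhoInt_ne_zero {w : ℂ} {ε : ℝ} (h : Admissible w ε) {t : ℂ} (ht : rhoInt w ε t ≠ 0) :
    t ∈ rhoIntRegion w ε := by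
  obtain ⟨h1, h2, h3, h4, h5, h6, h7, h8⟩ := h
  have hε : (ε : ℂ) ≠ 0 := by exact_mod_cast h1.ne'
  have hw : 0 < ‖w‖ := norm_pos_iff.2 h3
  have a1 := norm_sub_norm_le (1 : ℂ) t
  have a2 := norm_sub_norm_le (1 : ℂ) (1 - t)
  have a3 := norm_sub_norm_le (1 : ℂ) (w * t)
  have a4 := norm_sub_norm_le (1 : ℂ) (1 - w * t)
  have a5 : ‖1 - w‖ - ‖w * (1 - t)‖ ≤ ‖1 - w * t‖ := by
    have := norm_sub_norm_le (1 - w) (-(w * (1 - t)))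
    rw [norm_neg, show 1 - w - -(w * (1 - t)) = 1 - w * t by ring] at this
    exact this
  have a6 := norm_sub_norm_le t 1
  have a7 := norm_sub_norm_le (w * t) 1
  have a8 := norm_sub_norm_le t (t - 1)
  have a9 := norm_sub_norm_le (w * t) (w * t - 1)
  rw [sub_sub_cancel] at a2 a4 a8 a9
  rw [norm_sub_rev t 1] at a6 a8
  rw [norm_sub_rev (w * t) 1] at a7 a9
  simp only [norm_one, norm_mul] at a1 a2 a3 a4 a5 a6 a7 a8 a9
  have hεn : ‖(ε : ℂ) * t‖ = ε * ‖t‖ := by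
    rw [norm_mul, Complex.norm_real, Real.norm_eq_abs, abs_of_pos h1]
  by_contra hn
  apply ht
  change ¬(ε / 2 ≤ ‖t‖ ∧ ε / 2 ≤ ‖1 - t‖ ∧ ε / 2 ≤ ‖1 - w * t‖ ∧ ‖t‖ ≤ 7 / (4 * ε)) at hn
  simp only [not_and_or, not_le] at hn
  unfold rhoInt
  rcases hn with hn | hn | hn | hn
  · rw [cut_eq_one (u := ε * t) (by rw [hεn]; nlinarith [norm_nonneg t]),
      cut_div_eq_one h1 (by linarith), cut_div_eq_zero h1 (by linarith),
      cut_div_eq_zero h1 (by nlinarith [norm_nonneg t])]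
    simp
  · rw [cut_eq_one (u := ε * t) (by rw [hεn]; nlinarith [norm_nonneg t]),
      cut_div_eq_zero h1 (by linarith), cut_div_eq_one h1 (by linarith),
      cut_div_eq_zero h1 (by nlinarith [norm_nonneg (1 - t)])]
    simp
  · rw [cut_eq_one (u := ε * t) (by rw [hεn]; nlinarith [norm_nonneg t]),
      cut_div_eq_zero h1 (u := t) (by
        by_contra hc
        nlinarith [norm_nonneg t]),
      cut_div_eq_zero h1 (u := 1 - t) (by
        by_contra hc
        nlinarith [norm_nonneg (1 - t)]), cut_div_eq_one h1 (by linarith)]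
    simp
  · rw [div_lt_iff₀ (by positivity)] at hn
    have hbig : 1 < ‖t‖ := by nlinarith
    rw [cut_eq_zero (u := ε * t) (by rw [hεn]; linarith),
      cut_div_eq_zero h1 (u := t) (by nlinarith),
      cut_div_eq_zero h1 (u := 1 - t) (by nlinarith),
      cut_div_eq_zero h1 (u := 1 - w * t) (by nlinarith)]
    simp

lemma isClosed_rhoIntRegion (w : ℂ) (ε : ℝ) : IsClosed (rhoIntRegion w ε) := by
  change IsClosed ({t : ℂ | ε / 2 ≤ ‖t‖} ∩ ({t : ℂ | ε / 2 ≤ ‖1 - t‖} ∩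
    ({t : ℂ | ε / 2 ≤ ‖1 - w * t‖} ∩ {t : ℂ | ‖t‖ ≤ 7 / (4 * ε)})))
  exact ((isClosed_le continuous_const (by fun_prop)).inter ((isClosed_le continuous_const
    (by fun_prop)).inter ((isClosed_le continuous_const (by fun_prop)).inter
      (isClosed_le (by fun_prop) continuous_const))))

lemma tsupport_rhoInt {w : ℂ} {ε : ℝ} (h : Admissible w ε) :
    tsupport (rhoInt w ε) ⊆ rhoIntRegion w ε :=
  closure_minimal (fun _ ht => rhoInt_ne_zero h ht) (isClosed_rhoIntRegion w ε)

lemma rhoIntRegion_ne_zero {w : ℂ} {ε : ℝ} (hε : 0 < ε) {t : ℂ} (ht : t ∈ rhoIntRegion w ε) :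
    t ≠ 0 ∧ 1 - t ≠ 0 ∧ 1 - w * t ≠ 0 :=
  ⟨norm_pos_iff.1 (by linarith [ht.1]), norm_pos_iff.1 (by linarith [ht.2.1]),
    norm_pos_iff.1 (by linarith [ht.2.2.1])⟩

lemma hasCompactSupport_rhoInt {w : ℂ} {ε : ℝ} (h : Admissible w ε) :
    HasCompactSupport (rhoInt w ε) := by
  refine HasCompactSupport.intro (isCompact_closedBall (0 : ℂ) (7 / (4 * ε))) fun t ht => ?_
  by_contra h0
  exact ht (by simpa using (rhoInt_ne_zero h h0).2.2.2)

/-- Where the integral converges, the four local cutoffs and `rhoInt` add up to 1, and each local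
piece equals its regularization. The right side makes sense beyond convergence. -/
theorem integral_eq_regEuler {P Q S : ExpPair} {w : ℂ} {ε : ℝ} (h : Admissible w ε)
    (hP : -2 < P.2.re) (hQ : -2 < Q.2.re) (hS : -2 < S.2.re) (hO : -2 < (pairInf P Q S).2.re) :
    ∫ t, gpow t P * gpow (1 - t) Q * gpow (1 - w * t) S = regEuler P Q S w ε := by
  obtain ⟨h1, h2, h3, h4, h5, h6, h7, h8⟩ := id h
  have hw : 0 < ‖w‖ := norm_pos_iff.2 h3
  have hw1 : 0 < ‖1 - w‖ := norm_pos_iff.2 (sub_ne_zero.2 (Ne.symm h4))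
  have p1 := euInt_zero_piece (P := P) (Q := Q) (S := S) (w := w) h1 (by linarith) (by linarith) hP
  have p2 := euInt_one_piece (P := P) (Q := Q) (S := S) (w := w) h1 (by linarith) h4 (by
    rw [norm_div, norm_sub_rev, div_mul_eq_mul_div, div_le_iff₀ hw1]; linarith) hQ
  have p3 := euInt_third_piece (P := P) (Q := Q) (S := S) (w := w) h1 (by linarith) h3 h4 (by
    rw [norm_div, norm_one, div_mul_eq_mul_div, div_le_iff₀ hw1]; linarith) hS
  have p4 := euInt_inf_piece (P := P) (Q := Q) (S := S) (w := w) h1 (by linarith) h3 (by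
    rw [norm_div, norm_one, div_mul_eq_mul_div, div_le_iff₀ hw]; linarith) hO
  have p5 : Integrable (euInt (rhoInt w ε) P Q S w) :=
    integrable_euInt (contDiff_rhoInt w ε) (hasCompactSupport_rhoInt h)
      (fun t ht => rhoIntRegion_ne_zero h1 (tsupport_rhoInt h ht))
  rw [regEuler, ← p1.2, ← p2.2, ← p3.2, ← p4.2, rest_eq, ← integral_add' p1.1 p2.1,
    ← integral_add' (p1.1.add p2.1) p3.1, ← integral_add' ((p1.1.add p2.1).add p3.1) p4.1,
    ← integral_add' (((p1.1.add p2.1).add p3.1).add p4.1) p5]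
  congr 1
  ext t
  simp only [euInt, rhoInt, Pi.add_apply]
  ring

/-! ### The decomposition at a point of confluence -/

/-- The part of the cutoff `cut (t/8)` away from `0` and `1`. -/
def rhoConf (t : ℂ) : ℂ := cut (t / (8 : ℝ)) - cut (t / (1 / 8 : ℝ)) - cut ((1 - t) / (1 / 8 : ℝ))

/-- The cutoff of the intermediate region `1 ≪ |t| ≪ 1/|w|`. -/
def rhoMid (w t : ℂ) : ℂ := (1 - cut (t / (8 : ℝ))) * cut ((w * t) / (1 / 8 : ℝ))

/-- The regularized integral over a neighbourhood of the points `0` and `1`. -/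
def regNear (P Q S : ExpPair) (w : ℂ) : ℂ :=
  regLoc P Q S w (1 / 8) + gpow (1 - w) S * regLoc Q P S (w / (w - 1)) (1 / 8) +
  rest rhoConf P Q S w

/-- The regularized Euler type integral for small `w`. -/
def regConf (P Q S : ExpPair) (w : ℂ) : ℂ :=
  regNear P Q S w + rest (rhoMid w) P Q S w +
  gpow (-1) (Q + S) * gpow w (-P - Q - pairOne) * regNear (pairInf P Q S) S Q w

lemma contDiff_rhoConf : ContDiff ℝ ∞ rhoConf :=
  ((contDiff_cut_comp (by fun_prop) _).sub (contDiff_cut_comp (by fun_prop) _)).sub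
    (contDiff_cut_comp (by fun_prop) _)

lemma rhoConf_ne_zero {t : ℂ} (ht : rhoConf t ≠ 0) :
    1 / 16 ≤ ‖t‖ ∧ 1 / 16 ≤ ‖1 - t‖ ∧ ‖t‖ ≤ 14 := by
  have a1 := norm_sub_norm_le (1 : ℂ) t
  have a2 := norm_sub_norm_le (1 : ℂ) (1 - t)
  have a6 := norm_sub_norm_le t 1
  have a8 := norm_sub_norm_le t (t - 1)
  rw [sub_sub_cancel] at a2 a8
  rw [norm_sub_rev t 1] at a6 a8
  rw [norm_one] at a1 a2 a6
  by_contra hn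
  apply ht
  simp only [not_and_or, not_le] at hn
  unfold rhoConf
  rcases hn with hn | hn | hn
  · rw [cut_div_eq_one (by norm_num) (by linarith), cut_div_eq_one (by norm_num) (by linarith),
      cut_div_eq_zero (by norm_num) (by linarith)]
    simp
  · rw [cut_div_eq_one (by norm_num) (by linarith), cut_div_eq_zero (by norm_num) (by linarith),
      cut_div_eq_one (by norm_num) (by linarith)]
    simp
  · rw [cut_div_eq_zero (by norm_num) (by linarith), cut_div_eq_zero (by norm_num) (by linarith),
      cut_div_eq_zero (by norm_num) (by linarith)]
    simp

lemma tsupport_rhoConf :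
    tsupport rhoConf ⊆ {t | 1 / 16 ≤ ‖t‖ ∧ 1 / 16 ≤ ‖1 - t‖ ∧ ‖t‖ ≤ 14} :=
  closure_minimal (fun _ ht => rhoConf_ne_zero ht) (by
    change IsClosed ({t : ℂ | 1 / 16 ≤ ‖t‖} ∩ ({t : ℂ | 1 / 16 ≤ ‖1 - t‖} ∩ {t : ℂ | ‖t‖ ≤ 14}))
    exact ((isClosed_le continuous_const (by fun_prop)).inter ((isClosed_le continuous_const
      (by fun_prop)).inter (isClosed_le (by fun_prop) continuous_const))))

lemma tsupport_rhoConf_ne_zero {w t : ℂ} (hw : ‖w‖ ≤ 1 / 256) (ht : t ∈ tsupport rhoConf) :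
    t ≠ 0 ∧ 1 - t ≠ 0 ∧ 1 - w * t ≠ 0 := by
  obtain ⟨h1, h2, h3⟩ := tsupport_rhoConf ht
  refine ⟨norm_pos_iff.1 (by linarith), norm_pos_iff.1 (by linarith), ?_⟩
  apply one_sub_ne_zero_of_norm_lt
  rw [norm_mul]
  nlinarith [norm_nonneg w]

lemma hasCompactSupport_rhoConf : HasCompactSupport rhoConf := by
  refine HasCompactSupport.intro (isCompact_closedBall (0 : ℂ) 14) fun t ht => ?_
  by_contra h0
  exact ht (by simpa using (rhoConf_ne_zero h0).2.2)

lemma contDiff_rhoMid (w : ℂ) : ContDiff ℝ ∞ (rhoMid w) :=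
  (contDiff_const.sub (contDiff_cut_comp (by fun_prop) _)).mul (contDiff_cut_comp (by fun_prop) _)

lemma rhoMid_ne_zero {w t : ℂ} (ht : rhoMid w t ≠ 0) : 4 ≤ ‖t‖ ∧ ‖w * t‖ ≤ 7 / 32 := by
  by_contra hn
  apply ht
  simp only [not_and_or, not_le] at hn
  unfold rhoMid
  rcases hn with hn | hn
  · rw [cut_div_eq_one (by norm_num) (by linarith)]; simp
  · rw [cut_div_eq_zero (u := w * t) (by norm_num) (by linarith)]; simp

lemma tsupport_rhoMid (w : ℂ) : tsupport (rhoMid w) ⊆ {t | 4 ≤ ‖t‖ ∧ ‖w * t‖ ≤ 7 / 32} :=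
  closure_minimal (fun _ ht => rhoMid_ne_zero ht) (by
    change IsClosed ({t : ℂ | 4 ≤ ‖t‖} ∩ {t : ℂ | ‖w * t‖ ≤ 7 / 32})
    exact (isClosed_le continuous_const (by fun_prop)).inter (isClosed_le (by fun_prop)
      continuous_const))

lemma tsupport_rhoMid_ne_zero {w t : ℂ} (ht : t ∈ tsupport (rhoMid w)) :
    t ≠ 0 ∧ 1 - t ≠ 0 ∧ 1 - w * t ≠ 0 := by
  obtain ⟨h1, h2⟩ := tsupport_rhoMid w ht
  refine ⟨norm_pos_iff.1 (by linarith), ?_, one_sub_ne_zero_of_norm_lt (by linarith)⟩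
  rw [← norm_pos_iff]
  have := norm_sub_norm_le t 1
  rw [norm_sub_rev, norm_one] at this
  linarith

lemma hasCompactSupport_rhoMid {w : ℂ} (hw : w ≠ 0) : HasCompactSupport (rhoMid w) := by
  have hw' : 0 < ‖w‖ := norm_pos_iff.2 hw
  refine HasCompactSupport.intro (isCompact_closedBall (0 : ℂ) (7 / 32 / ‖w‖)) fun t ht => ?_
  by_contra h0
  refine ht ?_
  have := (rhoMid_ne_zero h0).2
  rw [norm_mul, mul_comm] at this
  rw [Metric.mem_closedBall, dist_zero_right, le_div_iff₀ hw']
  exact this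

lemma regNear_eq {P Q S : ExpPair} {w : ℂ} (hw : ‖w‖ ≤ 1 / 256)
    (hP : -2 < P.2.re) (hQ : -2 < Q.2.re) :
    Integrable (euInt (fun t => cut (t / (8 : ℝ))) P Q S w) ∧
      ∫ t, euInt (fun t => cut (t / (8 : ℝ))) P Q S w t = regNear P Q S w := by
  have hw1 : w ≠ 1 := by rintro rfl; rw [norm_one] at hw; norm_num at hw
  have hw2 : 1 / 2 ≤ ‖w - 1‖ := by
    have := norm_sub_norm_le (1 : ℂ) w
    rw [norm_one] at this
    rw [norm_sub_rev]; linarith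
  have p1 := euInt_zero_piece (P := P) (Q := Q) (S := S) (w := w) (ε := 1 / 8) (by norm_num)
    (by norm_num) (by linarith) hP
  have p2 := euInt_one_piece (P := P) (Q := Q) (S := S) (w := w) (ε := 1 / 8) (by norm_num)
    (by norm_num) hw1 (by
      rw [norm_div, div_mul_eq_mul_div, div_le_iff₀ (by linarith)]; linarith) hQ
  have p3 : Integrable (euInt rhoConf P Q S w) :=
    integrable_euInt contDiff_rhoConf hasCompactSupport_rhoConf
      (fun t ht => tsupport_rhoConf_ne_zero hw ht)
  have e : euInt (fun t => cut (t / (8 : ℝ))) P Q S w = fun t =>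
      euInt (fun t => cut (t / (1 / 8 : ℝ))) P Q S w t +
      euInt (fun t => cut ((1 - t) / (1 / 8 : ℝ))) P Q S w t + euInt rhoConf P Q S w t := by
    ext t
    simp only [euInt, rhoConf]
    ring
  rw [e]
  refine ⟨(p1.1.add p2.1).add p3, ?_⟩
  rw [regNear, ← p1.2, ← p2.2, rest_eq, ← integral_add' p1.1 p2.1, ← integral_add' (p1.1.add p2.1) p3]
  rfl

/-- The substitution t = 1/(wv) exchanges 0 with ∞ and 1 with 1/w, so the far pair is treated as a
second near pair; `rhoMid` fills the annulus between them. The cutoffs have fixed size, so nothing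
degenerates as w → 0. -/
theorem integral_eq_regConf {P Q S : ExpPair} {w : ℂ} (hw0 : w ≠ 0) (hw : ‖w‖ ≤ 1 / 256)
    (hP : -2 < P.2.re) (hQ : -2 < Q.2.re) (hS : -2 < S.2.re) (hO : -2 < (pairInf P Q S).2.re) :
    ∫ t, gpow t P * gpow (1 - t) Q * gpow (1 - w * t) S = regConf P Q S w := by
  have p1 := regNear_eq (P := P) (Q := Q) (S := S) hw hP hQ
  have p2 : Integrable (euInt (rhoMid w) P Q S w) :=
    integrable_euInt (contDiff_rhoMid w) (hasCompactSupport_rhoMid hw0)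
      (fun t ht => tsupport_rhoMid_ne_zero ht)
  have p3 := regNear_eq (P := pairInf P Q S) (Q := S) (S := Q) hw hO hS
  have p4 := euInt_comp_inv hw0 p3.1
  rw [regConf, ← p1.2, ← p3.2, ← p4.2, rest_eq, ← integral_add' p1.1 p2,
    ← integral_add' (p1.1.add p2) p4.1]
  refine integral_congr_ae ?_
  filter_upwards [compl_mem_ae_iff.2 (measure_singleton (0 : ℂ))] with t ht
  have hwt : w * t ≠ 0 := mul_ne_zero hw0 ht
  have hcut : cut ((w * t)⁻¹ / (8 : ℝ)) = 1 - cut ((w * t) / (1 / 8 : ℝ)) := by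
    rw [← cut_inv (by
      rw [div_ne_zero_iff]; exact ⟨hwt, by norm_num⟩)]
    congr 1
    push_cast
    field_simp
  -- For |w| ≤ 1/256 the near and the far cutoff have disjoint supports: |t| ≤ 14 forces |wt| ≤
  -- 14/256 < 1/16. Hence the three cutoffs sum to 1.
  have hz : (1 - cut ((w * t) / (1 / 8 : ℝ))) * cut (t / (8 : ℝ)) = 0 := by
    by_cases h : ‖t‖ ≤ 14
    · rw [cut_div_eq_one (u := w * t) (by norm_num)]
      · simp
      · rw [norm_mul]; nlinarith [norm_nonneg w, norm_nonneg t]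
    · rw [cut_div_eq_zero (u := t) (by norm_num) (by linarith)]
      simp
  simp only [euInt, rhoMid, Pi.add_apply, hcut]
  have hz' : (1 - (cut ((w * t) / (1 / 8 : ℝ)) : ℂ)) * cut (t / (8 : ℝ)) = 0 := by
    exact_mod_cast hz
  simp only [Complex.ofReal_sub, Complex.ofReal_one]
  linear_combination (-(gpow t P * gpow (1 - t) Q * gpow (1 - w * t) S)) * hz'

/-! ### Regularity of the gamma function of the complex field -/

/-- The gamma function of the complex field, with the larger of the two arguments in the
numerator. -/
lemma gammaC_eq (k : ℤ) (σ : ℂ) : gammaC (k, σ) =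
    Complex.I ^ |k| * Complex.Gamma ((σ + |k|) / 2) / Complex.Gamma (1 - (σ - |k|) / 2) := by
  unfold gammaC ExpPair.fst' ExpPair.snd'
  dsimp only
  rcases le_or_gt 0 k with hk | hk
  · rw [abs_of_nonneg hk]
    split_ifs with h
    · obtain ⟨n, hn⟩ := h
      obtain ⟨m, rfl⟩ := Int.eq_ofNat_of_zero_le hk
      have e1 : (-((m : ℤ) : ℂ) + σ) / 2 = -((n + m : ℕ) : ℂ) := by
        push_cast at hn ⊢; linear_combination hn
      have e2 : (σ + ((m : ℤ) : ℂ)) / 2 = -(n : ℂ) := by rw [← hn]; ring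
      -- Both numerators sit at poles, where `Complex.Gamma` has the value 0 by convention; this
      -- agrees with the value 0 chosen for `gammaC`.
      rw [e1, e2, Complex.Gamma_neg_nat_eq_zero, Complex.Gamma_neg_nat_eq_zero]
      simp
    · congr 3 <;> ring
  · rw [abs_of_neg hk]
    obtain ⟨m, hm⟩ := Int.eq_ofNat_of_zero_le (neg_nonneg.2 hk.le)
    obtain rfl : k = -m := by lia
    have e1 : (σ + ((-(-(m : ℤ)) : ℤ) : ℂ)) / 2 = (-((-(m : ℤ) : ℤ) : ℂ) + σ) / 2 := by
      push_cast; ring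
    have e2 : (σ - ((-(-(m : ℤ)) : ℤ) : ℂ)) / 2 = (((-(m : ℤ) : ℤ) : ℂ) + σ) / 2 := by
      push_cast; ring
    rw [e1, e2]
    split_ifs with h
    · rfl
    · set x : ℂ := (((-(m : ℤ) : ℤ) : ℂ) + σ) / 2 with hx
      have e3 : (-((-(m : ℤ) : ℤ) : ℂ) + σ) / 2 = x + m := by rw [hx]; push_cast; ring
      rw [e3]
      -- If x is a positive integer, both denominators are at poles and both quotients are 0.
      -- Otherwise the reflection formula at x and at x + m compares the two expressions, with a
      -- sign from the antiperiodicity of the sine.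
      by_cases hp : ∃ n : ℕ, x = n + 1
      · obtain ⟨n, hn⟩ := hp
        have a1 : 1 - x = -(n : ℂ) := by rw [hn]; ring
        have a2 : 1 - (x + m) = -((n + m : ℕ) : ℂ) := by rw [hn]; push_cast; ring
        rw [a1, a2, Complex.Gamma_neg_nat_eq_zero, Complex.Gamma_neg_nat_eq_zero]
        simp
      · have g1 : Complex.Gamma (1 - x) ≠ 0 := by
          refine Complex.Gamma_ne_zero fun n hn => hp ⟨n, ?_⟩
          linear_combination -hn
        have g2 : Complex.Gamma (1 - (x + m)) ≠ 0 := by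
          refine Complex.Gamma_ne_zero fun n hn => ?_
          rcases lt_or_ge n m with hnm | hnm
          · refine h ⟨m - n - 1, ?_⟩
            rw [Nat.cast_sub (by lia), Nat.cast_sub hnm.le]
            push_cast
            linear_combination -hn
          · refine hp ⟨n - m, ?_⟩
            rw [Nat.cast_sub hnm]
            linear_combination -hn
        have r1 := Complex.Gamma_mul_Gamma_one_sub x
        have r2 := Complex.Gamma_mul_Gamma_one_sub (x + m)
        have hs : Complex.sin (Real.pi * (x + m)) = (-1) ^ m * Complex.sin (Real.pi * x) := by
          rw [mul_add, mul_comm (Real.pi : ℂ) (m : ℂ)]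
          simpa [smul_eq_mul] using Complex.sin_antiperiodic.add_nat_mul_eq (x := (Real.pi : ℂ) * x) m
        rw [hs] at r2
        have hI : Complex.I ^ (-(m : ℤ)) = (-1) ^ m * Complex.I ^ (-(-(m : ℤ))) := by
          rw [neg_neg, zpow_neg, zpow_natCast, ← inv_pow, Complex.inv_I, neg_eq_neg_one_mul,
            mul_pow]
        have hm1 : ((-1 : ℂ) ^ m) * (-1) ^ m = 1 := by rw [← mul_pow]; simp
        rw [div_eq_div_iff g2 g1, hI]
        have r3 : Complex.Gamma (x + m) * Complex.Gamma (1 - (x + m)) =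
            (-1) ^ m * (Complex.Gamma x * Complex.Gamma (1 - x)) := by
          rw [r1, r2]
          rw [div_eq_mul_inv, mul_inv, ← inv_pow]
          norm_num
          ring
        linear_combination (-Complex.I ^ (-(-(m : ℤ)))) * r3

/-- The reciprocal of `Γ^ℂ`. -/
lemma inv_gammaC (k : ℤ) (σ : ℂ) : (gammaC (k, σ))⁻¹ =
    (Complex.I ^ |k|)⁻¹ * Complex.Gamma (1 - (σ - |k|) / 2) * (Complex.Gamma ((σ + |k|) / 2))⁻¹ := by
  rw [gammaC_eq, div_eq_mul_inv, mul_inv, mul_inv, inv_inv]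
  ring

/-- The quotient of `Γ^ℂ(k|σ)⁻¹` by `ibpConst k (σ - 2)`, without the removable singularity. -/
def invGammaDiv (k : ℤ) (σ : ℂ) : ℂ :=
  (Complex.I ^ |k|)⁻¹ * Complex.Gamma (1 - (σ - |k|) / 2) *
    if k = 0 then (2 * Complex.Gamma (σ / 2 + 1))⁻¹
    else (Complex.Gamma ((σ + |k|) / 2))⁻¹ * (k * Complex.I)⁻¹

lemma invGammaDiv_mul (k : ℤ) (σ : ℂ) :
    invGammaDiv k σ * ibpConst k (σ - 2) = (gammaC (k, σ))⁻¹ := by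
  rw [inv_gammaC, invGammaDiv, ibpConst]
  by_cases hk : k = 0
  · subst hk
    simp only [if_true]
    by_cases hσ : σ = 0
    · subst hσ
      simp [Complex.Gamma_zero]
    · have : Complex.Gamma (σ / 2 + 1) = σ / 2 * Complex.Gamma (σ / 2) :=
        Complex.Gamma_add_one _ (div_ne_zero hσ two_ne_zero)
      rw [this]
      simp only [mul_inv, abs_zero, Int.cast_zero, add_zero]
      field_simp
      ring
  · simp only [if_neg hk]
    have : (k : ℂ) ≠ 0 := by exact_mod_cast hk
    have := Complex.I_ne_zero
    field_simp

/-- The points where `Γ^ℂ(k|σ)⁻¹` is visibly holomorphic. -/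
def InvGammaReg (k : ℤ) (σ : ℂ) : Prop := σ.re < 3 ∧ (k = 0 → σ ≠ 2)

/-- The poles are at σ = 2 + 2m + |k|. To the left of Re σ = 3 only σ = 2 with k = 0 remains, that
is, the pair 1|1. -/
lemma differentiableAt_Gamma_num {k : ℤ} {σ : ℂ} (h : InvGammaReg k σ) :
    DifferentiableAt ℂ (fun σ : ℂ => Complex.Gamma (1 - (σ - |k|) / 2)) σ := by
  refine DifferentiableAt.comp σ (g := Complex.Gamma) (Complex.differentiableAt_Gamma _ ?_)
    (by fun_prop)
  intro m hm
  have hσ : σ = 2 + 2 * m + |k| := by linear_combination (-2 : ℂ) * hm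
  have hre : σ.re = 2 + 2 * m + |k| := by
    rw [hσ]; simp
  have h3 := h.1
  rw [hre] at h3
  have h4 : (2 + 2 * (m : ℤ) + |k| : ℤ) < 3 := by exact_mod_cast h3
  have h0 := abs_nonneg k
  have hm0 : m = 0 := by lia
  have hk0 : |k| = 0 := by lia
  refine h.2 (abs_eq_zero.1 hk0) ?_
  rw [hσ, hm0, hk0]; simp

lemma differentiableAt_inv_gammaC {k : ℤ} {σ : ℂ} (h : InvGammaReg k σ) :
    DifferentiableAt ℂ (fun σ : ℂ => (gammaC (k, σ))⁻¹) σ := by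
  simp only [inv_gammaC]
  have h1 := differentiableAt_Gamma_num h
  have h2 : DifferentiableAt ℂ (fun σ : ℂ => (Complex.Gamma ((σ + |k|) / 2))⁻¹) σ :=
    DifferentiableAt.comp σ (g := fun x => (Complex.Gamma x)⁻¹)
      Complex.differentiable_one_div_Gamma.differentiableAt (by fun_prop)
  exact (h1.const_mul _).mul h2

lemma differentiableAt_invGammaDiv {k : ℤ} {σ : ℂ} (h : InvGammaReg k σ) :
    DifferentiableAt ℂ (invGammaDiv k) σ := by
  unfold invGammaDiv
  have h1 := differentiableAt_Gamma_num h
  refine (h1.const_mul _).mul ?_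
  by_cases hk : k = 0
  · simp only [hk, if_true, mul_inv]
    refine DifferentiableAt.const_mul ?_ _
    exact DifferentiableAt.comp σ (g := fun x => (Complex.Gamma x)⁻¹)
      Complex.differentiable_one_div_Gamma.differentiableAt (by fun_prop)
  · simp only [if_neg hk]
    refine DifferentiableAt.mul_const ?_ _
    exact DifferentiableAt.comp σ (g := fun x => (Complex.Gamma x)⁻¹)
      Complex.differentiable_one_div_Gamma.differentiableAt (by fun_prop)

/-- The poles are at σ = -2m - |k|. To the right of Re σ = -1 only σ = 0 with k = 0 is left, and a
nonzero imaginary part avoids it. In the application Re σ is 2a or 2b, above -1 throughout the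
square. -/
lemma contDiffAt_gammaC {k : ℤ} {σ : ℝ → ℂ} {s : ℝ} (hσ : ContDiffAt ℝ ∞ σ s)
    (h1 : -1 < (σ s).re) (h2 : k = 0 → (σ s).im ≠ 0) :
    ContDiffAt ℝ ∞ (fun s => gammaC (k, σ s)) s := by
  simp only [gammaC_eq, div_eq_mul_inv]
  have hI : ContDiff ℝ ∞ fun x : ℂ => (Complex.Gamma x)⁻¹ :=
    (Complex.differentiable_one_div_Gamma.contDiff (n := ∞)).restrict_scalars ℝ
  have hG : ∀ x : ℂ, (∀ m : ℕ, x ≠ -m) → ContDiffAt ℝ ∞ Complex.Gamma x := by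
    intro x hx
    have : ContDiffAt ℝ ∞ (fun x : ℂ => ((Complex.Gamma x)⁻¹)⁻¹) x :=
      hI.contDiffAt.inv (inv_ne_zero (Complex.Gamma_ne_zero hx))
    simpa only [inv_inv] using this
  refine (contDiffAt_const.mul ?_).mul ?_
  · refine ContDiffAt.comp s (g := Complex.Gamma) (hG _ ?_) ((hσ.add contDiffAt_const).div_const _)
    intro m hm
    have hσ' : σ s = -2 * m - |k| := by linear_combination (2 : ℂ) * hm
    by_cases hk : k = 0
    · apply h2 hk
      rw [hσ', hk]; simp
    · rw [hσ'] at h1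
      have h3 : (-1 : ℝ) < -2 * m - |k| := by simpa using h1
      have h4 : (-1 : ℤ) < -2 * m - |k| := by exact_mod_cast h3
      have := abs_pos.2 hk
      lia
  · exact ContDiffAt.comp s (g := fun x => (Complex.Gamma x)⁻¹) hI.contDiffAt
      (contDiffAt_const.sub ((hσ.sub contDiffAt_const).div_const _))

/-! ### The analytic continuation of the kernel -/

/-- The exponent of `t` in the Euler type integral of the kernel. -/
def exA (k : ℤ) (s : ℝ) (α : ℂ) : ExpPair := (-k, 2 * α - 2 - Complex.I * s)
/-- The exponent of `1 - t`. -/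
def exB (k : ℤ) (s : ℝ) (β : ℂ) : ExpPair := (k, 2 * β - 2 + Complex.I * s)
/-- The exponent of `1 - z t`. -/
def exC (k : ℤ) (s : ℝ) (α : ℂ) : ExpPair := (-k, -2 * α - Complex.I * s)
/-- The exponent at infinity. -/
def exD (k : ℤ) (s : ℝ) (β : ℂ) : ExpPair := (k, -2 * β + Complex.I * s)

lemma eulerIntegral_eq (z : ℂ) (k : ℤ) (s : ℝ) (α β : ℂ) :
    eulerIntegral (diagPair α + lamPair k s) (diagPair α - lamPair k s) (diagPair (α + β)) z =
      (Real.pi : ℂ)⁻¹ * (gammaC (-k, 2 * α - Complex.I * s))⁻¹ *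
        (gammaC (k, 2 * β + Complex.I * s))⁻¹ *
        ∫ t, gpow t (exA k s α) * gpow (1 - t) (exB k s β) * gpow (1 - z * t) (exC k s α) := by
  have e1 : diagPair α - lamPair k s = (-k, 2 * α - Complex.I * s) := by
    ext <;> simp [diagPair, lamPair]
  have e2 : diagPair (α + β) - diagPair α + lamPair k s = (k, 2 * β + Complex.I * s) := by
    ext <;> simp [diagPair, lamPair]; ring
  have e3 : diagPair (α + β) - (diagPair α - lamPair k s) = (k, 2 * β + Complex.I * s) := by
    rw [← e2]; abel
  have e4 : ((-k, 2 * α - Complex.I * s) : ExpPair) - diagPair 1 = exA k s α := by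
    ext <;> simp [diagPair, exA]; ring
  have e5 : ((k, 2 * β + Complex.I * s) : ExpPair) - diagPair 1 = exB k s β := by
    ext <;> simp [diagPair, exB]; ring
  have e6 : -(diagPair α + lamPair k s) = exC k s α := by
    ext <;> simp [diagPair, lamPair, exC]; ring
  rw [eulerIntegral, e3, e1, e4, e5, e6, mul_inv, mul_inv]

lemma pairInf_ABC (k : ℤ) (s : ℝ) (α β : ℂ) :
    pairInf (exA k s α) (exB k s β) (exC k s α) = exD k s β := by
  ext <;> simp [pairInf, pairOne, exA, exB, exC, exD]; ring

lemma pairInf_ADC (k : ℤ) (s : ℝ) (α β : ℂ) :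
    pairInf (exA k s α) (exD k s β) (exC k s α) = exB k s β := by
  ext <;> simp [pairInf, pairOne, exA, exB, exC, exD]; ring

lemma pairInf_ACB (k : ℤ) (s : ℝ) (α β : ℂ) :
    pairInf (exA k s α) (exC k s α) (exB k s β) = exD k s β := by
  ext <;> simp [pairInf, pairOne, exA, exB, exC, exD]; ring

/-- The parameters for which none of the local constants of the four exponents vanishes. -/
def regDomain (k : ℤ) (s : ℝ) : Set (ℂ × ℂ) :=
  {w | InSquare w.1.re w.2.re ∧ (k = 0 →
    2 * w.1 - Complex.I * s ≠ 2 ∧ 2 * w.2 + Complex.I * s ≠ 2 ∧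
    2 * w.1 + Complex.I * s ≠ 2 ∧ 2 * w.2 - Complex.I * s ≠ 2 ∧
    2 * w.1 - Complex.I * s ≠ 0 ∧ 2 * w.2 + Complex.I * s ≠ 0)}

lemma InSquare.bounds {a b : ℝ} (h : InSquare a b) :
    -(1 / 2) < a ∧ a < 3 / 2 ∧ -(1 / 2) < b ∧ b < 3 / 2 := by
  obtain ⟨h1, h2, h3, h4⟩ := h
  exact ⟨by linarith, by linarith, by linarith, by linarith⟩

lemma isOpen_regDomain (k : ℤ) (s : ℝ) : IsOpen (regDomain k s) := by
  have h1 : IsOpen {w : ℂ × ℂ | InSquare w.1.re w.2.re} := by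
    unfold InSquare
    refine IsOpen.and ?_ (IsOpen.and ?_ (IsOpen.and ?_ ?_)) <;>
      exact isOpen_lt (by fun_prop) (by fun_prop)
  by_cases hk : k = 0
  · have e : regDomain k s = {w : ℂ × ℂ | InSquare w.1.re w.2.re} ∩
        ({w | 2 * w.1 - Complex.I * s ≠ 2} ∩ ({w | 2 * w.2 + Complex.I * s ≠ 2} ∩
        ({w | 2 * w.1 + Complex.I * s ≠ 2} ∩ ({w | 2 * w.2 - Complex.I * s ≠ 2} ∩
        ({w | 2 * w.1 - Complex.I * s ≠ 0} ∩ {w | 2 * w.2 + Complex.I * s ≠ 0}))))) := by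
      ext w
      change (_ ∧ (_ → _)) ↔ _
      simp only [hk, true_imp_iff]
      rfl
    rw [e]
    refine h1.inter ((isOpen_ne_fun ?_ ?_).inter ((isOpen_ne_fun ?_ ?_).inter
      ((isOpen_ne_fun ?_ ?_).inter ((isOpen_ne_fun ?_ ?_).inter
      ((isOpen_ne_fun ?_ ?_).inter (isOpen_ne_fun ?_ ?_)))))) <;> fun_prop
  · have e : regDomain k s = {w : ℂ × ℂ | InSquare w.1.re w.2.re} := by
      ext w
      change (_ ∧ (_ → _)) ↔ _
      simp only [hk, false_imp_iff, and_true]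
      rfl
    rw [e]
    exact h1

/-- The sum of two positive integers is below 3 only for the pair 1|1, so within the square a single
exceptional value has to be avoided. -/
lemma not_isPosIntPair {k : ℤ} {σ : ℂ} (h1 : σ.re < 3) (h2 : k = 0 → σ ≠ 2) :
    ¬ IsPosIntPair (k, σ) := by
  rintro ⟨m, n, hm, hn, h3, h4⟩
  simp only [ExpPair.fst', ExpPair.snd'] at h3 h4
  have h5 : σ = m + n := by linear_combination h3 + h4
  have h6 : (k : ℂ) = m - n := by linear_combination h3 - h4
  rw [h5] at h1
  have h7 : (m : ℝ) + n < 3 := by simpa using h1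
  have h8 : m + n < 3 := by exact_mod_cast h7
  have hm1 : m = 1 := by lia
  have hn1 : n = 1 := by lia
  subst hm1 hn1
  refine h2 ?_ (by rw [h5]; norm_num)
  have : (k : ℂ) = 0 := by rw [h6]; simp
  exact_mod_cast this

lemma kernelDomain_pairs (k : ℤ) (s : ℝ) (α β : ℂ) :
    diagPair α + lamPair k s = (k, 2 * α + Complex.I * s) ∧
    diagPair α - lamPair k s = (-k, 2 * α - Complex.I * s) ∧
    diagPair (α + β) - (diagPair α + lamPair k s) = (-k, 2 * β - Complex.I * s) ∧
    diagPair (α + β) - (diagPair α - lamPair k s) = (k, 2 * β + Complex.I * s) := by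
  refine ⟨?_, ?_, ?_, ?_⟩ <;> ext <;> simp [diagPair, lamPair] <;> ring

lemma regDomain_subset (k : ℤ) (s : ℝ) : regDomain k s ⊆ kernelDomain k s := by
  rintro ⟨α, β⟩ ⟨h1, h2⟩
  obtain ⟨b1, b2, b3, b4⟩ := h1.bounds
  obtain ⟨e1, e2, e3, e4⟩ := kernelDomain_pairs k s α β
  dsimp only at h1 h2 b1 b2 b3 b4
  refine ⟨h1, ?_⟩
  dsimp only
  rw [e3, e4, e1, e2]
  refine ⟨not_isPosIntPair ?_ fun hk => (h2 hk).2.2.1,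
    not_isPosIntPair ?_ fun hk => (h2 (neg_eq_zero.1 hk)).1,
    not_isPosIntPair ?_ fun hk => (h2 (neg_eq_zero.1 hk)).2.2.2.1,
    not_isPosIntPair ?_ fun hk => (h2 hk).2.1⟩ <;> simp <;> linarith

lemma isPosIntPair_two : IsPosIntPair (0, 2) :=
  ⟨1, 1, one_pos, one_pos, by simp [ExpPair.fst'], by simp [ExpPair.snd']⟩

lemma kernelDomain_ne {k : ℤ} {s : ℝ} {α β : ℂ} (h : (α, β) ∈ kernelDomain k s) (hk : k = 0) :
    2 * α - Complex.I * s ≠ 2 ∧ 2 * β + Complex.I * s ≠ 2 ∧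
    2 * α + Complex.I * s ≠ 2 ∧ 2 * β - Complex.I * s ≠ 2 := by
  obtain ⟨-, h1, h2, h3, h4⟩ := h
  obtain ⟨e1, e2, e3, e4⟩ := kernelDomain_pairs k s α β
  dsimp only at h1 h2 h3 h4
  rw [e1] at h1
  rw [e2] at h2
  rw [e3] at h3
  rw [e4] at h4
  subst hk
  refine ⟨fun h => h2 ?_, fun h => h4 ?_, fun h => h1 ?_, fun h => h3 ?_⟩ <;> rw [h] <;>
    simpa using isPosIntPair_two

/-- For real parameters each excluded equality forces s = 0 on comparing imaginary parts, so poles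
over real points occur only at λ = 0. -/
lemma mem_regDomain_real {a b : ℝ} (h : InSquare a b) {k : ℤ} {s : ℝ} (hks : (k, s) ≠ (0, 0)) :
    ((a : ℂ), (b : ℂ)) ∈ regDomain k s := by
  refine ⟨by simpa using h, fun hk => ?_⟩
  have hs : s ≠ 0 := fun hs => hks (by rw [hk, hs])
  refine ⟨?_, ?_, ?_, ?_, ?_, ?_⟩ <;> intro h <;> apply hs <;>
    simpa using congrArg Complex.im h

lemma InSquare.segment {a b : ℝ} (h : InSquare a b) {t : ℝ} (h0 : 0 ≤ t) (h1 : t ≤ 1) :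
    InSquare (a + t * (1 / 2 - a)) (b + t * (1 / 2 - b)) := by
  obtain ⟨h2, h3, h4, h5⟩ := h
  unfold InSquare
  refine ⟨?_, ?_, ?_, ?_⟩
  · nlinarith
  · nlinarith
  · nlinarith
  · nlinarith

/-- Holomorphic functions that agree on the tube `0 < Re α, Re β < 1` agree at real points. -/
theorem eq_of_eq_on_tube {a b : ℝ} (hab : InSquare a b) {k : ℤ} {s : ℝ} (hks : (k, s) ≠ (0, 0))
    {G₁ G₂ : ℂ × ℂ → ℂ} (h1 : DifferentiableOn ℂ G₁ (regDomain k s))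
    (h2 : DifferentiableOn ℂ G₂ (regDomain k s))
    (h : ∀ α β : ℂ, 0 < α.re → α.re < 1 → 0 < β.re → β.re < 1 → G₁ (α, β) = G₂ (α, β)) :
    G₁ (a, b) = G₂ (a, b) := by
  -- The complex line through (a, b) at t = 0 and (1/2, 1/2) at t = 1. Its real segment stays among
  -- the regular points and ends inside the tube, so the one-variable identity theorem on a
  -- thickened segment suffices; connectedness of `regDomain` is not needed.
  set l : ℂ → ℂ × ℂ := fun t => ((a : ℂ) + t * (1 / 2 - a), (b : ℂ) + t * (1 / 2 - b)) with hl
  have hld : Differentiable ℂ l := by rw [hl]; fun_prop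
  set K : Set ℂ := segment ℝ (0 : ℂ) 1 with hK
  have hKc : IsCompact K := by
    rw [hK, segment_eq_image_lineMap]
    exact isCompact_Icc.image (by fun_prop)
  have hV : IsOpen (l ⁻¹' regDomain k s) := (isOpen_regDomain k s).preimage hld.continuous
  have hKV : K ⊆ l ⁻¹' regDomain k s := by
    rw [hK, segment_eq_image_lineMap]
    rintro _ ⟨t, ht, rfl⟩
    have := mem_regDomain_real (hab.segment ht.1 ht.2) hks
    simpa [hl, AffineMap.lineMap_apply] using this
  obtain ⟨δ, hδ, hsub⟩ := hKc.exists_thickening_subset_open hV hKV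
  set N := Metric.thickening δ K
  have hNo : IsOpen N := Metric.isOpen_thickening
  have hNc : IsPreconnected N := ((convex_segment (𝕜 := ℝ) (0 : ℂ) 1).thickening δ).isPreconnected
  have hmem : ∀ x ∈ K, x ∈ N := fun x hx => Metric.self_subset_thickening hδ K hx
  have hd : ∀ {G : ℂ × ℂ → ℂ}, DifferentiableOn ℂ G (regDomain k s) →
      AnalyticOnNhd ℂ (G ∘ l) N := fun hG =>
    (hG.comp hld.differentiableOn fun x hx => hsub hx).analyticOnNhd hNo
  have hev : G₁ ∘ l =ᶠ[𝓝 1] G₂ ∘ l := by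
    have ht : Filter.Tendsto l (𝓝 1) (𝓝 (1 / 2, 1 / 2)) := by
      have := hld.continuous.tendsto 1
      simpa [hl] using this
    have ho : IsOpen {w : ℂ × ℂ | 0 < w.1.re ∧ w.1.re < 1 ∧ 0 < w.2.re ∧ w.2.re < 1} := by
      refine IsOpen.and ?_ (IsOpen.and ?_ (IsOpen.and ?_ ?_)) <;>
        exact isOpen_lt (by fun_prop) (by fun_prop)
    filter_upwards [ht (ho.mem_nhds (by
      refine ⟨?_, ?_, ?_, ?_⟩ <;> norm_num))] with x hx
    exact h _ _ hx.1 hx.2.1 hx.2.2.1 hx.2.2.2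
  have := (hd h1).eqOn_of_preconnected_of_eventuallyEq (hd h2) hNc
    (hmem 1 (right_mem_segment ℝ _ _)) hev (hmem 0 (left_mem_segment ℝ _ _))
  simpa [hl] using this

lemma differentiableAt_core {kP kQ kS : ℤ} {σP σQ σS : ℂ × ℂ → ℂ} (hσP : ContDiff ℂ ∞ σP)
    (hσQ : ContDiff ℂ ∞ σQ) (hσS : ContDiff ℂ ∞ σS) {w : ℂ} {ε : ℝ} (hε : 0 < ε)
    (hε2 : ε ≤ 1 / 2) (hw : ‖w‖ * ε ≤ 1 / 2) {x : ℂ × ℂ} (hx : -3 < (σP x).re) :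
    DifferentiableAt ℂ (fun x => core (kP, σP x) (kQ, σQ x) (kS, σS x) w ε) x := by
  refine (differentiableOn_core (kP := kP) (kQ := kQ) (kS := kS) hσP hσQ hσS hε hε2
    hw).differentiableAt ((isOpen_lt continuous_const ?_).mem_nhds hx)
  exact Complex.continuous_re.comp hσP.continuous

lemma differentiableAt_regLoc {kP kQ kS : ℤ} {σP σQ σS : ℂ × ℂ → ℂ} (hσP : ContDiff ℂ ∞ σP)
    (hσQ : ContDiff ℂ ∞ σQ) (hσS : ContDiff ℂ ∞ σS) {w : ℂ} {ε : ℝ} (hε : 0 < ε)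
    (hε2 : ε ≤ 1 / 2) (hw : ‖w‖ * ε ≤ 1 / 2) {x : ℂ × ℂ} (hx : -3 < (σP x).re)
    (hx2 : kP = 0 → σP x ≠ -2) :
    DifferentiableAt ℂ (fun x => regLoc (kP, σP x) (kQ, σQ x) (kS, σS x) w ε) x := by
  unfold regLoc
  refine DifferentiableAt.mul ?_ (differentiableAt_core hσP hσQ hσS hε hε2 hw hx)
  unfold ibpConst
  by_cases hk : kP = 0
  · simp only [hk, if_true]
    have hd : DifferentiableAt ℂ σP x := hσP.contDiffAt.differentiableAt (by simp)
    refine (hd.add_const 2).inv fun h => hx2 hk ?_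
    exact eq_neg_of_add_eq_zero_left h
  · simp only [hk, if_false]
    exact differentiableAt_const _

section
variable (k : ℤ) (s : ℝ)

lemma contDiff_exA : ContDiff ℂ ∞ fun x : ℂ × ℂ => (exA k s x.1).2 := by unfold exA; fun_prop
lemma contDiff_exB : ContDiff ℂ ∞ fun x : ℂ × ℂ => (exB k s x.2).2 := by unfold exB; fun_prop
lemma contDiff_exC : ContDiff ℂ ∞ fun x : ℂ × ℂ => (exC k s x.1).2 := by unfold exC; fun_prop
lemma contDiff_exD : ContDiff ℂ ∞ fun x : ℂ × ℂ => (exD k s x.2).2 := by unfold exD; fun_prop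

variable {k s} {α β : ℂ}

lemma ex_re_gt (h : InSquare α.re β.re) :
    -3 < (exA k s α).2.re ∧ -3 < (exB k s β).2.re ∧ -3 < (exC k s α).2.re ∧
      -3 < (exD k s β).2.re := by
  obtain ⟨h1, h2, h3, h4⟩ := h.bounds
  simp only [exA, exB, exC, exD]
  refine ⟨?_, ?_, ?_, ?_⟩ <;> simp <;> linarith

lemma tube_re_gt (h1 : 0 < α.re) (h2 : α.re < 1) (h3 : 0 < β.re) (h4 : β.re < 1) :
    -2 < (exA k s α).2.re ∧ -2 < (exB k s β).2.re ∧ -2 < (exC k s α).2.re ∧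
      -2 < (exD k s β).2.re := by
  simp only [exA, exB, exC, exD]
  refine ⟨?_, ?_, ?_, ?_⟩ <;> simp <;> linarith

lemma ex_ne (h : (α, β) ∈ regDomain k s) :
    ((exA k s α).1 = 0 → (exA k s α).2 ≠ -2) ∧ ((exB k s β).1 = 0 → (exB k s β).2 ≠ -2) ∧
    ((exC k s α).1 = 0 → (exC k s α).2 ≠ -2) ∧ ((exD k s β).1 = 0 → (exD k s β).2 ≠ -2) := by
  obtain ⟨-, h⟩ := h
  simp only [exA, exB, exC, exD, neg_eq_zero]
  refine ⟨fun hk h0 => (h hk).2.2.2.2.1 ?_, fun hk h0 => (h hk).2.2.2.2.2 ?_,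
    fun hk h0 => (h hk).2.2.1 ?_, fun hk h0 => (h hk).2.2.2.1 ?_⟩ <;>
  first | linear_combination h0 | linear_combination -h0

lemma invGammaReg_A (h : (α, β) ∈ kernelDomain k s) :
    InvGammaReg (-k) (2 * α - Complex.I * s) := by
  have hb := h.1.bounds
  dsimp only at hb
  exact ⟨by simp; linarith, fun hk => (kernelDomain_ne h (neg_eq_zero.1 hk)).1⟩

lemma invGammaReg_B (h : (α, β) ∈ kernelDomain k s) :
    InvGammaReg k (2 * β + Complex.I * s) := by
  have hb := h.1.bounds
  dsimp only at hb
  exact ⟨by simp; linarith, fun hk => (kernelDomain_ne h hk).2.1⟩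

lemma differentiableAt_prefA (h : (α, β) ∈ kernelDomain k s) :
    DifferentiableAt ℂ (fun x : ℂ × ℂ => (gammaC (-k, 2 * x.1 - Complex.I * s))⁻¹) (α, β) :=
  DifferentiableAt.comp (α, β) (f := fun x : ℂ × ℂ => 2 * x.1 - Complex.I * s)
    (differentiableAt_inv_gammaC (invGammaReg_A h)) (by fun_prop)

lemma differentiableAt_prefB (h : (α, β) ∈ kernelDomain k s) :
    DifferentiableAt ℂ (fun x : ℂ × ℂ => (gammaC (k, 2 * x.2 + Complex.I * s))⁻¹) (α, β) :=
  DifferentiableAt.comp (α, β) (f := fun x : ℂ × ℂ => 2 * x.2 + Complex.I * s)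
    (differentiableAt_inv_gammaC (invGammaReg_B h)) (by fun_prop)

lemma ibpConst_exA (k : ℤ) (s : ℝ) (α : ℂ) :
    ibpConst (exA k s α).1 (exA k s α).2 = ibpConst (-k) (2 * α - Complex.I * s - 2) := by
  simp only [exA]; congr 1; ring

lemma ibpConst_exB (k : ℤ) (s : ℝ) (β : ℂ) :
    ibpConst (exB k s β).1 (exB k s β).2 = ibpConst k (2 * β + Complex.I * s - 2) := by
  simp only [exB]; congr 1; ring

end

lemma Admissible.bounds {z : ℂ} {ε : ℝ} (h : Admissible z ε) : ε ≤ 1 / 2 ∧ ‖z‖ * ε ≤ 1 / 2 ∧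
    ‖z / (z - 1)‖ * ε ≤ 1 / 2 ∧ ‖1 / (1 - z)‖ * ε ≤ 1 / 2 ∧ ‖1 / z‖ * ε ≤ 1 / 2 := by
  have h1 : 0 < ‖1 - z‖ := norm_pos_iff.2 (sub_ne_zero.2 h.ne_one.symm)
  have h0 : 0 < ‖z‖ := norm_pos_iff.2 h.ne_zero
  refine ⟨by linarith [h.le_half], by linarith [h.norm_le], ?_, ?_, ?_⟩
  · rw [norm_div, norm_sub_rev, div_mul_eq_mul_div, div_le_iff₀ h1]
    linarith [h.norm_div_le]
  · rw [norm_div, norm_one, div_mul_eq_mul_div, div_le_iff₀ h1]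
    linarith [h.norm_sub_le]
  · rw [norm_div, norm_one, div_mul_eq_mul_div, div_le_iff₀ h0]
    linarith [h.norm_inv_le]

/-- The regularized integral has four families of poles. Those from t = 0 and t = 1 are absorbed by
replacing reciprocal gamma factor and local constant together by `invGammaDiv`, which has no
singularity there. Those from 1/z and ∞ lie where a + λ|a - conj λ or b - λ|b + conj λ equals 1|1,
outside `kernelDomain`. -/
theorem exists_isKernelContinuation {z : ℂ} (hz : z ∈ dotC) (k : ℤ) (s : ℝ) :
    ∃ G : ℂ × ℂ → ℂ, IsKernelContinuation z k s G := by
  obtain ⟨ε, hev⟩ := exists_admissible hz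
  have had := hev.self_of_nhds
  obtain ⟨b1, b2, b3, b4, b5⟩ := had.bounds
  have hε := had.pos
  have hz1 : 1 - z ≠ 0 := sub_ne_zero.2 had.ne_one.symm
  refine ⟨fun x => (Real.pi : ℂ)⁻¹ * (
    invGammaDiv (-k) (2 * x.1 - Complex.I * s) * (gammaC (k, 2 * x.2 + Complex.I * s))⁻¹ *
      core (exA k s x.1) (exB k s x.2) (exC k s x.1) z ε +
    (gammaC (-k, 2 * x.1 - Complex.I * s))⁻¹ * invGammaDiv k (2 * x.2 + Complex.I * s) *
      (gpow (1 - z) (exC k s x.1) *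
        core (exB k s x.2) (exA k s x.1) (exC k s x.1) (z / (z - 1)) ε) +
    (gammaC (-k, 2 * x.1 - Complex.I * s))⁻¹ * (gammaC (k, 2 * x.2 + Complex.I * s))⁻¹ *
      (gpow z (-exA k s x.1 - pairOne) * gpow ((z - 1) / z) (exB k s x.2) *
          regLoc (exC k s x.1) (exA k s x.1) (exB k s x.2) (1 / (1 - z)) ε +
        gpow (-1) (exB k s x.2) * gpow (-z) (exC k s x.1) *
          regLoc (exD k s x.2) (exB k s x.2) (exC k s x.1) (1 / z) ε +
        rest (rhoInt z ε) (exA k s x.1) (exB k s x.2) (exC k s x.1) z)), ?_, ?_⟩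
  · rintro ⟨α, β⟩ h
    apply DifferentiableAt.differentiableWithinAt
    have hA := differentiableAt_prefA h
    have hB := differentiableAt_prefB h
    obtain ⟨r1, r2, r3, r4⟩ := ex_re_gt (k := k) (s := s) h.1
    have hne := kernelDomain_ne h
    have hA' : DifferentiableAt ℂ (fun x : ℂ × ℂ => invGammaDiv (-k) (2 * x.1 - Complex.I * s))
        (α, β) := DifferentiableAt.comp (α, β) (f := fun x : ℂ × ℂ => 2 * x.1 - Complex.I * s)
      (differentiableAt_invGammaDiv (invGammaReg_A h)) (by fun_prop)
    have hB' : DifferentiableAt ℂ (fun x : ℂ × ℂ => invGammaDiv k (2 * x.2 + Complex.I * s))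
        (α, β) := DifferentiableAt.comp (α, β) (f := fun x : ℂ × ℂ => 2 * x.2 + Complex.I * s)
      (differentiableAt_invGammaDiv (invGammaReg_B h)) (by fun_prop)
    have dA := contDiff_exA k s
    have dB := contDiff_exB k s
    have dC := contDiff_exC k s
    have dD := contDiff_exD k s
    have gp : ∀ {y : ℂ} (hy : y ≠ 0) (m : ℤ) {σ : ℂ × ℂ → ℂ} (hσ : ContDiff ℂ ∞ σ),
        DifferentiableAt ℂ (fun x => gpow y (m, σ x)) (α, β) := fun hy m σ hσ =>
      (differentiable_gpow_exponent hy m (hσ.differentiable (by simp))).differentiableAt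
    refine DifferentiableAt.const_mul (DifferentiableAt.add (DifferentiableAt.add ?_ ?_) ?_) _
    · exact (hA'.mul hB).mul (differentiableAt_core dA dB dC hε b1 b2 r1)
    · exact (hA.mul hB').mul ((gp hz1 (-k) dC).mul (differentiableAt_core dB dA dC hε b1 b3 r2))
    · refine (hA.mul hB).mul (DifferentiableAt.add (DifferentiableAt.add ?_ ?_) ?_)
      · have hσ : ContDiff ℂ ∞ fun x : ℂ × ℂ => -(exA k s x.1).2 - 2 := dA.neg.sub contDiff_const
        refine DifferentiableAt.mul (DifferentiableAt.mul ?_ ?_) ?_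
        · exact gp had.ne_zero (-(-k) - 0) hσ
        · exact gp (div_ne_zero (sub_ne_zero.2 had.ne_one) had.ne_zero) k dB
        · refine differentiableAt_regLoc dC dA dB hε b1 b4 r3 fun hk h0 =>
            (hne (neg_eq_zero.1 hk)).2.2.1 ?_
          simp only [exC] at h0
          linear_combination -h0
      · refine DifferentiableAt.mul (DifferentiableAt.mul ?_ ?_) ?_
        · exact gp (by norm_num) k dB
        · exact gp (neg_ne_zero.2 had.ne_zero) (-k) dC
        · refine differentiableAt_regLoc dD dB dC hε b1 b5 r4 fun hk h0 =>
            (hne hk).2.2.2 ?_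
          simp only [exD] at h0
          linear_combination -h0
      · refine differentiableOn_rest dA dB dC (contDiff_rhoInt z ε) (hasCompactSupport_rhoInt had)
          (fun t ht => ?_) _
        exact rhoIntRegion_ne_zero hε (tsupport_rhoInt had ht)
  · intro α β h1 h2 h3 h4
    obtain ⟨r1, r2, r3, r4⟩ := tube_re_gt (k := k) (s := s) h1 h2 h3 h4
    have hO : -2 < (pairInf (exA k s α) (exB k s β) (exC k s α)).2.re := by rwa [pairInf_ABC]
    rw [eulerIntegral_eq, integral_eq_regEuler had r1 r2 r3 hO, regEuler, pairInf_ABC]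
    have c1 : ibpConst (exA k s α).1 (exA k s α).2 ≠ 0 := ibpConst_ne_zero _ r1
    have c2 : ibpConst (exB k s β).1 (exB k s β).2 ≠ 0 := ibpConst_ne_zero _ r2
    have e1 := invGammaDiv_mul (-k) (2 * α - Complex.I * s)
    have e2 := invGammaDiv_mul k (2 * β + Complex.I * s)
    rw [← ibpConst_exA] at e1
    rw [← ibpConst_exB] at e2
    have l1 : ∀ Q S w, core (exA k s α) Q S w ε = ibpConst (exA k s α).1 (exA k s α).2 *
        regLoc (exA k s α) Q S w ε := fun Q S w => by
      rw [regLoc, mul_inv_cancel_left₀ c1]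
    have l2 : ∀ Q S w, core (exB k s β) Q S w ε = ibpConst (exB k s β).1 (exB k s β).2 *
        regLoc (exB k s β) Q S w ε := fun Q S w => by
      rw [regLoc, mul_inv_cancel_left₀ c2]
    simp only [l1, l2]
    rw [← e1, ← e2]
    ring

/-! ### The spectral density -/

/-- The density of the integrand of `J*`, relative to the regularized Euler type integral. -/
def density (a b : ℝ) (F : ℤ × ℝ → ℂ) (k : ℤ) (s : ℝ) : ℂ :=
  F (k, s) * (4 * (Real.pi : ℂ) ^ 3)⁻¹ * ((((k : ℝ) ^ 2 + s ^ 2) / 4 : ℝ) : ℂ) *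
    (starRingEnd ℂ) (gammaC (-k, 2 * a - Complex.I * s) * gammaC (k, 2 * b + Complex.I * s))

/-- This frees the argument from the choice hidden in `kernel`: any `E` that is holomorphic on
`regDomain` and equals the convergent integral on the tube may be used, in particular a different
one for each region of z. At λ = 0 both sides vanish with `F`. -/
theorem adjointIntegrand_eq {a b : ℝ} (hab : InSquare a b) {F : ℤ × ℝ → ℂ}
    (hF : F ∈ EvenTestFunctions) {z : ℂ} (hz : z ∈ dotC) (k : ℤ) (s : ℝ) {E : ℂ × ℂ → ℂ}
    (hE : (k, s) ≠ (0, 0) → DifferentiableOn ℂ E (regDomain k s))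
    (hE2 : ∀ α β : ℂ, 0 < α.re → α.re < 1 → 0 < β.re → β.re < 1 → E (α, β) =
      ∫ t, gpow t (exA k s α) * gpow (1 - t) (exB k s β) * gpow (1 - z * t) (exC k s α)) :
    adjointIntegrand a b F z k s = density a b F k s * E (a, b) := by
  by_cases hks : (k, s) = (0, 0)
  · obtain ⟨rfl, rfl⟩ := Prod.mk.inj hks
    have : F (0, 0) = 0 := hF.2.2.2.self_of_nhds
    simp [adjointIntegrand, density, this]
  obtain ⟨hG1, hG2⟩ := Classical.epsilon_spec (exists_isKernelContinuation hz k s)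
  have hk : kernel a b z k s = (Real.pi : ℂ)⁻¹ * (gammaC (-k, 2 * a - Complex.I * s))⁻¹ *
        (gammaC (k, 2 * b + Complex.I * s))⁻¹ * E (a, b) := by
    refine eq_of_eq_on_tube hab hks (hG1.mono (regDomain_subset k s))
      (G₂ := fun x => (Real.pi : ℂ)⁻¹ * (gammaC (-k, 2 * x.1 - Complex.I * s))⁻¹ *
        (gammaC (k, 2 * x.2 + Complex.I * s))⁻¹ * E x) ?_ ?_
    · intro x hx
      have hx' := regDomain_subset k s hx
      exact (((differentiableAt_prefA (α := x.1) (β := x.2) hx').const_mul _).mul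
        (differentiableAt_prefB (α := x.1) (β := x.2) hx')).differentiableWithinAt.mul (hE hks x hx)
    · intro α β h1 h2 h3 h4
      rw [hG2 α β h1 h2 h3 h4, eulerIntegral_eq, hE2 α β h1 h2 h3 h4]
  have e1 : diagPair (a : ℂ) - lamPair k s = (-k, 2 * a - Complex.I * s) := by
    ext <;> simp [diagPair, lamPair]
  have e2 : diagPair (b : ℂ) + lamPair k s = (k, 2 * b + Complex.I * s) := by
    ext <;> simp [diagPair, lamPair]
  rw [adjointIntegrand, hk, plancherelDensity, density, e1, e2]
  set x := gammaC (-k, 2 * a - Complex.I * s)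
  set y := gammaC (k, 2 * b + Complex.I * s)
  have h1 : ‖(lamPair k s).fst' * x * y‖ ^ 2 =
      ((k : ℝ) ^ 2 + s ^ 2) / 4 * (‖x‖ ^ 2 * ‖y‖ ^ 2) := by
    have : ‖(lamPair k s).fst'‖ ^ 2 = ((k : ℝ) ^ 2 + s ^ 2) / 4 := by
      rw [← Complex.normSq_eq_norm_sq]
      simp [lamPair, ExpPair.fst', Complex.normSq_apply]
      ring
    rw [norm_mul, norm_mul, mul_pow, mul_pow, this]
    ring
  rw [h1, map_mul]
  -- The reciprocal gamma factor of the kernel against the squared modulus in the density; the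
  -- identity survives at x = 0 because the inverse of 0 is 0.
  have hx : ∀ x : ℂ, x⁻¹ * ((‖x‖ ^ 2 : ℝ) : ℂ) = (starRingEnd ℂ) x := by
    intro x
    by_cases h : x = 0
    · simp [h]
    · rw [← Complex.normSq_eq_norm_sq, ← Complex.mul_conj, inv_mul_cancel_left₀ h]
  rw [← hx x, ← hx y]
  have := Real.pi_ne_zero
  push_cast
  field_simp

/-- The gamma factors can be singular only at λ = 0, near which `F` vanishes. -/
lemma contDiff_density {a b : ℝ} (hab : InSquare a b) {F : ℤ × ℝ → ℂ}
    (hF : F ∈ EvenTestFunctions) (k : ℤ) : ContDiff ℝ ∞ (density a b F k) := by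
  rw [contDiff_iff_contDiffAt]
  intro s
  by_cases hks : k = 0 ∧ s = 0
  · obtain ⟨rfl, rfl⟩ := hks
    have h0 : density a b F 0 =ᶠ[𝓝 0] fun _ => 0 := by
      have h1 : Filter.Tendsto (fun s : ℝ => ((0 : ℤ), s)) (𝓝 0) (𝓝 (0, 0)) :=
        (Continuous.prodMk_right (0 : ℤ)).tendsto 0
      filter_upwards [h1.eventually hF.2.2.2] with s hs
      simp [density, hs]
    exact contDiffAt_const.congr_of_eventuallyEq h0
  · obtain ⟨b1, b2, b3, b4⟩ := hab.bounds
    unfold density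
    refine (((hF.2.1 k).contDiffAt.mul contDiffAt_const).mul ?_).mul ?_
    · exact (Complex.ofRealCLM.contDiff.comp (by fun_prop :
        ContDiff ℝ ∞ fun s : ℝ => ((k : ℝ) ^ 2 + s ^ 2) / 4)).contDiffAt
    · have hc : ContDiff ℝ ∞ fun s : ℝ => (s : ℂ) := Complex.ofRealCLM.contDiff
      refine ContDiffAt.comp s (g := starRingEnd ℂ) Complex.conjCLE.contDiff.contDiffAt ?_
      refine (contDiffAt_gammaC (contDiff_const.sub (contDiff_const.mul hc)).contDiffAt ?_ ?_).mul
        (contDiffAt_gammaC (contDiff_const.add (contDiff_const.mul hc)).contDiffAt ?_ ?_)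
      · simp; linarith
      · intro hk; simpa using fun h => hks ⟨neg_eq_zero.1 hk, h⟩
      · simp; linarith
      · intro hk; simpa using fun h => hks ⟨hk, h⟩

lemma hasCompactSupport_density (a b : ℝ) {F : ℤ × ℝ → ℂ} (hF : F ∈ EvenTestFunctions) (k : ℤ) :
    HasCompactSupport (density a b F k) := by
  have h1 : HasCompactSupport fun s : ℝ => F (k, s) :=
    hF.2.2.1.comp_isClosedEmbedding (g := fun s : ℝ => (k, s))
      (Topology.IsClosedEmbedding.of_continuous_injective_isClosedMap
        (Continuous.prodMk_right k) (fun x y h => (Prod.mk.inj h).2) fun C hC => by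
          have : (fun s : ℝ => (k, s)) '' C = {k} ×ˢ C := by ext ⟨i, x⟩; simp [eq_comm, and_comm]
          rw [this]; exact (isClosed_discrete _).prod hC)
  exact ((h1.mul_right).mul_right).mul_right

lemma zero_notMem_tsupport_density (a b : ℝ) {F : ℤ × ℝ → ℂ} (hF : F ∈ EvenTestFunctions) :
    (0 : ℝ) ∉ tsupport (density a b F 0) := by
  rw [notMem_tsupport_iff_eventuallyEq]
  have h1 : Filter.Tendsto (fun s : ℝ => ((0 : ℤ), s)) (𝓝 0) (𝓝 (0, 0)) :=
    (Continuous.prodMk_right (0 : ℤ)).tendsto 0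
  filter_upwards [h1.eventually hF.2.2.2] with s hs
  simp [density, hs]

/-! ### The three charts -/

lemma norm_div_sub_one_le {w : ℂ} (hw : ‖w‖ ≤ 1 / 256) : ‖w / (w - 1)‖ * (1 / 8) ≤ 1 / 2 := by
  have h2 : 1 / 2 ≤ ‖w - 1‖ := by
    have := norm_sub_norm_le (1 : ℂ) w
    rw [norm_one] at this
    rw [norm_sub_rev]; linarith
  rw [norm_div, div_mul_eq_mul_div, div_le_iff₀ (by linarith)]
  linarith

lemma ne_one_of_norm_le {w : ℂ} (hw : ‖w‖ ≤ 1 / 256) : w ≠ 1 := by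
  rintro rfl; rw [norm_one] at hw; norm_num at hw

lemma differentiableAt_gpow_exp {y : ℂ} (hy : y ≠ 0) (m : ℤ) {σ : ℂ × ℂ → ℂ}
    (hσ : ContDiff ℂ ∞ σ) (x : ℂ × ℂ) : DifferentiableAt ℂ (fun x => gpow y (m, σ x)) x :=
  (differentiable_gpow_exponent hy m (hσ.differentiable (by simp))).differentiableAt

section
variable {kP kQ kS : ℤ} {σP σQ σS : ℂ × ℂ → ℂ} (hσP : ContDiff ℂ ∞ σP)
    (hσQ : ContDiff ℂ ∞ σQ) (hσS : ContDiff ℂ ∞ σS)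
include hσP hσQ hσS

lemma differentiableAt_regNear {w : ℂ} (hw : ‖w‖ ≤ 1 / 256) {x : ℂ × ℂ}
    (h1 : -3 < (σP x).re) (h2 : -3 < (σQ x).re) (h3 : kP = 0 → σP x ≠ -2)
    (h4 : kQ = 0 → σQ x ≠ -2) :
    DifferentiableAt ℂ (fun x => regNear (kP, σP x) (kQ, σQ x) (kS, σS x) w) x := by
  unfold regNear
  have hw1 := ne_one_of_norm_le hw
  refine DifferentiableAt.add (DifferentiableAt.add ?_ (DifferentiableAt.mul ?_ ?_)) ?_
  · exact differentiableAt_regLoc hσP hσQ hσS (by norm_num) (by norm_num) (by linarith) h1 h3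
  · exact differentiableAt_gpow_exp (sub_ne_zero.2 hw1.symm) kS hσS x
  · exact differentiableAt_regLoc hσQ hσP hσS (by norm_num) (by norm_num)
      (norm_div_sub_one_le hw) h2 h4
  · exact differentiableOn_rest hσP hσQ hσS contDiff_rhoConf hasCompactSupport_rhoConf
      (fun t ht => tsupport_rhoConf_ne_zero hw ht) _

lemma differentiableAt_regConf {w : ℂ} (hw0 : w ≠ 0) (hw : ‖w‖ ≤ 1 / 256) {x : ℂ × ℂ}
    {kO : ℤ} {σO : ℂ × ℂ → ℂ} (hσO : ContDiff ℂ ∞ σO)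
    (hO : ∀ x, pairInf (kP, σP x) (kQ, σQ x) (kS, σS x) = (kO, σO x))
    (h1 : -3 < (σP x).re ∧ (kP = 0 → σP x ≠ -2)) (h2 : -3 < (σQ x).re ∧ (kQ = 0 → σQ x ≠ -2))
    (h3 : -3 < (σS x).re ∧ (kS = 0 → σS x ≠ -2)) (h4 : -3 < (σO x).re ∧ (kO = 0 → σO x ≠ -2)) :
    DifferentiableAt ℂ (fun x => regConf (kP, σP x) (kQ, σQ x) (kS, σS x) w) x := by
  unfold regConf
  simp only [hO]
  refine DifferentiableAt.add (DifferentiableAt.add ?_ ?_) (DifferentiableAt.mul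
    (DifferentiableAt.mul ?_ ?_) ?_)
  · exact differentiableAt_regNear hσP hσQ hσS hw h1.1 h2.1 h1.2 h2.2
  · exact differentiableOn_rest hσP hσQ hσS (contDiff_rhoMid w) (hasCompactSupport_rhoMid hw0)
      (fun t ht => tsupport_rhoMid_ne_zero ht) _
  · exact differentiableAt_gpow_exp (by norm_num) (kQ + kS) (hσQ.add hσS) x
  · exact differentiableAt_gpow_exp hw0 (-kP - kQ - 0)
      ((hσP.neg.sub hσQ).sub contDiff_const) x
  · exact differentiableAt_regNear hσO hσS hσQ hw h4.1 h3.1 h4.2 h3.2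

lemma differentiableAt_regEuler {w : ℂ} {ε : ℝ} (had : Admissible w ε) {x : ℂ × ℂ}
    {kO : ℤ} {σO : ℂ × ℂ → ℂ} (hσO : ContDiff ℂ ∞ σO)
    (hO : ∀ x, pairInf (kP, σP x) (kQ, σQ x) (kS, σS x) = (kO, σO x))
    (h1 : -3 < (σP x).re ∧ (kP = 0 → σP x ≠ -2)) (h2 : -3 < (σQ x).re ∧ (kQ = 0 → σQ x ≠ -2))
    (h3 : -3 < (σS x).re ∧ (kS = 0 → σS x ≠ -2)) (h4 : -3 < (σO x).re ∧ (kO = 0 → σO x ≠ -2)) :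
    DifferentiableAt ℂ (fun x => regEuler (kP, σP x) (kQ, σQ x) (kS, σS x) w ε) x := by
  unfold regEuler
  simp only [hO]
  obtain ⟨b1, b2, b3, b4, b5⟩ := had.bounds
  have hε := had.pos
  refine DifferentiableAt.add (DifferentiableAt.add (DifferentiableAt.add (DifferentiableAt.add ?_
    (DifferentiableAt.mul ?_ ?_)) (DifferentiableAt.mul (DifferentiableAt.mul ?_ ?_) ?_))
    (DifferentiableAt.mul (DifferentiableAt.mul ?_ ?_) ?_)) ?_
  · exact differentiableAt_regLoc hσP hσQ hσS hε b1 b2 h1.1 h1.2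
  · exact differentiableAt_gpow_exp (sub_ne_zero.2 had.ne_one.symm) kS hσS x
  · exact differentiableAt_regLoc hσQ hσP hσS hε b1 b3 h2.1 h2.2
  · exact differentiableAt_gpow_exp had.ne_zero (-kP - 0)
      (hσP.neg.sub contDiff_const) x
  · exact differentiableAt_gpow_exp
      (div_ne_zero (sub_ne_zero.2 had.ne_one) had.ne_zero) kQ hσQ x
  · exact differentiableAt_regLoc hσS hσP hσQ hε b1 b4 h3.1 h3.2
  · exact differentiableAt_gpow_exp (by norm_num) kQ hσQ x
  · exact differentiableAt_gpow_exp (neg_ne_zero.2 had.ne_zero) kS hσS x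
  · exact differentiableAt_regLoc hσO hσQ hσS hε b1 b5 h4.1 h4.2
  · exact differentiableOn_rest hσP hσQ hσS (contDiff_rhoInt w ε) (hasCompactSupport_rhoInt had)
      (fun t ht => rhoIntRegion_ne_zero hε (tsupport_rhoInt had ht)) _

end

/-- The change of variable `t → t / (t - 1)`. -/
lemma integral_comp_mobius {P Q S O : ExpPair} {z : ℂ} (hO : pairInf P Q S = O) :
    ∫ t, gpow t P * gpow (1 - t) Q * gpow (1 - z * t) S =
      gpow (-1) P * ∫ t, gpow t P * gpow (1 - t) O * gpow (1 - (1 - z) * t) S := by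
  rw [← integral_add_right_eq_self
    (fun t => gpow t P * gpow (1 - t) Q * gpow (1 - z * t) S) (1 : ℂ),
    integral_comp_inv, ← integral_sub_right_eq_self
    (fun t => ((‖t‖ : ℂ) ^ 4)⁻¹ * (gpow (t⁻¹ + 1) P * gpow (1 - (t⁻¹ + 1)) Q *
      gpow (1 - z * (t⁻¹ + 1)) S)) (1 : ℂ), ← integral_const_mul]
  refine integral_congr_ae ?_
  filter_upwards [compl_mem_ae_iff.2 (measure_singleton (1 : ℂ))] with t ht
  have h1 : t - 1 ≠ 0 := sub_ne_zero.2 ht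
  have h2 : 1 - t ≠ 0 := sub_ne_zero.2 (Ne.symm ht)
  have e1 : (t - 1)⁻¹ + 1 = (-1) * t / (1 - t) := by field_simp; ring
  have e2 : 1 - (-1) * t / (1 - t) = 1 / (1 - t) := by field_simp; ring
  have e3 : 1 - z * ((-1) * t / (1 - t)) = (1 - (1 - z) * t) / (1 - t) := by field_simp; ring
  rw [e1, e2, e3, ← hO]
  simp only [gpow_div, gpow_mul, gpow_one, one_mul, ← gpow_neg, pairInf,
    sub_eq_add_neg _ Q, sub_eq_add_neg _ S, sub_eq_add_neg _ pairOne]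
  have h3 : gpow (1 - t) (-pairOne) = ((‖t - 1‖ : ℂ) ^ 2)⁻¹ := by
    rw [gpow_neg, gpow_pairOne, norm_sub_rev]
  rw [gpow_add h2, gpow_add h2, gpow_add h2, gpow_add h2, h3]
  have h4 : (‖t - 1‖ : ℂ) ≠ 0 := by exact_mod_cast norm_ne_zero_iff.2 h1
  field_simp

/-- The change of variable `t → t / z`. -/
lemma integral_comp_scale {P Q S : ExpPair} {z : ℂ} (hz : z ≠ 0) :
    ∫ t, gpow t P * gpow (1 - t) Q * gpow (1 - z * t) S =
      gpow z⁻¹ (P + pairOne) * ∫ t, gpow t P * gpow (1 - t) S * gpow (1 - z⁻¹ * t) Q := by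
  have hz' := inv_ne_zero hz
  have := integral_comp_mul (fun t => gpow t P * gpow (1 - t) Q * gpow (1 - z * t) S) hz'
  have h2 : (‖z⁻¹‖ : ℂ) ≠ 0 := by exact_mod_cast norm_ne_zero_iff.2 hz'
  have h3 : ∫ t, gpow t P * gpow (1 - t) Q * gpow (1 - z * t) S =
      (‖z⁻¹‖ : ℂ) ^ 2 * ∫ t, gpow (z⁻¹ * t) P * gpow (1 - z⁻¹ * t) Q * gpow (1 - z * (z⁻¹ * t)) S := by
    rw [this, mul_inv_cancel_left₀ (pow_ne_zero 2 h2)]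
  rw [h3, gpow_add hz', gpow_pairOne, mul_comm (gpow z⁻¹ P)]
  rw [← integral_const_mul, ← integral_const_mul]
  refine integral_congr_ae (Filter.Eventually.of_forall fun t => ?_)
  dsimp only
  rw [gpow_mul, mul_inv_cancel_left₀ hz]
  ring

lemma ex_all {k : ℤ} {s : ℝ} {x : ℂ × ℂ} (hx : x ∈ regDomain k s) :
    (-3 < (exA k s x.1).2.re ∧ (-k = 0 → (exA k s x.1).2 ≠ -2)) ∧
    (-3 < (exB k s x.2).2.re ∧ (k = 0 → (exB k s x.2).2 ≠ -2)) ∧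
    (-3 < (exC k s x.1).2.re ∧ (-k = 0 → (exC k s x.1).2 ≠ -2)) ∧
    (-3 < (exD k s x.2).2.re ∧ (k = 0 → (exD k s x.2).2 ≠ -2)) := by
  obtain ⟨r1, r2, r3, r4⟩ := ex_re_gt (k := k) (s := s) hx.1
  obtain ⟨n1, n2, n3, n4⟩ := ex_ne (α := x.1) (β := x.2) hx
  exact ⟨⟨r1, n1⟩, ⟨r2, n2⟩, ⟨r3, n3⟩, ⟨r4, n4⟩⟩

section
variable {a b : ℝ} (hab : InSquare a b) {F : ℤ × ℝ → ℂ} (hF : F ∈ EvenTestFunctions)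
include hab hF

theorem adjointIntegrand_eq_regEuler {z : ℂ} {ε : ℝ} (had : Admissible z ε) (k : ℤ) (s : ℝ) :
    adjointIntegrand a b F z k s =
      density a b F k s * regEuler (exA k s a) (exB k s b) (exC k s a) z ε := by
  refine adjointIntegrand_eq hab hF ⟨had.ne_zero, had.ne_one⟩ k s
    (E := fun x => regEuler (exA k s x.1) (exB k s x.2) (exC k s x.1) z ε) (fun _ x hx => ?_) ?_
  · obtain ⟨h1, h2, h3, h4⟩ := ex_all hx
    exact (differentiableAt_regEuler (contDiff_exA k s) (contDiff_exB k s) (contDiff_exC k s) had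
      (contDiff_exD k s) (fun x => pairInf_ABC k s x.1 x.2) h1 h2 h3 h4).differentiableWithinAt
  · intro α β h1 h2 h3 h4
    obtain ⟨r1, r2, r3, r4⟩ := tube_re_gt (k := k) (s := s) h1 h2 h3 h4
    exact (integral_eq_regEuler had r1 r2 r3 (by rwa [pairInf_ABC])).symm

theorem adjointIntegrand_eq_zero_chart {z : ℂ} (hz : z ≠ 0) (hz2 : ‖z‖ ≤ 1 / 256) (k : ℤ)
    (s : ℝ) : adjointIntegrand a b F z k s =
      density a b F k s * regConf (exA k s a) (exB k s b) (exC k s a) z := by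
  refine adjointIntegrand_eq hab hF ⟨hz, ne_one_of_norm_le hz2⟩ k s
    (E := fun x => regConf (exA k s x.1) (exB k s x.2) (exC k s x.1) z) (fun _ x hx => ?_) ?_
  · obtain ⟨h1, h2, h3, h4⟩ := ex_all hx
    exact (differentiableAt_regConf (contDiff_exA k s) (contDiff_exB k s) (contDiff_exC k s) hz hz2
      (contDiff_exD k s) (fun x => pairInf_ABC k s x.1 x.2) h1 h2 h3 h4).differentiableWithinAt
  · intro α β h1 h2 h3 h4
    obtain ⟨r1, r2, r3, r4⟩ := tube_re_gt (k := k) (s := s) h1 h2 h3 h4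
    exact (integral_eq_regConf hz hz2 r1 r2 r3 (by rwa [pairInf_ABC])).symm

/-- The substitution t ↦ t/(t-1) exchanges the singular points 1 and ∞, hence `exB` and `exD`, and
turns z into 1 - z. -/
theorem adjointIntegrand_eq_one_chart {z : ℂ} (hz : 1 - z ≠ 0) (hz2 : ‖1 - z‖ ≤ 1 / 256) (k : ℤ)
    (s : ℝ) : adjointIntegrand a b F z k s =
      density a b F k s * ((-1) ^ (-k) * regConf (exA k s a) (exD k s b) (exC k s a) (1 - z)) := by
  refine adjointIntegrand_eq hab hF ⟨?_, fun h => hz (by rw [h, sub_self])⟩ k s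
    (E := fun x => (-1) ^ (-k) * regConf (exA k s x.1) (exD k s x.2) (exC k s x.1) (1 - z))
    (fun _ x hx => ?_) ?_
  · rintro rfl; exact ne_one_of_norm_le hz2 (sub_zero 1)
  · obtain ⟨h1, h2, h3, h4⟩ := ex_all hx
    exact ((differentiableAt_regConf (contDiff_exA k s) (contDiff_exD k s) (contDiff_exC k s) hz hz2
      (contDiff_exB k s) (fun x => pairInf_ADC k s x.1 x.2) h1 h4 h3 h2).const_mul
      _).differentiableWithinAt
  · intro α β h1 h2 h3 h4
    obtain ⟨r1, r2, r3, r4⟩ := tube_re_gt (k := k) (s := s) h1 h2 h3 h4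
    rw [integral_comp_mobius (pairInf_ABC k s α β), gpow_neg_one,
      integral_eq_regConf hz hz2 r1 r4 r3 (by rwa [pairInf_ADC])]
    rfl

/-- The scaling t ↦ t/z exchanges the singular points 1 and 1/z, hence `exB` and `exC`, and turns z
into 1/z. The power in front supplies the decay |z|^(-2a). -/
theorem adjointIntegrand_eq_inf_chart {z : ℂ} (hz : z ≠ 0) (hz2 : ‖z⁻¹‖ ≤ 1 / 256) (k : ℤ)
    (s : ℝ) : adjointIntegrand a b F z k s =
      density a b F k s * (gpow z⁻¹ (exA k s a + pairOne) *
        regConf (exA k s a) (exC k s a) (exB k s b) z⁻¹) := by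
  refine adjointIntegrand_eq hab hF ⟨hz, ?_⟩ k s
    (E := fun x => gpow z⁻¹ (exA k s x.1 + pairOne) *
      regConf (exA k s x.1) (exC k s x.1) (exB k s x.2) z⁻¹)
    (fun _ x hx => ?_) ?_
  · rintro rfl; exact ne_one_of_norm_le hz2 inv_one
  · obtain ⟨h1, h2, h3, h4⟩ := ex_all hx
    refine DifferentiableAt.differentiableWithinAt (DifferentiableAt.mul ?_
      (differentiableAt_regConf (contDiff_exA k s) (contDiff_exC k s) (contDiff_exB k s)
      (inv_ne_zero hz) hz2 (contDiff_exD k s) (fun x => pairInf_ACB k s x.1 x.2) h1 h3 h2 h4))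
    exact differentiableAt_gpow_exp
      (inv_ne_zero hz) (-k + 0) ((contDiff_exA k s).add contDiff_const) x
  · intro α β h1 h2 h3 h4
    obtain ⟨r1, r2, r3, r4⟩ := tube_re_gt (k := k) (s := s) h1 h2 h3 h4
    rw [integral_comp_scale hz,
      integral_eq_regConf (inv_ne_zero hz) hz2 r1 r3 r2 (by rwa [pairInf_ACB])]

end

/-! ### Smooth dependence on parameters -/

section Param

variable {E X : Type} [NormedAddCommGroup E] [NormedSpace ℝ E] [FiniteDimensional ℝ E]
  [NormedAddCommGroup X] [NormedSpace ℝ X] [FiniteDimensional ℝ X] [MeasurableSpace X]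
  [BorelSpace X] {μ : Measure X}

/-- A kernel that depends exponentially on the smooth parameter `σ`. -/
def expKer (κ : X → ℂ) (L : X → ℝ) (σ : E → ℂ) (n : ℕ) (e : E) (x : X) : ℂ :=
  κ x * Complex.exp (σ e * L x) * (L x : ℂ) ^ n

variable {κ : X → ℂ} {L : X → ℝ} {σ : E → ℂ} {K : Set X}

/-- The kernel and its derivatives are locally uniformly dominated on `K`. -/
def LocDominated (μ : Measure X) (κ : X → ℂ) (L : X → ℝ) (σ : E → ℂ) (K : Set X) : Prop :=
  ∀ (n : ℕ) (e₀ : E), ∃ g : X → ℝ, Integrable g μ ∧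
    ∀ᶠ e in 𝓝 e₀, ∀ x ∈ K, ‖expKer κ L σ n e x‖ ≤ g x

omit [NormedAddCommGroup E] [NormedSpace ℝ E] [FiniteDimensional ℝ E] [NormedAddCommGroup X]
  [NormedSpace ℝ X] [FiniteDimensional ℝ X] [BorelSpace X] in
lemma measurable_expKer (hκ : Measurable κ) (hL : Measurable L) (n : ℕ) (e : E) :
    Measurable (expKer κ L σ n e) := by
  unfold expKer
  fun_prop

lemma integrable_expKer_mul (hκ : Measurable κ) (hL : Measurable L) (hK : IsCompact K)
    (hdom : LocDominated μ κ L σ K) (n : ℕ) (e : E) {φ : X → ℂ} (hφ : Continuous φ)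
    (hs : ∀ᵐ x ∂μ, x ∉ K → φ x = 0) :
    Integrable (fun x => expKer κ L σ n e x * φ x) μ := by
  obtain ⟨g, hg, hb⟩ := hdom n e
  obtain ⟨C, hC⟩ := hK.exists_bound_of_continuousOn hφ.continuousOn
  refine Integrable.mono' (hg.abs.mul_const |C|)
    ((measurable_expKer hκ hL n e).aestronglyMeasurable.mul hφ.aestronglyMeasurable) ?_
  filter_upwards [hs] with x hx
  by_cases h : x ∈ K
  · rw [norm_mul]
    exact mul_le_mul ((hb.self_of_nhds x h).trans (le_abs_self _)) ((hC x h).trans (le_abs_self _))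
      (norm_nonneg _) (abs_nonneg _)
  · rw [hx h]; simp; positivity

/-- Differentiating the exponential in the parameter only brings down one more factor `L`. Kernels
with all powers of `L` thus form a family closed under differentiation, for which local domination
is assumed uniformly. -/
lemma hasFDerivAt_integral_expKer (hσ : ContDiff ℝ ∞ σ) (hκ : Measurable κ) (hL : Measurable L)
    (hK : IsCompact K) (hdom : LocDominated μ κ L σ K) (n : ℕ) {ψ : E × X → ℂ}
    (hψ : ContDiff ℝ ∞ ψ) (hs : ∀ᵐ x ∂μ, x ∉ K → ∀ e, ψ (e, x) = 0) (e₀ : E) :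
    HasFDerivAt (fun e => ∫ x, expKer κ L σ n e x * ψ (e, x) ∂μ)
      (∫ x, ((expKer κ L σ (n + 1) e₀ x * ψ (e₀, x)) • fderiv ℝ σ e₀ +
        expKer κ L σ n e₀ x • (fderiv ℝ ψ (e₀, x)).comp (ContinuousLinearMap.inl ℝ E X)) ∂μ) e₀ ∧
    Integrable (fun x => (expKer κ L σ (n + 1) e₀ x * ψ (e₀, x)) • fderiv ℝ σ e₀ +
        expKer κ L σ n e₀ x • (fderiv ℝ ψ (e₀, x)).comp (ContinuousLinearMap.inl ℝ E X)) μ := by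
  have hψd := hψ.differentiable (by simp)
  have hψ' : Continuous fun p : E × X => (fderiv ℝ ψ p).comp (ContinuousLinearMap.inl ℝ E X) :=
    (hψ.continuous_fderiv (by simp)).clm_comp continuous_const
  have hσ' : Continuous fun e => fderiv ℝ σ e := hσ.continuous_fderiv (by simp)
  obtain ⟨g₁, hg₁, hb₁⟩ := hdom (n + 1) e₀
  obtain ⟨g₂, hg₂, hb₂⟩ := hdom n e₀
  have hc : IsCompact (Metric.closedBall e₀ 1 ×ˢ K) := by
    have : ProperSpace E := FiniteDimensional.proper ℝ E
    exact (isCompact_closedBall e₀ 1).prod hK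
  obtain ⟨C₁, hC₁⟩ := hc.exists_bound_of_continuousOn hψ.continuous.continuousOn
  obtain ⟨C₂, hC₂⟩ := hc.exists_bound_of_continuousOn hψ'.continuousOn
  obtain ⟨C₃, hC₃⟩ := hc.exists_bound_of_continuousOn
    (f := fun p : E × X => fderiv ℝ σ p.1) (hσ'.comp continuous_fst).continuousOn
  have hev := (hb₁.and hb₂).and (Metric.closedBall_mem_nhds e₀ one_pos)
  have hd0 : ∀ᵐ x ∂μ, x ∉ K → ∀ e, (fderiv ℝ ψ (e, x)).comp (ContinuousLinearMap.inl ℝ E X) = 0 := by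
    filter_upwards [hs] with x hx hxK e
    have h1 : HasFDerivAt (fun e => ψ (e, x))
        ((fderiv ℝ ψ (e, x)).comp (ContinuousLinearMap.inl ℝ E X)) e :=
      (hψd (e, x)).hasFDerivAt.comp e (hasFDerivAt_prodMk_left e x)
    have h2 : (fun e => ψ (e, x)) = fun _ => 0 := funext (hx hxK)
    rw [h2] at h1
    exact h1.unique (hasFDerivAt_const _ _)
  set F' : E → X → E →L[ℝ] ℂ := fun e x =>
    (expKer κ L σ (n + 1) e x * ψ (e, x)) • fderiv ℝ σ e +
      expKer κ L σ n e x • (fderiv ℝ ψ (e, x)).comp (ContinuousLinearMap.inl ℝ E X) with hF'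
  have hmeas : ∀ e, AEStronglyMeasurable (F' e) μ := by
    intro e
    refine AEStronglyMeasurable.add ?_ ?_
    · exact (((measurable_expKer hκ hL (n + 1) e).aestronglyMeasurable.mul
        (hψ.continuous.comp (Continuous.prodMk_right e)).aestronglyMeasurable)).smul_const _
    · exact (measurable_expKer hκ hL n e).aestronglyMeasurable.smul
        (hψ'.comp (Continuous.prodMk_right e)).aestronglyMeasurable
  set bound : X → ℝ := fun x => |g₁ x| * |C₁| * |C₃| + |g₂ x| * |C₂|
  have hbi : Integrable bound μ :=
    ((hg₁.abs.mul_const _).mul_const _).add (hg₂.abs.mul_const _)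
  have hbd : ∀ᵐ x ∂μ, ∀ e ∈ {e | ((∀ x ∈ K, ‖expKer κ L σ (n + 1) e x‖ ≤ g₁ x) ∧
      ∀ x ∈ K, ‖expKer κ L σ n e x‖ ≤ g₂ x) ∧ e ∈ Metric.closedBall e₀ 1}, ‖F' e x‖ ≤ bound x := by
    filter_upwards [hs, hd0] with x hx hx' e he
    by_cases h : x ∈ K
    · refine (norm_add_le _ _).trans (add_le_add ?_ ?_)
      · rw [norm_smul, norm_mul]
        gcongr
        · exact (he.1.1 x h).trans (le_abs_self _)
        · exact (hC₁ (e, x) ⟨he.2, h⟩).trans (le_abs_self _)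
        · exact (hC₃ (e, x) ⟨he.2, h⟩).trans (le_abs_self _)
      · rw [norm_smul]
        gcongr
        · exact (he.1.2 x h).trans (le_abs_self _)
        · exact (hC₂ (e, x) ⟨he.2, h⟩).trans (le_abs_self _)
    · have : F' e x = 0 := by
        ext v
        simp [hF', hx h, hx' h]
      rw [this, norm_zero]
      positivity
  refine ⟨hasFDerivAt_integral_of_dominated_of_fderiv_le (F' := F') hev ?_ ?_ (hmeas e₀) hbd hbi ?_,
    hbi.mono' (hmeas e₀) ?_⟩
  · refine Filter.Eventually.of_forall fun e => ?_
    exact (measurable_expKer hκ hL n e).aestronglyMeasurable.mul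
      (hψ.continuous.comp (Continuous.prodMk_right e)).aestronglyMeasurable
  · exact integrable_expKer_mul hκ hL hK hdom n e₀ (hψ.continuous.comp (Continuous.prodMk_right e₀))
      (hs.mono fun x hx h => hx h e₀)
  · refine Filter.Eventually.of_forall fun x e _ => ?_
    have h1 : HasFDerivAt (fun e => ψ (e, x))
        ((fderiv ℝ ψ (e, x)).comp (ContinuousLinearMap.inl ℝ E X)) e :=
      (hψd (e, x)).hasFDerivAt.comp e (hasFDerivAt_prodMk_left e x)
    have h2 : HasFDerivAt σ (fderiv ℝ σ e) e := (hσ.differentiable (by simp) e).hasFDerivAt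
    have h3 : HasFDerivAt (fun e => expKer κ L σ n e x) (expKer κ L σ (n + 1) e x • fderiv ℝ σ e) e := by
      have := (((h2.mul_const (L x : ℂ)).cexp).const_mul (κ x)).mul_const ((L x : ℂ) ^ n)
      refine this.congr_fderiv ?_
      ext v
      simp [expKer]
      ring
    refine (h3.mul h1).congr_fderiv ?_
    ext v
    simp [hF']
    ring
  · filter_upwards [hbd] with x hx
    exact hx e₀ hev.self_of_nhds

theorem contDiff_integral_expKer (hσ : ContDiff ℝ ∞ σ) (hκ : Measurable κ) (hL : Measurable L)
    (hK : IsCompact K) (hdom : LocDominated μ κ L σ K) {ψ : E × X → ℂ}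
    (hψ : ContDiff ℝ ∞ ψ) (hs : ∀ᵐ x ∂μ, x ∉ K → ∀ e, ψ (e, x) = 0) :
    ContDiff ℝ ∞ (fun e => ∫ x, expKer κ L σ 0 e x * ψ (e, x) ∂μ) := by
  -- The derivative is a sum of two integrals of the same kind, one with n raised and both with a
  -- new amplitude, so the induction on the order m has to let n and ψ vary.
  suffices H : ∀ m n : ℕ, ∀ ψ : E × X → ℂ, ContDiff ℝ ∞ ψ →
      (∀ᵐ x ∂μ, x ∉ K → ∀ e, ψ (e, x) = 0) →
      ContDiff ℝ m (fun e => ∫ x, expKer κ L σ n e x * ψ (e, x) ∂μ) by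
    rw [contDiff_infty]
    exact fun m => H m 0 ψ hψ hs
  intro m
  induction m with
  | zero =>
    intro n ψ hψ hs
    rw [Nat.cast_zero, contDiff_zero, continuous_iff_continuousAt]
    exact fun e => (hasFDerivAt_integral_expKer hσ hκ hL hK hdom n hψ hs e).1.continuousAt
  | succ m ih =>
    intro n ψ hψ hs
    have hd := hasFDerivAt_integral_expKer hσ hκ hL hK hdom n hψ hs
    rw [Nat.cast_succ, contDiff_succ_iff_fderiv_apply]
    refine ⟨fun e => (hd e).1.differentiableAt, by simp, fun v => ?_⟩
    have h1 : ContDiff ℝ ∞ fun p : E × X => ψ p * fderiv ℝ σ p.1 v :=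
      hψ.mul (((hσ.fderiv_right (m := ∞) (by simp)).clm_apply contDiff_const).comp contDiff_fst)
    have h2 : ContDiff ℝ ∞ fun p : E × X => fderiv ℝ ψ p (v, 0) :=
      (hψ.fderiv_right (m := ∞) (by simp)).clm_apply contDiff_const
    have s1 : ∀ᵐ x ∂μ, x ∉ K → ∀ e, ψ (e, x) * fderiv ℝ σ e v = 0 :=
      hs.mono fun x hx h e => by rw [hx h, zero_mul]
    have s2 : ∀ᵐ x ∂μ, x ∉ K → ∀ e, fderiv ℝ ψ (e, x) (v, 0) = 0 := by
      filter_upwards [hs] with x hx hxK e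
      have h1 : HasFDerivAt (fun e => ψ (e, x))
          ((fderiv ℝ ψ (e, x)).comp (ContinuousLinearMap.inl ℝ E X)) e :=
        (hψ.differentiable (by simp) (e, x)).hasFDerivAt.comp e (hasFDerivAt_prodMk_left e x)
      have h2 : (fun e => ψ (e, x)) = fun _ => 0 := funext (hx hxK)
      rw [h2] at h1
      have := congrArg (fun l : E →L[ℝ] ℂ => l v) (h1.unique (hasFDerivAt_const _ _))
      simpa using this
    convert (ih (n + 1) _ h1 s1).add (ih n _ h2 s2) using 1
    ext e
    rw [(hd e).1.fderiv, ContinuousLinearMap.integral_apply (hd e).2, ← integral_add]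
    · congr 1
      ext x
      simp
      ring
    · exact integrable_expKer_mul hκ hL hK hdom (n + 1) e
        (h1.continuous.comp (Continuous.prodMk_right e)) (s1.mono fun x hx h => hx h e)
    · exact integrable_expKer_mul hκ hL hK hdom n e
        (h2.continuous.comp (Continuous.prodMk_right e)) (s2.mono fun x hx h => hx h e)

/-- Integrals of smooth functions over a compact set depend smoothly on parameters. -/
theorem contDiff_integral_of_compact [IsFiniteMeasureOnCompacts μ] (hK : IsCompact K)
    {ψ : E × X → ℂ} (hψ : ContDiff ℝ ∞ ψ) (hs : ∀ᵐ x ∂μ, x ∉ K → ∀ e, ψ (e, x) = 0) :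
    ContDiff ℝ ∞ (fun e => ∫ x, ψ (e, x) ∂μ) := by
  have h := contDiff_integral_expKer (μ := μ) (κ := fun _ => 1) (L := fun _ => 0)
    (σ := fun _ : E => 0) contDiff_const measurable_const measurable_const hK ?_ hψ hs
  · simpa [expKer] using h
  · intro n e₀
    refine ⟨K.indicator fun _ => ‖expKer (fun _ : X => 1) (fun _ => 0) (fun _ : E => 0) n e₀ 0‖,
      ?_, ?_⟩
    · rw [integrable_indicator_iff hK.measurableSet]
      exact integrableOn_const hK.measure_lt_top.ne
    · refine Filter.Eventually.of_forall fun e x hx => ?_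
      rw [Set.indicator_of_mem hx]
      simp [expKer]

end Param

section GpowParam

variable {E : Type} [NormedAddCommGroup E] [NormedSpace ℝ E] [FiniteDimensional ℝ E]

/-- The phase of the generalized power. -/
def phaseKer (k : ℤ) : ℂ → ℂ := ({0}ᶜ : Set ℂ).indicator fun u => gpow u (k, 0)

lemma measurable_phaseKer (k : ℤ) : Measurable (phaseKer k) :=
  (measurable_gpow k measurable_id measurable_const).indicator (measurableSet_singleton 0).compl

lemma expKer_phaseKer (k : ℤ) (σ : E → ℂ) (n : ℕ) (e : E) {u : ℂ} (hu : u ≠ 0) :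
    expKer (phaseKer k) (fun u => Real.log ‖u‖) σ n e u =
      gpow u (k, σ e) * (Real.log ‖u‖ : ℂ) ^ n := by
  rw [expKer, phaseKer, Set.indicator_of_mem (by simpa using hu), gpow_eq_exp hu, gpow_eq_exp hu,
    mul_assoc (u ^ k), ← Complex.exp_add]
  congr 3
  dsimp only
  ring

lemma abs_log_le {t r : ℝ} (ht : 0 < t) (hr : 0 < r) : |Real.log r| ≤ (r ^ t + r ^ (-t)) / t := by
  have h1 := Real.log_le_rpow_div hr.le ht
  have h2 := Real.log_le_rpow_div (inv_pos.2 hr).le ht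
  rw [Real.log_inv, Real.inv_rpow hr.le, ← Real.rpow_neg hr.le] at h2
  have h3 := Real.rpow_pos_of_pos hr t
  have h4 := Real.rpow_pos_of_pos hr (-t)
  rw [add_div, abs_le]
  have h5 : 0 < r ^ t / t := div_pos h3 ht
  have h6 : 0 < r ^ (-t) / t := div_pos h4 ht
  constructor <;> linarith

/-- The power r^δ is divided into n + 1 equal powers, one to control each logarithm and one left
over. -/
lemma rpow_mul_abs_log_pow_le {δ R r : ℝ} (hδ : 0 < δ) (n : ℕ) (hr : 0 < r) (hrR : r ≤ R) :
    r ^ δ * |Real.log r| ^ n ≤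
      R ^ (δ / (n + 1)) * ((R ^ (2 * (δ / (n + 1))) + 1) / (δ / (n + 1))) ^ n := by
  set t := δ / (n + 1) with ht
  have ht0 : 0 < t := by positivity
  have h1 : r ^ δ = r ^ t * (r ^ t) ^ n := by
    rw [← Real.rpow_natCast, ← Real.rpow_mul hr.le, ← Real.rpow_add hr]
    congr 1
    rw [ht]; field_simp
    ring
  rw [h1, mul_assoc, ← mul_pow]
  have h2 : r ^ t * |Real.log r| ≤ (R ^ (2 * t) + 1) / t := by
    calc r ^ t * |Real.log r| ≤ r ^ t * ((r ^ t + r ^ (-t)) / t) :=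
          mul_le_mul_of_nonneg_left (abs_log_le ht0 hr) (by positivity)
      _ = (r ^ (2 * t) + 1) / t := by
          rw [two_mul, Real.rpow_add hr, mul_div_assoc', mul_add, ← Real.rpow_add hr t (-t)]
          simp
      _ ≤ _ := by gcongr
  have hR : 0 < R := hr.trans_le hrR
  gcongr

lemma locDominated_gpow (k : ℤ) {σ : E → ℂ} (hσ : Continuous σ) (hre : ∀ e, -2 < (σ e).re)
    (R : ℝ) :
    LocDominated volume (phaseKer k) (fun u => Real.log ‖u‖) σ (Metric.closedBall 0 R) := by
  intro n e₀
  set R' := max R 1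
  -- A quarter of the distance to the critical exponent -2: the majorant's exponent ρ is lower by 2δ
  -- and still above -2; one δ allows the parameter to vary, another absorbs the logarithms.
  set δ := ((σ e₀).re + 2) / 4 with hδ
  have hδ0 : 0 < δ := by have := hre e₀; rw [hδ]; linarith
  set ρ := (σ e₀).re - 2 * δ with hρ
  have hρ0 : -2 < ρ := by rw [hρ, hδ]; linarith [hre e₀]
  set C := R' ^ (2 * δ) *
    (R' ^ (δ / (n + 1)) * ((R' ^ (2 * (δ / (n + 1))) + 1) / (δ / (n + 1))) ^ n)
  refine ⟨(Metric.closedBall (0 : ℂ) R').indicator fun u => ‖u‖ ^ ρ * C, ?_, ?_⟩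
  · rw [integrable_indicator_iff Metric.isClosed_closedBall.measurableSet]
    exact (integrableOn_norm_rpow hρ0 R').mul_const C
  · have hc : Continuous fun e => (σ e).re := Complex.continuous_re.comp hσ
    filter_upwards [hc.continuousAt.eventually (Ioo_mem_nhds (show (σ e₀).re - δ < (σ e₀).re by linarith)
      (show (σ e₀).re < (σ e₀).re + δ by linarith))] with e he u hu
    have hR0 : 1 ≤ R' := le_max_right _ _
    have huR : ‖u‖ ≤ R' := (mem_closedBall_zero_iff.1 hu).trans (le_max_left _ _)
    rw [Set.indicator_of_mem (mem_closedBall_zero_iff.2 huR)]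
    by_cases h0 : u = 0
    · subst h0
      simp only [expKer, phaseKer]
      rw [Set.indicator_of_notMem (by simp)]
      simp only [zero_mul, norm_zero]
      positivity
    · have hr : 0 < ‖u‖ := norm_pos_iff.2 h0
      rw [expKer_phaseKer k σ n e h0, norm_mul, norm_gpow h0, norm_pow, Complex.norm_real,
        Real.norm_eq_abs]
      dsimp only
      have h1 : ‖u‖ ^ (σ e).re = ‖u‖ ^ ρ * (‖u‖ ^ ((σ e).re - ρ - δ) * ‖u‖ ^ δ) := by
        rw [← Real.rpow_add hr, ← Real.rpow_add hr]
        congr 1; ring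
      rw [h1, mul_assoc, mul_assoc]
      refine mul_le_mul_of_nonneg_left (mul_le_mul ?_
        (rpow_mul_abs_log_pow_le hδ0 n hr huR) (by positivity) (by positivity)) (by positivity)
      calc ‖u‖ ^ ((σ e).re - ρ - δ) ≤ R' ^ ((σ e).re - ρ - δ) :=
            Real.rpow_le_rpow hr.le huR (by rw [hρ]; linarith [he.1])
        _ ≤ R' ^ (2 * δ) := Real.rpow_le_rpow_of_exponent_le hR0 (by rw [hρ]; linarith [he.2])

theorem contDiff_integral_gpow (k : ℤ) {σ : E → ℂ} (hσ : ContDiff ℝ ∞ σ)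
    (hre : ∀ e, -2 < (σ e).re) {ψ : E × ℂ → ℂ} (hψ : ContDiff ℝ ∞ ψ) (R : ℝ)
    (hs : ∀ e u, R < ‖u‖ → ψ (e, u) = 0) :
    ContDiff ℝ ∞ (fun e => ∫ u, gpow u (k, σ e) * ψ (e, u)) := by
  have h := contDiff_integral_expKer (μ := volume) hσ (measurable_phaseKer k)
    (Real.measurable_log.comp measurable_norm) (isCompact_closedBall (0 : ℂ) R)
    (locDominated_gpow k hσ.continuous hre R) hψ (Filter.Eventually.of_forall fun u hu e =>
      hs e u (by simpa using hu))
  convert h using 1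
  ext e
  refine integral_congr_ae ?_
  filter_upwards [compl_mem_ae_iff.2 (measure_singleton (0 : ℂ))] with u hu
  rw [Function.comp_def, expKer_phaseKer k σ 0 e hu]
  simp

lemma fderiv_apply_mul (φ : ℂ → ℂ) (e u : ℂ) : fderiv ℝ φ u (e * u) =
    dz φ u * (e * u) + dzbar φ u * (starRingEnd ℂ) (e * u) := by
  set v := e * u
  have h : fderiv ℝ φ u v = v.re * fderiv ℝ φ u 1 + v.im * fderiv ℝ φ u Complex.I := by
    conv_lhs => rw [show v = v.re • (1 : ℂ) + v.im • Complex.I by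
      rw [Complex.real_smul, Complex.real_smul, mul_one]; exact (Complex.re_add_im v).symm]
    rw [map_add, map_smul, map_smul]
    simp
  rw [h, dz, dzbar]
  have h1 : v = v.re + v.im * Complex.I := (Complex.re_add_im v).symm
  have h2 : (starRingEnd ℂ) v = v.re - v.im * Complex.I := by
    apply Complex.ext <;> simp
  rw [h2]
  conv_rhs => enter [1, 2]; rw [h1]
  linear_combination ((v.im : ℂ) * fderiv ℝ φ u Complex.I) * Complex.I_sq

lemma contDiff_dz_snd {Φ : E × ℂ → ℂ} (h : ContDiff ℝ ∞ Φ) :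
    ContDiff ℝ ∞ (fun e : E × ℂ => dz (fun u => Φ (e.1, u)) e.2) := by
  have := contDiff_fderiv_snd h
  exact ((this.clm_apply contDiff_const).sub
    (contDiff_const.mul (this.clm_apply contDiff_const))).div_const _

lemma contDiff_dzbar_snd {Φ : E × ℂ → ℂ} (h : ContDiff ℝ ∞ Φ) :
    ContDiff ℝ ∞ (fun e : E × ℂ => dzbar (fun u => Φ (e.1, u)) e.2) := by
  have := contDiff_fderiv_snd h
  exact ((this.clm_apply contDiff_const).add
    (contDiff_const.mul (this.clm_apply contDiff_const))).div_const _

/-- The derivative along u ↦ vu is vu ∂ψ plus its conjugate counterpart. The factors u and conj u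
pass into the power, which raises the real part of the exponent from above -3 to above -2 and
reduces the claim to `contDiff_integral_gpow`. -/
theorem contDiff_integral_gpow_fderiv (k : ℤ) {σ : E → ℂ} (hσ : ContDiff ℝ ∞ σ)
    (hre : ∀ e, -3 < (σ e).re) {ψ : E × ℂ → ℂ} (hψ : ContDiff ℝ ∞ ψ) (R : ℝ)
    (hs : ∀ e u, R < ‖u‖ → ψ (e, u) = 0) (v : ℂ) :
    ContDiff ℝ ∞ (fun e => ∫ u, gpow u (k, σ e) * fderiv ℝ (fun u => ψ (e, u)) u (v * u)) := by
  have hz : ∀ e u, R < ‖u‖ → fderiv ℝ (fun u => ψ (e, u)) u = 0 := by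
    intro e u hu
    have : (fun u => ψ (e, u)) =ᶠ[𝓝 u] fun _ => 0 := by
      filter_upwards [(isOpen_lt continuous_const continuous_norm).mem_nhds hu] with y hy
      exact hs e y hy
    rw [this.fderiv_eq]; simp
  have d1 := contDiff_dz_snd hψ
  have d2 := contDiff_dzbar_snd hψ
  have s1 : ∀ e u, R < ‖u‖ → dz (fun u => ψ (e, u)) u = 0 := fun e u hu => by
    simp [dz, hz e u hu]
  have s2 : ∀ e u, R < ‖u‖ → dzbar (fun u => ψ (e, u)) u = 0 := fun e u hu => by
    simp [dzbar, hz e u hu]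
  have r1 : ∀ e, -2 < (σ e + 1).re := fun e => by
    rw [Complex.add_re, Complex.one_re]; linarith [hre e]
  have c1 := contDiff_integral_gpow (k + 1) (hσ.add contDiff_const) r1 d1 R s1
  have c2 := contDiff_integral_gpow (k - 1) (hσ.add contDiff_const) r1 d2 R s2
  have hi : ∀ e (l : ℤ) (f : ℂ → ℂ), Continuous f → (∀ u, R < ‖u‖ → f u = 0) →
      Integrable fun u => gpow u (l, σ e + 1) * f u := fun e l f hf h0 =>
    integrable_gpow_mul (P := (l, σ e + 1)) (r1 e) hf
      (HasCompactSupport.of_support_subset_isCompact (isCompact_closedBall (0 : ℂ) R) (by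
        intro u hu
        by_contra h
        exact hu (h0 u (by simpa using h))))
  convert (c1.const_smul v).add (c2.const_smul ((starRingEnd ℂ) v)) using 1
  ext e
  have i1 := hi e (k + 1) _ (d1.continuous.comp (Continuous.prodMk_right e)) (s1 e)
  have i2 := hi e (k - 1) _ (d2.continuous.comp (Continuous.prodMk_right e)) (s2 e)
  simp only [Function.comp_def] at i1 i2
  simp only [smul_eq_mul]
  rw [← integral_const_mul, ← integral_const_mul, ← integral_add (i1.const_mul _) (i2.const_mul _)]
  refine integral_congr_ae ?_
  filter_upwards [compl_mem_ae_iff.2 (measure_singleton (0 : ℂ))] with u hu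
  rw [fderiv_apply_mul, gpow_add_one hu, gpow_conj_add_one hu, map_mul]
  ring

variable {kP kQ kS : ℤ} {σP σQ σS w : E → ℂ} {m : E → ℂ}

/-- The parameter cutoff `m` is moved under the integral, where it makes the amplitude globally
smooth. -/
theorem contDiff_mul_core (hσP : ContDiff ℝ ∞ σP) (hσQ : ContDiff ℝ ∞ σQ)
    (hσS : ContDiff ℝ ∞ σS) (hre : ∀ e, -3 < (σP e).re) {ε : ℝ} (hε : 0 < ε) (hε2 : ε ≤ 1 / 2)
    (hm : ContDiff ℝ ∞ m) (hw : ∀ e ∈ tsupport m, ContDiffAt ℝ ∞ w e)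
    (hwε : ∀ e ∈ tsupport m, ‖w e‖ * ε ≤ 1 / 2) :
    ContDiff ℝ ∞ (fun e => m e * core (kP, σP e) (kQ, σQ e) (kS, σS e) (w e) ε) := by
  have h := contDiff_locPhi kQ kS hε hε2 hm hw hwε hσQ hσS
  have := contDiff_integral_gpow_fderiv kP hσP hre h (7 / 4 * ε) (fun e u hu => by
    rw [locPhi_eq_zero _ _ _ hε hu.le, mul_zero]) (ibpDir kP)
  convert this.neg using 1
  ext e
  rw [core, mul_neg, ← integral_const_mul]
  congr 2
  ext u
  by_cases hme : e ∈ tsupport m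
  · have hd := (contDiff_locPhi_single (kQ, σQ e) (kS, σS e) hε hε2 (hwε e hme)).differentiable
      (by simp) u
    rw [show (fun u => m (e, u).1 * locPhi (kQ, σQ (e, u).1) (kS, σS (e, u).1) (w (e, u).1) ε (e, u).2)
      = fun u => m e * locPhi (kQ, σQ e) (kS, σS e) (w e) ε u from rfl, fderiv_const_mul hd]
    simp
    ring
  · simp [image_eq_zero_of_notMem_tsupport hme]

theorem contDiff_mul_rest (hσP : ContDiff ℝ ∞ σP) (hσQ : ContDiff ℝ ∞ σQ)
    (hσS : ContDiff ℝ ∞ σS) {B : E × ℂ → ℂ} (R : ℝ) (hm : ContDiff ℝ ∞ fun p : E × ℂ => m p.1 * B p)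
    (hw : ∀ e ∈ tsupport m, ContDiffAt ℝ ∞ w e)
    (h0 : ∀ e ∈ tsupport fun p : E × ℂ => m p.1 * B p,
      e.2 ≠ 0 ∧ 1 - e.2 ≠ 0 ∧ 1 - w e.1 * e.2 ≠ 0)
    (hR : ∀ e u, R < ‖u‖ → m e * B (e, u) = 0) :
    ContDiff ℝ ∞ (fun e => m e * rest (fun u => B (e, u)) (kP, σP e) (kQ, σQ e) (kS, σS e) (w e)) := by
  have h := contDiff_rest kP kQ kS hm (fun e he => hw e.1
    (tsupport_comp_subset_preimage m continuous_fst (tsupport_mul_subset_left he))) h0 hσP hσQ hσS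
  have := contDiff_integral_of_compact (μ := volume) (isCompact_closedBall (0 : ℂ) R) h
    (Filter.Eventually.of_forall fun u hu e => by
      dsimp only
      rw [hR e u (by simpa using hu)]; simp)
  convert this using 1
  ext e
  rw [rest, ← integral_const_mul]
  congr 1
  ext u
  ring

end GpowParam

/-! ### Joint smoothness of the regularized integrals in the point and the spectral parameter -/

lemma contDiff_of_forall_tsupport {E : Type*} [NormedAddCommGroup E] [NormedSpace ℝ E] {f : E → ℂ}
    (h : ∀ x ∈ tsupport f, ContDiffAt ℝ ∞ f x) : ContDiff ℝ ∞ f := by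
  rw [contDiff_iff_contDiffAt]
  intro x
  by_cases hx : x ∈ tsupport f
  · exact h x hx
  · exact contDiffAt_const.congr_of_eventuallyEq (notMem_tsupport_iff_eventuallyEq.1 hx)

lemma contDiffAt_complex_div {E : Type*} [NormedAddCommGroup E] [NormedSpace ℝ E] {f g : E → ℂ}
    {x : E} (hf : ContDiffAt ℝ ∞ f x) (hg : ContDiffAt ℝ ∞ g x) (h : g x ≠ 0) :
    ContDiffAt ℝ ∞ (fun x => f x / g x) x := by
  simp only [div_eq_mul_inv]
  exact hf.mul (hg.inv h)

section Joint

variable {kP kQ kS kO : ℤ} {σP σQ σS σO : ℂ × ℝ → ℂ} {m : ℂ × ℝ → ℂ}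

/-- The conditions on an exponent under which the local integrals are regularized. -/
structure RegExp (m : ℂ × ℝ → ℂ) (k : ℤ) (σ : ℂ × ℝ → ℂ) : Prop where
  contDiff : ContDiff ℝ ∞ σ
  re_gt : ∀ e, -3 < (σ e).re
  ne : ∀ e ∈ tsupport m, ibpConst k (σ e) ≠ 0

lemma RegExp.mono {m' : ℂ × ℝ → ℂ} {k : ℤ} {σ : ℂ × ℝ → ℂ} (h : RegExp m k σ)
    (hm : tsupport m' ⊆ tsupport m) : RegExp m' k σ :=
  ⟨h.1, h.2, fun e he => h.3 e (hm he)⟩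

lemma contDiff_ibpConst {k : ℤ} {σ : ℂ × ℝ → ℂ} (hσ : ContDiff ℝ ∞ σ) :
    ContDiff ℝ ∞ fun e => ibpConst k (σ e) := by
  unfold ibpConst
  split_ifs
  · exact hσ.add contDiff_const
  · exact contDiff_const

lemma contDiff_mul_inv_ibpConst {k : ℤ} {σ : ℂ × ℝ → ℂ} (hm : ContDiff ℝ ∞ m) (h : RegExp m k σ) :
    ContDiff ℝ ∞ fun e => m e * (ibpConst k (σ e))⁻¹ :=
  contDiff_of_forall_tsupport fun e he => hm.contDiffAt.mul
    ((contDiff_ibpConst h.contDiff).contDiffAt.inv (h.ne e (tsupport_mul_subset_left he)))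

lemma contDiff_mul_regLoc {w : ℂ × ℝ → ℂ} (hP : RegExp m kP σP) (hσQ : ContDiff ℝ ∞ σQ)
    (hσS : ContDiff ℝ ∞ σS) {ε : ℝ} (hε : 0 < ε) (hε2 : ε ≤ 1 / 2)
    (hm : ContDiff ℝ ∞ m) (hw : ∀ e ∈ tsupport m, ContDiffAt ℝ ∞ w e)
    (hwε : ∀ e ∈ tsupport m, ‖w e‖ * ε ≤ 1 / 2) :
    ContDiff ℝ ∞ (fun e => m e * regLoc (kP, σP e) (kQ, σQ e) (kS, σS e) (w e) ε) := by
  have h := contDiff_mul_core (kP := kP) (kQ := kQ) (kS := kS) hP.contDiff hσQ hσS hP.re_gt hε hε2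
    (contDiff_mul_inv_ibpConst hm hP) (fun e he => hw e (tsupport_mul_subset_left he))
    (fun e he => hwε e (tsupport_mul_subset_left he))
  convert h using 1
  ext e
  rw [regLoc]
  ring

theorem contDiff_mul_regNear (hP : RegExp m kP σP) (hQ : RegExp m kQ σQ)
    (hσS : ContDiff ℝ ∞ σS) (hm : ContDiff ℝ ∞ m) (hw : ∀ e ∈ tsupport m, ‖e.1‖ ≤ 1 / 256) :
    ContDiff ℝ ∞ (fun e => m e * regNear (kP, σP e) (kQ, σQ e) (kS, σS e) e.1) := by
  have h1 := contDiff_mul_regLoc (kQ := kQ) (kS := kS) (w := Prod.fst) hP hQ.contDiff hσS (ε := 1 / 8) (by norm_num)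
    (by norm_num) hm (fun _ _ => contDiffAt_fst) (fun e he => by linarith [hw e he])
  have hm2 := contDiff_mul_gpow (g := fun e : ℂ × ℝ => 1 - e.1) (σ := σS) kS hm
    (fun _ _ => by fun_prop) hσS (fun e he => sub_ne_zero.2 (ne_one_of_norm_le (hw e he)).symm)
  have hsub : tsupport (fun e => m e * gpow (1 - e.1) (kS, σS e)) ⊆ tsupport m :=
    tsupport_mul_subset_left
  have h2 := contDiff_mul_regLoc (kQ := kP) (kS := kS) (w := fun e => e.1 / (e.1 - 1)) (hQ.mono hsub) hP.contDiff hσS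
    (ε := 1 / 8) (by norm_num) (by norm_num) hm2 (fun e he => contDiffAt_complex_div contDiffAt_fst
      (contDiffAt_fst.sub contDiffAt_const) (sub_ne_zero.2 (ne_one_of_norm_le (hw e (hsub he)))))
    (fun e he => norm_div_sub_one_le (hw e (hsub he)))
  have h3 := contDiff_mul_rest (w := Prod.fst) (B := fun p : (ℂ × ℝ) × ℂ => rhoConf p.2)
    (kP := kP) (kQ := kQ) (kS := kS) hP.contDiff hQ.contDiff hσS (R := 14)
    ((hm.comp contDiff_fst).mul (contDiff_rhoConf.comp contDiff_snd))
    (fun _ _ => contDiffAt_fst) (fun e he => ?_) (fun e u hu => ?_)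
  · convert (h1.add h2).add h3 using 1
    ext e
    rw [regNear]
    ring
  · exact tsupport_rhoConf_ne_zero
      (hw e.1 (tsupport_comp_subset_preimage m continuous_fst (tsupport_mul_subset_left he)))
      (tsupport_comp_subset_preimage rhoConf continuous_snd (tsupport_mul_subset_right he))
  · have : rhoConf u = 0 := by
      by_contra h
      linarith [(rhoConf_ne_zero h).2.2]
    simp [this]

theorem contDiff_mul_regEuler {ε : ℝ} (hP : RegExp m kP σP) (hQ : RegExp m kQ σQ)
    (hS : RegExp m kS σS) (hO : RegExp m kO σO)
    (hO' : ∀ e, pairInf (kP, σP e) (kQ, σQ e) (kS, σS e) = (kO, σO e))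
    (hm : ContDiff ℝ ∞ m) (hε : 0 < ε) (hw : ∀ e ∈ tsupport m, Admissible e.1 ε) :
    ContDiff ℝ ∞ (fun e => m e * regEuler (kP, σP e) (kQ, σQ e) (kS, σS e) e.1 ε) := by
  by_cases hempty : ∃ e, e ∈ tsupport m
  swap
  · have : ∀ e, m e = 0 := fun e => image_eq_zero_of_notMem_tsupport fun h => hempty ⟨e, h⟩
    simp only [this, zero_mul]
    exact contDiff_const
  obtain ⟨e₀, he₀⟩ := hempty
  have hε2 := (hw e₀ he₀).bounds.1
  have hsub1 : ∀ e ∈ tsupport m, 1 - e.1 ≠ 0 := fun e he => sub_ne_zero.2 (hw e he).ne_one.symm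
  have hsub2 : ∀ e ∈ tsupport m, e.1 - 1 ≠ 0 := fun e he => sub_ne_zero.2 (hw e he).ne_one
  have h1 := contDiff_mul_regLoc (kQ := kQ) (kS := kS) (w := Prod.fst) hP hQ.contDiff hS.contDiff
    hε hε2 hm (fun _ _ => contDiffAt_fst) (fun e he => (hw e he).bounds.2.1)
  -- the piece at `1`
  have hm2 := contDiff_mul_gpow (g := fun e : ℂ × ℝ => 1 - e.1) (σ := σS) kS hm
    (fun _ _ => by fun_prop) hS.contDiff hsub1
  have hs2 : tsupport (fun e => m e * gpow (1 - e.1) (kS, σS e)) ⊆ tsupport m :=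
    tsupport_mul_subset_left
  have h2 := contDiff_mul_regLoc (kQ := kP) (kS := kS) (w := fun e => e.1 / (e.1 - 1))
    (hQ.mono hs2) hP.contDiff hS.contDiff hε hε2 hm2 (fun e he => contDiffAt_complex_div contDiffAt_fst
      (contDiffAt_fst.sub contDiffAt_const) (hsub2 e (hs2 he))) (fun e he => (hw e (hs2 he)).bounds.2.2.1)
  -- the piece at `1 / w`
  have hm3 := contDiff_mul_gpow (g := fun e : ℂ × ℝ => e.1) (σ := fun e => -σP e - 2) (-kP - 0) hm
    (fun _ _ => by fun_prop) (hP.contDiff.neg.sub contDiff_const) (fun e he => (hw e he).ne_zero)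
  have hs3 : tsupport (fun e => m e * gpow e.1 (-kP - 0, -σP e - 2)) ⊆ tsupport m :=
    tsupport_mul_subset_left
  have hm3' := contDiff_mul_gpow (g := fun e : ℂ × ℝ => (e.1 - 1) / e.1) (σ := σQ) kQ hm3
    (fun e he => contDiffAt_complex_div (contDiffAt_fst.sub contDiffAt_const) contDiffAt_fst (hw e (hs3 he)).ne_zero) hQ.contDiff
    (fun e he => div_ne_zero (hsub2 e (hs3 he)) (hw e (hs3 he)).ne_zero)
  have hs3' : tsupport (fun e => m e * gpow e.1 (-kP - 0, -σP e - 2) *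
      gpow ((e.1 - 1) / e.1) (kQ, σQ e)) ⊆ tsupport m := tsupport_mul_subset_left.trans hs3
  have h3 := contDiff_mul_regLoc (kQ := kP) (kS := kQ) (w := fun e => 1 / (1 - e.1))
    (hS.mono hs3') hP.contDiff hQ.contDiff hε hε2 hm3' (fun e he => contDiffAt_complex_div contDiffAt_const
      (contDiffAt_const.sub contDiffAt_fst) (hsub1 e (hs3' he))) (fun e he => (hw e (hs3' he)).bounds.2.2.2.1)
  -- the piece at infinity
  have hm4 := contDiff_mul_gpow (g := fun _ : ℂ × ℝ => -1) (σ := σQ) kQ hm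
    (fun _ _ => by fun_prop) hQ.contDiff (fun e he => by norm_num)
  have hs4 : tsupport (fun e => m e * gpow (-1) (kQ, σQ e)) ⊆ tsupport m :=
    tsupport_mul_subset_left
  have hm4' := contDiff_mul_gpow (g := fun e : ℂ × ℝ => -e.1) (σ := σS) kS hm4
    (fun e he => by fun_prop) hS.contDiff (fun e he => neg_ne_zero.2 (hw e (hs4 he)).ne_zero)
  have hs4' : tsupport (fun e => m e * gpow (-1) (kQ, σQ e) * gpow (-e.1) (kS, σS e)) ⊆
      tsupport m := tsupport_mul_subset_left.trans hs4
  have h4 := contDiff_mul_regLoc (kQ := kQ) (kS := kS) (w := fun e => 1 / e.1)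
    (hO.mono hs4') hQ.contDiff hS.contDiff hε hε2 hm4' (fun e he => contDiffAt_complex_div contDiffAt_const
      contDiffAt_fst (hw e (hs4' he)).ne_zero) (fun e he => (hw e (hs4' he)).bounds.2.2.2.2)
  have hB : ContDiff ℝ ∞ fun p : (ℂ × ℝ) × ℂ => rhoInt p.1.1 ε p.2 := by
    unfold rhoInt
    exact ((((Complex.ofRealCLM.contDiff.comp (contDiff_cut.comp (by fun_prop))).sub
      (contDiff_cut_comp (by fun_prop) _)).sub (contDiff_cut_comp (by fun_prop) _)).sub
      (contDiff_cut_comp (by fun_prop) _))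
  have hne : ∀ p : (ℂ × ℝ) × ℂ, m p.1 * rhoInt p.1.1 ε p.2 ≠ 0 →
      p.2 ∈ rhoIntRegion p.1.1 ε := fun p hp =>
    rhoInt_ne_zero (hw p.1 (subset_tsupport m (left_ne_zero_of_mul hp))) (right_ne_zero_of_mul hp)
  have h5 := contDiff_mul_rest (w := Prod.fst) (B := fun p : (ℂ × ℝ) × ℂ => rhoInt p.1.1 ε p.2)
    (kP := kP) (kQ := kQ) (kS := kS) hP.contDiff hQ.contDiff hS.contDiff (R := 7 / (4 * ε))
    ((hm.comp contDiff_fst).mul hB)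
    (fun _ _ => contDiffAt_fst) (fun p hp => ?_) (fun e u hu => ?_)
  · convert (((h1.add h2).add h3).add h4).add h5 using 1
    ext e
    rw [regEuler, hO']
    change _ = _ + _ + m e * gpow e.1 (-((kP, σP e) : ExpPair) - pairOne) * _ * _ + _ + _
    ring
  · have hcl : IsClosed {p : (ℂ × ℝ) × ℂ | p.2 ∈ rhoIntRegion p.1.1 ε} := by
      change IsClosed ({p : (ℂ × ℝ) × ℂ | ε / 2 ≤ ‖p.2‖} ∩ ({p : (ℂ × ℝ) × ℂ | ε / 2 ≤ ‖1 - p.2‖} ∩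
        ({p : (ℂ × ℝ) × ℂ | ε / 2 ≤ ‖1 - p.1.1 * p.2‖} ∩
          {p : (ℂ × ℝ) × ℂ | ‖p.2‖ ≤ 7 / (4 * ε)})))
      exact ((isClosed_le continuous_const (by fun_prop)).inter ((isClosed_le continuous_const
        (by fun_prop)).inter ((isClosed_le continuous_const (by fun_prop)).inter
          (isClosed_le (by fun_prop) continuous_const))))
    exact rhoIntRegion_ne_zero hε (closure_minimal hne hcl hp)
  · by_contra h
    have := (hne (e, u) h).2.2.2
    linarith

/-- Integration over the spectral parameter preserves smoothness. -/
lemma contDiff_integral_snd {G : ℂ × ℝ → ℂ} (hG : ContDiff ℝ ∞ G) {K : Set ℝ} (hK : IsCompact K)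
    (hs : ∀ z, ∀ s ∉ K, G (z, s) = 0) :
    (∀ z, Integrable fun s => G (z, s)) ∧ ContDiff ℝ ∞ fun z => ∫ s, G (z, s) := by
  refine ⟨fun z => (hG.continuous.comp (Continuous.prodMk_right z)).integrable_of_hasCompactSupport
    (HasCompactSupport.intro hK (hs z)), contDiff_integral_of_compact hK hG
      (Filter.Eventually.of_forall fun s hs' z => hs z s hs')⟩

end Joint

/-! ### Smoothness of the transform away from 0 and 1 -/

section

lemma contDiff_ofReal_snd : ContDiff ℝ ∞ fun e : ℂ × ℝ => (e.2 : ℂ) :=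
  Complex.ofRealCLM.contDiff.comp contDiff_snd

lemma contDiff_exA_snd (k : ℤ) (a : ℂ) : ContDiff ℝ ∞ fun e : ℂ × ℝ => (exA k e.2 a).2 :=
  contDiff_const.sub (contDiff_const.mul contDiff_ofReal_snd)
lemma contDiff_exB_snd (k : ℤ) (b : ℂ) : ContDiff ℝ ∞ fun e : ℂ × ℝ => (exB k e.2 b).2 :=
  contDiff_const.add (contDiff_const.mul contDiff_ofReal_snd)
lemma contDiff_exC_snd (k : ℤ) (a : ℂ) : ContDiff ℝ ∞ fun e : ℂ × ℝ => (exC k e.2 a).2 :=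
  contDiff_const.sub (contDiff_const.mul contDiff_ofReal_snd)
lemma contDiff_exD_snd (k : ℤ) (b : ℂ) : ContDiff ℝ ∞ fun e : ℂ × ℝ => (exD k e.2 b).2 :=
  contDiff_const.add (contDiff_const.mul contDiff_ofReal_snd)

variable {a b : ℝ} {F : ℤ × ℝ → ℂ} {k : ℤ} {m : ℂ × ℝ → ℂ}

/-- On the support of the density λ ≠ 0, because `F` vanishes near 0|0. This is where that
hypothesis makes all four local constants invertible. -/
lemma regExp_all (hab : InSquare a b) (hF : F ∈ EvenTestFunctions)
    (hm : ∀ e ∈ tsupport m, e.2 ∈ tsupport (density a b F k)) :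
    RegExp m (-k) (fun e => (exA k e.2 a).2) ∧ RegExp m k (fun e => (exB k e.2 b).2) ∧
    RegExp m (-k) (fun e => (exC k e.2 a).2) ∧ RegExp m k (fun e => (exD k e.2 b).2) := by
  have hr := fun e : ℂ × ℝ => ex_re_gt (k := k) (s := e.2) (α := a) (β := b) (by simpa using hab)
  have hks : ∀ e ∈ tsupport m, (k, e.2) ≠ (0, 0) := by
    intro e he h
    obtain ⟨rfl, h2⟩ := Prod.mk.inj h
    have := hm e he
    rw [h2] at this
    exact zero_notMem_tsupport_density a b hF this
  have hn := fun e he => ex_ne (mem_regDomain_real hab (hks e he))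
  have hc : ∀ {l : ℤ} {σ : ℂ}, (l = 0 → σ ≠ -2) → ibpConst l σ ≠ 0 := by
    intro l σ h
    unfold ibpConst
    split_ifs with hl
    · exact fun h0 => h hl (eq_neg_of_add_eq_zero_left h0)
    · exact mul_ne_zero (by exact_mod_cast hl) Complex.I_ne_zero
  exact ⟨⟨contDiff_exA_snd k a, fun e => (hr e).1, fun e he => hc (hn e he).1⟩,
    ⟨contDiff_exB_snd k b, fun e => (hr e).2.1, fun e he => hc (hn e he).2.1⟩,
    ⟨contDiff_exC_snd k a, fun e => (hr e).2.2.1, fun e he => hc (hn e he).2.2.1⟩,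
    ⟨contDiff_exD_snd k b, fun e => (hr e).2.2.2, fun e he => hc (hn e he).2.2.2⟩⟩

lemma tsupport_cutoff_density {χ : ℂ → ℝ} {e : ℂ × ℝ}
    (he : e ∈ tsupport fun e : ℂ × ℝ => (χ e.1 : ℂ) * density a b F k e.2) :
    e.1 ∈ tsupport χ ∧ e.2 ∈ tsupport (density a b F k) := by
  refine ⟨?_, tsupport_comp_subset_preimage _ continuous_snd (tsupport_mul_subset_right he)⟩
  have h1 := tsupport_comp_subset_preimage (fun z : ℂ => (χ z : ℂ)) continuous_fst
    (tsupport_mul_subset_left he)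
  exact closure_mono (fun z hz => by simpa using hz) h1

lemma contDiff_cutoff_density (hab : InSquare a b) (hF : F ∈ EvenTestFunctions) {χ : ℂ → ℝ}
    (hχ : ContDiff ℝ ∞ χ) :
    ContDiff ℝ ∞ fun e : ℂ × ℝ => (χ e.1 : ℂ) * density a b F k e.2 :=
  (Complex.ofRealCLM.contDiff.comp (hχ.comp contDiff_fst)).mul
    ((contDiff_density hab hF k).comp contDiff_snd)

/-- A cutoff χ around z₀ turns the local regularization into a globally smooth function of (z, s)
with compact support in s; it is divided out again near z₀. -/
theorem interior_smooth (hab : InSquare a b) (hF : F ∈ EvenTestFunctions) (k : ℤ) {z₀ : ℂ}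
    (hz : z₀ ∈ dotC) : Integrable (adjointIntegrand a b F z₀ k) ∧
      ContDiffAt ℝ ∞ (fun z => ∫ s, adjointIntegrand a b F z k s) z₀ := by
  obtain ⟨ε, hev⟩ := exists_admissible hz
  obtain ⟨χ, hχ1, -, hχ2, -, hχ3⟩ := exists_contDiff_tsupport_subset (n := ⊤) hev
  have hm := contDiff_cutoff_density (k := k) hab hF (χ := χ) hχ2
  obtain ⟨hA, hB, hC, hD⟩ := regExp_all hab hF
    (m := fun e : ℂ × ℝ => (χ e.1 : ℂ) * density a b F k e.2)
    (fun e he => (tsupport_cutoff_density he).2)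
  have h := contDiff_mul_regEuler hA hB hC hD (fun e => pairInf_ABC k e.2 a b) hm
    hev.self_of_nhds.pos (fun e he => hχ1 (tsupport_cutoff_density he).1)
  have h2 := contDiff_integral_snd h (hasCompactSupport_density a b hF k) (fun z s hs => by
    dsimp only
    rw [image_eq_zero_of_notMem_tsupport hs]; simp)
  have hχ0 : ∀ᶠ z in 𝓝 z₀, χ z ≠ 0 :=
    hχ2.continuous.continuousAt.eventually_ne (by rw [hχ3]; exact one_ne_zero)
  have hint : ∀ᶠ z in 𝓝 z₀, adjointIntegrand a b F z k = fun s => (χ z : ℂ)⁻¹ *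
      ((χ z : ℂ) * density a b F k s * regEuler (exA k s a) (exB k s b) (exC k s a) z ε) := by
    filter_upwards [hev, hχ0] with z hz hz0
    ext s
    have : (χ z : ℂ) ≠ 0 := by exact_mod_cast hz0
    rw [adjointIntegrand_eq_regEuler hab hF hz, mul_assoc, inv_mul_cancel_left₀ this]
  refine ⟨?_, ?_⟩
  · rw [hint.self_of_nhds]
    exact (h2.1 z₀).const_mul _
  · have h3 : ContDiffAt ℝ ∞ (fun z => (χ z : ℂ)⁻¹) z₀ :=
      (Complex.ofRealCLM.contDiff.comp hχ2).contDiffAt.inv (by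
        have := hχ0.self_of_nhds
        simpa using this)
    refine (h3.mul h2.2.contDiffAt).congr_of_eventuallyEq ?_
    filter_upwards [hint] with z hz
    rw [hz, integral_const_mul]
    rfl

lemma adjointJ_eq_sum (a b : ℝ) {F : ℤ × ℝ → ℂ} {T : Finset ℤ}
    (hT : ∀ k ∉ T, ∀ s, F (k, s) = 0) (z : ℂ) :
    adjointJ a b F z = ∑ k ∈ T, ∫ s, adjointIntegrand a b F z k s := by
  rw [adjointJ, tsum_eq_sum fun k hk => ?_]
  simp [adjointIntegrand, hT k hk]

lemma exists_finset_support {F : ℤ × ℝ → ℂ} (hF : F ∈ EvenTestFunctions) :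
    ∃ T : Finset ℤ, ∀ k ∉ T, ∀ s, F (k, s) = 0 := by
  have h1 : (Prod.fst '' tsupport F).Finite :=
    (hF.2.2.1.image continuous_fst).finite_of_discrete
  refine ⟨h1.toFinset, fun k hk s => ?_⟩
  by_contra h
  exact hk (h1.mem_toFinset.2 ⟨(k, s), subset_tsupport F h, rfl⟩)

theorem contDiffOn_adjointJ (hab : InSquare a b) (hF : F ∈ EvenTestFunctions) :
    ContDiffOn ℝ ∞ (adjointJ a b F) dotC := by
  obtain ⟨T, hT⟩ := exists_finset_support hF
  have : adjointJ a b F = fun z => ∑ k ∈ T, ∫ s, adjointIntegrand a b F z k s :=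
    funext (adjointJ_eq_sum a b hT)
  rw [this]
  exact fun z hz => (ContDiffAt.sum fun k _ => (interior_smooth hab hF k hz).2).contDiffWithinAt

end

/-! ### Splitting a product of powers -/

/-- The holomorphic power `(1 - x)^q`. -/
def hpow (q x : ℂ) : ℂ := Complex.exp (q * Complex.log (1 - x))

lemma one_sub_mem_slitPlane {x : ℂ} (hx : ‖x‖ < 1) : 1 - x ∈ Complex.slitPlane := by
  left
  have := (Complex.re_le_norm x)
  simp only [Complex.sub_re, Complex.one_re]
  linarith

/-- In the unit disc the principal logarithm of 1 - x is available, and the generalized power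
separates into a holomorphic factor in x and one in conj x. -/
lemma gpow_one_sub {x : ℂ} (hx : ‖x‖ < 1) (k : ℤ) (σ : ℂ) : gpow (1 - x) (k, σ) =
    hpow ((k + σ) / 2) x * hpow ((σ - k) / 2) ((starRingEnd ℂ) x) := by
  have h0 : 1 - x ≠ 0 := one_sub_ne_zero_of_norm_lt hx
  have h1 : Complex.log (1 - (starRingEnd ℂ) x) = (starRingEnd ℂ) (Complex.log (1 - x)) := by
    rw [← Complex.log_conj _ (Complex.slitPlane_arg_ne_pi (one_sub_mem_slitPlane hx))]
    simp
  rw [gpow_eq_exp h0, hpow, hpow, h1, ← Complex.exp_add]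
  set l := Complex.log (1 - x) with hl
  have h2 : 1 - x = Complex.exp l := (Complex.exp_log h0).symm
  have h3 : ((Real.log ‖1 - x‖ : ℝ) : ℂ) = (l + (starRingEnd ℂ) l) / 2 := by
    rw [Complex.add_conj, hl, Complex.log_re]
    push_cast
    ring
  rw [h3, h2, ← Complex.exp_int_mul, ← Complex.exp_add]
  congr 1
  dsimp only
  ring

lemma differentiableOn_hpow (q : ℂ) : DifferentiableOn ℂ (hpow q) (Metric.ball 0 1) := by
  intro x hx
  apply DifferentiableAt.differentiableWithinAt
  have := one_sub_mem_slitPlane (mem_ball_zero_iff.1 hx)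
  unfold hpow
  exact (((differentiableAt_const _).sub differentiableAt_id).clog this).const_mul q |>.cexp

/-- A point of the circle of radius `15/16`. -/
def cpt (θ : ℝ) : ℂ := circleMap 0 (15 / 16) θ

lemma norm_cpt (θ : ℝ) : ‖cpt θ‖ = 15 / 16 := by
  rw [cpt, norm_circleMap_zero, abs_of_pos (by norm_num)]

lemma cpt_ne_zero (θ : ℝ) : cpt θ ≠ 0 := by
  rw [← norm_pos_iff, norm_cpt]; norm_num

lemma contDiff_cpt : ContDiff ℝ ∞ cpt := by
  unfold cpt circleMap
  exact contDiff_const.add (contDiff_const.mul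
    ((Complex.ofRealCLM.contDiff.mul contDiff_const).cexp))

/-- Cauchy's formula with kernel c/(c - x), on a circle slightly inside the unit disc. -/
lemma hpow_cauchy (q : ℂ) {x : ℂ} (hx : ‖x‖ < 15 / 16) :
    ∫ θ in Set.Ioc 0 (2 * Real.pi), hpow q (cpt θ) * (1 - x / cpt θ)⁻¹ =
      2 * Real.pi * hpow q x := by
  have hd : DiffContOnCl ℂ (hpow q) (Metric.ball 0 (15 / 16)) := by
    refine ⟨(differentiableOn_hpow q).mono (Metric.ball_subset_ball (by norm_num)), ?_⟩
    refine (differentiableOn_hpow q).continuousOn.mono ?_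
    rw [closure_ball _ (by norm_num)]
    exact Metric.closedBall_subset_ball (by norm_num)
  have h := hd.circleIntegral_sub_inv_smul (w := x) (by simpa using hx)
  rw [circleIntegral, intervalIntegral.integral_of_le Real.two_pi_pos.le] at h
  have e : ∀ θ : ℝ, deriv (circleMap 0 (15 / 16)) θ • (circleMap 0 (15 / 16) θ - x)⁻¹ •
      hpow q (circleMap 0 (15 / 16) θ) = Complex.I * (hpow q (cpt θ) * (1 - x / cpt θ)⁻¹) := by
    intro θ
    rw [deriv_circleMap]
    change cpt θ * Complex.I * ((cpt θ - x)⁻¹ * hpow q (cpt θ)) = _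
    have h0 := cpt_ne_zero θ
    rw [show 1 - x / cpt θ = (cpt θ - x) / cpt θ by field_simp, inv_div]
    ring
  simp only [deriv_circleMap] at h e
  simp only [e, integral_const_mul] at h
  have h2 : Complex.I * (∫ θ in Set.Ioc 0 (2 * Real.pi), hpow q (cpt θ) * (1 - x / cpt θ)⁻¹) =
      Complex.I * (2 * Real.pi * hpow q x) := by
    rw [h, smul_eq_mul]; ring
  exact mul_left_cancel₀ Complex.I_ne_zero h2

/-- Lebesgue measure on the torus. -/
def torus : Measure (ℝ × ℝ) :=
  (volume.restrict (Set.Ioc 0 (2 * Real.pi))).prod (volume.restrict (Set.Ioc 0 (2 * Real.pi)))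

instance : IsFiniteMeasure torus := by unfold torus; infer_instance

/-- The common factor of the kernels below. -/
def cauKer (q r w : ℂ) (θ : ℝ × ℝ) : ℂ :=
  hpow q (cpt θ.1) * hpow r (cpt θ.2) * (1 - w / (cpt θ.1 * cpt θ.2))⁻¹

/-- The part of `(1 - x)^q (1 - w/x)^r` of degree `0` in `x`. -/
def decC (q r w : ℂ) : ℂ :=
  (4 * (Real.pi : ℂ) ^ 2)⁻¹ * ∫ θ, cut (w / (1 / 8 : ℝ)) * cauKer q r w θ ∂torus

/-- The part of `(1 - x)^q (1 - w/x)^r` of positive degree in `x`, divided by `x`. -/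
def decD (q r x w : ℂ) : ℂ :=
  (4 * (Real.pi : ℂ) ^ 2)⁻¹ *
    ∫ θ, cut (w / (1 / 8 : ℝ)) * cut (x / (1 / 2 : ℝ)) * cauKer q r w θ * (cpt θ.1 - x)⁻¹ ∂torus

lemma one_sub_div_cpt_ne_zero {w : ℂ} (hw : ‖w‖ ≤ 7 / 32) (θ : ℝ × ℝ) :
    1 - w / (cpt θ.1 * cpt θ.2) ≠ 0 := by
  apply one_sub_ne_zero_of_norm_lt
  rw [norm_div, norm_mul, norm_cpt, norm_cpt, div_lt_iff₀ (by norm_num)]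
  linarith

lemma cpt_sub_ne_zero {x : ℂ} (hx : ‖x‖ ≤ 7 / 8) (θ : ℝ) : cpt θ - x ≠ 0 := by
  intro h
  have h2 := norm_cpt θ
  rw [sub_eq_zero.1 h] at h2
  linarith

section
variable {E : Type*} [NormedAddCommGroup E] [NormedSpace ℝ E] {q r x w : E → ℂ} {t : E → ℝ}

lemma contDiff_hpow_cpt (hq : ContDiff ℝ ∞ q) (ht : ContDiff ℝ ∞ t) :
    ContDiff ℝ ∞ fun e => hpow (q e) (cpt (t e)) := by
  unfold hpow
  refine (hq.mul ?_).cexp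
  rw [contDiff_iff_contDiffAt]
  intro e
  have h1 : ContDiffAt ℝ ∞ (fun e => 1 - cpt (t e)) e :=
    (contDiff_const.sub (contDiff_cpt.comp ht)).contDiffAt
  exact ((Complex.contDiffAt_log (n := ∞) (one_sub_mem_slitPlane (x := cpt (t e))
    (by rw [norm_cpt]; norm_num))).restrict_scalars ℝ).comp e h1

/-- The cutoff keeps |w| ≤ 7/32, well below (15/16)², so the denominator of the kernel has no zero
on the support and the product is smooth for all w. -/
lemma contDiff_cut_mul_cauKer {θ : E → ℝ × ℝ} (hq : ContDiff ℝ ∞ q) (hr : ContDiff ℝ ∞ r)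
    (hw : ContDiff ℝ ∞ w) (hθ : ContDiff ℝ ∞ θ) :
    ContDiff ℝ ∞ fun e => (cut (w e / (1 / 8 : ℝ)) : ℂ) * cauKer (q e) (r e) (w e) (θ e) := by
  have h1 := contDiff_hpow_cpt hq (contDiff_fst.comp hθ)
  have h2 := contDiff_hpow_cpt hr (contDiff_snd.comp hθ)
  refine contDiff_of_forall_tsupport fun e he => ?_
  have hn : ‖w e‖ ≤ 7 / 4 * (1 / 8) := tsupport_cut_comp_subset hw.continuous (by norm_num) (tsupport_mul_subset_left he)
  refine (contDiff_cut_comp hw _).contDiffAt.mul ((h1.mul h2).contDiffAt.mul (ContDiffAt.inv ?_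
    (one_sub_div_cpt_ne_zero (by linarith) (θ e))))
  refine contDiffAt_const.sub (contDiffAt_complex_div hw.contDiffAt
    ((contDiff_cpt.comp (contDiff_fst.comp hθ)).mul
      (contDiff_cpt.comp (contDiff_snd.comp hθ))).contDiffAt
    (mul_ne_zero (cpt_ne_zero _) (cpt_ne_zero _)))

end

section
variable {E : Type} [NormedAddCommGroup E] [NormedSpace ℝ E] [FiniteDimensional ℝ E]
  {q r x w : E → ℂ}

lemma torus_ae_mem : ∀ᵐ θ ∂torus, θ ∈ Set.Icc 0 (2 * Real.pi) ×ˢ Set.Icc 0 (2 * Real.pi) := by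
  rw [torus, Measure.prod_restrict]
  filter_upwards [ae_restrict_mem (measurableSet_Ioc.prod measurableSet_Ioc)] with θ hθ
  exact ⟨Set.Ioc_subset_Icc_self hθ.1, Set.Ioc_subset_Icc_self hθ.2⟩

theorem contDiff_decC (hq : ContDiff ℝ ∞ q) (hr : ContDiff ℝ ∞ r) (hw : ContDiff ℝ ∞ w) :
    ContDiff ℝ ∞ fun e => decC (q e) (r e) (w e) := by
  unfold decC
  refine contDiff_const.mul (contDiff_integral_of_compact (μ := torus)
    (K := Set.Icc 0 (2 * Real.pi) ×ˢ Set.Icc 0 (2 * Real.pi)) (isCompact_Icc.prod isCompact_Icc)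
    (contDiff_cut_mul_cauKer (E := E × (ℝ × ℝ)) (q := fun p => q p.1) (r := fun p => r p.1) (w := fun p => w p.1)
      (hq.comp contDiff_fst) (hr.comp contDiff_fst)
      (hw.comp contDiff_fst) contDiff_snd) ?_)
  filter_upwards [torus_ae_mem] with θ hθ h
  exact absurd hθ h

theorem contDiff_decD (hq : ContDiff ℝ ∞ q) (hr : ContDiff ℝ ∞ r) (hx : ContDiff ℝ ∞ x)
    (hw : ContDiff ℝ ∞ w) : ContDiff ℝ ∞ fun e => decD (q e) (r e) (x e) (w e) := by
  unfold decD
  have h1 := contDiff_cut_mul_cauKer (E := E × (ℝ × ℝ)) (q := fun p => q p.1) (r := fun p => r p.1)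
    (w := fun p => w p.1) (hq.comp contDiff_fst) (hr.comp contDiff_fst)
      (hw.comp contDiff_fst) contDiff_snd
  have h2 : ContDiff ℝ ∞ fun p : E × (ℝ × ℝ) => (cut (x p.1 / (1 / 2 : ℝ)) : ℂ) *
      (cpt p.2.1 - x p.1)⁻¹ := by
    refine contDiff_of_forall_tsupport fun e he => ?_
    have hn : ‖x e.1‖ ≤ 7 / 4 * (1 / 2) := tsupport_cut_comp_subset (hx.comp contDiff_fst).continuous (by norm_num)
      (tsupport_mul_subset_left he)
    refine (contDiff_cut_comp (hx.comp contDiff_fst) _).contDiffAt.mul (ContDiffAt.inv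
      (((contDiff_cpt.comp (contDiff_fst.comp contDiff_snd)).sub
        (hx.comp contDiff_fst)).contDiffAt) (cpt_sub_ne_zero ?_ _))
    linarith
  have h3 : ContDiff ℝ ∞ fun p : E × (ℝ × ℝ) => (cut (w p.1 / (1 / 8 : ℝ)) : ℂ) *
      cut (x p.1 / (1 / 2 : ℝ)) * cauKer (q p.1) (r p.1) (w p.1) p.2 * (cpt p.2.1 - x p.1)⁻¹ := by
    have e : (fun p : E × (ℝ × ℝ) => (cut (w p.1 / (1 / 8 : ℝ)) : ℂ) *
        cut (x p.1 / (1 / 2 : ℝ)) * cauKer (q p.1) (r p.1) (w p.1) p.2 * (cpt p.2.1 - x p.1)⁻¹) =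
        fun p => ((cut (w p.1 / (1 / 8 : ℝ)) : ℂ) * cauKer (q p.1) (r p.1) (w p.1) p.2) *
          ((cut (x p.1 / (1 / 2 : ℝ)) : ℂ) * (cpt p.2.1 - x p.1)⁻¹) := by
      funext p
      ring
    rw [e]
    exact h1.mul h2
  refine contDiff_const.mul (contDiff_integral_of_compact (μ := torus)
    (K := Set.Icc 0 (2 * Real.pi) ×ˢ Set.Icc 0 (2 * Real.pi)) (isCompact_Icc.prod isCompact_Icc) h3 ?_)
  filter_upwards [torus_ae_mem] with θ hθ h
  exact absurd hθ h

end

lemma integrable_torus {f : ℝ × ℝ → ℂ} (hf : Continuous f) : Integrable f torus := by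
  have h1 : IntegrableOn f (Set.Icc 0 (2 * Real.pi) ×ˢ Set.Icc 0 (2 * Real.pi))
      (volume.prod volume) :=
    hf.continuousOn.integrableOn_compact (isCompact_Icc.prod isCompact_Icc)
  rw [torus, Measure.prod_restrict]
  exact h1.mono_set (Set.prod_mono Set.Ioc_subset_Icc_self Set.Ioc_subset_Icc_self)

lemma cut_eq_one_of_le {x : ℂ} {d : ℝ} (hd : 0 < d) (hx : ‖x‖ ≤ d / 2) : cut (x / d) = 1 :=
  cut_div_eq_one hd (by linarith)

lemma decD_swap (q r y w : ℂ) : decD r q y w = (4 * (Real.pi : ℂ) ^ 2)⁻¹ *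
    ∫ θ, cut (w / (1 / 8 : ℝ)) * cut (y / (1 / 2 : ℝ)) * cauKer q r w θ * (cpt θ.2 - y)⁻¹ ∂torus := by
  rw [decD, torus, ← integral_prod_swap]
  congr 2
  ext θ
  simp only [cauKer, Prod.fst_swap, Prod.snd_swap]
  rw [mul_comm (cpt θ.2) (cpt θ.1)]
  ring

/-- With X = x/c₁ and Y = y/c₂ the product of the two Cauchy kernels satisfies (1 - XY)/((1 - X)(1 -
Y)) = 1 + X/(1 - X) + Y/(1 - Y). Dividing by 1 - XY leaves coefficients that depend on xy and on at
most one of x and y. For y = w/x this sorts the Laurent series in x by the sign of the degree, with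
coefficients smooth in w up to w = 0. -/
theorem hpow_mul_hpow (q r : ℂ) {x y : ℂ} (hx : ‖x‖ ≤ 1 / 4) (hy : ‖y‖ ≤ 1 / 4) :
    hpow q x * hpow r y =
      decC q r (x * y) + x * decD q r x (x * y) + y * decD r q y (x * y) := by
  have hw : ‖x * y‖ ≤ 1 / 16 := by
    rw [norm_mul]; nlinarith [norm_nonneg x, norm_nonneg y]
  have c1 : cut (x * y / (1 / 8 : ℝ)) = 1 := cut_eq_one_of_le (by norm_num) (by linarith)
  have c2 : cut (x / (1 / 2 : ℝ)) = 1 := cut_eq_one_of_le (by norm_num) (by linarith)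
  have c3 : cut (y / (1 / 2 : ℝ)) = 1 := cut_eq_one_of_le (by norm_num) (by linarith)
  have hk : Continuous fun θ => cauKer q r (x * y) θ := by
    have := (contDiff_cut_mul_cauKer (E := ℝ × ℝ) (q := fun _ => q) (r := fun _ => r)
      (w := fun _ => x * y) contDiff_const contDiff_const contDiff_const contDiff_id).continuous
    simp only [c1, Complex.ofReal_one, one_mul] at this
    exact this
  have hx2 : Continuous fun θ : ℝ × ℝ => (cpt θ.1 - x)⁻¹ :=
    ((contDiff_cpt.continuous.comp continuous_fst).sub continuous_const).inv₀
      fun θ => cpt_sub_ne_zero (by linarith) _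
  have hy2 : Continuous fun θ : ℝ × ℝ => (cpt θ.2 - y)⁻¹ :=
    ((contDiff_cpt.continuous.comp continuous_snd).sub continuous_const).inv₀
      fun θ => cpt_sub_ne_zero (by linarith) _
  rw [decD_swap q r y, decC, decD, c1, c2, c3]
  simp only [Complex.ofReal_one, one_mul]
  have e : ∀ θ : ℝ × ℝ, (hpow q (cpt θ.1) * (1 - x / cpt θ.1)⁻¹) *
      (hpow r (cpt θ.2) * (1 - y / cpt θ.2)⁻¹) = cauKer q r (x * y) θ +
      x * (cauKer q r (x * y) θ * (cpt θ.1 - x)⁻¹) +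
      y * (cauKer q r (x * y) θ * (cpt θ.2 - y)⁻¹) := by
    intro θ
    have n1 := cpt_ne_zero θ.1
    have n2 := cpt_ne_zero θ.2
    have n3 : cpt θ.1 - x ≠ 0 := cpt_sub_ne_zero (by linarith) _
    have n4 : cpt θ.2 - y ≠ 0 := cpt_sub_ne_zero (by linarith) _
    have n5 := one_sub_div_cpt_ne_zero (w := x * y) (by linarith) θ
    have n6 : cpt θ.1 * cpt θ.2 - x * y ≠ 0 := by
      intro h
      apply n5
      rw [sub_eq_zero] at h
      rw [← h, div_self (mul_ne_zero n1 n2), sub_self]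
    unfold cauKer
    rw [show 1 - x / cpt θ.1 = (cpt θ.1 - x) / cpt θ.1 by field_simp,
      show 1 - y / cpt θ.2 = (cpt θ.2 - y) / cpt θ.2 by field_simp,
      show 1 - x * y / (cpt θ.1 * cpt θ.2) = (cpt θ.1 * cpt θ.2 - x * y) / (cpt θ.1 * cpt θ.2) by
        field_simp]
    field_simp
    ring
  have hI := integral_prod_mul (μ := volume.restrict (Set.Ioc 0 (2 * Real.pi)))
    (ν := volume.restrict (Set.Ioc 0 (2 * Real.pi))) (fun θ => hpow q (cpt θ) * (1 - x / cpt θ)⁻¹)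
    (fun θ => hpow r (cpt θ) * (1 - y / cpt θ)⁻¹)
  rw [hpow_cauchy q (by linarith), hpow_cauchy r (by linarith)] at hI
  have i1 := integrable_torus hk
  have i2 : Integrable (fun θ => x * (cauKer q r (x * y) θ * (cpt θ.1 - x)⁻¹)) torus :=
    (integrable_torus (hk.mul hx2)).const_mul x
  have i3 : Integrable (fun θ => y * (cauKer q r (x * y) θ * (cpt θ.2 - y)⁻¹)) torus :=
    (integrable_torus (hk.mul hy2)).const_mul y
  change ∫ θ, _ ∂torus = _ at hI
  simp only [e] at hI
  have i12 : Integrable (fun θ => cauKer q r (x * y) θ +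
      x * (cauKer q r (x * y) θ * (cpt θ.1 - x)⁻¹)) torus := i1.add i2
  rw [integral_add i12 i3, integral_add i1 i2, integral_const_mul, integral_const_mul] at hI
  have hpi : (Real.pi : ℂ) ≠ 0 := by exact_mod_cast Real.pi_ne_zero
  have : hpow q x * hpow r y = (4 * (Real.pi : ℂ) ^ 2)⁻¹ *
      (2 * Real.pi * hpow q x * (2 * Real.pi * hpow r y)) := by
    field_simp
    ring
  rw [this, ← hI]
  ring

/-- Holomorphy of the parts of positive degree. -/
lemma differentiableOn_decD (q r : ℂ) {w : ℂ} (hw : ‖w‖ ≤ 1 / 16) :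
    DifferentiableOn ℂ (fun x => decD q r x w) (Metric.ball 0 (1 / 4)) := by
  have c1 : cut (w / (1 / 8 : ℝ)) = 1 := cut_eq_one_of_le (by norm_num) (by linarith)
  have hk : Continuous fun θ => cauKer q r w θ := by
    have := (contDiff_cut_mul_cauKer (E := ℝ × ℝ) (q := fun _ => q) (r := fun _ => r)
      (w := fun _ => w) contDiff_const contDiff_const contDiff_const contDiff_id).continuous
    simp only [c1, Complex.ofReal_one, one_mul] at this
    exact this
  have h0 : ∀ x ∈ Metric.ball (0 : ℂ) (1 / 4), decD q r x w = (4 * (Real.pi : ℂ) ^ 2)⁻¹ *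
      ∫ θ, cauKer q r w θ * (cpt θ.1 - x)⁻¹ ∂torus := by
    intro x hx
    have hx' : ‖x‖ < 1 / 4 := by simpa using hx
    have c2 : cut (x / (1 / 2 : ℝ)) = 1 := cut_eq_one_of_le (by norm_num) (by linarith)
    simp only [decD, c1, c2, Complex.ofReal_one, one_mul]
  refine DifferentiableOn.congr ?_ h0
  intro x₀ hx₀
  apply DifferentiableAt.differentiableWithinAt
  refine DifferentiableAt.const_mul ?_ _
  have hdist : ∀ x ∈ Metric.ball (0 : ℂ) (1 / 4), ∀ θ, 1 / 2 ≤ ‖cpt θ - x‖ := by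
    intro x hx θ
    have hx' : ‖x‖ < 1 / 4 := by simpa using hx
    have := norm_sub_norm_le (cpt θ) x
    rw [norm_cpt] at this
    linarith
  have hne : ∀ x ∈ Metric.ball (0 : ℂ) (1 / 4), ∀ θ, cpt θ - x ≠ 0 := fun x hx θ =>
    norm_pos_iff.1 (by linarith [hdist x hx θ])
  have hmeas : ∀ x ∈ Metric.ball (0 : ℂ) (1 / 4), Continuous fun θ : ℝ × ℝ => (cpt θ.1 - x)⁻¹ :=
    fun x hx => ((contDiff_cpt.continuous.comp continuous_fst).sub continuous_const).inv₀
      fun θ => hne x hx _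
  have hnhds : Metric.ball (0 : ℂ) (1 / 4) ∈ 𝓝 x₀ := Metric.isOpen_ball.mem_nhds hx₀
  refine (hasDerivAt_integral_of_dominated_loc_of_deriv_le (μ := torus)
    (F := fun x θ => cauKer q r w θ * (cpt θ.1 - x)⁻¹)
    (F' := fun x θ => cauKer q r w θ * (((cpt θ.1 - x)⁻¹) ^ 2))
    (bound := fun θ => ‖cauKer q r w θ‖ * 4) hnhds ?_
    (integrable_torus (hk.mul (hmeas x₀ hx₀))) ?_ ?_ ?_ ?_).2.differentiableAt
  · filter_upwards [hnhds] with x hx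
    exact (hk.mul (hmeas x hx)).aestronglyMeasurable
  · exact (hk.mul ((hmeas x₀ hx₀).pow 2)).aestronglyMeasurable
  · refine Filter.Eventually.of_forall fun θ x hx => ?_
    rw [norm_mul, norm_pow, norm_inv]
    refine mul_le_mul_of_nonneg_left ?_ (norm_nonneg _)
    have h1 : ‖cpt θ.1 - x‖⁻¹ ≤ 2 := by
      rw [inv_le_comm₀ (norm_pos_iff.2 (hne x hx _)) two_pos]
      linarith [hdist x hx θ.1]
    have h2 : 0 ≤ ‖cpt θ.1 - x‖⁻¹ := inv_nonneg.2 (norm_nonneg _)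
    nlinarith
  · exact (integrable_torus hk).norm.mul_const 4
  · refine Filter.Eventually.of_forall fun θ x hx => ?_
    have h1 : HasDerivAt (fun x : ℂ => cpt θ.1 - x) (-1) x := by
      simpa using (hasDerivAt_id x).const_sub (cpt θ.1)
    have := (h1.inv (hne x hx _)).const_mul (cauKer q r w θ)
    refine this.congr_deriv ?_
    rw [inv_pow]
    ring

/-! ### Integrals over the intermediate region -/

/-- The weight on the region `|w| ≪ |u| ≪ 1`. -/
def oscWt (l : ℤ) (σ w u : ℂ) : ℂ :=
  gpow u (l, σ) * (cut (u / (1 / 8 : ℝ)) * cut ((w / u) / (1 / 8 : ℝ)))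

lemma oscWt_ne_zero {l : ℤ} {σ w u : ℂ} (h : oscWt l σ w u ≠ 0) : ‖u‖ ≤ 7 / 32 ∧ ‖w / u‖ ≤ 7 / 32 := by
  by_contra hn
  apply h
  simp only [not_and_or, not_le] at hn
  unfold oscWt
  rcases hn with hn | hn
  · rw [cut_div_eq_zero (u := u) (by norm_num) (by linarith)]; simp
  · rw [cut_div_eq_zero (u := w / u) (by norm_num) (by linarith)]; simp

lemma ae_ne_zero : ∀ᵐ u : ℂ, u ≠ 0 := compl_mem_ae_iff.2 (measure_singleton (0 : ℂ))

lemma continuousAt_oscWt (l : ℤ) (σ w : ℂ) {u : ℂ} (hu : u ≠ 0) : ContinuousAt (oscWt l σ w) u := by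
  have h1 : ContDiffAt ℝ ∞ (fun u : ℂ => gpow u (l, σ)) u :=
    contDiffAt_gpow_comp l contDiffAt_id contDiffAt_const hu
  have h2 : ContinuousAt (fun u : ℂ => cut ((w / u) / (1 / 8 : ℝ))) u :=
    contDiff_cut.continuous.continuousAt.comp
      ((continuousAt_const.div continuousAt_id hu).div_const _)
  have h3 : Continuous fun u : ℂ => cut (u / (1 / 8 : ℝ)) :=
    contDiff_cut.continuous.comp (continuous_id.div_const _)
  exact h1.continuousAt.mul ((Complex.continuous_ofReal.continuousAt.comp h3.continuousAt).mul
    (Complex.continuous_ofReal.continuousAt.comp h2))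

/-- For fixed w ≠ 0 the weight lives on a compact annulus away from the origin. -/
lemma integrable_oscWt_mul (l : ℤ) (σ : ℂ) {w : ℂ} (hw : w ≠ 0) {g : ℂ → ℂ}
    (hg : ∀ u ≠ 0, ContinuousAt g u) : Integrable fun u => oscWt l σ w u * g u := by
  set K : Set ℂ := Metric.closedBall 0 (7 / 32) ∩ {u | ‖w‖ / (7 / 32) ≤ ‖u‖} with hK
  have hKc : IsCompact K :=
    (isCompact_closedBall (0 : ℂ) (7 / 32)).inter_right (isClosed_le continuous_const continuous_norm)
  have hw' : 0 < ‖w‖ := norm_pos_iff.2 hw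
  have hne : ∀ u ∈ K, u ≠ 0 := fun u hu =>
    norm_pos_iff.1 (lt_of_lt_of_le (by positivity) hu.2)
  have hc : ContinuousOn (fun u => oscWt l σ w u * g u) K := fun u hu =>
    ((continuousAt_oscWt l σ w (hne u hu)).mul (hg u (hne u hu))).continuousWithinAt
  have h1 : IntegrableOn (fun u => oscWt l σ w u * g u) K := hc.integrableOn_compact hKc
  refine h1.integrable_of_ae_notMem_eq_zero ?_
  filter_upwards [ae_ne_zero] with u hu huK
  by_contra h
  obtain ⟨h2, h3⟩ := oscWt_ne_zero (left_ne_zero_of_mul h)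
  refine huK ⟨by simpa using h2, ?_⟩
  rw [norm_div, div_le_iff₀ (norm_pos_iff.2 hu)] at h3
  show ‖w‖ / (7 / 32) ≤ ‖u‖
  rw [div_le_iff₀ (by norm_num)]
  linarith

/-- The radial weight on the region `|w| ≪ |u| ≪ 1`. -/
def midWt (κ w u : ℂ) : ℂ :=
  gpow u (0, κ - 2) * (cut (u / (1 / 8 : ℝ)) * cut ((w / u) / (1 / 8 : ℝ)))

lemma midWt_ne_zero {κ w u : ℂ} (h : midWt κ w u ≠ 0) : ‖u‖ ≤ 7 / 32 ∧ ‖w / u‖ ≤ 7 / 32 :=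
  oscWt_ne_zero (l := 0) (σ := κ - 2) h

lemma integrable_midWt_mul (κ : ℂ) {w : ℂ} (hw : w ≠ 0) {g : ℂ → ℂ}
    (hg : ∀ u ≠ 0, ContinuousAt g u) : Integrable fun u => midWt κ w u * g u :=
  integrable_oscWt_mul 0 (κ - 2) hw hg

/-- The change of variable `u → w / u`. -/
lemma integral_comp_const_div (g : ℂ → ℂ) {w : ℂ} (hw : w ≠ 0) :
    ∫ u, g u = ∫ u, (‖w‖ : ℂ) ^ 2 * ((‖u‖ : ℂ) ^ 4)⁻¹ * g (w / u) := by
  have hw' : (‖w‖ : ℂ) ≠ 0 := by exact_mod_cast norm_ne_zero_iff.2 hw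
  have h1 := integral_comp_mul g hw
  have h2 := integral_comp_inv (fun u => g (w * u))
  have h3 : ∫ u, g u = (‖w‖ : ℂ) ^ 2 * ∫ u, g (w * u) := by
    rw [h1, mul_inv_cancel_left₀ (pow_ne_zero 2 hw')]
  rw [h3, h2, ← integral_const_mul]
  refine integral_congr_ae (Filter.Eventually.of_forall fun u => ?_)
  dsimp only
  rw [div_eq_mul_inv]
  ring

lemma midWt_div (κ : ℂ) {w u : ℂ} (hw : w ≠ 0) (hu : u ≠ 0) :
    (‖w‖ : ℂ) ^ 2 * ((‖u‖ : ℂ) ^ 4)⁻¹ * midWt κ w (w / u) = gpow w (0, κ) * midWt (-κ) w u := by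
  have e1 : w / (w / u) = u := by field_simp
  have hw' : (‖w‖ : ℂ) ≠ 0 := by exact_mod_cast norm_ne_zero_iff.2 hw
  have hu' : (‖u‖ : ℂ) ≠ 0 := by exact_mod_cast norm_ne_zero_iff.2 hu
  have e2 : gpow w (0, κ) = gpow w (0, κ - 2) * (‖w‖ : ℂ) ^ 2 := by
    rw [← gpow_pairOne, ← gpow_add hw]
    congr 1; ext <;> simp [pairOne]
  have e3 : gpow u (0, -κ - 2) = (gpow u (0, κ - 2))⁻¹ * ((‖u‖ : ℂ) ^ 4)⁻¹ := by
    rw [show ((‖u‖ : ℂ) ^ 4)⁻¹ = gpow u (-pairOne - pairOne) by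
      rw [gpow_sub hu, gpow_neg, gpow_pairOne]; field_simp, ← gpow_neg, ← gpow_add hu]
    congr 1
    ext
    · simp [pairOne]
    · simp [pairOne]; ring
  rw [midWt, midWt, e1, e2, e3, gpow_div]
  ring

/-- The annulus is invariant under u ↦ w/u, which exchanges its two ends and the sign of κ. -/
lemma integral_midWt_swap (κ : ℂ) {w : ℂ} (hw : w ≠ 0) (g : ℂ → ℂ) :
    ∫ u, midWt κ w u * g u = gpow w (0, κ) * ∫ u, midWt (-κ) w u * g (w / u) := by
  rw [integral_comp_const_div _ hw, ← integral_const_mul]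
  refine integral_congr_ae ?_
  filter_upwards [ae_ne_zero] with u hu
  linear_combination g (w / u) * midWt_div κ hw hu

lemma integral_circle_eq_zero {g : ℂ → ℂ} (hg : DifferentiableOn ℂ g (Metric.ball 0 (8 / 7)))
    (h0 : g 0 = 0) : ∫ θ in Set.Ioo (-Real.pi) Real.pi, g (Complex.exp (θ * Complex.I)) = 0 := by
  have hd : DiffContOnCl ℂ g (Metric.ball 0 1) := by
    refine ⟨hg.mono (Metric.ball_subset_ball (by norm_num)), hg.continuousOn.mono ?_⟩
    rw [closure_ball _ one_ne_zero]
    exact Metric.closedBall_subset_ball (by norm_num)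
  have h := hd.circleIntegral_sub_inv_smul (w := 0) (by simp)
  rw [circleIntegral, h0, smul_zero] at h
  have e : ∀ θ : ℝ, deriv (circleMap 0 1) θ • (circleMap 0 1 θ - 0)⁻¹ • g (circleMap 0 1 θ) =
      Complex.I * g (Complex.exp (θ * Complex.I)) := by
    intro θ
    have : circleMap 0 1 θ = Complex.exp (θ * Complex.I) := by simp [circleMap]
    rw [deriv_circleMap, this, sub_zero, smul_eq_mul, smul_eq_mul]
    have := Complex.exp_ne_zero (θ * Complex.I)
    field_simp
  simp only [e] at h
  rw [intervalIntegral.integral_const_mul] at h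
  have h2 := (mul_eq_zero.1 h).resolve_left Complex.I_ne_zero
  have hp : Function.Periodic (fun θ : ℝ => g (Complex.exp (θ * Complex.I))) (2 * Real.pi) := by
    intro θ
    dsimp only
    congr 1
    push_cast
    rw [add_mul, Complex.exp_add, Complex.exp_two_pi_mul_I, mul_one]
  have h3 := hp.intervalIntegral_add_eq (-Real.pi) 0
  rw [zero_add, h2, show -Real.pi + 2 * Real.pi = Real.pi by ring,
    intervalIntegral.integral_of_le (by linarith [Real.pi_pos]), integral_Ioc_eq_integral_Ioo] at h3
  exact h3

/-- On the circle |u| = r both u and conj(w/u) are constant multiples of exp(iθ). The integrand is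
then a radial weight times a holomorphic function of exp(iθ) vanishing at 0, whose circular mean is
0. -/
lemma integral_midWt_eq_zero (κ : ℂ) {w : ℂ} {a b : ℂ → ℂ}
    (ha : DifferentiableOn ℂ a (Metric.ball 0 (1 / 4)))
    (hb : DifferentiableOn ℂ b (Metric.ball 0 (1 / 4))) (h0 : a 0 * b 0 = 0) :
    ∫ u, midWt κ w u * (a u * b ((starRingEnd ℂ) (w / u))) = 0 := by
  set f : ℂ → ℂ := fun u => midWt κ w u * (a u * b ((starRingEnd ℂ) (w / u))) with hf
  rw [← Complex.integral_comp_polarCoord_symm]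
  by_cases hi : IntegrableOn (fun p => p.1 • f (Complex.polarCoord.symm p)) polarCoord.target
    (volume.prod volume)
  swap
  · exact integral_undef hi
  have ht : polarCoord.target = Set.Ioi (0 : ℝ) ×ˢ Set.Ioo (-Real.pi) Real.pi := rfl
  rw [ht] at hi ⊢
  rw [Measure.volume_eq_prod, setIntegral_prod _ hi]
  refine setIntegral_eq_zero_of_forall_eq_zero fun r hr => ?_
  have hr0 : (0 : ℝ) < r := hr
  have hrc : (r : ℂ) ≠ 0 := by exact_mod_cast hr0.ne'
  have hpol : ∀ θ : ℝ, Complex.polarCoord.symm (r, θ) = r * Complex.exp (θ * Complex.I) := by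
    intro θ
    rw [Complex.polarCoord_symm_apply, Complex.exp_mul_I]
    push_cast
    rfl
  have hnexp : ∀ θ : ℝ, ‖Complex.exp (θ * Complex.I)‖ = 1 := Complex.norm_exp_ofReal_mul_I
  have hnorm : ∀ θ : ℝ, ‖(r : ℂ) * Complex.exp (θ * Complex.I)‖ = r := fun θ => by
    rw [norm_mul, hnexp, mul_one, Complex.norm_real, Real.norm_eq_abs, abs_of_pos hr0]
  have hwt : ∀ θ : ℝ, midWt κ w (r * Complex.exp (θ * Complex.I)) = midWt κ w r := by
    intro θ
    have e1 : ‖(r : ℂ)‖ = r := by rw [Complex.norm_real, Real.norm_eq_abs, abs_of_pos hr0]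
    unfold midWt
    rw [cut_congr (u := r * Complex.exp (θ * Complex.I) / (1 / 8 : ℝ)) (v := r / (1 / 8 : ℝ))
      (by rw [norm_div, norm_div, hnorm, e1]),
      cut_congr (u := w / (r * Complex.exp (θ * Complex.I)) / (1 / 8 : ℝ))
        (v := w / r / (1 / 8 : ℝ)) (by
          rw [norm_div, norm_div, norm_div (w / r), norm_div, hnorm, e1])]
    congr 1
    simp [gpow, abs_of_pos hr0]
  have hconj : ∀ θ : ℝ, (starRingEnd ℂ) (w / (r * Complex.exp (θ * Complex.I))) =
      (starRingEnd ℂ) w / r * Complex.exp (θ * Complex.I) := by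
    intro θ
    have hc : (starRingEnd ℂ) (Complex.exp (θ * Complex.I)) = (Complex.exp (θ * Complex.I))⁻¹ := by
      rw [← Complex.exp_conj, ← Complex.exp_neg]
      congr 1
      simp
    rw [map_div₀, map_mul, hc, Complex.conj_ofReal]
    have := Complex.exp_ne_zero (θ * Complex.I)
    field_simp
  by_cases hz : midWt κ w r = 0
  · refine setIntegral_eq_zero_of_forall_eq_zero fun θ _ => ?_
    simp only [hf, hpol, hwt, hz, zero_mul, smul_zero]
  obtain ⟨b1, b2⟩ := midWt_ne_zero hz
  have b1' : r ≤ 7 / 32 := by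
    rwa [Complex.norm_real, Real.norm_eq_abs, abs_of_pos hr0] at b1
  set g : ℂ → ℂ := fun ξ => a (r * ξ) * b ((starRingEnd ℂ) w / r * ξ)
  -- On the support of the weight r and |w|/r are at most 7/32, and 7/32 · 8/7 = 1/4.
  have hg : DifferentiableOn ℂ g (Metric.ball 0 (8 / 7)) := by
    refine DifferentiableOn.mul (ha.comp (by fun_prop) fun ξ hξ => ?_)
      (hb.comp (by fun_prop) fun ξ hξ => ?_)
    · rw [mem_ball_zero_iff] at hξ ⊢
      rw [norm_mul]
      nlinarith [norm_nonneg ξ, norm_nonneg (r : ℂ)]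
    · rw [mem_ball_zero_iff] at hξ ⊢
      have : ‖(starRingEnd ℂ) w / (r : ℂ)‖ = ‖w / (r : ℂ)‖ := by
        rw [norm_div, norm_div, Complex.norm_conj]
      rw [norm_mul, this]
      nlinarith [norm_nonneg ξ, norm_nonneg (w / (r : ℂ))]
  have h := integral_circle_eq_zero hg (by simpa [g] using mul_eq_zero.1 h0)
  have e : ∀ θ : ℝ, r • f (Complex.polarCoord.symm (r, θ)) =
      (r * midWt κ w r) * g (Complex.exp (θ * Complex.I)) := by
    intro θ
    simp only [hf, hpol, hwt, hconj, g, Complex.real_smul]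
    ring
  simp only [e]
  rw [integral_const_mul, h, mul_zero]

lemma integral_midWt_eq_zero' (κ : ℂ) {w : ℂ} (hw : w ≠ 0) {a b : ℂ → ℂ}
    (ha : DifferentiableOn ℂ a (Metric.ball 0 (1 / 4)))
    (hb : DifferentiableOn ℂ b (Metric.ball 0 (1 / 4))) (h0 : a 0 * b 0 = 0) :
    ∫ u, midWt κ w u * (a ((starRingEnd ℂ) u) * b (w / u)) = 0 := by
  rw [integral_midWt_swap κ hw (fun u => a ((starRingEnd ℂ) u) * b (w / u))]
  have h := integral_midWt_eq_zero (-κ) (w := w) hb ha (by rw [mul_comm]; exact h0)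
  refine mul_eq_zero_of_right _ ((integral_congr_ae ?_).trans h)
  filter_upwards [ae_ne_zero] with u hu
  rw [show w / (w / u) = u by field_simp]
  ring

/-- The first part of an integral over the intermediate region. -/
def midAlpha (μ : ℂ) (G : (ℂ × ℝ) × ℂ → ℂ) (e : ℂ × ℝ) : ℂ :=
  ∫ u, gpow u (0, μ - 2) * ((cut (u / (1 / 8 : ℝ)) : ℂ) * G (e, u))

/-- The second part of an integral over the intermediate region. -/
def midBeta (μ : ℂ) (G : (ℂ × ℝ) × ℂ → ℂ) (e : ℂ × ℝ) : ℂ :=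
  ∫ u, gpow u (0, μ - 2) * (-((cut (u / (8 : ℝ)) : ℂ) * G (e, e.1 * u)))

section
variable {μ : ℂ} (hμ : 0 < μ.re) {G : (ℂ × ℝ) × ℂ → ℂ} (hG : ContDiff ℝ ∞ G)
include hG

lemma contDiff_midAlpha_aux :
    ContDiff ℝ ∞ fun p : (ℂ × ℝ) × ℂ => (cut (p.2 / (1 / 8 : ℝ)) : ℂ) * G p :=
  (contDiff_cut_comp contDiff_snd _).mul hG

lemma contDiff_midBeta_aux :
    ContDiff ℝ ∞ fun p : (ℂ × ℝ) × ℂ => -((cut (p.2 / (8 : ℝ)) : ℂ) * G (p.1, p.1.1 * p.2)) :=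
  ((contDiff_cut_comp contDiff_snd _).mul (hG.comp (contDiff_fst.prodMk
    ((contDiff_fst.comp contDiff_fst).mul contDiff_snd)))).neg

omit hG in
lemma midAlpha_aux_eq_zero (e : ℂ × ℝ) (u : ℂ) (hu : 7 / 32 < ‖u‖) :
    (cut (u / (1 / 8 : ℝ)) : ℂ) * G (e, u) = 0 := by
  rw [cut_div_eq_zero (by norm_num) (by linarith)]; simp

omit hG in
lemma midBeta_aux_eq_zero (e : ℂ × ℝ) (u : ℂ) (hu : 14 < ‖u‖) :
    -((cut (u / (8 : ℝ)) : ℂ) * G (e, e.1 * u)) = 0 := by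
  rw [cut_div_eq_zero (by norm_num) (by linarith)]; simp

include hμ

lemma contDiff_midAlpha : ContDiff ℝ ∞ (midAlpha μ G) :=
  contDiff_integral_gpow (E := ℂ × ℝ) 0 (σ := fun _ => μ - 2) contDiff_const
    (fun _ => by simpa using hμ) (contDiff_midAlpha_aux hG) _ midAlpha_aux_eq_zero

lemma contDiff_midBeta : ContDiff ℝ ∞ (midBeta μ G) :=
  contDiff_integral_gpow (E := ℂ × ℝ) 0 (σ := fun _ => μ - 2) contDiff_const
    (fun _ => by simpa using hμ) (contDiff_midBeta_aux hG) _ midBeta_aux_eq_zero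

lemma integrable_midAlpha (e : ℂ × ℝ) :
    Integrable fun u => gpow u (0, μ - 2) * ((cut (u / (1 / 8 : ℝ)) : ℂ) * G (e, u)) := by
  have h1 : Continuous fun u : ℂ => (cut (u / (1 / 8 : ℝ)) : ℂ) * G (e, u) :=
    ((contDiff_cut_comp (g := fun u : ℂ => u) contDiff_id _).continuous.mul (hG.continuous.comp (by fun_prop)))
  have h2 : HasCompactSupport fun u : ℂ => (cut (u / (1 / 8 : ℝ)) : ℂ) * G (e, u) :=
    HasCompactSupport.of_support_subset_isCompact (isCompact_closedBall (0 : ℂ) (7 / 32)) (by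
      intro u hu
      by_contra h
      exact hu (midAlpha_aux_eq_zero (G := G) e u (by simpa using h)))
  have h0 : -2 < (μ - 2).re := by simpa using hμ
  exact integrable_gpow_mul (P := (0, μ - 2)) h0 h1 h2

lemma integrable_midBeta (e : ℂ × ℝ) :
    Integrable fun u => gpow u (0, μ - 2) * (-((cut (u / (8 : ℝ)) : ℂ) * G (e, e.1 * u))) := by
  have h1 : Continuous fun u : ℂ => -((cut (u / (8 : ℝ)) : ℂ) * G (e, e.1 * u)) :=
    ((contDiff_cut_comp (g := fun u : ℂ => u) contDiff_id _).continuous.mul (hG.continuous.comp (by fun_prop))).neg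
  have h2 : HasCompactSupport fun u : ℂ => -((cut (u / (8 : ℝ)) : ℂ) * G (e, e.1 * u)) :=
    HasCompactSupport.of_support_subset_isCompact (isCompact_closedBall (0 : ℂ) (14)) (by
      intro u hu
      by_contra h
      exact hu (midBeta_aux_eq_zero (G := G) e u (by simpa using h)))
  have h0 : -2 < (μ - 2).re := by simpa using hμ
  exact integrable_gpow_mul (P := (0, μ - 2)) h0 h1 h2

/-- For small w the product of the two cutoffs is the cutoff of the outer disc minus that of the
inner disc. Since Re μ > 0, the integral over each disc converges separately, and rescaling the
inner one by w produces the factor |w|^μ. -/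
lemma integral_midWt_eq {w : ℂ} (hw0 : w ≠ 0) (hw : ‖w‖ ≤ 1 / 256) (s : ℝ) :
    ∫ u, midWt μ w u * G ((w, s), u) = midAlpha μ G (w, s) + gpow w (0, μ) * midBeta μ G (w, s) := by
  have hw' : (‖w‖ : ℂ) ≠ 0 := by exact_mod_cast norm_ne_zero_iff.2 hw0
  have i1 := integrable_midAlpha hμ hG (w, s)
  have i3 := integrable_comp_mul (integrable_midBeta hμ hG (w, s)) (inv_ne_zero hw0)
  have e1 : gpow w (0, μ) * midBeta μ G (w, s) =
      ∫ u, gpow w (0, μ - 2) * (gpow (w⁻¹ * u) (0, μ - 2) *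
        (-((cut (w⁻¹ * u / (8 : ℝ)) : ℂ) * G ((w, s), w * (w⁻¹ * u))))) := by
    rw [integral_const_mul, integral_comp_mul (fun u => gpow u (0, μ - 2) *
      (-((cut (u / (8 : ℝ)) : ℂ) * G ((w, s), w * u)))) (inv_ne_zero hw0)]
    have : gpow w (0, μ) = gpow w (0, μ - 2) * (‖w‖ : ℂ) ^ 2 := by
      rw [← gpow_pairOne, ← gpow_add hw0]
      congr 1; ext <;> simp [pairOne]
    rw [this, norm_inv, midBeta]
    push_cast
    simp only [inv_inv, inv_pow]
    ring
  rw [e1, midAlpha, ← integral_add i1 (i3.const_mul _)]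
  refine integral_congr_ae ?_
  filter_upwards [ae_ne_zero] with u hu
  rw [gpow_mul, gpow_inv, mul_inv_cancel_left₀ hw0]
  have hg := gpow_ne_zero hw0 (0, μ - 2)
  have hcut : (cut (w / u / (1 / 8 : ℝ)) : ℂ) = 1 - cut (w⁻¹ * u / (8 : ℝ)) := by
    have : w / u / (1 / 8 : ℝ) = (w⁻¹ * u / (8 : ℝ))⁻¹ := by push_cast; field_simp
    rw [this, cut_inv (by
      refine div_ne_zero (mul_ne_zero (inv_ne_zero hw0) hu) (by norm_num))]
    simp
  have hz : (cut (w⁻¹ * u / (8 : ℝ)) : ℂ) * (1 - cut (u / (1 / 8 : ℝ))) = 0 := by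
    by_cases h : ‖w⁻¹ * u‖ ≤ 14
    · have : ‖u‖ ≤ 1 / 16 := by
        have e : u = w * (w⁻¹ * u) := by rw [mul_inv_cancel_left₀ hw0]
        rw [e, norm_mul]
        nlinarith [norm_nonneg w, norm_nonneg (w⁻¹ * u)]
      rw [cut_div_eq_one (u := u) (by norm_num) (by linarith)]; simp
    · rw [cut_div_eq_zero (u := w⁻¹ * u) (by norm_num) (by linarith)]; simp
  rw [midWt, hcut]
  generalize gpow w (0, μ - 2) = A at hg ⊢
  have hA : A * A⁻¹ = 1 := mul_inv_cancel₀ hg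
  linear_combination (gpow u (0, μ - 2) * G ((w, s), u)) * hz +
    (gpow u (0, μ - 2) * (cut (w⁻¹ * u / (8 : ℝ)) : ℂ) * G ((w, s), u)) * hA

end

/-! ### Expansions at the points `0` and `1` -/

/-- The singular function of the expansions. -/
def singPow (κ : ℝ) (w : ℂ) : ℂ := ((if κ = 0 then Real.log ‖w‖ else ‖w‖ ^ κ : ℝ) : ℂ)

/-- A family of functions with an expansion at the origin. -/
def HasMidExpansion (κ : ℝ) (f : ℂ → ℝ → ℂ) : Prop :=
  ∃ α β : ℂ × ℝ → ℂ, ContDiff ℝ ∞ α ∧ ContDiff ℝ ∞ β ∧ ∀ w ≠ 0, ‖w‖ ≤ 1 / 256 → ∀ s : ℝ,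
    f w s = α (w, s) + β (w, s) * singPow κ w

section
variable {κ : ℝ} {f g : ℂ → ℝ → ℂ}

lemma HasMidExpansion.of_contDiff {α : ℂ × ℝ → ℂ} (h : ContDiff ℝ ∞ α) :
    HasMidExpansion κ fun w s => α (w, s) :=
  ⟨α, fun _ => 0, h, contDiff_const, fun w _ _ s => by simp⟩

lemma HasMidExpansion.add (hf : HasMidExpansion κ f) (hg : HasMidExpansion κ g) :
    HasMidExpansion κ fun w s => f w s + g w s := by
  obtain ⟨α, β, h1, h2, h3⟩ := hf
  obtain ⟨α', β', h1', h2', h3'⟩ := hg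
  exact ⟨_, _, h1.add h1', h2.add h2', fun w hw hw' s => by
    simp only [h3 w hw hw' s, h3' w hw hw' s]; ring⟩

lemma HasMidExpansion.smooth_mul {α : ℂ × ℝ → ℂ} (h : ContDiff ℝ ∞ α) (hg : HasMidExpansion κ g) :
    HasMidExpansion κ fun w s => α (w, s) * g w s := by
  obtain ⟨α', β', h1', h2', h3'⟩ := hg
  exact ⟨_, _, h.mul h1', h.mul h2', fun w hw hw' s => by
    simp only [h3' w hw hw' s]; ring⟩

lemma HasMidExpansion.congr (hf : HasMidExpansion κ f)
    (h : ∀ w ≠ 0, ‖w‖ ≤ 1 / 256 → ∀ s, g w s = f w s) : HasMidExpansion κ g := by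
  obtain ⟨α, β, h1, h2, h3⟩ := hf
  exact ⟨α, β, h1, h2, fun w hw hw' s => by rw [h w hw hw' s, h3 w hw hw' s]⟩

lemma HasMidExpansion.gpow_norm (κ : ℝ) : HasMidExpansion κ fun w _ => gpow w (0, (κ : ℂ)) := by
  by_cases h : κ = 0
  · refine ⟨fun _ => 1, fun _ => 0, contDiff_const, contDiff_const, fun w hw _ s => ?_⟩
    dsimp only
    rw [h, gpow_ofReal, Real.rpow_zero]; simp
  · refine ⟨fun _ => 0, fun _ => 1, contDiff_const, contDiff_const, fun w hw _ s => ?_⟩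
    dsimp only
    rw [gpow_ofReal, singPow, if_neg h]; simp

end

lemma contDiff_conj : ContDiff ℝ ∞ (starRingEnd ℂ) := Complex.conjCLE.contDiff

lemma contDiff_gpow_pairOne : ContDiff ℝ ∞ fun e : ℂ × ℝ => gpow e.1 pairOne := by
  have : (fun e : ℂ × ℝ => gpow e.1 pairOne) = fun e => (starRingEnd ℂ) e.1 * e.1 := by
    ext e
    rw [gpow_pairOne, Complex.conj_mul']
  rw [this]
  exact (contDiff_conj.comp contDiff_fst).mul contDiff_fst

/-- The power |w|^(κ+2) is |w|^κ times the smooth function |w|², so no exponent besides κ appears.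
-/
lemma HasMidExpansion.midWt_add_two {κ : ℝ} (hκ : -2 < κ) {G : (ℂ × ℝ) × ℂ → ℂ}
    (hG : ContDiff ℝ ∞ G) :
    HasMidExpansion κ fun w s => ∫ u, midWt (κ + 2) w u * G ((w, s), u) := by
  have hre : 0 < ((κ : ℂ) + 2).re := by simp; linarith
  refine ((of_contDiff (contDiff_midAlpha hre hG)).add (smooth_mul
    (contDiff_gpow_pairOne.mul (contDiff_midBeta hre hG)) (HasMidExpansion.gpow_norm κ))).congr
    fun w hw hw' s => ?_
  rw [integral_midWt_eq hre hG hw hw']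
  have : gpow w (0, (κ : ℂ) + 2) =
      gpow w (0, κ) * gpow w pairOne := by
    rw [← gpow_add hw]; congr 1
  rw [this]
  ring

/-- Here the two ends change roles: |w|^κ |w|^(2-κ) = |w|² is smooth, and the outer disc carries the
singular power. -/
lemma HasMidExpansion.gpow_mul_midWt {κ : ℝ} (hκ : κ < 2) {G : (ℂ × ℝ) × ℂ → ℂ}
    (hG : ContDiff ℝ ∞ G) :
    HasMidExpansion κ fun w s => gpow w (0, (κ : ℂ)) *
      ∫ u, midWt (2 - κ) w u * G ((w, s), u) := by
  have hre : 0 < ((2 : ℂ) - κ).re := by simpa using hκ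
  refine ((of_contDiff (contDiff_gpow_pairOne.mul (contDiff_midBeta hre hG))).add (smooth_mul
    (contDiff_midAlpha hre hG) (HasMidExpansion.gpow_norm κ))).congr
    fun w hw hw' s => ?_
  rw [integral_midWt_eq hre hG hw hw']
  have : gpow w pairOne = gpow w (0, κ) *
      gpow w (0, (2 : ℂ) - κ) := by
    rw [← gpow_add hw]; congr 1; ext <;> simp [pairOne]
  rw [this]
  ring

/-- The logarithmic integral. -/
lemma exists_integral_midWt_zero : ∃ c d : ℂ, ∀ w ≠ 0, ‖w‖ ≤ 1 / 256 →
    ∫ u, midWt 0 w u = c + d * (Real.log ‖w‖ : ℂ) := by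
  set h : ℝ → ℝ := fun r => cut (r : ℂ) with hh
  have hcut : ∀ u : ℂ, cut u = h ‖u‖ := fun u => cut_congr (by simp)
  have hcont : Continuous h := contDiff_cut.continuous.comp Complex.continuous_ofReal
  have h1 : ∀ r : ℝ, |r| ≤ 1 / 2 → h r = 1 := fun r hr => cut_eq_one (by simpa using hr)
  have h0 : ∀ r : ℝ, 7 / 4 ≤ |r| → h r = 0 := fun r hr => cut_eq_zero (by simpa using hr)
  set C : ℝ := 2 * (volume : Measure ℂ).real (Metric.ball 0 1)
  -- In polar coordinates the integrand is dr/r times two cutoffs, both equal to 1 on 16ρ ≤ r ≤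
  -- 1/16. The plateau yields log(1/256) - log ρ. The inner ramp from 32ρ/7 to 16ρ, rescaled by ρ,
  -- and the outer ramp from 1/16 to 7/32 give the constants `c1` and `c2`.
  set c1 : ℝ := ∫ y in (32 / 7 : ℝ)..16, y⁻¹ * h (8 / y)
  set c2 : ℝ := ∫ y in (1 / 16 : ℝ)..(7 / 32), y⁻¹ * h (8 * y)
  refine ⟨((C * (c1 + c2 + Real.log (1 / 256)) : ℝ) : ℂ), ((-C : ℝ) : ℂ), fun w hw0 hw => ?_⟩
  set ρ := ‖w‖ with hρ
  have hρ0 : 0 < ρ := norm_pos_iff.2 hw0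
  have e1 : ∫ u, midWt 0 w u = ((∫ u : ℂ, (‖u‖ ^ 2)⁻¹ * (h (8 * ‖u‖) * h (8 * ρ / ‖u‖)) : ℝ) : ℂ) := by
    rw [← integral_complex_ofReal]
    refine integral_congr_ae ?_
    filter_upwards [ae_ne_zero] with u hu
    have : gpow u (0, 0 - 2) = ((‖u‖ : ℂ) ^ 2)⁻¹ := by
      rw [← gpow_pairOne, ← gpow_neg]; congr 1; ext <;> simp [pairOne]
    rw [midWt, this, hcut, hcut, norm_div, norm_div (w / u), norm_div, Complex.norm_real]
    have e8 : ‖(1 / 8 : ℝ)‖ = 1 / 8 := by norm_num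
    rw [e8]
    push_cast
    congr 4
    · ring
    · ring
  have e2 := integral_fun_norm_addHaar (volume : Measure ℂ)
    (fun r : ℝ => (r ^ 2)⁻¹ * (h (8 * r) * h (8 * ρ / r)))
  rw [e1, e2, Complex.finrank_real_complex]
  have e3 : ∫ y in Set.Ioi (0 : ℝ), y ^ (2 - 1) • ((y ^ 2)⁻¹ * (h (8 * y) * h (8 * ρ / y))) =
      ∫ y in (32 / 7 * ρ)..(7 / 32), y⁻¹ * (h (8 * y) * h (8 * ρ / y)) := by
    rw [intervalIntegral.integral_of_le (by linarith)]
    have : ∀ y ∈ Set.Ioi (0 : ℝ), y ^ (2 - 1) • ((y ^ 2)⁻¹ * (h (8 * y) * h (8 * ρ / y))) =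
        (Set.Ioc (32 / 7 * ρ) (7 / 32)).indicator
          (fun y => y⁻¹ * (h (8 * y) * h (8 * ρ / y))) y := by
      intro y hy
      have hy0 : (0 : ℝ) < y := hy
      by_cases hm : y ∈ Set.Ioc (32 / 7 * ρ) (7 / 32)
      · rw [Set.indicator_of_mem hm, smul_eq_mul, Nat.add_one_sub_one, pow_one]
        field_simp
      · rw [Set.indicator_of_notMem hm]
        simp only [Set.mem_Ioc, not_and_or, not_le, not_lt] at hm
        rcases hm with hm | hm
        · rw [h0 (8 * ρ / y)]
          · simp
          · rw [abs_of_pos (by positivity), le_div_iff₀ hy0]; linarith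
        · rw [h0 (8 * y)]
          · simp
          · rw [abs_of_pos (by positivity)]; linarith
    rw [setIntegral_congr_fun measurableSet_Ioi this, setIntegral_indicator measurableSet_Ioc]
    congr 2
    ext y
    simp only [Set.mem_inter_iff, Set.mem_Ioi, Set.mem_Ioc]
    constructor
    · exact fun h => h.2
    · exact fun h => ⟨by nlinarith [h.1], h⟩
  have hii : ∀ p q : ℝ, 0 < p → p ≤ q → IntervalIntegrable
      (fun y => y⁻¹ * (h (8 * y) * h (8 * ρ / y))) volume p q := by
    intro p q hp hpq
    apply ContinuousOn.intervalIntegrable_of_Icc hpq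
    have hne : ∀ y ∈ Set.Icc p q, y ≠ 0 := fun y hy => (lt_of_lt_of_le hp hy.1).ne'
    exact (continuousOn_id.inv₀ hne).mul (((hcont.comp (by fun_prop)).continuousOn).mul
      (hcont.comp_continuousOn (continuousOn_const.div continuousOn_id hne)))
  have e4 : ∫ y in (32 / 7 * ρ)..(7 / 32), y⁻¹ * (h (8 * y) * h (8 * ρ / y)) =
      c1 + (Real.log (1 / 256) - Real.log ρ) + c2 := by
    rw [← intervalIntegral.integral_add_adjacent_intervals (b := 1 / 16)
      (hii _ _ (by positivity) (by linarith)) (hii _ _ (by norm_num) (by norm_num)),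
      ← intervalIntegral.integral_add_adjacent_intervals (b := 16 * ρ)
      (hii _ _ (by positivity) (by linarith)) (hii _ _ (by positivity) (by linarith))]
    congr 1
    · congr 1
      · have := intervalIntegral.integral_comp_mul_left (a := 32 / 7) (b := 16)
          (fun y => y⁻¹ * (h (8 * y) * h (8 * ρ / y))) hρ0.ne'
        rw [mul_comm (32 / 7) ρ, mul_comm 16 ρ, ← (eq_inv_smul_iff₀ hρ0.ne').1 this, smul_eq_mul,
          ← intervalIntegral.integral_const_mul]
        refine intervalIntegral.integral_congr fun y hy => ?_
        rw [Set.uIcc_of_le (by norm_num)] at hy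
        have hy0 : 0 < y := by linarith [hy.1]
        rw [h1 (8 * (ρ * y))]
        · rw [show 8 * ρ / (ρ * y) = 8 / y by field_simp]
          field_simp
        · rw [abs_of_pos (by positivity)]
          nlinarith [hy.2]
      · rw [← Real.log_div (by norm_num) hρ0.ne', show 1 / 256 / ρ = (1 / 16) / (16 * ρ) by
          field_simp; norm_num, ← integral_inv_of_pos (by positivity) (by norm_num)]
        refine intervalIntegral.integral_congr fun y hy => ?_
        rw [Set.uIcc_of_le (by linarith)] at hy
        have hy0 : 0 < y := by linarith [hy.1]
        rw [h1 (8 * y), h1 (8 * ρ / y)]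
        · simp
        · rw [abs_of_pos (by positivity), div_le_iff₀ hy0]
          linarith [hy.1]
        · rw [abs_of_pos (by positivity)]
          linarith [hy.2]
    · refine intervalIntegral.integral_congr fun y hy => ?_
      rw [Set.uIcc_of_le (by norm_num)] at hy
      have hy0 : 0 < y := by linarith [hy.1]
      rw [h1 (8 * ρ / y), mul_one]
      rw [abs_of_pos (by positivity), div_le_iff₀ hy0]
      linarith [hy.1]
  rw [e3, e4, smul_eq_mul]
  simp only [nsmul_eq_mul]
  push_cast
  simp only [C]
  push_cast
  ring

/-- The only source of a logarithm. For κ > 0 the integral splits into its two ends directly, for κ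
< 0 after the exchange u ↦ w/u, and for κ = 0 neither end converges alone. -/
lemma HasMidExpansion.midWt_one {κ : ℝ} : HasMidExpansion κ fun w _ => ∫ u, midWt κ w u := by
  rcases lt_trichotomy κ 0 with h | h | h
  · have hre : 0 < (-(κ : ℂ)).re := by simpa using h
    have h1 := contDiff_midAlpha hre (contDiff_const (c := (1 : ℂ)))
    have h2 := contDiff_midBeta hre (contDiff_const (c := (1 : ℂ)))
    refine ((smooth_mul h1 (HasMidExpansion.gpow_norm κ)).add (of_contDiff h2)).congr
      fun w hw hw' s => ?_
    have e := integral_midWt_swap κ hw (fun _ => 1)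
    have e2 := integral_midWt_eq hre (contDiff_const (c := (1 : ℂ))) hw hw' s
    simp only [mul_one] at e e2
    rw [e, e2, mul_add, ← mul_assoc, ← gpow_add hw]
    have : ((0, (κ : ℂ)) : ExpPair) + (0, -(κ : ℂ)) = 0 := by ext <;> simp
    rw [this, gpow_zero]
    ring
  · obtain ⟨c, d, hcd⟩ := exists_integral_midWt_zero
    refine ⟨fun _ => c, fun _ => d, contDiff_const, contDiff_const, fun w hw hw' s => ?_⟩
    dsimp only
    rw [h, Complex.ofReal_zero, hcd w hw hw', singPow, if_pos rfl]
  · have hre : 0 < (κ : ℂ).re := by simpa using h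
    have h1 := contDiff_midAlpha hre (contDiff_const (c := (1 : ℂ)))
    have h2 := contDiff_midBeta hre (contDiff_const (c := (1 : ℂ)))
    refine ((of_contDiff h1).add (smooth_mul h2 (HasMidExpansion.gpow_norm κ))).congr
      fun w hw hw' s => ?_
    have e2 := integral_midWt_eq hre (contDiff_const (c := (1 : ℂ))) hw hw' s
    simp only [mul_one] at e2
    rw [e2]
    ring

section
variable {κ : ℝ} (hκ : -2 < κ) (hκ2 : κ < 2) {kQ kS : ℤ} {σQ σS : ℝ → ℂ}
  (hQ : ContDiff ℝ ∞ σQ) (hS : ContDiff ℝ ∞ σS)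

lemma gpow_mul_gpow_eq {kQ kS : ℤ} {σQ σS u y : ℂ} (hu : ‖u‖ ≤ 1 / 4) (hy : ‖y‖ ≤ 1 / 4) :
    gpow (1 - u) (kQ, σQ) * gpow (1 - y) (kS, σS) =
      (decC ((kQ + σQ) / 2) ((kS + σS) / 2) (u * y) +
        u * decD ((kQ + σQ) / 2) ((kS + σS) / 2) u (u * y) +
        y * decD ((kS + σS) / 2) ((kQ + σQ) / 2) y (u * y)) *
      (decC ((σQ - kQ) / 2) ((σS - kS) / 2) ((starRingEnd ℂ) (u * y)) +
        (starRingEnd ℂ) u * decD ((σQ - kQ) / 2) ((σS - kS) / 2) ((starRingEnd ℂ) u)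
          ((starRingEnd ℂ) (u * y)) +
        (starRingEnd ℂ) y * decD ((σS - kS) / 2) ((σQ - kQ) / 2) ((starRingEnd ℂ) y)
          ((starRingEnd ℂ) (u * y))) := by
  rw [gpow_one_sub (by linarith), gpow_one_sub (by linarith), map_mul, ← hpow_mul_hpow _ _ hu hy,
    ← hpow_mul_hpow _ _ (by simpa using hu) (by simpa using hy)]
  ring

/-- Of the nine products of the two splittings only those invariant in angular degree survive; the
last one is brought to the variable y = w/u. Without this cancellation cross terms such as u conj(y)
would spoil the form of the expansion. -/
lemma integral_midWt_gpow (κ : ℂ) {w : ℂ} (hw0 : w ≠ 0) (hw : ‖w‖ ≤ 1 / 256) (q r q' r' : ℂ) :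
    ∫ u, midWt κ w u *
      ((decC q r w + u * decD q r u w + w / u * decD r q (w / u) w) *
        (decC q' r' ((starRingEnd ℂ) w) +
          (starRingEnd ℂ) u * decD q' r' ((starRingEnd ℂ) u) ((starRingEnd ℂ) w) +
          (starRingEnd ℂ) (w / u) * decD r' q' ((starRingEnd ℂ) (w / u)) ((starRingEnd ℂ) w))) =
    decC q r w * decC q' r' ((starRingEnd ℂ) w) * (∫ u, midWt κ w u) +
    (∫ u, midWt (κ + 2) w u *
      (decD q r u w * decD q' r' ((starRingEnd ℂ) u) ((starRingEnd ℂ) w))) +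
    gpow w (0, κ) * ∫ u, midWt (2 - κ) w u *
      (decD r q u w * decD r' q' ((starRingEnd ℂ) u) ((starRingEnd ℂ) w)) := by
  have hw' : ‖w‖ ≤ 1 / 16 := by linarith
  have hwc : ‖(starRingEnd ℂ) w‖ ≤ 1 / 16 := by simpa using hw'
  have hD : ∀ q r v : ℂ, Continuous fun x => decD q r x v := fun q r v =>
    (contDiff_decD (E := ℂ) contDiff_const contDiff_const contDiff_id contDiff_const).continuous
  have hc : Continuous (starRingEnd ℂ) := Complex.continuous_conj
  have hy : ∀ u : ℂ, u ≠ 0 → ContinuousAt (fun u => w / u) u := fun u hu =>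
    continuousAt_const.div continuousAt_id hu
  have hyc : ∀ u : ℂ, u ≠ 0 → ContinuousAt (fun u => (starRingEnd ℂ) (w / u)) u := fun u hu =>
    hc.continuousAt.comp (hy u hu)
  -- the individual factors
  set C := decC q r w
  set C' := decC q' r' ((starRingEnd ℂ) w)
  set D : ℂ → ℂ := fun u => decD q r u w with hDdef
  set E : ℂ → ℂ := fun y => decD r q y w with hEdef
  set D' : ℂ → ℂ := fun u => decD q' r' u ((starRingEnd ℂ) w) with hDdef'
  set E' : ℂ → ℂ := fun y => decD r' q' y ((starRingEnd ℂ) w) with hEdef'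
  have cD : ∀ u, ContinuousAt D u := fun u => (hD q r w).continuousAt
  have cE : ∀ u ≠ 0, ContinuousAt (fun u => E (w / u)) u := fun u hu =>
    (hD r q w).continuousAt.comp (hy u hu)
  have cD' : ∀ u, ContinuousAt (fun u => D' ((starRingEnd ℂ) u)) u := fun u =>
    ((hD q' r' _).comp hc).continuousAt
  have cE' : ∀ u ≠ 0, ContinuousAt (fun u => E' ((starRingEnd ℂ) (w / u))) u := fun u hu =>
    (hD r' q' _).continuousAt.comp (hyc u hu)
  have dD : DifferentiableOn ℂ D (Metric.ball 0 (1 / 4)) := differentiableOn_decD q r hw'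
  have dE : DifferentiableOn ℂ E (Metric.ball 0 (1 / 4)) := differentiableOn_decD r q hw'
  have dD' : DifferentiableOn ℂ D' (Metric.ball 0 (1 / 4)) := differentiableOn_decD q' r' hwc
  have dE' : DifferentiableOn ℂ E' (Metric.ball 0 (1 / 4)) := differentiableOn_decD r' q' hwc
  -- Four applications dispose of the six vanishing products: `z1` and `z3` take two each.
  have z1 := integral_midWt_eq_zero κ (w := w) (a := fun u => C + u * D u) (b := fun y => y * E' y)
    ((differentiableOn_const C).add (differentiableOn_id.mul dD)) (differentiableOn_id.mul dE')
    (by simp)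
  have z2 := integral_midWt_eq_zero κ (w := w) (a := fun u => u * D u) (b := fun _ => C')
    (differentiableOn_id.mul dD) (differentiableOn_const C') (by simp)
  have z3 := integral_midWt_eq_zero' κ hw0 (a := fun u => u * D' u) (b := fun y => C + y * E y)
    (differentiableOn_id.mul dD') ((differentiableOn_const C).add (differentiableOn_id.mul dE))
    (by simp)
  have z4 := integral_midWt_eq_zero' κ hw0 (a := fun _ => C') (b := fun y => y * E y)
    (differentiableOn_const C') (differentiableOn_id.mul dE) (by simp)
  have i0 : Integrable fun u => C * C' * midWt κ w u := by
    have := (integrable_midWt_mul κ hw0 (g := fun _ => 1) fun u _ => continuousAt_const).const_mul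
      (C * C')
    simpa using this
  have i1 := integrable_midWt_mul κ hw0 (g := fun u => (C + u * D u) *
    ((starRingEnd ℂ) (w / u) * E' ((starRingEnd ℂ) (w / u)))) fun u hu =>
      (continuousAt_const.add (continuousAt_id.mul (cD u))).mul ((hyc u hu).mul (cE' u hu))
  have i2 := integrable_midWt_mul κ hw0 (g := fun u => u * D u * C') fun u hu =>
      (continuousAt_id.mul (cD u)).mul continuousAt_const
  have i3 := integrable_midWt_mul κ hw0 (g := fun u => (starRingEnd ℂ) u * D' ((starRingEnd ℂ) u) *
    (C + w / u * E (w / u))) fun u hu =>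
      (hc.continuousAt.mul (cD' u)).mul (continuousAt_const.add ((hy u hu).mul (cE u hu)))
  have i4 := integrable_midWt_mul κ hw0 (g := fun u => C' * (w / u * E (w / u))) fun u hu =>
      continuousAt_const.mul ((hy u hu).mul (cE u hu))
  have i5 := integrable_midWt_mul κ hw0 (g := fun u => (u * (starRingEnd ℂ) u) *
    (D u * D' ((starRingEnd ℂ) u))) fun u hu =>
      (continuousAt_id.mul hc.continuousAt).mul ((cD u).mul (cD' u))
  have i6 := integrable_midWt_mul κ hw0 (g := fun u => (w / u * (starRingEnd ℂ) (w / u)) *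
    (E (w / u) * E' ((starRingEnd ℂ) (w / u)))) fun u hu =>
      ((hy u hu).mul (hyc u hu)).mul ((cE u hu).mul (cE' u hu))
  have e5 : ∀ (κ : ℂ) (f : ℂ → ℂ), ∫ u, midWt κ w u * ((u * (starRingEnd ℂ) u) * f u) =
      ∫ u, midWt (κ + 2) w u * f u := by
    intro κ f
    refine integral_congr_ae ?_
    filter_upwards [ae_ne_zero] with u hu
    have : gpow u (0, κ + 2 - 2) = gpow u (0, κ - 2) * (u * (starRingEnd ℂ) u) := by
      rw [Complex.mul_conj', ← gpow_pairOne, ← gpow_add hu]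
      congr 1; ext <;> simp [pairOne]
    rw [midWt, midWt, this]
    ring
  have e6 := integral_midWt_swap κ hw0 (fun u => (w / u * (starRingEnd ℂ) (w / u)) *
    (E (w / u) * E' ((starRingEnd ℂ) (w / u))))
  have e7 : ∫ u, midWt (-κ) w u * ((w / (w / u) * (starRingEnd ℂ) (w / (w / u))) *
      (E (w / (w / u)) * E' ((starRingEnd ℂ) (w / (w / u))))) =
      ∫ u, midWt (2 - κ) w u * (E u * E' ((starRingEnd ℂ) u)) := by
    rw [show (2 : ℂ) - κ = -κ + 2 by ring, ← e5]
    refine integral_congr_ae ?_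
    filter_upwards [ae_ne_zero] with u hu
    rw [show w / (w / u) = u by field_simp]
  rw [← e5 κ, ← e7, ← e6]
  have s1 : Integrable fun u => C * C' * midWt κ w u +
      midWt κ w u * ((C + u * D u) * ((starRingEnd ℂ) (w / u) * E' ((starRingEnd ℂ) (w / u)))) :=
    i0.add i1
  have s2 := s1.add i2
  have s3 := s2.add i3
  have s4 := s3.add i4
  have s5 := s4.add i5
  have hsum := integral_add s5 i6
  have hs5 := integral_add s4 i5
  have hs4 := integral_add s3 i4
  have hs3 := integral_add s2 i3
  have hs2 := integral_add s1 i2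
  have hs1 := integral_add i0 i1
  rw [integral_const_mul] at hs1
  simp only [Pi.add_apply] at hsum hs5 hs4 hs3 hs2
  rw [hs5, hs4, hs3, hs2, hs1, z1, z2, z3, z4] at hsum
  simp only [add_zero] at hsum
  rw [← hsum]
  refine integral_congr_ae (Filter.Eventually.of_forall fun u => ?_)
  simp only [hDdef, hEdef, hDdef', hEdef']
  ring

-- The bounds on κ, which the square provides at both points, make κ + 2 and 2 - κ positive, so the
-- terms |u|² DD' and |y|² EE' converge at both ends of the annulus.
include hκ hκ2 hQ hS in
theorem HasMidExpansion.integral_gpow : HasMidExpansion κ fun w s => ∫ u, midWt κ w u *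
    (gpow (1 - u) (kQ, σQ s) * gpow (1 - w / u) (kS, σS s)) := by
  have hq : ContDiff ℝ ∞ fun s => ((kQ : ℂ) + σQ s) / 2 := (contDiff_const.add hQ).div_const 2
  have hr : ContDiff ℝ ∞ fun s => ((kS : ℂ) + σS s) / 2 := (contDiff_const.add hS).div_const 2
  have hq' : ContDiff ℝ ∞ fun s => (σQ s - (kQ : ℂ)) / 2 := (hQ.sub contDiff_const).div_const 2
  have hr' : ContDiff ℝ ∞ fun s => (σS s - (kS : ℂ)) / 2 := (hS.sub contDiff_const).div_const 2
  have hs : ContDiff ℝ ∞ fun e : ℂ × ℝ => e.2 := contDiff_snd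
  have hs2 : ContDiff ℝ ∞ fun e : (ℂ × ℝ) × ℂ => e.1.2 := contDiff_snd.comp contDiff_fst
  have hw2 : ContDiff ℝ ∞ fun e : (ℂ × ℝ) × ℂ => e.1.1 := contDiff_fst.comp contDiff_fst
  have g1 := smooth_mul ((contDiff_decC (hq.comp hs) (hr.comp hs) contDiff_fst).mul
    (contDiff_decC (hq'.comp hs) (hr'.comp hs) (contDiff_conj.comp contDiff_fst)))
    (HasMidExpansion.midWt_one (κ := κ))
  have g2 := HasMidExpansion.midWt_add_two hκ
    ((contDiff_decD (hq.comp hs2) (hr.comp hs2) contDiff_snd hw2).mul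
    (contDiff_decD (hq'.comp hs2) (hr'.comp hs2) (contDiff_conj.comp contDiff_snd)
      (contDiff_conj.comp hw2)))
  have g3 := HasMidExpansion.gpow_mul_midWt hκ2
    ((contDiff_decD (hr.comp hs2) (hq.comp hs2) contDiff_snd hw2).mul
    (contDiff_decD (hr'.comp hs2) (hq'.comp hs2) (contDiff_conj.comp contDiff_snd)
      (contDiff_conj.comp hw2)))
  refine ((g1.add g2).add g3).congr fun w hw hw' s => ?_
  refine Eq.trans ?_ (integral_midWt_gpow κ hw hw' (((kQ : ℂ) + σQ s) / 2)
    (((kS : ℂ) + σS s) / 2) ((σQ s - (kQ : ℂ)) / 2) ((σS s - (kS : ℂ)) / 2))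
  refine integral_congr_ae ?_
  filter_upwards [ae_ne_zero] with u hu
  by_cases h0 : midWt κ w u = 0
  · rw [h0, zero_mul, zero_mul]
  obtain ⟨b1, b2⟩ := midWt_ne_zero h0
  rw [gpow_mul_gpow_eq (by linarith) (by linarith), mul_div_cancel₀ _ hu]

end

/-- Under t = 1/u the region 1 ≪ |t| ≪ 1/|w| becomes |w| ≪ |u| ≪ 1, and `cut_inv` converts the
cutoff. -/
lemma rest_rhoMid (P Q S : ExpPair) (w : ℂ) : rest (rhoMid w) P Q S w =
    gpow (-1) Q * ∫ u, gpow u (-P - Q - pairOne - pairOne) *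
      (cut (u / (1 / 8 : ℝ)) * cut ((w / u) / (1 / 8 : ℝ))) *
        (gpow (1 - u) Q * gpow (1 - w / u) S) := by
  rw [rest, integral_comp_inv, ← integral_const_mul]
  refine integral_congr_ae ?_
  filter_upwards [ae_ne_zero] with u hu
  have e1 : (1 : ℂ) - u⁻¹ = (-1) * (1 - u) / u := by field_simp; ring
  have e2 : cut (u⁻¹ / (8 : ℝ)) = 1 - cut (u / (1 / 8 : ℝ)) := by
    rw [← cut_inv (div_ne_zero hu (by norm_num))]
    congr 1
    push_cast
    field_simp
  have e3 : gpow u (-P - Q - pairOne - pairOne) = (gpow u P)⁻¹ * (gpow u Q)⁻¹ *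
      ((‖u‖ : ℂ) ^ 4)⁻¹ := by
    rw [gpow_sub hu, gpow_sub hu, gpow_sub hu, gpow_neg, gpow_pairOne]
    have := gpow_ne_zero hu P
    have := gpow_ne_zero hu Q
    field_simp
  simp only [rhoMid]
  rw [e1, e2, e3, gpow_inv, gpow_div, gpow_mul, ← div_eq_mul_inv w u]
  push_cast
  have : (1 - (1 - (cut (u / (1 / 8 : ℝ)) : ℂ))) = cut (u / (1 / 8 : ℝ)) := by ring
  push_cast at this
  rw [this]
  ring

lemma HasMidExpansion.integral {κ : ℝ} {f : ℂ → ℝ → ℂ} (hf : HasMidExpansion κ f) {K : Set ℝ}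
    (hK : IsCompact K) (h0 : ∀ w, ∀ s ∉ K, f w s = 0) :
    ∃ α β : ℂ → ℂ, ContDiff ℝ ∞ α ∧ ContDiff ℝ ∞ β ∧ ∀ w ≠ 0, ‖w‖ ≤ 1 / 256 →
      ∫ s, f w s = α w + β w * singPow κ w := by
  obtain ⟨α, β, h1, h2, h3⟩ := hf
  obtain ⟨R, hR⟩ := hK.isBounded.subset_closedBall (0 : ℝ)
  -- The coefficients need not have compact support in s although their combination has; a bump
  -- equal to 1 on `K` supplies it.
  let η : ContDiffBump (0 : ℝ) := ⟨max R 1, max R 1 + 1, by positivity, by linarith⟩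
  have hη : ContDiff ℝ ∞ fun e : ℂ × ℝ => (η e.2 : ℂ) :=
    Complex.ofRealCLM.contDiff.comp (η.contDiff.comp contDiff_snd)
  have hη0 : ∀ s ∉ tsupport η, η s = 0 := fun s hs => image_eq_zero_of_notMem_tsupport hs
  have hη1 : ∀ s ∈ K, η s = 1 := fun s hs =>
    η.one_of_mem_closedBall (Metric.closedBall_subset_closedBall (le_max_left R 1) (hR hs))
  have g1 := contDiff_integral_snd (hη.mul h1) η.hasCompactSupport (fun z s hs => by
    simp [hη0 s hs])
  have g2 := contDiff_integral_snd (hη.mul h2) η.hasCompactSupport (fun z s hs => by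
    simp [hη0 s hs])
  refine ⟨_, _, g1.2, g2.2, fun w hw hw' => ?_⟩
  rw [← integral_mul_const, ← integral_add (g1.1 w) ((g2.1 w).mul_const _)]
  refine integral_congr_ae (Filter.Eventually.of_forall fun s => ?_)
  by_cases hs : s ∈ K
  · simp only [hη1 s hs]
    rw [h3 w hw hw' s]
    push_cast
    ring
  · have := h3 w hw hw' s
    rw [h0 w s hs] at this
    simp only [h0 w s hs]
    linear_combination (η s : ℂ) * this

/-- The near pair is smooth in w, the far pair is |w|^κ times smooth, and the annulus is covered by
`HasMidExpansion.integral_gpow`. The essential hypothesis is `hPQ`: the dependence on λ cancels in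
the exponent of the annulus, so κ is the same for all s. -/
lemma hasMidExpansion_regConf {κ : ℝ} (hκ : -2 < κ) (hκ2 : κ < 2) {m : ℂ × ℝ → ℂ}
    {kP kQ kS kO : ℤ} {τP τQ τS τO : ℝ → ℂ} (hP : RegExp m kP fun e => τP e.2)
    (hQ : RegExp m kQ fun e => τQ e.2) (hS : RegExp m kS fun e => τS e.2)
    (hO : RegExp m kO fun e => τO e.2)
    (hO' : ∀ s, pairInf (kP, τP s) (kQ, τQ s) (kS, τS s) = (kO, τO s))
    (hPQ : ∀ s, -((kP, τP s) : ExpPair) - (kQ, τQ s) - pairOne = (0, (κ : ℂ)))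
    (hm : ContDiff ℝ ∞ m) (hw : ∀ e ∈ tsupport m, ‖e.1‖ ≤ 1 / 256) :
    HasMidExpansion κ fun w s => m (w, s) * regConf (kP, τP s) (kQ, τQ s) (kS, τS s) w := by
  have hτ : ∀ {k : ℤ} {τ : ℝ → ℂ}, RegExp m k (fun e => τ e.2) → ContDiff ℝ ∞ τ := by
    intro k τ h
    exact h.contDiff.comp ((contDiff_const (c := (0 : ℂ))).prodMk contDiff_id)
  have g1 := contDiff_mul_regNear (kS := kS) hP hQ hS.contDiff hm hw
  have g2 := contDiff_mul_regNear (kS := kQ) hO hS hQ.contDiff hm hw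
  have g3 := HasMidExpansion.integral_gpow hκ hκ2 (kQ := kQ) (kS := kS) (hτ hQ) (hτ hS)
  refine (((HasMidExpansion.of_contDiff g1).add (g3.smooth_mul (hm.mul (contDiff_const
    (c := (-1 : ℂ) ^ kQ))))).add ((HasMidExpansion.gpow_norm κ).smooth_mul
      (g2.mul (contDiff_const (c := (-1 : ℂ) ^ (kQ + kS)))))).congr fun w hw0 hw' s => ?_
  have e1 : rest (rhoMid w) (kP, τP s) (kQ, τQ s) (kS, τS s) w = (-1) ^ kQ *
      ∫ u, midWt κ w u * (gpow (1 - u) (kQ, τQ s) * gpow (1 - w / u) (kS, τS s)) := by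
    rw [rest_rhoMid, gpow_neg_one, hPQ]
    have : ((0, (κ : ℂ)) : ExpPair) - pairOne = (0, (κ : ℂ) - 2) := by simp [pairOne]
    rw [this]
    rfl
  rw [regConf, e1, hPQ, hO', gpow_neg_one]
  change _ = _ + _ + _ * (-1) ^ (kQ + kS) * _
  dsimp only [Prod.fst_add]
  ring

section
variable {a b : ℝ} (hab : InSquare a b) {F : ℤ × ℝ → ℂ} (hF : F ∈ EvenTestFunctions)

/-- The cutoff function near a singular point. -/
def chi (z : ℂ) : ℝ := cut (z / (1 / 1024 : ℝ))

lemma contDiff_chi : ContDiff ℝ ∞ chi := contDiff_cut.comp (contDiff_id.div_const _)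

lemma chi_eq_one {z : ℂ} (hz : ‖z‖ ≤ 1 / 2048) : chi z = 1 :=
  cut_div_eq_one (by norm_num) (by linarith)

lemma tsupport_chi {z : ℂ} (hz : z ∈ tsupport chi) : ‖z‖ ≤ 1 / 256 := by
  have : tsupport chi ⊆ {e | ‖e‖ ≤ 1 / 256} := by
    refine closure_minimal (fun e he => ?_) (isClosed_le continuous_norm continuous_const)
    by_contra h
    replace h : ¬ ‖e‖ ≤ 1 / 256 := h
    exact he (cut_div_eq_zero (by norm_num) (by linarith [not_le.1 h]))
  exact this hz

/-- The localized spectral density. -/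
def locDensity (a b : ℝ) (F : ℤ × ℝ → ℂ) (k : ℤ) (e : ℂ × ℝ) : ℂ :=
  (chi e.1 : ℂ) * density a b F k e.2

include hab hF

lemma contDiff_locDensity (k : ℤ) : ContDiff ℝ ∞ (locDensity a b F k) :=
  contDiff_cutoff_density hab hF contDiff_chi

omit hab hF in
lemma tsupport_locDensity {k : ℤ} {e : ℂ × ℝ} (he : e ∈ tsupport (locDensity a b F k)) :
    ‖e.1‖ ≤ 1 / 256 ∧ e.2 ∈ tsupport (density a b F k) :=
  ⟨tsupport_chi (tsupport_cutoff_density he).1, (tsupport_cutoff_density he).2⟩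

lemma hasExpansionAt_zero (k : ℤ) :
    HasExpansionAt (fun z => ∫ s, adjointIntegrand a b F z k s) 0 (2 - 2 * a - 2 * b) := by
  obtain ⟨hA, hB, hC, hD⟩ := regExp_all hab hF (fun e he => (tsupport_locDensity he).2)
  obtain ⟨b1, b2, b3, b4⟩ := id hab
  obtain ⟨α, β, h1, h2, h3⟩ := (hasMidExpansion_regConf (κ := 2 - 2 * a - 2 * b) (by linarith)
    (by linarith) hA hB hC hD (fun s => pairInf_ABC k s a b) (fun s => by
      ext <;> simp [exA, exB, pairOne]; ring) (contDiff_locDensity hab hF k)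
    (fun e he => (tsupport_locDensity he).1)).integral (hasCompactSupport_density a b hF k)
      (fun w s hs => by simp [locDensity, image_eq_zero_of_notMem_tsupport hs])
  refine ⟨1 / 2048, by norm_num, α, β, h1.contDiffOn, h2.contDiffOn, fun z hz hz0 => ?_⟩
  have hz' : ‖z‖ < 1 / 2048 := by simpa using hz
  rw [sub_zero]
  refine Eq.trans ?_ (h3 z hz0 (by linarith))
  refine integral_congr_ae (Filter.Eventually.of_forall fun s => ?_)
  dsimp only
  rw [adjointIntegrand_eq_zero_chart hab hF hz0 (by linarith) k s, locDensity,
    chi_eq_one hz'.le, Complex.ofReal_one, one_mul]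
  rfl

lemma hasExpansionAt_one (k : ℤ) :
    HasExpansionAt (fun z => ∫ s, adjointIntegrand a b F z k s) 1 (2 * b - 2 * a) := by
  obtain ⟨hA, hB, hC, hD⟩ := regExp_all hab hF (fun e he => (tsupport_locDensity he).2)
  obtain ⟨b1, b2, b3, b4⟩ := id hab
  obtain ⟨α, β, h1, h2, h3⟩ := (hasMidExpansion_regConf (κ := 2 * b - 2 * a) (by linarith)
    (by linarith) hA hD hC hB (fun s => pairInf_ADC k s a b) (fun s => by
      ext <;> simp [exA, exD, pairOne]; ring) (contDiff_locDensity hab hF k)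
    (fun e he => (tsupport_locDensity he).1)).integral (hasCompactSupport_density a b hF k)
      (fun w s hs => by simp [locDensity, image_eq_zero_of_notMem_tsupport hs])
  have hsub : ContDiff ℝ ∞ fun z : ℂ => 1 - z := contDiff_const.sub contDiff_id
  refine ⟨1 / 2048, by norm_num, fun z => (-1) ^ (-k) * α (1 - z), fun z => (-1) ^ (-k) * β (1 - z),
    (contDiff_const.mul (h1.comp hsub)).contDiffOn, (contDiff_const.mul (h2.comp hsub)).contDiffOn,
    fun z hz hz0 => ?_⟩
  have hz' : ‖1 - z‖ < 1 / 2048 := by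
    rw [norm_sub_rev]; simpa [dist_eq_norm] using hz
  have hz0' : 1 - z ≠ 0 := sub_ne_zero.2 (Ne.symm hz0)
  have := h3 (1 - z) hz0' (by linarith)
  rw [norm_sub_rev z 1]
  rw [mul_assoc, ← mul_add]
  change _ = _ * (_ + _ * singPow (2 * b - 2 * a) (1 - z))
  rw [← this, ← integral_const_mul]
  refine integral_congr_ae (Filter.Eventually.of_forall fun s => ?_)
  dsimp only
  rw [adjointIntegrand_eq_one_chart hab hF hz0' (by linarith) k s, locDensity,
    chi_eq_one hz'.le, Complex.ofReal_one, one_mul]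
  change _ = _ * (_ * regConf (exA k s a) (exD k s b) (exC k s a) (1 - z))
  ring

omit hab hF in
lemma HasExpansionAt.sum {ι : Type} {z₀ : ℂ} {κ : ℝ} (T : Finset ι) {f : ι → ℂ → ℂ}
    (h : ∀ i, HasExpansionAt (f i) z₀ κ) : HasExpansionAt (fun z => ∑ i ∈ T, f i z) z₀ κ := by
  classical
  induction T using Finset.induction_on with
  | empty => exact ⟨1, one_pos, fun _ => 0, fun _ => 0, contDiffOn_const, contDiffOn_const,
      fun z _ _ => by simp⟩
  | insert i T hi ih =>
    obtain ⟨r, hr, α, β, h1, h2, h3⟩ := ih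
    obtain ⟨r', hr', α', β', h1', h2', h3'⟩ := h i
    have s1 : Metric.ball z₀ (min r r') ⊆ Metric.ball z₀ r :=
      Metric.ball_subset_ball (min_le_left _ _)
    have s2 : Metric.ball z₀ (min r r') ⊆ Metric.ball z₀ r' :=
      Metric.ball_subset_ball (min_le_right _ _)
    refine ⟨min r r', lt_min hr hr', fun z => α' z + α z, fun z => β' z + β z,
      (h1'.mono s2).add (h1.mono s1), (h2'.mono s2).add (h2.mono s1), fun z hz hz0 => ?_⟩
    have h3 := h3 z (s1 hz) hz0
    dsimp only at h3 ⊢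
    rw [Finset.sum_insert hi, h3, h3' z (s2 hz) hz0]
    ring

theorem hasExpansionAt_adjointJ : HasExpansionAt (adjointJ a b F) 0 (2 - 2 * a - 2 * b) ∧
    HasExpansionAt (adjointJ a b F) 1 (2 * b - 2 * a) := by
  obtain ⟨T, hT⟩ := exists_finset_support hF
  rw [funext (adjointJ_eq_sum a b hT)]
  exact ⟨HasExpansionAt.sum T (hasExpansionAt_zero hab hF),
    HasExpansionAt.sum T (hasExpansionAt_one hab hF)⟩

end

/-! ### Regularized expansions with oscillating exponents -/

lemma hasFDerivAt_gpow_neg_two {u : ℂ} (hu : u ≠ 0) (e : ℂ) :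
    ∃ L : ℂ →L[ℝ] ℂ, HasFDerivAt (fun u : ℂ => gpow u (0, -2)) L u ∧
      L (e * u) = -2 * (e.re : ℂ) * gpow u (0, -2) := by
  have h1 : HasFDerivAt (fun u : ℂ => ‖u‖ ^ 2) (2 • (innerSL ℝ u)) u :=
    (hasStrictFDerivAt_norm_sq u).hasFDerivAt
  have hn : ‖u‖ ^ 2 ≠ 0 := pow_ne_zero 2 (norm_ne_zero_iff.2 hu)
  have h2 := (hasDerivAt_inv hn).hasFDerivAt.comp u h1
  have h3 := (Complex.ofRealCLM.hasFDerivAt (x := (‖u‖ ^ 2)⁻¹)).comp u h2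
  have e0 : ∀ u : ℂ, gpow u (0, -2) = (((‖u‖ ^ 2)⁻¹ : ℝ) : ℂ) := by
    intro u
    have : ((0, -2) : ExpPair) = -pairOne := by simp [pairOne]
    rw [this, gpow_neg, gpow_pairOne]
    push_cast
    rfl
  refine ⟨_, h3.congr_of_eventuallyEq (Filter.Eventually.of_forall fun v => e0 v), ?_⟩
  have h4 : inner ℝ u (e * u) = e.re * ‖u‖ ^ 2 := by
    rw [Complex.inner, mul_assoc, Complex.mul_conj, Complex.re_mul_ofReal, Complex.normSq_eq_norm_sq]
  rw [e0]
  simp [h4]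
  field_simp

/-- For an amplitude vanishing near the origin a factor |u|⁻² can be moved from the power to the
amplitude, which lowers the admissible exponent by 2. -/
theorem integral_gpow_mul_ibp_of_notMem (k : ℤ) {σ : ℂ} (hσ : -4 < σ.re) {φ : ℂ → ℂ}
    (hφ : ContDiff ℝ ∞ φ) (hc : HasCompactSupport φ) (h0 : 0 ∉ tsupport φ) :
    ibpConst k σ * ∫ u, gpow u (k, σ) * φ u =
      -∫ u, gpow u (k, σ) * fderiv ℝ φ u (ibpDir k * u) := by
  have hne : ∀ u ∈ tsupport φ, u ≠ 0 := fun u hu h => h0 (h ▸ hu)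
  have hφ' := contDiff_mul_gpow (g := fun u : ℂ => u) (σ := fun _ => (-2 : ℂ)) 0 hφ
    (fun _ _ => contDiffAt_id) contDiff_const hne
  have hc' : HasCompactSupport fun u => φ u * gpow u (0, -2) := hc.mul_right
  have h := integral_gpow_mul_ibp k (σ := σ + 2) (by simp; linarith) (hφ'.of_le (by simp)) hc'
  have e1 : ∀ u : ℂ, u ≠ 0 → gpow u (k, σ + 2) * gpow u (0, -2) = gpow u (k, σ) := by
    intro u hu
    rw [← gpow_add hu]
    congr 1; ext <;> simp
  have e2 : ∫ u, gpow u (k, σ + 2) * (φ u * gpow u (0, -2)) = ∫ u, gpow u (k, σ) * φ u := by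
    refine integral_congr_ae ?_
    filter_upwards [ae_ne_zero] with u hu
    rw [← e1 u hu]; ring
  have e3 : ∫ u, gpow u (k, σ + 2) * fderiv ℝ (fun u => φ u * gpow u (0, -2)) u (ibpDir k * u) =
      ∫ u, (-2 * ((ibpDir k).re : ℂ)) * (gpow u (k, σ) * φ u) +
        gpow u (k, σ) * fderiv ℝ φ u (ibpDir k * u) := by
    refine integral_congr_ae ?_
    filter_upwards [ae_ne_zero] with u hu
    obtain ⟨L, hL, hL2⟩ := hasFDerivAt_gpow_neg_two hu (ibpDir k)
    have hd : fderiv ℝ (fun u => φ u * gpow u (0, -2)) u = _ := ((hφ.differentiable (by simp) u).hasFDerivAt.mul hL).fderiv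
    rw [hd, ← e1 u hu]
    simp [hL2]
    ring
  have i1 : Integrable fun u => gpow u (k, σ) * φ u := by
    have := contDiff_mul_gpow (g := fun u : ℂ => u) (σ := fun _ => σ) k hφ
      (fun _ _ => contDiffAt_id) contDiff_const hne
    simp only [mul_comm (φ _)] at this
    exact this.continuous.integrable_of_hasCompactSupport hc.mul_left
  have i2 : Integrable fun u => gpow u (k, σ) * fderiv ℝ φ u (ibpDir k * u) := by
    have hd : ContDiff ℝ ∞ fun u => fderiv ℝ φ u (ibpDir k * u) :=
      (hφ.fderiv_right (m := ∞) (by simp)).clm_apply (contDiff_const.mul contDiff_id)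
    have hs : tsupport (fun u => fderiv ℝ φ u (ibpDir k * u)) ⊆ tsupport φ := by
      refine closure_minimal (fun u hu => ?_) (isClosed_tsupport φ)
      by_contra h
      apply hu
      have := image_eq_zero_of_notMem_tsupport (fun h' => h (tsupport_fderiv_subset ℝ h'))
      simp [this]
    have := contDiff_mul_gpow (g := fun u : ℂ => u) (σ := fun _ => σ) k hd
      (fun _ _ => contDiffAt_id) contDiff_const (fun u hu => hne u (hs hu))
    simp only [mul_comm (fderiv ℝ φ _ _)] at this
    exact this.continuous.integrable_of_hasCompactSupport
      (HasCompactSupport.mul_left (hc.mono' (subset_tsupport _ |>.trans hs)))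
  rw [e2, e3, integral_add (i1.const_mul _) i2, integral_const_mul] at h
  have hk : ibpConst k (σ + 2) - 2 * ((ibpDir k).re : ℂ) = ibpConst k σ := by
    unfold ibpConst ibpDir
    split_ifs <;> simp
  rw [← hk]
  linear_combination h

lemma integrable_gpow_mul_fderiv (k : ℤ) {σ : ℂ} (hσ : -3 < σ.re) {φ : ℂ → ℂ}
    (hφ : ContDiff ℝ ∞ φ) (hc : HasCompactSupport φ) (v : ℂ) :
    Integrable fun u => gpow u (k, σ) * fderiv ℝ φ u (v * u) := by
  have hd : ContDiff ℝ ∞ fun u => fderiv ℝ φ u := hφ.fderiv_right (m := ∞) (by simp)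
  have c1 : Continuous fun u => dz φ u * v := by
    have : Continuous fun u => fderiv ℝ φ u := hd.continuous
    unfold dz; fun_prop
  have c2 : Continuous fun u => dzbar φ u * (starRingEnd ℂ) v := by
    have : Continuous fun u => fderiv ℝ φ u := hd.continuous
    unfold dzbar; fun_prop
  have s0 : ∀ u, u ∉ tsupport φ → fderiv ℝ φ u = 0 := fun u h =>
    image_eq_zero_of_notMem_tsupport (fun h' => h (tsupport_fderiv_subset ℝ h'))
  have s1 : HasCompactSupport fun u => dz φ u * v :=
    HasCompactSupport.intro hc fun u hu => by simp [dz, s0 u hu]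
  have s2 : HasCompactSupport fun u => dzbar φ u * (starRingEnd ℂ) v :=
    HasCompactSupport.intro hc fun u hu => by simp [dzbar, s0 u hu]
  have hre : -2 < (σ + 1).re := by simp; linarith
  have j1 := integrable_gpow_mul (P := (k + 1, σ + 1)) hre c1 s1
  have j2 := integrable_gpow_mul (P := (k - 1, σ + 1)) hre c2 s2
  refine (j1.add j2).congr ?_
  filter_upwards [ae_ne_zero] with u hu
  rw [Pi.add_apply, fderiv_apply_mul, gpow_add_one hu, gpow_conj_add_one hu, map_mul]
  ring

/-- The outer cutoff equals 1 on the support of the inner disc's cutoff, so the annular cutoff is a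
difference of two disc cutoffs. -/
lemma cut_mul_cut_div {w u : ℂ} (hw0 : w ≠ 0) (hw : ‖w‖ ≤ 1 / 256) (hu : u ≠ 0) :
    (cut (u / (1 / 8 : ℝ)) : ℂ) * cut ((w / u) / (1 / 8 : ℝ)) =
      cut (u / (1 / 8 : ℝ)) - cut (w⁻¹ * u / (8 : ℝ)) := by
  have hcut : (cut (w / u / (1 / 8 : ℝ)) : ℂ) = 1 - cut (w⁻¹ * u / (8 : ℝ)) := by
    have : w / u / (1 / 8 : ℝ) = (w⁻¹ * u / (8 : ℝ))⁻¹ := by push_cast; field_simp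
    rw [this, cut_inv (by
      refine div_ne_zero (mul_ne_zero (inv_ne_zero hw0) hu) (by norm_num))]
    simp
  have hz : (cut (w⁻¹ * u / (8 : ℝ)) : ℂ) * (1 - cut (u / (1 / 8 : ℝ))) = 0 := by
    by_cases h : ‖w⁻¹ * u‖ ≤ 14
    · have : ‖u‖ ≤ 1 / 16 := by
        have e : u = w * (w⁻¹ * u) := by rw [mul_inv_cancel_left₀ hw0]
        rw [e, norm_mul]
        nlinarith [norm_nonneg w, norm_nonneg (w⁻¹ * u)]
      rw [cut_div_eq_one (u := u) (by norm_num) (by linarith)]; simp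
    · rw [cut_div_eq_zero (u := w⁻¹ * u) (by norm_num) (by linarith)]; simp
  rw [hcut]
  linear_combination hz

/-- Integration by parts in an integral over the intermediate region. -/
lemma ibpConst_mul_integral_oscWt (l : ℤ) {σ : ℂ} (hσ : -3 < σ.re) {G : (ℂ × ℝ) × ℂ → ℂ}
    (hG : ContDiff ℝ ∞ G) {w : ℂ} (hw0 : w ≠ 0) (hw : ‖w‖ ≤ 1 / 256) (s : ℝ) :
    ibpConst l σ * ∫ u, oscWt l σ w u * G ((w, s), u) =
      -(∫ u, gpow u (l, σ) * fderiv ℝ (fun u => (cut (u / (1 / 8 : ℝ)) : ℂ) * G ((w, s), u)) u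
        (ibpDir l * u)) -
      gpow w (l, σ + 2) * ∫ u, gpow u (l, σ) * fderiv ℝ
        (fun u => -((cut (u / (8 : ℝ)) : ℂ) * G ((w, s), w * u))) u (ibpDir l * u) := by
  set φ₁ : ℂ → ℂ := fun u => (cut (u / (1 / 8 : ℝ)) : ℂ) * G ((w, s), u) with hφ₁
  set φ₂ : ℂ → ℂ := fun u => -((cut (u / (8 : ℝ)) : ℂ) * G ((w, s), w * u)) with hφ₂
  have d1 : ContDiff ℝ ∞ φ₁ := (contDiff_cut_comp (g := fun u : ℂ => u) contDiff_id _).mul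
    (hG.comp ((contDiff_const (c := (w, s))).prodMk contDiff_id))
  have d2 : ContDiff ℝ ∞ φ₂ := ((contDiff_cut_comp (g := fun u : ℂ => u) contDiff_id _).mul
    (hG.comp ((contDiff_const (c := (w, s))).prodMk (contDiff_const.mul contDiff_id)))).neg
  have z1 : ∀ u, 7 / 32 < ‖u‖ → φ₁ u = 0 := fun u hu => midAlpha_aux_eq_zero (w, s) u hu
  have z2 : ∀ u, 14 < ‖u‖ → φ₂ u = 0 := fun u hu => midBeta_aux_eq_zero (w, s) u hu
  have c1 : HasCompactSupport φ₁ := HasCompactSupport.intro (isCompact_closedBall (0 : ℂ) (7 / 32))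
    fun u hu => z1 u (by simpa using hu)
  have c2 : HasCompactSupport φ₂ := HasCompactSupport.intro (isCompact_closedBall (0 : ℂ) 14)
    fun u hu => z2 u (by simpa using hu)
  -- The sum vanishes near 0, so integration by parts applies to it. After differentiation along the
  -- linear field each summand is integrable alone, and the two ends can be separated.
  set φ : ℂ → ℂ := fun u => φ₁ u + φ₂ (w⁻¹ * u) with hφ
  have d2' : ContDiff ℝ ∞ fun u => φ₂ (w⁻¹ * u) := d2.comp (contDiff_const.mul contDiff_id)
  have hφd : ContDiff ℝ ∞ φ := d1.add d2'
  have hw' : 0 < ‖w‖ := norm_pos_iff.2 hw0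
  have hφc : HasCompactSupport φ := by
    refine HasCompactSupport.intro (isCompact_closedBall (0 : ℂ) (7 / 32)) fun u hu => ?_
    have hu' : 7 / 32 < ‖u‖ := by simpa using hu
    rw [hφ]
    dsimp only
    rw [z1 u hu', z2, add_zero]
    rw [norm_mul, norm_inv, inv_mul_eq_div, lt_div_iff₀ hw']
    linarith
  have hval : ∀ u, u ≠ 0 → φ u = (cut (u / (1 / 8 : ℝ)) * cut ((w / u) / (1 / 8 : ℝ))) *
      G ((w, s), u) := by
    intro u hu
    rw [cut_mul_cut_div hw0 hw hu]
    simp only [hφ, hφ₁, hφ₂, mul_inv_cancel_left₀ hw0]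
    ring
  have hφ0 : 0 ∉ tsupport φ := by
    rw [notMem_tsupport_iff_eventuallyEq]
    filter_upwards [Metric.ball_mem_nhds (0 : ℂ) (show 0 < ‖w‖ / 2 by positivity)] with u hu
    have hu' : ‖u‖ < ‖w‖ / 2 := by simpa using hu
    by_cases h0 : u = 0
    · simp only [hφ, hφ₁, hφ₂, h0, mul_zero]
      simp [cut_zero]
    · rw [hval u h0, cut_div_eq_zero (u := w / u) (by norm_num)]
      · simp
      · rw [norm_div, le_div_iff₀ (norm_pos_iff.2 h0)]
        linarith [norm_pos_iff.2 h0]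
  have h := integral_gpow_mul_ibp_of_notMem l (by linarith) hφd hφc hφ0
  have e1 : ∫ u, oscWt l σ w u * G ((w, s), u) = ∫ u, gpow u (l, σ) * φ u := by
    refine integral_congr_ae ?_
    filter_upwards [ae_ne_zero] with u hu
    rw [hval u hu, oscWt]
    ring
  have i1 := integrable_gpow_mul_fderiv l hσ d1 c1 (ibpDir l)
  have i2 := integrable_gpow_mul_fderiv l hσ d2 c2 (ibpDir l)
  have i3 := integrable_comp_mul i2 (inv_ne_zero hw0)
  have e2 : gpow w (l, σ + 2) * ∫ u, gpow u (l, σ) * fderiv ℝ φ₂ u (ibpDir l * u) =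
      ∫ u, gpow w (l, σ) * (gpow (w⁻¹ * u) (l, σ) *
        fderiv ℝ φ₂ (w⁻¹ * u) (ibpDir l * (w⁻¹ * u))) := by
    have hn : (‖w‖ : ℂ) ≠ 0 := by exact_mod_cast hw'.ne'
    rw [integral_const_mul, integral_comp_mul
      (fun u => gpow u (l, σ) * fderiv ℝ φ₂ u (ibpDir l * u)) (inv_ne_zero hw0)]
    have : gpow w (l, σ + 2) = gpow w (l, σ) * (‖w‖ : ℂ) ^ 2 := by
      rw [← gpow_pairOne, ← gpow_add hw0]
      congr 1; ext <;> simp [pairOne]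
    rw [this, norm_inv]
    push_cast
    field_simp
  rw [e1, h, e2, ← neg_add', ← integral_add i1 (i3.const_mul _)]
  congr 1
  refine integral_congr_ae ?_
  filter_upwards [ae_ne_zero] with u hu
  have hd : fderiv ℝ φ u (ibpDir l * u) = fderiv ℝ φ₁ u (ibpDir l * u) +
      fderiv ℝ φ₂ (w⁻¹ * u) (ibpDir l * (w⁻¹ * u)) := by
    have f1 := (d1.differentiable (by simp) u).hasFDerivAt
    have f3 : HasFDerivAt (fun u : ℂ => w⁻¹ * u) (w⁻¹ • ContinuousLinearMap.id ℝ ℂ) u :=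
      (hasFDerivAt_id u).const_mul w⁻¹
    have f2 := (d2.differentiable (by simp) (w⁻¹ * u)).hasFDerivAt.comp u f3
    have f4 : fderiv ℝ φ u = _ := (f1.add f2).fderiv
    rw [f4]
    simp only [ContinuousLinearMap.add_apply, ContinuousLinearMap.comp_apply,
      ContinuousLinearMap.smul_apply, ContinuousLinearMap.id_apply, smul_eq_mul]
    congr 2
    ring
  rw [hd, gpow_mul, gpow_inv, ← mul_assoc (gpow w (l, σ)), mul_inv_cancel_left₀ (gpow_ne_zero hw0 _)]
  ring

/-- The oscillating counterpart of `integral_midWt_eq`: neither end of the annulus need converge,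
but dividing by the local constant, nonzero on the support of `m`, replaces convergence. -/
theorem exists_regular_expansion {m σ : ℂ × ℝ → ℂ} {l : ℤ} (hm : ContDiff ℝ ∞ m)
    (hσ : RegExp m l σ) {G : (ℂ × ℝ) × ℂ → ℂ} (hG : ContDiff ℝ ∞ G) :
    ∃ A B : ℂ × ℝ → ℂ, ContDiff ℝ ∞ A ∧ ContDiff ℝ ∞ B ∧ (∀ e, m e = 0 → A e = 0 ∧ B e = 0) ∧
      ∀ w ≠ 0, ‖w‖ ≤ 1 / 256 → ∀ s : ℝ,
        m (w, s) * ∫ u, oscWt l (σ (w, s)) w u * G ((w, s), u) =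
          A (w, s) + gpow w (l, σ (w, s) + 2) * B (w, s) := by
  have h1 := contDiff_integral_gpow_fderiv (E := ℂ × ℝ) l hσ.contDiff hσ.re_gt
    (contDiff_midAlpha_aux hG) (7 / 32) midAlpha_aux_eq_zero (ibpDir l)
  have h2 := contDiff_integral_gpow_fderiv (E := ℂ × ℝ) l hσ.contDiff hσ.re_gt
    (contDiff_midBeta_aux hG) 14 midBeta_aux_eq_zero (ibpDir l)
  have hmi := (contDiff_mul_inv_ibpConst hm hσ).neg
  refine ⟨_, _, hmi.mul h1, hmi.mul h2, fun e he => by simp [he], fun w hw0 hw s => ?_⟩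
  have h := ibpConst_mul_integral_oscWt l (hσ.re_gt (w, s)) hG hw0 hw s
  by_cases hm0 : m (w, s) = 0
  · simp [hm0]
  have hc := hσ.ne (w, s) (subset_tsupport m hm0)
  have h3 : ∫ u, oscWt l (σ (w, s)) w u * G ((w, s), u) = (ibpConst l (σ (w, s)))⁻¹ *
      (ibpConst l (σ (w, s)) * ∫ u, oscWt l (σ (w, s)) w u * G ((w, s), u)) := by
    rw [inv_mul_cancel_left₀ hc]
  rw [h3, h]
  dsimp only
  ring

/-! ### Wirtinger derivatives -/

/-- `f` is real differentiable at `z` with `∂f/∂z = p` and `∂f/∂(conj z) = q`. -/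
def HasWirt (f : ℂ → ℂ) (p q z : ℂ) : Prop :=
  ∃ L : ℂ →L[ℝ] ℂ, HasFDerivAt f L z ∧ ∀ v, L v = p * v + q * (starRingEnd ℂ) v

lemma realLinear_eq (M : ℂ →L[ℝ] ℂ) (v : ℂ) :
    M v = (M 1 - Complex.I * M Complex.I) / 2 * v +
      (M 1 + Complex.I * M Complex.I) / 2 * (starRingEnd ℂ) v := by
  have h : M v = v.re * M 1 + v.im * M Complex.I := by
    conv_lhs => rw [show v = v.re • (1 : ℂ) + v.im • Complex.I by
      rw [Complex.real_smul, Complex.real_smul, mul_one]; exact (Complex.re_add_im v).symm]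
    rw [map_add, map_smul, map_smul]
    simp
  have h1 : v = v.re + v.im * Complex.I := (Complex.re_add_im v).symm
  have h2 : (starRingEnd ℂ) v = v.re - v.im * Complex.I := by
    apply Complex.ext <;> simp
  rw [h, h2]
  nth_rewrite 3 [h1]
  linear_combination ((v.im : ℂ) * M Complex.I) * Complex.I_sq

section
variable {f g : ℂ → ℂ} {p q p' q' z : ℂ}

lemma HasWirt.coeff_eq (h : HasWirt f p q z) :
    p = (fderiv ℝ f z 1 - Complex.I * fderiv ℝ f z Complex.I) / 2 ∧
    q = (fderiv ℝ f z 1 + Complex.I * fderiv ℝ f z Complex.I) / 2 := by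
  obtain ⟨L, hL, hv⟩ := h
  rw [hL.fderiv, hv, hv]
  simp only [map_one, Complex.conj_I]
  constructor
  · linear_combination (p / 2 - q / 2) * Complex.I_sq
  · linear_combination (-p / 2 + q / 2) * Complex.I_sq

lemma HasWirt.dz_eq (h : HasWirt f p q z) : dz f z = p := h.coeff_eq.1.symm

lemma HasWirt.dzbar_eq (h : HasWirt f p q z) : dzbar f z = q := h.coeff_eq.2.symm

lemma HasWirt.add (hf : HasWirt f p q z) (hg : HasWirt g p' q' z) :
    HasWirt (fun z => f z + g z) (p + p') (q + q') z := by
  obtain ⟨L, hL, hv⟩ := hf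
  obtain ⟨L', hL', hv'⟩ := hg
  exact ⟨L + L', hL.add hL', fun v => by simp [hv, hv']; ring⟩

lemma HasWirt.mul (hf : HasWirt f p q z) (hg : HasWirt g p' q' z) :
    HasWirt (fun z => f z * g z) (p * g z + f z * p') (q * g z + f z * q') z := by
  obtain ⟨L, hL, hv⟩ := hf
  obtain ⟨L', hL', hv'⟩ := hg
  exact ⟨_, hL.mul hL', fun v => by simp [hv, hv']; ring⟩

lemma HasWirt.const_mul (c : ℂ) (hf : HasWirt f p q z) :
    HasWirt (fun z => c * f z) (c * p) (c * q) z := by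
  obtain ⟨L, hL, hv⟩ := hf
  exact ⟨_, hL.const_mul c, fun v => by simp [hv]; ring⟩

lemma HasWirt.congr (hf : HasWirt f p q z) (h : g =ᶠ[𝓝 z] f) : HasWirt g p q z := by
  obtain ⟨L, hL, hv⟩ := hf
  exact ⟨L, hL.congr_of_eventuallyEq h, hv⟩

lemma HasWirt.congr_coeff (hf : HasWirt f p q z) (hp : p' = p) (hq : q' = q) :
    HasWirt f p' q' z := by
  rw [hp, hq]; exact hf

end

lemma gpow_sub_one {z : ℂ} (hz : z ≠ 0) (k : ℤ) (σ : ℂ) :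
    gpow z (k - 1, σ - 1) = gpow z (k, σ) * z⁻¹ := by
  have := gpow_add_one hz (k - 1) (σ - 1)
  rw [sub_add_cancel, sub_add_cancel] at this
  rw [this, mul_inv_cancel_right₀ hz]

lemma gpow_conj_sub_one {z : ℂ} (hz : z ≠ 0) (k : ℤ) (σ : ℂ) :
    gpow z (k + 1, σ - 1) = gpow z (k, σ) * ((starRingEnd ℂ) z)⁻¹ := by
  have := gpow_conj_add_one hz (k + 1) (σ - 1)
  rw [add_sub_cancel_right, sub_add_cancel] at this
  rw [this, mul_inv_cancel_right₀ ((map_ne_zero _).2 hz)]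

lemma hasWirt_log_norm {z : ℂ} (hz : z ≠ 0) :
    HasWirt (fun z => (Real.log ‖z‖ : ℂ)) (2⁻¹ * z⁻¹) (2⁻¹ * ((starRingEnd ℂ) z)⁻¹) z := by
  have h1 : HasFDerivAt (fun u : ℂ => ‖u‖ ^ 2) (2 • (innerSL ℝ z)) z :=
    (hasStrictFDerivAt_norm_sq z).hasFDerivAt
  have hn : ‖z‖ ^ 2 ≠ 0 := pow_ne_zero 2 (norm_ne_zero_iff.2 hz)
  have h3 := (Complex.ofRealCLM.hasFDerivAt (x := 2⁻¹ * Real.log (‖z‖ ^ 2))).comp z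
    ((h1.log hn).const_mul (2⁻¹ : ℝ))
  refine ⟨_, h3.congr_of_eventuallyEq (Filter.Eventually.of_forall fun v => ?_), fun v => ?_⟩
  · simp
  · have hz' : (starRingEnd ℂ) z ≠ 0 := (map_ne_zero _).2 hz
    have h4 : (v.re : ℂ) * z.re + v.im * z.im =
        (v * (starRingEnd ℂ) z + (starRingEnd ℂ) v * z) / 2 := by
      apply Complex.ext <;> simp; ring
    have h5 : (‖z‖ : ℂ) ^ 2 = z * (starRingEnd ℂ) z := (Complex.mul_conj' z).symm
    simp [h5]
    field_simp
    rw [h4]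
    ring

lemma hasWirt_gpow {z : ℂ} (hz : z ≠ 0) (k : ℤ) (σ : ℂ) : HasWirt (fun z => gpow z (k, σ))
    ((k + σ) / 2 * gpow z (k - 1, σ - 1)) ((σ - k) / 2 * gpow z (k + 1, σ - 1)) z := by
  have e : (fun z => gpow z (k, σ)) =ᶠ[𝓝 z] fun z => z ^ k *
      Complex.exp ((σ - k) * (Real.log ‖z‖ : ℝ)) := by
    filter_upwards [isOpen_ne.mem_nhds hz] with y hy using gpow_eq_exp hy (k, σ)
  have h1 : HasWirt (fun z : ℂ => z ^ k) (k * z ^ (k - 1)) 0 z :=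
    ⟨_, (hasDerivAt_zpow k z (Or.inl hz)).hasFDerivAt.restrictScalars ℝ, fun v => by
      simp [mul_comm]⟩
  have h2 : HasWirt (fun z : ℂ => Complex.exp ((σ - k) * (Real.log ‖z‖ : ℝ)))
      (Complex.exp ((σ - k) * (Real.log ‖z‖ : ℝ)) * ((σ - k) * (2⁻¹ * z⁻¹)))
      (Complex.exp ((σ - k) * (Real.log ‖z‖ : ℝ)) * ((σ - k) * (2⁻¹ * ((starRingEnd ℂ) z)⁻¹))) z := by
    obtain ⟨L, hL, hv⟩ := (hasWirt_log_norm hz).const_mul (σ - k)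
    exact ⟨_, hL.cexp, fun v => by simp [hv]; ring⟩
  refine ((h1.mul h2).congr e).congr_coeff ?_ ?_
  · rw [gpow_sub_one hz, gpow_eq_exp hz, zpow_sub_one₀ hz]
    dsimp only
    ring
  · rw [gpow_conj_sub_one hz, gpow_eq_exp hz]
    dsimp only
    ring

section
variable {E : Type} [NormedAddCommGroup E] [NormedSpace ℝ E]

/-- The holomorphic part of the derivative of `Φ` at `x` along the complex line `T`. -/
def thDer (Φ : E → ℂ) (x : E) (T : ℂ → E) : ℂ :=
  (fderiv ℝ Φ x (T 1) - Complex.I * fderiv ℝ Φ x (T Complex.I)) / 2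

/-- The antiholomorphic part of the derivative of `Φ` at `x` along the complex line `T`. -/
def thDerBar (Φ : E → ℂ) (x : E) (T : ℂ → E) : ℂ :=
  (fderiv ℝ Φ x (T 1) + Complex.I * fderiv ℝ Φ x (T Complex.I)) / 2

/-- When P depends on z through 1/z, its derivative is -1/z times a dilation field `T`. The factor
1/z is kept outside, so what remains is again a smooth amplitude in the variable 1/z. -/
lemma hasWirt_comp_inv {Φ : E → ℂ} {P : ℂ → E} {z : ℂ} (hΦ : DifferentiableAt ℝ Φ (P z))
    (T : ℂ →L[ℝ] E) (hP : HasFDerivAt P (T.comp ((-z⁻¹) • ContinuousLinearMap.id ℝ ℂ)) z) :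
    HasWirt (fun z => Φ (P z)) (-z⁻¹ * thDer Φ (P z) T)
      (-(starRingEnd ℂ) z⁻¹ * thDerBar Φ (P z) T) z := by
  refine ⟨_, hΦ.hasFDerivAt.comp z hP, fun v => ?_⟩
  have := realLinear_eq ((fderiv ℝ Φ (P z)).comp T) (-z⁻¹ * v)
  simp only [ContinuousLinearMap.comp_apply] at this
  change fderiv ℝ Φ (P z) (T (-z⁻¹ * v)) = _
  rw [this, thDer, thDerBar, map_mul, map_neg]
  ring

end

section
variable {X : Type} [NormedAddCommGroup X] [NormedSpace ℝ X]
  [MeasurableSpace X] [BorelSpace X] {μ : Measure X} [IsFiniteMeasureOnCompacts μ]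

/-- Differentiation under the integral sign. -/
theorem HasWirt.integral {g p q : ℂ → X → ℂ} {z₀ : ℂ} {U : Set ℂ} (hU : U ∈ 𝓝 z₀) {K : Set X}
    (hK : IsCompact K) (h0 : ∀ z ∈ U, ∀ x ∉ K, g z x = 0)
    (hg : ∀ z ∈ U, ∀ x, ContDiffAt ℝ ∞ (fun e : ℂ × X => g e.1 e.2) (z, x))
    (h : ∀ x, HasWirt (fun z => g z x) (p z₀ x) (q z₀ x) z₀) :
    HasWirt (fun z => ∫ x, g z x ∂μ) (∫ x, p z₀ x ∂μ) (∫ x, q z₀ x ∂μ) z₀ := by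
  obtain ⟨r, hr, hrU⟩ := Metric.nhds_basis_closedBall.mem_iff.1 hU
  have hb : Metric.ball z₀ r ⊆ U := Metric.ball_subset_closedBall.trans hrU
  set F' : ℂ → X → ℂ →L[ℝ] ℂ := fun z x =>
    (fderiv ℝ (fun e : ℂ × X => g e.1 e.2) (z, x)).comp (ContinuousLinearMap.inl ℝ ℂ X) with hF'
  have hd : ∀ z ∈ U, ∀ x, HasFDerivAt (fun z => g z x) (F' z x) z := fun z hz x => by
    have h1 : HasFDerivAt (fun z : ℂ => (z, x)) (ContinuousLinearMap.inl ℝ ℂ X) z :=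
      hasFDerivAt_prodMk_left z x
    have h2 : DifferentiableAt ℝ (fun e : ℂ × X => g e.1 e.2) (z, x) :=
      (hg z hz x).differentiableAt (by simp)
    exact h2.hasFDerivAt.comp z h1
  have hcF' : ∀ z ∈ U, ∀ x, ContinuousAt (fun e : ℂ × X => F' e.1 e.2) (z, x) := fun z hz x => by
    have : ContinuousAt (fderiv ℝ (fun e : ℂ × X => g e.1 e.2)) (z, x) :=
      ((hg z hz x).fderiv_right (m := ∞) (by simp)).continuousAt
    exact this.clm_comp continuousAt_const
  have hF'0 : ∀ z ∈ Metric.ball z₀ r, ∀ x ∉ K, F' z x = 0 := by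
    intro z hz x hx
    have e : (fun z => g z x) =ᶠ[𝓝 z] fun _ => 0 := by
      filter_upwards [Metric.isOpen_ball.mem_nhds hz] with y hy using h0 y (hb hy) x hx
    exact (hd z (hb hz) x).unique ((hasFDerivAt_const (0 : ℂ) z).congr_of_eventuallyEq e)
  have hz₀ : z₀ ∈ Metric.ball z₀ r := Metric.mem_ball_self hr
  have hcont : ∀ z ∈ U, Continuous (g z) := fun z hz => continuous_iff_continuousAt.2 fun x =>
    (hg z hz x).continuousAt.comp (f := fun x => (z, x)) (Continuous.prodMk_right z).continuousAt
  have hcont' : Continuous (F' z₀) := continuous_iff_continuousAt.2 fun x =>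
    (hcF' z₀ (hb hz₀) x).comp (f := fun x => (z₀, x)) (Continuous.prodMk_right z₀).continuousAt
  obtain ⟨C, hC⟩ := ((isCompact_closedBall z₀ r).prod hK).exists_bound_of_continuousOn
    (f := fun e : ℂ × X => F' e.1 e.2) fun e he => (hcF' e.1 (hrU he.1) e.2).continuousWithinAt
  have hi : Integrable (F' z₀) μ :=
    hcont'.integrable_of_hasCompactSupport (HasCompactSupport.intro hK (hF'0 z₀ hz₀))
  have hmain := hasFDerivAt_integral_of_dominated_of_fderiv_le (μ := μ) (F := g) (F' := F')
    (bound := K.indicator fun _ => C) (Metric.ball_mem_nhds z₀ hr)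
    (by
      filter_upwards [hU] with z hz using (hcont z hz).aestronglyMeasurable)
    ((hcont z₀ (hb hz₀)).integrable_of_hasCompactSupport
      (HasCompactSupport.intro hK (h0 z₀ (hb hz₀))))
    hcont'.aestronglyMeasurable
    (by
      refine Filter.Eventually.of_forall fun x z hz => ?_
      by_cases hx : x ∈ K
      · rw [Set.indicator_of_mem hx]
        exact hC (z, x) ⟨Metric.ball_subset_closedBall hz, hx⟩
      · rw [Set.indicator_of_notMem hx, hF'0 z hz x hx, norm_zero])
    (by
      rw [integrable_indicator_iff hK.measurableSet]
      exact integrableOn_const hK.measure_lt_top.ne)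
    (Filter.Eventually.of_forall fun x z hz => hd z (hb hz) x)
  refine ⟨_, hmain, fun v => ?_⟩
  have i1 : ∀ v, Integrable (fun x => F' z₀ x v) μ := fun v => hi.apply_continuousLinearMap v
  have hpq : ∀ x, p z₀ x = (F' z₀ x 1 - Complex.I * F' z₀ x Complex.I) / 2 ∧
      q z₀ x = (F' z₀ x 1 + Complex.I * F' z₀ x Complex.I) / 2 := fun x => by
    have := (h x).coeff_eq
    rwa [(hd z₀ (hb hz₀) x).fderiv] at this
  have ip : Integrable (p z₀) μ := by
    rw [funext fun x => (hpq x).1]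
    exact ((i1 1).sub ((i1 Complex.I).const_mul _)).div_const 2
  have iq : Integrable (q z₀) μ := by
    rw [funext fun x => (hpq x).2]
    exact ((i1 1).add ((i1 Complex.I).const_mul _)).div_const 2
  rw [ContinuousLinearMap.integral_apply hi, ← integral_mul_const, ← integral_mul_const,
    ← integral_add (ip.mul_const _) (iq.mul_const _)]
  refine integral_congr_ae (Filter.Eventually.of_forall fun x => ?_)
  dsimp only
  rw [(hpq x).1, (hpq x).2]
  exact realLinear_eq _ v

end

/-! ### Oscillatory integrals at infinity -/

section
variable {E : Type} [NormedAddCommGroup E] [NormedSpace ℝ E] {Φ : E → ℂ} {T : E → ℂ → E}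

lemma contDiff_thDer (hΦ : ContDiff ℝ ∞ Φ) (hT : ∀ c, ContDiff ℝ ∞ fun x => T x c) :
    ContDiff ℝ ∞ fun x => thDer Φ x (T x) := by
  have h : ContDiff ℝ ∞ (fderiv ℝ Φ) := hΦ.fderiv_right (m := ∞) (by simp)
  exact ((h.clm_apply (hT 1)).sub (contDiff_const.mul (h.clm_apply (hT _)))).div_const 2

lemma contDiff_thDerBar (hΦ : ContDiff ℝ ∞ Φ) (hT : ∀ c, ContDiff ℝ ∞ fun x => T x c) :
    ContDiff ℝ ∞ fun x => thDerBar Φ x (T x) := by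
  have h : ContDiff ℝ ∞ (fderiv ℝ Φ) := hΦ.fderiv_right (m := ∞) (by simp)
  exact ((h.clm_apply (hT 1)).add (contDiff_const.mul (h.clm_apply (hT _)))).div_const 2

lemma thDer_eq_zero {x : E} (h : Φ =ᶠ[𝓝 x] fun _ => 0) (S : ℂ → E) :
    thDer Φ x S = 0 ∧ thDerBar Φ x S = 0 := by
  have : fderiv ℝ Φ x = 0 := by rw [h.fderiv_eq]; simp
  simp [thDer, thDerBar, this]

end

/-- An oscillatory integral over the spectral parameter. -/
def oscInt (ρ : ℝ) (j : ℤ) (ε : ℝ) (G : ℂ × ℝ → ℂ) (z : ℂ) : ℂ :=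
  ∫ s : ℝ, gpow z (j, -(ρ : ℂ) + ε * Complex.I * s) * G (z⁻¹, s)

/-- The dilation field in the first variable. -/
def dilOsc (e : ℂ × ℝ) (c : ℂ) : ℂ × ℝ := (e.1 * c, 0)

lemma contDiff_dilOsc (c : ℂ) : ContDiff ℝ ∞ fun e => dilOsc e c :=
  (contDiff_fst.mul contDiff_const).prodMk contDiff_const

lemma hasFDerivAt_inv_complex {z : ℂ} (hz : z ≠ 0) : HasFDerivAt (fun z : ℂ => z⁻¹)
    ((z⁻¹ • ContinuousLinearMap.id ℝ ℂ).comp ((-z⁻¹) • ContinuousLinearMap.id ℝ ℂ)) z := by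
  refine ((hasDerivAt_inv hz).hasFDerivAt.restrictScalars ℝ).congr_fderiv ?_
  ext
  · simp; field_simp

section
variable {ρ : ℝ} {j : ℤ} {ε : ℝ} {G : ℂ × ℝ → ℂ} {K : Set ℝ}

/-- The amplitude of the derivative of an oscillatory integral. -/
def oscDz (ρ : ℝ) (j : ℤ) (ε : ℝ) (G : ℂ × ℝ → ℂ) (e : ℂ × ℝ) : ℂ :=
  (j + (-(ρ : ℂ) + ε * Complex.I * e.2)) / 2 * G e - thDer G e (dilOsc e)

/-- The amplitude of the conjugate derivative of an oscillatory integral. -/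
def oscDzbar (ρ : ℝ) (j : ℤ) (ε : ℝ) (G : ℂ × ℝ → ℂ) (e : ℂ × ℝ) : ℂ :=
  ((-(ρ : ℂ) + ε * Complex.I * e.2) - j) / 2 * G e - thDerBar G e (dilOsc e)

lemma contDiff_oscDz (hG : ContDiff ℝ ∞ G) : ContDiff ℝ ∞ (oscDz ρ j ε G) :=
  (((contDiff_const.add (contDiff_const.add (contDiff_const.mul contDiff_ofReal_snd))).div_const
    2).mul hG).sub (contDiff_thDer hG contDiff_dilOsc)

lemma contDiff_oscDzbar (hG : ContDiff ℝ ∞ G) : ContDiff ℝ ∞ (oscDzbar ρ j ε G) :=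
  ((((contDiff_const.add (contDiff_const.mul contDiff_ofReal_snd)).sub contDiff_const).div_const
    2).mul hG).sub (contDiff_thDerBar hG contDiff_dilOsc)

lemma osc_eventually_zero (hK : IsCompact K) (h0 : ∀ e : ℂ × ℝ, e.2 ∉ K → G e = 0) {e : ℂ × ℝ}
    (he : e.2 ∉ K) : G =ᶠ[𝓝 e] fun _ => 0 := by
  filter_upwards [(hK.isClosed.isOpen_compl.preimage continuous_snd).mem_nhds he] with y hy
  exact h0 y hy

/-- Whether the derivative hits the power or the amplitude, a factor 1/z or 1/conj z comes out,
which shifts the exponent and raises ρ by one; the new amplitude is still smooth. -/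
lemma hasWirt_oscInt (hG : ContDiff ℝ ∞ G) (hK : IsCompact K)
    (h0 : ∀ e : ℂ × ℝ, e.2 ∉ K → G e = 0) {z : ℂ} (hz : z ≠ 0) :
    HasWirt (oscInt ρ j ε G) (oscInt (ρ + 1) (j - 1) ε (oscDz ρ j ε G) z)
      (oscInt (ρ + 1) (j + 1) ε (oscDzbar ρ j ε G) z) z := by
  have hτ : ∀ s : ℝ, -((ρ + 1 : ℝ) : ℂ) + ε * Complex.I * s =
      -(ρ : ℂ) + ε * Complex.I * s - 1 := fun s => by push_cast; ring
  refine HasWirt.integral (μ := volume) (isOpen_ne.mem_nhds hz) hK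
    (X := ℝ) (g := fun z (s : ℝ) => gpow z (j, -(ρ : ℂ) + ε * Complex.I * s) * G (z⁻¹, s))
    (p := fun z (s : ℝ) => gpow z (j - 1, -((ρ + 1 : ℝ) : ℂ) + ε * Complex.I * s) *
      oscDz ρ j ε G (z⁻¹, s))
    (q := fun z (s : ℝ) => gpow z (j + 1, -((ρ + 1 : ℝ) : ℂ) + ε * Complex.I * s) *
      oscDzbar ρ j ε G (z⁻¹, s)) ?_ ?_ ?_
  · intro z _ s hs
    rw [h0 (z⁻¹, s) hs, mul_zero]
  · intro z hz s
    have hz' : z ≠ 0 := hz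
    refine (contDiffAt_gpow_comp j contDiffAt_fst (contDiffAt_const.add
      (contDiffAt_const.mul contDiff_ofReal_snd.contDiffAt)) hz').mul
      (hG.contDiffAt.comp _ ((contDiffAt_fst.inv hz').prodMk contDiffAt_snd))
  · intro s
    have hP : HasFDerivAt (fun z : ℂ => (z⁻¹, s)) (((ContinuousLinearMap.inl ℝ ℂ ℝ).comp
        (z⁻¹ • ContinuousLinearMap.id ℝ ℂ)).comp ((-z⁻¹) • ContinuousLinearMap.id ℝ ℂ)) z := by
      refine ((hasFDerivAt_inv_complex hz).prodMk (hasFDerivAt_const s z)).congr_fderiv ?_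
      ext <;> simp
    have h := (hasWirt_gpow hz j (-(ρ : ℂ) + ε * Complex.I * s)).mul
      (hasWirt_comp_inv (hG.differentiable (by simp) (z⁻¹, s)) _ hP)
    have e : (⇑((ContinuousLinearMap.inl ℝ ℂ ℝ).comp (z⁻¹ • ContinuousLinearMap.id ℝ ℂ)) :
        ℂ → ℂ × ℝ) = dilOsc (z⁻¹, s) := by
      funext c; simp [dilOsc]
    rw [e] at h
    refine h.congr_coeff ?_ ?_
    · rw [hτ, gpow_sub_one hz, oscDz]
      ring
    · rw [hτ, gpow_conj_sub_one hz, oscDzbar, map_inv₀]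
      ring

lemma gpow_oscillation {z : ℂ} (hz : z ≠ 0) (s : ℝ) :
    gpow z (j, -(ρ : ℂ) + ε * Complex.I * s) = gpow z (j, -(ρ : ℂ)) *
      Complex.exp (ε * Real.log ‖z‖ * Complex.I * s) := by
  rw [gpow_eq_exp hz, gpow_eq_exp hz, mul_assoc (z ^ (j, -(ρ : ℂ)).1),
    ← Complex.exp_add]
  congr 2
  dsimp only
  ring

/-- Repeated integration by parts in s against exp(iεs log|z|): each step gains 1/(ε log|z|) and
replaces the amplitude by its s-derivative. -/
lemma exists_bound_oscillation (hε : ε ≠ 0) (hK : IsCompact K) (N : ℕ) :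
    ∀ G : ℂ × ℝ → ℂ, ContDiff ℝ ∞ G → (∀ e : ℂ × ℝ, e.2 ∉ K → G e = 0) → ∃ C, ∀ z : ℂ, 1 ≤ ‖z‖ →
      ‖∫ s : ℝ, Complex.exp (ε * Real.log ‖z‖ * Complex.I * s) * G (z⁻¹, s)‖ *
        |Real.log ‖z‖| ^ N ≤ C := by
  have hexp : ∀ (L s : ℝ), ‖Complex.exp (ε * L * Complex.I * s)‖ = 1 := fun L s => by
    rw [show (ε : ℂ) * L * Complex.I * s = ((ε * L * s : ℝ) : ℂ) * Complex.I by push_cast; ring]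
    exact Complex.norm_exp_ofReal_mul_I _
  induction N with
  | zero =>
    intro G hG h0
    obtain ⟨M, hM⟩ := ((isCompact_closedBall (0 : ℂ) 1).prod hK).exists_bound_of_continuousOn
      hG.continuous.continuousOn
    refine ⟨M * (volume K).toReal, fun z hz => ?_⟩
    have hw : ‖z⁻¹‖ ≤ 1 := by rw [norm_inv]; exact inv_le_one_of_one_le₀ hz
    rw [pow_zero, mul_one, ← setIntegral_eq_integral_of_forall_compl_eq_zero (s := K) fun s hs => by
      rw [h0 _ hs, mul_zero]]
    refine norm_setIntegral_le_of_norm_le_const hK.measure_lt_top fun s hs => ?_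
    rw [norm_mul, hexp, one_mul]
    exact hM (z⁻¹, s) ⟨by simpa using hw, hs⟩
  | succ N ih =>
    intro G hG h0
    set G' : ℂ × ℝ → ℂ := fun e => fderiv ℝ G e (0, 1) with hG'
    have hGd : ContDiff ℝ ∞ G' :=
      (hG.fderiv_right (m := ∞) (by simp)).clm_apply contDiff_const
    have hG0 : ∀ e : ℂ × ℝ, e.2 ∉ K → G' e = 0 := fun e he => by
      have : fderiv ℝ G e = 0 := by rw [(osc_eventually_zero hK h0 he).fderiv_eq]; simp
      simp [hG', this]
    obtain ⟨C, hC⟩ := ih G' hGd hG0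
    refine ⟨|ε|⁻¹ * C, fun z hz => ?_⟩
    set L := Real.log ‖z‖
    set c : ℂ := ε * L * Complex.I with hc
    have hcont : ∀ Φ : ℂ × ℝ → ℂ, ContDiff ℝ ∞ Φ → (∀ e : ℂ × ℝ, e.2 ∉ K → Φ e = 0) →
        Integrable fun s : ℝ => Complex.exp (c * s) * Φ (z⁻¹, s) := by
      intro Φ hΦ hΦ0
      have : Continuous fun s : ℝ => Complex.exp (c * s) * Φ (z⁻¹, s) :=
        (Complex.continuous_exp.comp (continuous_const.mul Complex.continuous_ofReal)).mul
          (hΦ.continuous.comp (Continuous.prodMk_right z⁻¹))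
      exact this.integrable_of_hasCompactSupport (HasCompactSupport.intro hK fun s hs => by
        rw [hΦ0 _ hs, mul_zero])
    have hd : ∀ s : ℝ, HasDerivAt (fun s : ℝ => Complex.exp (c * s) * G (z⁻¹, s))
        (c * (Complex.exp (c * s) * G (z⁻¹, s)) + Complex.exp (c * s) * G' (z⁻¹, s)) s := by
      intro s
      have h1 : HasDerivAt (fun s : ℝ => Complex.exp (c * s)) (Complex.exp (c * s) * c) s := by
        have := (Complex.ofRealCLM.hasDerivAt (x := s)).const_mul c
        simpa using this.cexp
      have h2 : HasDerivAt (fun s : ℝ => G (z⁻¹, s)) (G' (z⁻¹, s)) s := by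
        have h3 : HasDerivAt (fun s : ℝ => (z⁻¹, s)) ((0 : ℂ), (1 : ℝ)) s :=
          (hasDerivAt_const s z⁻¹).prodMk (hasDerivAt_id s)
        exact (hG.differentiable (by simp) (z⁻¹, s)).hasFDerivAt.comp_hasDerivAt s h3
      refine (h1.mul h2).congr_deriv ?_
      ring
    have i1 := hcont G hG h0
    have i2 := hcont G' hGd hG0
    have hz0 := integral_eq_zero_of_hasDerivAt_of_integrable hd ((i1.const_mul c).add i2) i1
    rw [integral_add (i1.const_mul c) i2, integral_const_mul] at hz0
    have hn : |ε| * |L| * ‖∫ s : ℝ, Complex.exp (c * s) * G (z⁻¹, s)‖ =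
        ‖∫ s : ℝ, Complex.exp (c * s) * G' (z⁻¹, s)‖ := by
      rw [← norm_neg (∫ s : ℝ, Complex.exp (c * s) * G' (z⁻¹, s)), ← eq_neg_of_add_eq_zero_left hz0,
        norm_mul, hc]
      simp
    have hε' : 0 < |ε| := abs_pos.2 hε
    rw [le_inv_mul_iff₀ hε']
    calc _ = (|ε| * |L| * ‖∫ s : ℝ, Complex.exp (c * s) * G (z⁻¹, s)‖) * |L| ^ N := by ring
      _ ≤ C := by rw [hn]; exact hC z hz

lemma isBigO_oscInt (hε : ε ≠ 0) (hG : ContDiff ℝ ∞ G) (hK : IsCompact K)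
    (h0 : ∀ e : ℂ × ℝ, e.2 ∉ K → G e = 0) (N : ℕ) :
    oscInt ρ j ε G =O[Bornology.cobounded ℂ] fun z => ‖z‖ ^ (-ρ) * (Real.log ‖z‖ ^ N)⁻¹ := by
  obtain ⟨C, hC⟩ := exists_bound_oscillation hε hK N G hG h0
  refine Asymptotics.IsBigO.of_bound C ?_
  have : ∀ᶠ z in Bornology.cobounded ℂ, 2 ≤ ‖z‖ :=
    tendsto_norm_cobounded_atTop.eventually_ge_atTop 2
  filter_upwards [this] with z hz
  have hz0 : z ≠ 0 := norm_pos_iff.1 (by linarith)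
  have hlog : 0 < Real.log ‖z‖ := Real.log_pos (by linarith)
  have h1 := hC z (by linarith)
  rw [abs_of_pos hlog, ← le_div_iff₀ (pow_pos hlog N)] at h1
  have e : oscInt ρ j ε G z = gpow z (j, -(ρ : ℂ)) *
      ∫ s : ℝ, Complex.exp (ε * Real.log ‖z‖ * Complex.I * s) * G (z⁻¹, s) := by
    rw [oscInt, ← integral_const_mul]
    congr 1
    ext s
    rw [gpow_oscillation hz0, mul_assoc]
  have e2 : ‖gpow z (j, -(ρ : ℂ))‖ = ‖z‖ ^ (-ρ) := by
    rw [norm_gpow hz0]; simp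
  rw [e, norm_mul, e2, Real.norm_eq_abs, abs_of_pos (by positivity)]
  calc _ ≤ ‖z‖ ^ (-ρ) * (C / Real.log ‖z‖ ^ N) := by gcongr
    _ = _ := by ring

end

/-- The integral of a product of a spectral and a spatial oscillation. -/
def midInt (ρ : ℝ) (j l : ℤ) (H : (ℂ × ℝ) × (ℂ × ℂ) → ℂ) (z : ℂ) : ℂ :=
  ∫ x : ℝ × ℂ, gpow z (j, -((ρ : ℂ) + 1) + Complex.I * x.1) *
    (gpow x.2 (l, 2 * Complex.I * x.1 - 2) * H ((z⁻¹, x.1), (x.2, z⁻¹ / x.2)))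

/-- The dilation field in the first and the last variable. -/
def dilMid (p : (ℂ × ℝ) × (ℂ × ℂ)) (c : ℂ) : (ℂ × ℝ) × (ℂ × ℂ) := ((p.1.1 * c, 0), (0, p.2.2 * c))

lemma contDiff_dilMid (c : ℂ) : ContDiff ℝ ∞ fun p => dilMid p c :=
  (((contDiff_fst.comp contDiff_fst).mul contDiff_const).prodMk contDiff_const).prodMk
    (contDiff_const.prodMk ((contDiff_snd.comp contDiff_snd).mul contDiff_const))

/-- The support condition for amplitudes over the intermediate region. -/
def MidSupport (K : Set ℝ) (H : (ℂ × ℝ) × (ℂ × ℂ) → ℂ) : Prop :=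
  ∀ p, (p.1.2 ∉ K ∨ 1 / 4 < ‖p.2.1‖ ∨ 1 / 4 < ‖p.2.2‖) → H p = 0

section
variable {ρ : ℝ} {j l : ℤ} {H : (ℂ × ℝ) × (ℂ × ℂ) → ℂ} {K : Set ℝ}

/-- The amplitude of the derivative. -/
def midDz (ρ : ℝ) (j : ℤ) (H : (ℂ × ℝ) × (ℂ × ℂ) → ℂ) (p : (ℂ × ℝ) × (ℂ × ℂ)) : ℂ :=
  (j + (-((ρ : ℂ) + 1) + Complex.I * p.1.2)) / 2 * H p - thDer H p (dilMid p)

/-- The amplitude of the conjugate derivative. -/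
def midDzbar (ρ : ℝ) (j : ℤ) (H : (ℂ × ℝ) × (ℂ × ℂ) → ℂ) (p : (ℂ × ℝ) × (ℂ × ℂ)) : ℂ :=
  ((-((ρ : ℂ) + 1) + Complex.I * p.1.2) - j) / 2 * H p - thDerBar H p (dilMid p)

lemma contDiff_ofReal_mid : ContDiff ℝ ∞ fun p : (ℂ × ℝ) × (ℂ × ℂ) => (p.1.2 : ℂ) :=
  contDiff_ofReal_snd.comp contDiff_fst

lemma contDiff_midDz (hH : ContDiff ℝ ∞ H) : ContDiff ℝ ∞ (midDz ρ j H) :=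
  (((contDiff_const.add (contDiff_const.add (contDiff_const.mul contDiff_ofReal_mid))).div_const
    2).mul hH).sub (contDiff_thDer hH contDiff_dilMid)

lemma contDiff_midDzbar (hH : ContDiff ℝ ∞ H) : ContDiff ℝ ∞ (midDzbar ρ j H) :=
  ((((contDiff_const.add (contDiff_const.mul contDiff_ofReal_mid)).sub contDiff_const).div_const
    2).mul hH).sub (contDiff_thDerBar hH contDiff_dilMid)

lemma MidSupport.eventually_zero (hK : IsCompact K) (h : MidSupport K H)
    {p : (ℂ × ℝ) × (ℂ × ℂ)} (hp : p.1.2 ∉ K ∨ 1 / 4 < ‖p.2.1‖ ∨ 1 / 4 < ‖p.2.2‖) :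
    H =ᶠ[𝓝 p] fun _ => 0 := by
  have ho : IsOpen {p : (ℂ × ℝ) × (ℂ × ℂ) | p.1.2 ∉ K ∨ 1 / 4 < ‖p.2.1‖ ∨ 1 / 4 < ‖p.2.2‖} :=
    (hK.isClosed.isOpen_compl.preimage (continuous_snd.comp continuous_fst)).union
      ((isOpen_lt continuous_const (continuous_fst.comp continuous_snd).norm).union
        (isOpen_lt continuous_const (continuous_snd.comp continuous_snd).norm))
  filter_upwards [ho.mem_nhds hp] with y hy using h y hy

lemma MidSupport.dz (hK : IsCompact K) (h : MidSupport K H) : MidSupport K (midDz ρ j H) :=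
  fun p hp => by
    rw [midDz, h p hp, (thDer_eq_zero (h.eventually_zero hK hp) _).1]; simp

lemma MidSupport.dzbar (hK : IsCompact K) (h : MidSupport K H) : MidSupport K (midDzbar ρ j H) :=
  fun p hp => by
    rw [midDzbar, h p hp, (thDer_eq_zero (h.eventually_zero hK hp) _).2]; simp

/-- At u = 0 the convention z⁻¹/0 = 0 does not put the point outside the support of the amplitude,
so the vanishing has to come from the power. -/
lemma gpow_zero_osc (l : ℤ) (s : ℝ) : gpow 0 (l, 2 * Complex.I * s - 2) = 0 := by
  have : 2 * Complex.I * (s : ℂ) - 2 ≠ 0 := by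
    intro h
    have := congrArg Complex.re h
    simp at this
  simp [gpow, Complex.zero_cpow this]

lemma contDiffAt_mid (hH : ContDiff ℝ ∞ H) (h0 : MidSupport K H) {z : ℂ} (hz : z ≠ 0)
    (x : ℝ × ℂ) : ContDiffAt ℝ ∞ (fun e : ℂ × (ℝ × ℂ) =>
      gpow e.1 (j, -((ρ : ℂ) + 1) + Complex.I * e.2.1) *
        (gpow e.2.2 (l, 2 * Complex.I * e.2.1 - 2) *
          H ((e.1⁻¹, e.2.1), (e.2.2, e.1⁻¹ / e.2.2)))) (z, x) := by
  have hs : ContDiff ℝ ∞ fun e : ℂ × (ℝ × ℂ) => (e.2.1 : ℂ) :=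
    Complex.ofRealCLM.contDiff.comp (contDiff_fst.comp contDiff_snd)
  have hs' : ContDiff ℝ ∞ fun e : ℂ × (ℝ × ℂ) => e.2.1 := contDiff_fst.comp contDiff_snd
  have hu : ContDiff ℝ ∞ fun e : ℂ × (ℝ × ℂ) => e.2.2 := contDiff_snd.comp contDiff_snd
  by_cases hx : x.2 = 0
  -- Near u = 0 the quotient z⁻¹/u has norm above 1, hence above 1/4, and the integrand is
  -- identically zero there.
  · have : ∀ᶠ e : ℂ × (ℝ × ℂ) in 𝓝 (z, x), e.1 ≠ 0 ∧ ‖e.2.2‖ * ‖e.1‖ < 1 := by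
      refine (continuousAt_fst.eventually_ne hz).and ?_
      have hc : ContinuousAt (fun e : ℂ × (ℝ × ℂ) => ‖e.2.2‖ * ‖e.1‖) (z, x) := by fun_prop
      exact hc.eventually_lt_const (by simp [hx])
    refine (contDiffAt_const (c := (0 : ℂ))).congr_of_eventuallyEq ?_
    filter_upwards [this] with e he
    by_cases hu0 : e.2.2 = 0
    · rw [hu0, gpow_zero_osc]; ring
    · rw [h0 _ (Or.inr (Or.inr ?_))]
      · ring
      · have p1 := norm_pos_iff.2 hu0
        have p2 := norm_pos_iff.2 he.1
        dsimp only
        rw [norm_div, norm_inv, lt_div_iff₀ p1, lt_inv_comm₀ (by positivity) p2, lt_inv_comm₀ p2 (by positivity)]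
        rw [lt_inv_comm₀ (by positivity) p2, ← one_div, lt_div_iff₀ (by positivity)]
        nlinarith [he.2]
  · refine (contDiffAt_gpow_comp j contDiffAt_fst (contDiffAt_const.add
      (contDiffAt_const.mul hs.contDiffAt)) hz).mul ((contDiffAt_gpow_comp l hu.contDiffAt
      ((contDiffAt_const.mul hs.contDiffAt).sub contDiffAt_const) hx).mul
      (hH.contDiffAt.comp _ (((contDiffAt_fst.inv hz).prodMk hs'.contDiffAt).prodMk
        (hu.contDiffAt.prodMk (contDiffAt_complex_div (contDiffAt_fst.inv hz) hu.contDiffAt hx)))))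

lemma hasWirt_midInt (hH : ContDiff ℝ ∞ H) (hK : IsCompact K) (h0 : MidSupport K H) {z : ℂ}
    (hz : z ≠ 0) :
    HasWirt (midInt ρ j l H) (midInt (ρ + 1) (j - 1) l (midDz ρ j H) z)
      (midInt (ρ + 1) (j + 1) l (midDzbar ρ j H) z) z := by
  have hτ : ∀ s : ℝ, -(((ρ + 1 : ℝ) : ℂ) + 1) + Complex.I * s =
      -((ρ : ℂ) + 1) + Complex.I * s - 1 := fun s => by push_cast; ring
  refine HasWirt.integral (μ := volume) (isOpen_ne.mem_nhds hz)
    (hK.prod (isCompact_closedBall (0 : ℂ) (1 / 4))) (X := ℝ × ℂ)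
    (g := fun z (x : ℝ × ℂ) => gpow z (j, -((ρ : ℂ) + 1) + Complex.I * x.1) *
      (gpow x.2 (l, 2 * Complex.I * x.1 - 2) * H ((z⁻¹, x.1), (x.2, z⁻¹ / x.2))))
    (p := fun z (x : ℝ × ℂ) => gpow z (j - 1, -(((ρ + 1 : ℝ) : ℂ) + 1) + Complex.I * x.1) *
      (gpow x.2 (l, 2 * Complex.I * x.1 - 2) * midDz ρ j H ((z⁻¹, x.1), (x.2, z⁻¹ / x.2))))
    (q := fun z (x : ℝ × ℂ) => gpow z (j + 1, -(((ρ + 1 : ℝ) : ℂ) + 1) + Complex.I * x.1) *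
      (gpow x.2 (l, 2 * Complex.I * x.1 - 2) * midDzbar ρ j H ((z⁻¹, x.1), (x.2, z⁻¹ / x.2))))
    ?_ ?_ ?_
  · intro z _ x hx
    rw [h0, mul_zero, mul_zero]
    rw [Set.mem_prod, not_and_or] at hx
    rcases hx with hx | hx
    · exact Or.inl hx
    · exact Or.inr (Or.inl (by simpa using hx))
  · exact fun z hz x => contDiffAt_mid hH h0 hz x
  · intro x
    have hP : HasFDerivAt (fun z : ℂ => ((z⁻¹, x.1), (x.2, z⁻¹ / x.2)))
        ((((ContinuousLinearMap.inl ℝ ℂ ℝ).comp (z⁻¹ • ContinuousLinearMap.id ℝ ℂ)).prod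
          ((ContinuousLinearMap.inr ℝ ℂ ℂ).comp ((z⁻¹ / x.2) • ContinuousLinearMap.id ℝ ℂ))).comp
          ((-z⁻¹) • ContinuousLinearMap.id ℝ ℂ)) z := by
      have h1 := hasFDerivAt_inv_complex hz
      refine ((h1.prodMk (hasFDerivAt_const x.1 z)).prodMk
        ((hasFDerivAt_const x.2 z).prodMk (h1.mul_const (x.2)⁻¹))).congr_fderiv ?_
      ext <;> simp <;> ring
    have h := (hasWirt_gpow hz j (-((ρ : ℂ) + 1) + Complex.I * x.1)).mul
      ((hasWirt_comp_inv (hH.differentiable (by simp) ((z⁻¹, x.1), (x.2, z⁻¹ / x.2))) _ hP).const_mul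
        (gpow x.2 (l, 2 * Complex.I * x.1 - 2)))
    have e : (⇑(((ContinuousLinearMap.inl ℝ ℂ ℝ).comp (z⁻¹ • ContinuousLinearMap.id ℝ ℂ)).prod
          ((ContinuousLinearMap.inr ℝ ℂ ℂ).comp ((z⁻¹ / x.2) • ContinuousLinearMap.id ℝ ℂ))) :
        ℂ → (ℂ × ℝ) × (ℂ × ℂ)) = dilMid ((z⁻¹, x.1), (x.2, z⁻¹ / x.2)) := by
      funext c; simp [dilMid]
    rw [e] at h
    refine h.congr_coeff ?_ ?_
    · rw [hτ, gpow_sub_one hz, midDz]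
      ring
    · rw [hτ, gpow_conj_sub_one hz, midDzbar, map_inv₀]
      ring

end

/-! ### A class of rapidly decaying functions -/

/-- The weight |u|⁻² is just not integrable at 0. On the support |u||z| ≥ 4, so it is at most
|u|^(-3/2) |z|^(1/2), and half of the extra factor |z|⁻¹ is left. -/
lemma exists_bound_midInt {ρ : ℝ} {j l : ℤ} {H : (ℂ × ℝ) × (ℂ × ℂ) → ℂ} {K : Set ℝ}
    (hH : ContDiff ℝ ∞ H) (hK : IsCompact K) (h0 : MidSupport K H) :
    ∃ C, 0 ≤ C ∧ ∀ z : ℂ, 1 ≤ ‖z‖ → ‖midInt ρ j l H z‖ ≤ C * ‖z‖ ^ (-ρ - 1 / 2) := by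
  obtain ⟨M, hM⟩ := (((isCompact_closedBall (0 : ℂ) 1).prod hK).prod
    ((isCompact_closedBall (0 : ℂ) (1 / 4)).prod
      (isCompact_closedBall (0 : ℂ) (1 / 4)))).exists_bound_of_continuousOn hH.continuous.continuousOn
  set D : ℝ × ℂ → ℝ := fun x => K.indicator (fun _ => (1 : ℝ)) x.1 *
    (Metric.closedBall (0 : ℂ) (1 / 4)).indicator (fun u => ‖u‖ ^ (-(3 / 2) : ℝ)) x.2 with hD
  have hDi : Integrable D := by
    refine Integrable.mul_prod (μ := volume) (ν := volume) ?_ ?_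
    · rw [integrable_indicator_iff hK.measurableSet]
      exact integrableOn_const hK.measure_lt_top.ne
    · rw [integrable_indicator_iff Metric.isClosed_closedBall.measurableSet]
      exact integrableOn_norm_rpow (by norm_num) _
  have hD0 : ∀ x, 0 ≤ D x := fun x => mul_nonneg
    (Set.indicator_nonneg (fun _ _ => zero_le_one) _)
    (Set.indicator_nonneg (fun _ _ => by positivity) _)
  refine ⟨|M| * ∫ x, D x, mul_nonneg (abs_nonneg _) (integral_nonneg hD0), fun z hz => ?_⟩
  have hz0 : 0 < ‖z‖ := by linarith
  have hzne : z ≠ 0 := norm_pos_iff.1 hz0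
  have hb : ∀ x : ℝ × ℂ, ‖gpow z (j, -((ρ : ℂ) + 1) + Complex.I * x.1) *
      (gpow x.2 (l, 2 * Complex.I * x.1 - 2) * H ((z⁻¹, x.1), (x.2, z⁻¹ / x.2)))‖ ≤
      (|M| * ‖z‖ ^ (-ρ - 1 / 2)) * D x := by
    intro x
    by_cases hc : x.1 ∉ K ∨ 1 / 4 < ‖x.2‖ ∨ 1 / 4 < ‖z⁻¹ / x.2‖
    · rw [h0 ((z⁻¹, x.1), (x.2, z⁻¹ / x.2)) hc, mul_zero, mul_zero, norm_zero]
      exact mul_nonneg (by positivity) (hD0 x)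
    · by_cases hu : x.2 = 0
      · rw [hu, gpow_zero_osc, zero_mul, mul_zero, norm_zero]
        exact mul_nonneg (by positivity) (hD0 x)
      push Not at hc
      obtain ⟨c1, c2, c3⟩ := hc
      have hu0 : 0 < ‖x.2‖ := norm_pos_iff.2 hu
      have hDx : D x = ‖x.2‖ ^ (-(3 / 2) : ℝ) := by
        rw [hD]
        dsimp only
        rw [Set.indicator_of_mem c1, Set.indicator_of_mem (by simpa using c2), one_mul]
      have hHx : ‖H ((z⁻¹, x.1), (x.2, z⁻¹ / x.2))‖ ≤ |M| :=
        (hM ((z⁻¹, x.1), (x.2, z⁻¹ / x.2)) ⟨⟨by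
          simpa using inv_le_one_of_one_le₀ hz, c1⟩, by simpa using c2, by
            rw [mem_closedBall_zero_iff]; exact c3⟩).trans (le_abs_self M)
      have e1 : ‖gpow z (j, -((ρ : ℂ) + 1) + Complex.I * x.1)‖ = ‖z‖ ^ (-(ρ + 1)) := by
        rw [norm_gpow hzne]; simp
      have e2 : ‖gpow x.2 (l, 2 * Complex.I * x.1 - 2)‖ = ‖x.2‖ ^ (-2 : ℝ) := by
        rw [norm_gpow hu]; simp
      have h1 : 1 ≤ ‖x.2‖ * ‖z‖ := by
        rw [norm_div, norm_inv, div_le_iff₀ hu0, inv_le_iff_one_le_mul₀ hz0] at c3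
        nlinarith [mul_pos hu0 hz0]
      have h2 : 1 ≤ (‖x.2‖ * ‖z‖) ^ (1 / 2 : ℝ) := Real.one_le_rpow h1 (by norm_num)
      rw [Real.mul_rpow hu0.le hz0.le] at h2
      rw [norm_mul, norm_mul, e1, e2, hDx]
      have e3 : ‖x.2‖ ^ (-(3 / 2) : ℝ) = ‖x.2‖ ^ (-2 : ℝ) * ‖x.2‖ ^ (1 / 2 : ℝ) := by
        rw [← Real.rpow_add hu0]; norm_num
      have e4 : ‖z‖ ^ (-ρ - 1 / 2) = ‖z‖ ^ (-(ρ + 1)) * ‖z‖ ^ (1 / 2 : ℝ) := by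
        rw [← Real.rpow_add hz0]; congr 1; ring
      rw [e3, e4]
      calc ‖z‖ ^ (-(ρ + 1)) * (‖x.2‖ ^ (-2 : ℝ) * ‖H ((z⁻¹, x.1), (x.2, z⁻¹ / x.2))‖)
          ≤ ‖z‖ ^ (-(ρ + 1)) * (‖x.2‖ ^ (-2 : ℝ) * |M|) := by gcongr
        _ = (‖z‖ ^ (-(ρ + 1)) * (‖x.2‖ ^ (-2 : ℝ) * |M|)) * 1 := by ring
        _ ≤ (‖z‖ ^ (-(ρ + 1)) * (‖x.2‖ ^ (-2 : ℝ) * |M|)) *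
            (‖x.2‖ ^ (1 / 2 : ℝ) * ‖z‖ ^ (1 / 2 : ℝ)) := by gcongr
        _ = _ := by ring
  have := norm_integral_le_of_norm_le (hDi.const_mul (|M| * ‖z‖ ^ (-ρ - 1 / 2)))
    (Filter.Eventually.of_forall hb)
  rw [integral_const_mul] at this
  rw [midInt]
  refine this.trans (le_of_eq ?_)
  ring

lemma isBigO_midInt {ρ : ℝ} {j l : ℤ} {H : (ℂ × ℝ) × (ℂ × ℂ) → ℂ} {K : Set ℝ}
    (hH : ContDiff ℝ ∞ H) (hK : IsCompact K) (h0 : MidSupport K H) (N : ℕ) :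
    midInt ρ j l H =O[Bornology.cobounded ℂ] fun z => ‖z‖ ^ (-ρ) * (Real.log ‖z‖ ^ N)⁻¹ := by
  obtain ⟨C, hC0, hC⟩ := exists_bound_midInt (ρ := ρ) (j := j) (l := l) hH hK h0
  obtain ⟨C', hC'⟩ : ∃ C' : ℝ, ∀ r : ℝ, 0 < r → r ≤ 1 → r ^ (1 / 2 : ℝ) * |Real.log r| ^ N ≤ C' :=
    ⟨_, fun r hr hr1 => rpow_mul_abs_log_pow_le (R := 1) (by norm_num) N hr hr1⟩
  refine Asymptotics.IsBigO.of_bound (C * C') ?_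
  have : ∀ᶠ z in Bornology.cobounded ℂ, 2 ≤ ‖z‖ :=
    tendsto_norm_cobounded_atTop.eventually_ge_atTop 2
  filter_upwards [this] with z hz
  have hz0 : 0 < ‖z‖ := by linarith
  have hlog : 0 < Real.log ‖z‖ := Real.log_pos (by linarith)
  have h1 := hC' ‖z‖⁻¹ (inv_pos.2 hz0) (inv_le_one_of_one_le₀ (by linarith))
  rw [Real.log_inv, abs_neg, abs_of_pos hlog, ← le_div_iff₀ (pow_pos hlog N)] at h1
  refine (hC z (by linarith)).trans ?_
  rw [Real.norm_eq_abs, abs_of_pos (by positivity)]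
  have e : ‖z‖ ^ (-ρ - 1 / 2) = ‖z‖ ^ (-ρ) * ‖z‖⁻¹ ^ (1 / 2 : ℝ) := by
    rw [Real.inv_rpow hz0.le, ← Real.rpow_neg hz0.le, ← Real.rpow_add hz0]
    congr 1
  rw [e]
  calc C * (‖z‖ ^ (-ρ) * ‖z‖⁻¹ ^ (1 / 2 : ℝ)) ≤ C * (‖z‖ ^ (-ρ) * (C' / Real.log ‖z‖ ^ N)) := by
        gcongr
    _ = _ := by ring

/-- Sums of oscillatory integrals that decay at infinity as `|z|^(-ρ)` and faster than any power
of `ln |z|`. -/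
inductive DecayClass (ρ : ℝ) : (ℂ → ℂ) → Prop
  | osc (j : ℤ) (ε : ℝ) (G : ℂ × ℝ → ℂ) (K : Set ℝ) (hε : ε ≠ 0) (hG : ContDiff ℝ ∞ G)
      (hK : IsCompact K) (h0 : ∀ e : ℂ × ℝ, e.2 ∉ K → G e = 0) : DecayClass ρ (oscInt ρ j ε G)
  | mid (j l : ℤ) (H : (ℂ × ℝ) × (ℂ × ℂ) → ℂ) (K : Set ℝ) (hH : ContDiff ℝ ∞ H)
      (hK : IsCompact K) (h0 : MidSupport K H) : DecayClass ρ (midInt ρ j l H)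
  | add (f g : ℂ → ℂ) (hf : DecayClass ρ f) (hg : DecayClass ρ g) :
      DecayClass ρ fun z => f z + g z

section
variable {ρ : ℝ} {f : ℂ → ℂ}

lemma DecayClass.isBigO (h : DecayClass ρ f) (N : ℕ) :
    f =O[Bornology.cobounded ℂ] fun z => ‖z‖ ^ (-ρ) * (Real.log ‖z‖ ^ N)⁻¹ := by
  induction h with
  | osc j ε G K hε hG hK h0 => exact isBigO_oscInt hε hG hK h0 N
  | mid j l H K hH hK h0 => exact isBigO_midInt hH hK h0 N
  | add f g _ _ ihf ihg => exact ihf.add ihg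

/-- The decay of derivatives cannot be read off from the decay of the function; it follows because
the integral form persists under differentiation, with ρ raised by one. -/
lemma DecayClass.exists_hasWirt (h : DecayClass ρ f) : ∃ g g' : ℂ → ℂ, DecayClass (ρ + 1) g ∧
    DecayClass (ρ + 1) g' ∧ ∀ z ≠ 0, HasWirt f (g z) (g' z) z := by
  induction h with
  | osc j ε G K hε hG hK h0 =>
    refine ⟨_, _, .osc (j - 1) ε (oscDz ρ j ε G) K hε (contDiff_oscDz hG) hK ?_,
      .osc (j + 1) ε (oscDzbar ρ j ε G) K hε (contDiff_oscDzbar hG) hK ?_,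
      fun z hz => hasWirt_oscInt hG hK h0 hz⟩
    · intro e he
      rw [oscDz, h0 e he, (thDer_eq_zero (osc_eventually_zero hK h0 he) _).1]; simp
    · intro e he
      rw [oscDzbar, h0 e he, (thDer_eq_zero (osc_eventually_zero hK h0 he) _).2]; simp
  | mid j l H K hH hK h0 =>
    exact ⟨_, _, .mid (j - 1) l (midDz ρ j H) K (contDiff_midDz hH) hK (h0.dz hK),
      .mid (j + 1) l (midDzbar ρ j H) K (contDiff_midDzbar hH) hK (h0.dzbar hK),
      fun z hz => hasWirt_midInt hH hK h0 hz⟩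
  | add f g _ _ ihf ihg =>
    obtain ⟨f1, f2, h1, h2, h3⟩ := ihf
    obtain ⟨g1, g2, k1, k2, k3⟩ := ihg
    exact ⟨_, _, .add _ _ h1 k1, .add _ _ h2 k2, fun z hz => (h3 z hz).add (k3 z hz)⟩

lemma DecayClass.sum {ι : Type} (T : Finset ι) (hT : T.Nonempty) {f : ι → ℂ → ℂ}
    (h : ∀ i, DecayClass ρ (f i)) : DecayClass ρ fun z => ∑ i ∈ T, f i z := by
  classical
  induction hT using Finset.Nonempty.cons_induction with
  | singleton i => simpa using h i
  | cons i T hi hT ih =>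
    simp only [Finset.sum_cons]
    exact .add _ _ (h i) ih

lemma iterate_dz_congr {f g : ℂ → ℂ} {U : Set ℂ} (hU : IsOpen U) (h : ∀ z ∈ U, f z = g z) :
    (∀ z ∈ U, dz f z = dz g z) ∧ ∀ z ∈ U, dzbar f z = dzbar g z := by
  have : ∀ z ∈ U, fderiv ℝ f z = fderiv ℝ g z := fun z hz => by
    have e : f =ᶠ[𝓝 z] g := by
      filter_upwards [hU.mem_nhds hz] with y hy using h y hy
    exact e.fderiv_eq
  exact ⟨fun z hz => by rw [dz, dz, this z hz], fun z hz => by rw [dzbar, dzbar, this z hz]⟩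

theorem DecayClass.exists_iterate {g : ℂ → ℂ} {U : Set ℂ} (hU : IsOpen U) (hU0 : ∀ z ∈ U, z ≠ 0)
    (h : DecayClass ρ f) (hg : ∀ z ∈ U, g z = f z) (p q : ℕ) :
    ∃ f', DecayClass (ρ + p + q) f' ∧ ∀ z ∈ U, (dz^[p] (dzbar^[q] g)) z = f' z := by
  have hq : ∃ f', DecayClass (ρ + q) f' ∧ ∀ z ∈ U, (dzbar^[q] g) z = f' z := by
    induction q with
    | zero => exact ⟨f, by simpa using h, hg⟩
    | succ q ih =>
      obtain ⟨f', h1, h2⟩ := ih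
      obtain ⟨_, g2, _, h4, h5⟩ := h1.exists_hasWirt
      refine ⟨g2, by convert h4 using 1; push_cast; ring, fun z hz => ?_⟩
      rw [Function.iterate_succ_apply', (iterate_dz_congr hU h2).2 z hz,
        (h5 z (hU0 z hz)).dzbar_eq]
  induction p with
  | zero => simpa using hq
  | succ p ih =>
    obtain ⟨f', h1, h2⟩ := ih
    obtain ⟨g1, _, h3, _, h5⟩ := h1.exists_hasWirt
    refine ⟨g1, by convert h3 using 1; push_cast; ring, fun z hz => ?_⟩
    rw [Function.iterate_succ_apply', (iterate_dz_congr hU h2).1 z hz,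
      (h5 z (hU0 z hz)).dz_eq]

end

/-! ### The expansion at infinity -/

lemma oscWt_div (l : ℤ) (σ : ℂ) {w u : ℂ} (hw : w ≠ 0) (hu : u ≠ 0) :
    (‖w‖ : ℂ) ^ 2 * ((‖u‖ : ℂ) ^ 4)⁻¹ * oscWt l σ w (w / u) =
      gpow w (l, σ + 2) * oscWt (-l) (-σ - 4) w u := by
  have e1 : w / (w / u) = u := by field_simp
  have e2 : gpow w (l, σ + 2) = gpow w (l, σ) * (‖w‖ : ℂ) ^ 2 := by
    rw [← gpow_pairOne, ← gpow_add hw]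
    congr 1; ext <;> simp [pairOne]
  have e3 : gpow u (-l, -σ - 4) = (gpow u (l, σ))⁻¹ * ((‖u‖ : ℂ) ^ 4)⁻¹ := by
    have hu' : (‖u‖ : ℂ) ≠ 0 := by exact_mod_cast norm_ne_zero_iff.2 hu
    rw [show ((‖u‖ : ℂ) ^ 4)⁻¹ = gpow u (-pairOne - pairOne) by
      rw [gpow_sub hu, gpow_neg, gpow_pairOne]; field_simp, ← gpow_neg, ← gpow_add hu]
    congr 1
    ext
    · simp [pairOne]
    · simp [pairOne]; ring
  rw [oscWt, oscWt, e1, e2, e3, gpow_div]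
  ring

lemma integral_oscWt_swap (l : ℤ) (σ : ℂ) {w : ℂ} (hw : w ≠ 0) (g : ℂ → ℂ) :
    ∫ u, oscWt l σ w u * g (w / u) =
      gpow w (l, σ + 2) * ∫ u, oscWt (-l) (-σ - 4) w u * g u := by
  rw [integral_comp_const_div _ hw, ← integral_const_mul]
  refine integral_congr_ae ?_
  filter_upwards [ae_ne_zero] with u hu
  rw [show w / (w / u) = u by field_simp]
  linear_combination g u * oscWt_div l σ hw hu

/-- The part of a split product that depends on `u` only. -/
def splitU (q r q' r' w u : ℂ) : ℂ :=
  (decC q r w + u * decD q r u w) *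
    (decC q' r' ((starRingEnd ℂ) w) +
      (starRingEnd ℂ) u * decD q' r' ((starRingEnd ℂ) u) ((starRingEnd ℂ) w))

/-- The part of a split product that depends on `y` only. -/
def splitY (q r q' r' w y : ℂ) : ℂ :=
  y * decD r q y w * (decC q' r' ((starRingEnd ℂ) w) +
      (starRingEnd ℂ) y * decD r' q' ((starRingEnd ℂ) y) ((starRingEnd ℂ) w)) +
    decC q r w * ((starRingEnd ℂ) y * decD r' q' ((starRingEnd ℂ) y) ((starRingEnd ℂ) w))

/-- A factor of a mixed term of a split product. -/
def splitM (q r q' r' w u y : ℂ) : ℂ :=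
  decD q r u w * decD r' q' ((starRingEnd ℂ) y) ((starRingEnd ℂ) w)

section
variable {E : Type} [NormedAddCommGroup E] [NormedSpace ℝ E] [FiniteDimensional ℝ E]
  {q r q' r' w u y : E → ℂ} (hq : ContDiff ℝ ∞ q) (hr : ContDiff ℝ ∞ r) (hq' : ContDiff ℝ ∞ q')
  (hr' : ContDiff ℝ ∞ r') (hw : ContDiff ℝ ∞ w)
include hq hr hq' hr' hw

lemma contDiff_splitU (hu : ContDiff ℝ ∞ u) :
    ContDiff ℝ ∞ fun e => splitU (q e) (r e) (q' e) (r' e) (w e) (u e) :=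
  have hc := contDiff_conj.comp hu
  have hwc := contDiff_conj.comp hw
  ((contDiff_decC hq hr hw).add (hu.mul (contDiff_decD hq hr hu hw))).mul
    ((contDiff_decC hq' hr' hwc).add (hc.mul (contDiff_decD hq' hr' hc hwc)))

lemma contDiff_splitY (hy : ContDiff ℝ ∞ y) :
    ContDiff ℝ ∞ fun e => splitY (q e) (r e) (q' e) (r' e) (w e) (y e) :=
  have hc := contDiff_conj.comp hy
  have hwc := contDiff_conj.comp hw
  ((hy.mul (contDiff_decD hr hq hy hw)).mul ((contDiff_decC hq' hr' hwc).add
    (hc.mul (contDiff_decD hr' hq' hc hwc)))).add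
    ((contDiff_decC hq hr hw).mul (hc.mul (contDiff_decD hr' hq' hc hwc)))

lemma contDiff_splitM (hu : ContDiff ℝ ∞ u) (hy : ContDiff ℝ ∞ y) :
    ContDiff ℝ ∞ fun e => splitM (q e) (r e) (q' e) (r' e) (w e) (u e) (y e) :=
  (contDiff_decD hq hr hu hw).mul
    (contDiff_decD hr' hq' (contDiff_conj.comp hy) (contDiff_conj.comp hw))

end

/-- The nine products are grouped by the variables they involve. The weight is no longer radial, so
averaging is not available; instead the mixed products u conj(y) and y conj(u) are small, since |uy|
= |w|. -/
lemma gpow_mul_gpow_eq_split {kQ kS : ℤ} {σQ σS u y : ℂ} (hu : ‖u‖ ≤ 1 / 4) (hy : ‖y‖ ≤ 1 / 4)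
    {q r q' r' : ℂ} (hq : q = (kQ + σQ) / 2) (hr : r = (kS + σS) / 2) (hq' : q' = (σQ - kQ) / 2)
    (hr' : r' = (σS - kS) / 2) :
    gpow (1 - u) (kQ, σQ) * gpow (1 - y) (kS, σS) =
      splitU q r q' r' (u * y) u + splitY q r q' r' (u * y) y +
      (u * (starRingEnd ℂ) y * splitM q r q' r' (u * y) u y +
        y * (starRingEnd ℂ) u * splitM r q r' q' (u * y) y u) := by
  rw [gpow_mul_gpow_eq hu hy, ← hq, ← hr, ← hq', ← hr', splitU, splitY, splitM, splitM]
  ring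

/-- The splitting of an integral over the intermediate region. -/
lemma integral_oscWt_gpow (l : ℤ) (σ : ℂ) {w : ℂ} (hw0 : w ≠ 0) {kQ kS : ℤ} {σQ σS : ℂ}
    {q r q' r' : ℂ} (hq : q = (kQ + σQ) / 2) (hr : r = (kS + σS) / 2) (hq' : q' = (σQ - kQ) / 2)
    (hr' : r' = (σS - kS) / 2) :
    ∫ u, oscWt l σ w u * (gpow (1 - u) (kQ, σQ) * gpow (1 - w / u) (kS, σS)) =
      (∫ u, oscWt l σ w u * splitU q r q' r' w u) +
      gpow w (l, σ + 2) * (∫ u, oscWt (-l) (-σ - 4) w u * splitY q r q' r' w u) +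
      ∫ u, oscWt l σ w u * (u * (starRingEnd ℂ) (w / u) * splitM q r q' r' w u (w / u) +
        w / u * (starRingEnd ℂ) u * splitM r q r' q' w (w / u) u) := by
  have hc : Continuous (starRingEnd ℂ) := Complex.continuous_conj
  have hy : ∀ u : ℂ, u ≠ 0 → ContinuousAt (fun u => w / u) u := fun u hu =>
    continuousAt_const.div continuousAt_id hu
  have cU : Continuous (splitU q r q' r' w) := (contDiff_splitU (E := ℂ) contDiff_const
    contDiff_const contDiff_const contDiff_const contDiff_const contDiff_id).continuous
  have cY : Continuous (splitY q r q' r' w) := (contDiff_splitY (E := ℂ) contDiff_const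
    contDiff_const contDiff_const contDiff_const contDiff_const contDiff_id).continuous
  have cM : ∀ q r q' r' : ℂ, Continuous fun p : ℂ × ℂ => splitM q r q' r' w p.1 p.2 :=
    fun q r q' r' => (contDiff_splitM (E := ℂ × ℂ) contDiff_const contDiff_const contDiff_const
      contDiff_const contDiff_const contDiff_fst contDiff_snd).continuous
  have i1 := integrable_oscWt_mul l σ hw0 (g := splitU q r q' r' w) fun u _ => cU.continuousAt
  have i2 := integrable_oscWt_mul l σ hw0 (g := fun u => splitY q r q' r' w (w / u)) fun u hu =>
    cY.continuousAt.comp (hy u hu)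
  have i3 := integrable_oscWt_mul l σ hw0 (g := fun u => u * (starRingEnd ℂ) (w / u) *
    splitM q r q' r' w u (w / u) + w / u * (starRingEnd ℂ) u * splitM r q r' q' w (w / u) u)
    fun u hu => ((continuousAt_id.mul (hc.continuousAt.comp (hy u hu))).mul
      ((cM q r q' r').continuousAt.comp (f := fun u => (u, w / u))
        (continuousAt_id.prodMk (hy u hu)))).add (((hy u hu).mul hc.continuousAt).mul
      ((cM r q r' q').continuousAt.comp (f := fun u => (w / u, u))
        ((hy u hu).prodMk continuousAt_id)))
  rw [← integral_oscWt_swap l σ hw0 (splitY q r q' r' w), ← integral_add i1 i2]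
  have i12 : Integrable fun u => oscWt l σ w u * splitU q r q' r' w u +
    oscWt l σ w u * splitY q r q' r' w (w / u) := i1.add i2
  rw [← integral_add i12 i3]
  refine integral_congr_ae ?_
  filter_upwards [ae_ne_zero] with u hu
  by_cases h0 : oscWt l σ w u = 0
  · simp only [h0, zero_mul, add_zero]
  obtain ⟨b1, b2⟩ := oscWt_ne_zero h0
  rw [gpow_mul_gpow_eq_split (by linarith) (by linarith) hq hr hq' hr', mul_div_cancel₀ _ hu]
  ring

section
variable {a b : ℝ} (hab : InSquare a b) {F : ℤ × ℝ → ℂ} (hF : F ∈ EvenTestFunctions) (k : ℤ)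
include hab hF

omit hab in
-- The local constant is 2εis for l = 0 and il otherwise; it vanishes only at λ = 0, off the support
-- of the density.
lemma regExp_osc (ε : ℝ) (hε : ε ≠ 0) {l : ℤ} (hl : l = 0 → k = 0) :
    RegExp (locDensity a b F k) l fun e => 2 * (ε * Complex.I * e.2) - 2 := by
  refine ⟨(contDiff_const.mul (contDiff_const.mul contDiff_ofReal_snd)).sub contDiff_const,
    fun e => by simp; norm_num, fun e he => ?_⟩
  unfold ibpConst
  split_ifs with h
  · have hk := hl h
    subst hk
    have h2 := (tsupport_locDensity he).2
    rw [sub_add_cancel]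
    refine mul_ne_zero two_ne_zero (mul_ne_zero (mul_ne_zero (by exact_mod_cast hε)
      Complex.I_ne_zero) ?_)
    intro h3
    have h4 : e.2 = 0 := by exact_mod_cast h3
    rw [h4] at h2
    exact zero_notMem_tsupport_density a b hF h2
  · exact mul_ne_zero (by exact_mod_cast h) Complex.I_ne_zero

/-- The chart at infinity, with the regular, the intermediate and the distant contributions. -/
lemma adjointIntegrand_eq_inf {z : ℂ} (hz : 2048 < ‖z‖) (s : ℝ) :
    adjointIntegrand a b F z k s = gpow z (k, -((2 * a : ℝ) : ℂ) + Complex.I * s) *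
      (locDensity a b F k (z⁻¹, s) * (regNear (exA k s a) (exC k s a) (exB k s b) z⁻¹ +
        (-1) ^ (-k) * (∫ u, oscWt (2 * k) (2 * Complex.I * s - 2) z⁻¹ u *
          (gpow (1 - u) (exC k s a) * gpow (1 - z⁻¹ / u) (exB k s b))) +
        gpow z⁻¹ (2 * k, 2 * Complex.I * s) * regNear (exD k s b) (exB k s b) (exC k s a) z⁻¹)) := by
  have hz0 : z ≠ 0 := norm_pos_iff.1 (by linarith)
  have hw : ‖z⁻¹‖ ≤ 1 / 2048 := by
    rw [norm_inv, one_div]; exact inv_anti₀ (by norm_num) hz.le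
  have e1 : gpow z⁻¹ (exA k s a + pairOne) = gpow z (k, -((2 * a : ℝ) : ℂ) + Complex.I * s) := by
    rw [gpow_inv, ← gpow_neg]
    congr 1
    ext
    · simp [exA, pairOne]
    · simp [exA, pairOne]; ring
  have e2 : -exA k s a - exC k s a - pairOne = (2 * k, 2 * Complex.I * s) := by
    ext
    · simp [exA, exC, pairOne]; ring
    · simp [exA, exC, pairOne]; ring
  have e3 : (2 * k, 2 * Complex.I * s) - pairOne = ((2 * k, 2 * Complex.I * s - 2) : ExpPair) := by
    ext <;> simp [pairOne]
  have e4 : (exC k s a).1 = -k := rfl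
  have e5 : (exC k s a + exB k s b).1 = 0 := by simp [exC, exB]
  rw [adjointIntegrand_eq_inf_chart hab hF hz0 (by linarith) k s, locDensity,
    chi_eq_one hw, Complex.ofReal_one, one_mul, e1, regConf, pairInf_ACB, rest_rhoMid, gpow_neg_one,
    gpow_neg_one, e2, e3, e4, e5, zpow_zero, one_mul]
  change _ * (_ * (_ + (-1) ^ (-k) * (∫ u, oscWt (2 * k) (2 * Complex.I * s - 2) z⁻¹ u * _) + _)) = _
  ring

end

/-! ### Decay at infinity -/

section
variable {ρ : ℝ} {j l : ℤ} {ε : ℝ} {K : Set ℝ}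

lemma integrable_osc {G : ℂ × ℝ → ℂ} (hG : ContDiff ℝ ∞ G) (hK : IsCompact K)
    (h0 : ∀ e : ℂ × ℝ, e.2 ∉ K → G e = 0) {z : ℂ} (hz : z ≠ 0) :
    Integrable fun s : ℝ => gpow z (j, -(ρ : ℂ) + ε * Complex.I * s) * G (z⁻¹, s) := by
  have hs : ContDiff ℝ ∞ fun s : ℝ => (s : ℂ) := Complex.ofRealCLM.contDiff
  have hc : Continuous fun s : ℝ => gpow z (j, -(ρ : ℂ) + ε * Complex.I * s) * G (z⁻¹, s) := by
    refine Continuous.mul ?_ (hG.continuous.comp (Continuous.prodMk_right z⁻¹))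
    refine continuous_iff_continuousAt.2 fun s => ContDiffAt.continuousAt (𝕜 := ℝ) (n := ∞) ?_
    exact contDiffAt_gpow_comp j contDiffAt_const (contDiffAt_const.add
      (contDiffAt_const.mul hs.contDiffAt)) hz
  exact hc.integrable_of_hasCompactSupport (HasCompactSupport.intro hK fun s hs => by
    rw [h0 _ hs, mul_zero])

variable {H : (ℂ × ℝ) × (ℂ × ℂ) → ℂ}

lemma integrable_mid (hH : ContDiff ℝ ∞ H) (hK : IsCompact K) (h0 : MidSupport K H) {z : ℂ}
    (hz : z ≠ 0) : Integrable fun x : ℝ × ℂ => gpow z (j, -((ρ : ℂ) + 1) + Complex.I * x.1) *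
      (gpow x.2 (l, 2 * Complex.I * x.1 - 2) * H ((z⁻¹, x.1), (x.2, z⁻¹ / x.2))) := by
  have hc : Continuous fun x : ℝ × ℂ => gpow z (j, -((ρ : ℂ) + 1) + Complex.I * x.1) *
      (gpow x.2 (l, 2 * Complex.I * x.1 - 2) * H ((z⁻¹, x.1), (x.2, z⁻¹ / x.2))) :=
    continuous_iff_continuousAt.2 fun x => (contDiffAt_mid (ρ := ρ) (j := j) (l := l) hH h0 hz
      x).continuousAt.comp (f := fun x : ℝ × ℂ => (z, x)) (Continuous.prodMk_right z).continuousAt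
  refine hc.integrable_of_hasCompactSupport (HasCompactSupport.intro
    (hK.prod (isCompact_closedBall (0 : ℂ) (1 / 4))) fun x hx => ?_)
  rw [h0, mul_zero, mul_zero]
  rw [Set.mem_prod, not_and_or] at hx
  rcases hx with hx | hx
  · exact Or.inl hx
  · exact Or.inr (Or.inl (by simpa using hx))

lemma gpow_add_two {u : ℂ} (hu : u ≠ 0) (l : ℤ) (σ : ℂ) :
    gpow u (l + 2, σ) = gpow u (l, σ) * (u * ((starRingEnd ℂ) u)⁻¹) := by
  have h1 := gpow_conj_sub_one hu (l + 1) (σ + 1)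
  have h2 := gpow_sub_one hu (l + 1) (σ + 1)
  rw [add_sub_cancel_right] at h1 h2
  rw [add_sub_cancel_right] at h2
  rw [show l + 2 = l + 1 + 1 by ring, h1, h2]
  field_simp

lemma gpow_sub_two {u : ℂ} (hu : u ≠ 0) (l : ℤ) (σ : ℂ) :
    gpow u (l - 2, σ) = gpow u (l, σ) * ((starRingEnd ℂ) u * u⁻¹) := by
  have hu' : (starRingEnd ℂ) u ≠ 0 := (map_ne_zero _).2 hu
  have h := gpow_add_two hu (l - 2) σ
  rw [sub_add_cancel] at h
  rw [h]
  field_simp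

/-- The amplitude of a mixed term. -/
def mixAmp (m : ℂ × ℝ → ℂ) (M : ℂ × ℝ → ℂ × ℂ → ℂ) (p : (ℂ × ℝ) × (ℂ × ℂ)) : ℂ :=
  m p.1 * (((cut (p.2.1 / (1 / 8 : ℝ)) : ℂ) * cut (p.2.2 / (1 / 8 : ℝ))) * M p.1 p.2)

variable {m : ℂ × ℝ → ℂ} {M : ℂ × ℝ → ℂ × ℂ → ℂ}

lemma contDiff_mixAmp (hm : ContDiff ℝ ∞ m)
    (hM : ContDiff ℝ ∞ fun p : (ℂ × ℝ) × (ℂ × ℂ) => M p.1 p.2) : ContDiff ℝ ∞ (mixAmp m M) := by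
  have h1 : ContDiff ℝ ∞ fun u : ℂ => (cut (u / (1 / 8 : ℝ)) : ℂ) :=
    Complex.ofRealCLM.contDiff.comp (contDiff_cut.comp (contDiff_id.div_const _))
  exact (hm.comp contDiff_fst).mul (((h1.comp (contDiff_fst.comp contDiff_snd)).mul
    (h1.comp (contDiff_snd.comp contDiff_snd))).mul hM)

lemma midSupport_mixAmp (h0 : ∀ e : ℂ × ℝ, e.2 ∉ K → m e = 0) : MidSupport K (mixAmp m M) := by
  rintro p (hp | hp | hp)
  · rw [mixAmp, h0 _ hp, zero_mul]
  · rw [mixAmp, cut_div_eq_zero (u := p.2.1) (by norm_num) (by linarith)]; simp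
  · rw [mixAmp, cut_div_eq_zero (u := p.2.2) (by norm_num) (by linarith)]; simp

/-- With w = 1/z one has u conj(w/u) = conj(w) · u/conj(u). The first factor passes into the power
of z, gaining |z|⁻¹, and the second shifts the angular character of u by 2; the other mixed term is
conjugate. -/
lemma gpow_mul_integral_mix {z : ℂ} (hz : z ≠ 0) (k : ℤ) (s : ℝ) (M₁ M₂ : ℂ × ℝ → ℂ × ℂ → ℂ)
    (h₁ : Integrable fun u => gpow z (k + 1, -((ρ : ℂ) + 1) + Complex.I * s) *
      (gpow u (2 * k + 2, 2 * Complex.I * s - 2) * mixAmp m M₁ ((z⁻¹, s), (u, z⁻¹ / u))))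
    (h₂ : Integrable fun u => gpow z (k - 1, -((ρ : ℂ) + 1) + Complex.I * s) *
      (gpow u (2 * k - 2, 2 * Complex.I * s - 2) * mixAmp m M₂ ((z⁻¹, s), (u, z⁻¹ / u)))) :
    gpow z (k, -(ρ : ℂ) + Complex.I * s) * (m (z⁻¹, s) *
      ∫ u, oscWt (2 * k) (2 * Complex.I * s - 2) z⁻¹ u *
        (u * (starRingEnd ℂ) (z⁻¹ / u) * M₁ (z⁻¹, s) (u, z⁻¹ / u) +
          z⁻¹ / u * (starRingEnd ℂ) u * M₂ (z⁻¹, s) (u, z⁻¹ / u))) =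
    (∫ u, gpow z (k + 1, -((ρ : ℂ) + 1) + Complex.I * s) *
      (gpow u (2 * k + 2, 2 * Complex.I * s - 2) * mixAmp m M₁ ((z⁻¹, s), (u, z⁻¹ / u)))) +
    ∫ u, gpow z (k - 1, -((ρ : ℂ) + 1) + Complex.I * s) *
      (gpow u (2 * k - 2, 2 * Complex.I * s - 2) * mixAmp m M₂ ((z⁻¹, s), (u, z⁻¹ / u))) := by
  rw [← integral_const_mul, ← integral_const_mul, ← integral_add h₁ h₂]
  refine integral_congr_ae ?_
  filter_upwards [ae_ne_zero] with u hu
  have hτ : -((ρ : ℂ) + 1) + Complex.I * s = -(ρ : ℂ) + Complex.I * s - 1 := by ring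
  rw [hτ, gpow_conj_sub_one hz, gpow_sub_one hz, gpow_add_two hu, gpow_sub_two hu, mixAmp, mixAmp,
    oscWt, map_div₀, map_inv₀]
  dsimp only
  ring

end

section
variable {a b : ℝ} (hab : InSquare a b) {F : ℤ × ℝ → ℂ} (hF : F ∈ EvenTestFunctions) (k : ℤ)
include hab hF

/-- All contributions are sorted by their oscillation in z: one sign of λ is collected in `G₁`, the
other in `G₂`, and the mixed terms become two members of `midInt`. -/
theorem exists_decayClass_integral : ∃ f, DecayClass (2 * a) f ∧ ∀ z : ℂ, 2048 < ‖z‖ →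
    ∫ s, adjointIntegrand a b F z k s = f z := by
  set m := locDensity a b F k with hm_def
  set K := tsupport (density a b F k) with hK_def
  have hK : IsCompact K := hasCompactSupport_density a b hF k
  have hm : ContDiff ℝ ∞ m := contDiff_locDensity hab hF k
  have hm0 : ∀ e : ℂ × ℝ, e.2 ∉ K → m e = 0 := fun e he => by
    simp [hm_def, locDensity, image_eq_zero_of_notMem_tsupport he]
  have hmw : ∀ e ∈ tsupport m, ‖e.1‖ ≤ 1 / 256 := fun e he => (tsupport_locDensity he).1
  obtain ⟨hA, hB, hC, hD⟩ := regExp_all (m := m) hab hF (fun e he => (tsupport_locDensity he).2)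
  -- the exponents
  set q : ℝ → ℂ := fun s => (((exC k s a).1 : ℂ) + (exC k s a).2) / 2 with hq_def
  set r : ℝ → ℂ := fun s => (((exB k s b).1 : ℂ) + (exB k s b).2) / 2 with hr_def
  set q' : ℝ → ℂ := fun s => ((exC k s a).2 - ((exC k s a).1 : ℂ)) / 2 with hq'_def
  set r' : ℝ → ℂ := fun s => ((exB k s b).2 - ((exB k s b).1 : ℂ)) / 2 with hr'_def
  have hι : ContDiff ℝ ∞ fun s : ℝ => ((0 : ℂ), s) := contDiff_const.prodMk contDiff_id
  have hCs : ContDiff ℝ ∞ fun s : ℝ => (exC k s a).2 := hC.contDiff.comp hι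
  have hBs : ContDiff ℝ ∞ fun s : ℝ => (exB k s b).2 := hB.contDiff.comp hι
  have hq : ContDiff ℝ ∞ q := ((contDiff_const (c := ((-k : ℤ) : ℂ))).add hCs).div_const 2
  have hr : ContDiff ℝ ∞ r := ((contDiff_const (c := (k : ℂ))).add hBs).div_const 2
  have hq' : ContDiff ℝ ∞ q' := (hCs.sub (contDiff_const (c := ((-k : ℤ) : ℂ)))).div_const 2
  have hr' : ContDiff ℝ ∞ r' := (hBs.sub (contDiff_const (c := (k : ℂ)))).div_const 2
  have p1 : ContDiff ℝ ∞ fun x : (ℂ × ℝ) × ℂ => x.1.2 := contDiff_snd.comp contDiff_fst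
  have p2 : ContDiff ℝ ∞ fun x : (ℂ × ℝ) × ℂ => x.1.1 := contDiff_fst.comp contDiff_fst
  have P1 : ContDiff ℝ ∞ fun x : (ℂ × ℝ) × (ℂ × ℂ) => x.1.2 := contDiff_snd.comp contDiff_fst
  have P2 : ContDiff ℝ ∞ fun x : (ℂ × ℝ) × (ℂ × ℂ) => x.1.1 := contDiff_fst.comp contDiff_fst
  have P3 : ContDiff ℝ ∞ fun x : (ℂ × ℝ) × (ℂ × ℂ) => x.2.1 := contDiff_fst.comp contDiff_snd
  have P4 : ContDiff ℝ ∞ fun x : (ℂ × ℝ) × (ℂ × ℂ) => x.2.2 := contDiff_snd.comp contDiff_snd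
  -- the expansions
  obtain ⟨A₁, B₁, hA₁, hB₁, hz₁, e₁⟩ := exists_regular_expansion hm
    (regExp_osc hF k 1 one_ne_zero (l := 2 * k) (by omega))
    (contDiff_splitU (hq.comp p1) (hr.comp p1) (hq'.comp p1) (hr'.comp p1) p2 contDiff_snd)
  obtain ⟨A₂, B₂, hA₂, hB₂, hz₂, e₂⟩ := exists_regular_expansion hm
    (regExp_osc hF k (-1) (by norm_num) (l := -(2 * k)) (by omega))
    (contDiff_splitY (hq.comp p1) (hr.comp p1) (hq'.comp p1) (hr'.comp p1) p2 contDiff_snd)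
  have n1 := contDiff_mul_regNear (kS := k) hA hC hB.contDiff hm hmw
  have n2 := contDiff_mul_regNear (kS := -k) hD hB hC.contDiff hm hmw
  set c : ℂ := (-1) ^ (-k) with hc
  set G₁ : ℂ × ℝ → ℂ := fun e => m e * regNear (exA k e.2 a) (exC k e.2 a) (exB k e.2 b) e.1 +
    c * (A₁ e + B₂ e) with hG₁
  set G₂ : ℂ × ℝ → ℂ := fun e => m e * regNear (exD k e.2 b) (exB k e.2 b) (exC k e.2 a) e.1 +
    c * (B₁ e + A₂ e) with hG₂
  have sG₁ : ContDiff ℝ ∞ G₁ := n1.add (contDiff_const.mul (hA₁.add hB₂))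
  have sG₂ : ContDiff ℝ ∞ G₂ := n2.add (contDiff_const.mul (hB₁.add hA₂))
  have zG₁ : ∀ e : ℂ × ℝ, e.2 ∉ K → G₁ e = 0 := fun e he => by
    simp [hG₁, hm0 e he, hz₁ e (hm0 e he), hz₂ e (hm0 e he)]
  have zG₂ : ∀ e : ℂ × ℝ, e.2 ∉ K → G₂ e = 0 := fun e he => by
    simp [hG₂, hm0 e he, hz₁ e (hm0 e he), hz₂ e (hm0 e he)]
  set M₁ : ℂ × ℝ → ℂ × ℂ → ℂ := fun e p =>
    splitM (q e.2) (r e.2) (q' e.2) (r' e.2) e.1 p.1 p.2 with hM₁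
  set M₂ : ℂ × ℝ → ℂ × ℂ → ℂ := fun e p =>
    splitM (r e.2) (q e.2) (r' e.2) (q' e.2) e.1 p.2 p.1 with hM₂
  have hcm : ContDiff ℝ ∞ fun e => c * m e := contDiff_const.mul hm
  have hcm0 : ∀ e : ℂ × ℝ, e.2 ∉ K → c * m e = 0 := fun e he => by rw [hm0 e he, mul_zero]
  have sH₁ : ContDiff ℝ ∞ (mixAmp (fun e => c * m e) M₁) := contDiff_mixAmp hcm
    (contDiff_splitM (hq.comp P1) (hr.comp P1) (hq'.comp P1) (hr'.comp P1) P2 P3 P4)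
  have sH₂ : ContDiff ℝ ∞ (mixAmp (fun e => c * m e) M₂) := contDiff_mixAmp hcm
    (contDiff_splitM (hr.comp P1) (hq.comp P1) (hr'.comp P1) (hq'.comp P1) P2 P4 P3)
  have zH₁ : MidSupport K (mixAmp (fun e => c * m e) M₁) := midSupport_mixAmp hcm0
  have zH₂ : MidSupport K (mixAmp (fun e => c * m e) M₂) := midSupport_mixAmp hcm0
  refine ⟨_, ((DecayClass.osc k 1 G₁ K one_ne_zero sG₁ hK zG₁).add _ _
    (DecayClass.osc (-k) (-1) G₂ K (by norm_num) sG₂ hK zG₂)).add _ _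
    ((DecayClass.mid (k + 1) (2 * k + 2) _ K sH₁ hK zH₁).add _ _
    (DecayClass.mid (k - 1) (2 * k - 2) _ K sH₂ hK zH₂)), fun z hz => ?_⟩
  have hz0 : z ≠ 0 := norm_pos_iff.1 (by linarith)
  have hw0 : z⁻¹ ≠ 0 := inv_ne_zero hz0
  have hw : ‖z⁻¹‖ ≤ 1 / 256 := by
    rw [norm_inv, one_div]; exact inv_anti₀ (by norm_num) (by linarith)
  have i₁ := integrable_osc (ρ := 2 * a) (j := k) (ε := 1) sG₁ hK zG₁ hz0
  have i₂ := integrable_osc (ρ := 2 * a) (j := -k) (ε := -1) sG₂ hK zG₂ hz0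
  have i₃ := integrable_mid (ρ := 2 * a) (j := k + 1) (l := 2 * k + 2) sH₁ hK zH₁ hz0
  have i₄ := integrable_mid (ρ := 2 * a) (j := k - 1) (l := 2 * k - 2) sH₂ hK zH₂ hz0
  rw [oscInt, oscInt, midInt, midInt, Measure.volume_eq_prod, integral_prod _ i₃, integral_prod _ i₄,
    ← integral_add i₁ i₂, ← integral_add i₃.integral_prod_left i₄.integral_prod_left]
  refine Eq.trans ?_ (integral_add (i₁.add i₂) (i₃.integral_prod_left.add i₄.integral_prod_left))
  refine integral_congr_ae ?_
  filter_upwards [i₃.prod_right_ae, i₄.prod_right_ae] with s h₃ h₄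
  have E₁ := e₁ z⁻¹ hw0 hw s
  have E₂ := e₂ z⁻¹ hw0 hw s
  have E₃ := gpow_mul_integral_mix (ρ := 2 * a) (m := fun e => c * m e) hz0 k s M₁ M₂ h₃ h₄
  have E₄ := integral_oscWt_gpow (2 * k) (2 * Complex.I * s - 2) hw0 (kQ := (exC k s a).1)
    (kS := (exB k s b).1) (σQ := (exC k s a).2) (σS := (exB k s b).2) (q := q s) (r := r s)
    (q' := q' s) (r' := r' s) rfl rfl rfl rfl
  have t1 : 2 * (((1 : ℝ) : ℂ) * Complex.I * (z⁻¹, s).2) - 2 = 2 * Complex.I * s - 2 := by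
    push_cast; ring
  have t2 : 2 * (((-1 : ℝ) : ℂ) * Complex.I * (z⁻¹, s).2) - 2 = -(2 * Complex.I * s - 2) - 4 := by
    push_cast; ring
  have t3 : gpow z (-k, -((2 * a : ℝ) : ℂ) + ((-1 : ℝ) : ℂ) * Complex.I * s) =
      gpow z (k, -((2 * a : ℝ) : ℂ) + Complex.I * s) * gpow z⁻¹ (2 * k, 2 * Complex.I * s) := by
    rw [gpow_inv, ← gpow_neg, ← gpow_add hz0]
    congr 1
    ext
    · simp; ring
    · simp; ring
  -- The y-part comes with the power of w attached to 2λ, and its inner end brings the inverse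
  -- power. These cancel, which is why `B₂` belongs to `G₁` and `A₂` to `G₂`.
  have t4 : gpow z⁻¹ (-(2 * k), -(2 * Complex.I * s)) * gpow z⁻¹ (2 * k, 2 * Complex.I * s) = 1 := by
    rw [← gpow_add hw0]
    have : ((-(2 * k), -(2 * Complex.I * s)) : ExpPair) + (2 * k, 2 * Complex.I * s) = 0 := by
      ext <;> simp
    rw [this, gpow_zero]
  have t5 : -(2 * Complex.I * s - 2) - 4 + 2 = -(2 * Complex.I * (s : ℂ)) := by ring
  rw [t1] at E₁
  rw [t2, t5] at E₂
  rw [sub_add_cancel] at E₁ E₄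
  dsimp only [Function.comp] at E₁ E₂
  rw [adjointIntegrand_eq_inf hab hF k hz s]
  change _ = _ + _ + (_ + _)
  rw [← E₃, t3, Complex.ofReal_one, one_mul]
  change _ * (_ * (_ + c * (∫ u, _ * (gpow (1 - u) ((exC k s a).1, (exC k s a).2) *
    gpow (1 - z⁻¹ / u) ((exB k s b).1, (exB k s b).2))) + _)) = _
  rw [E₄]
  simp only [hG₁, hG₂, hM₁, hM₂]
  linear_combination gpow z (k, -((2 * a : ℝ) : ℂ) + Complex.I * s) * c * (E₁ +
    gpow z⁻¹ (2 * k, 2 * Complex.I * s) * E₂ + B₂ (z⁻¹, s) * t4)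

theorem isBigO_iterate_adjointJ (p q N : ℕ) :
    (dz^[p] (dzbar^[q] (adjointJ a b F))) =O[Bornology.cobounded ℂ]
      fun z => ‖z‖ ^ (-2 * a - p - q) * (Real.log ‖z‖ ^ N)⁻¹ := by
  obtain ⟨T, hT⟩ := exists_finset_support hF
  choose f hf hfz using exists_decayClass_integral hab hF
  -- `DecayClass.sum` requires a nonempty index set; inserting 0 provides one even if `T` is empty.
  have hT' : ∀ k ∉ insert 0 T, ∀ s, F (k, s) = 0 := fun k hk =>
    hT k fun h => hk (Finset.mem_insert_of_mem h)
  have hU : IsOpen {z : ℂ | 2048 < ‖z‖} := isOpen_lt continuous_const continuous_norm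
  obtain ⟨g, hg, hgz⟩ := (DecayClass.sum (insert 0 T) (Finset.insert_nonempty 0 T)
    hf).exists_iterate (g := adjointJ a b F) hU
      (fun z hz => norm_pos_iff.1 (lt_trans (by norm_num) hz)) (fun z hz => by
        rw [adjointJ_eq_sum a b hT' z]
        exact Finset.sum_congr rfl fun k _ => hfz k z hz) p q
  have h := hg.isBigO N
  rw [show -(2 * a + p + q) = -2 * a - p - q by ring] at h
  refine h.congr' ?_ Filter.EventuallyEq.rfl
  filter_upwards [tendsto_norm_cobounded_atTop.eventually_gt_atTop 2048] with z hz
  exact (hgz z hz).symm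

end

/-! ### Square integrability -/

/-- The growth exponent η is -κ for κ < 0, 1/2 for the logarithm and 0 for κ > 0. Against the weight
|z - z₀|^(-κ) the square then has exponent κ, -1 or -κ, above -2 in each case. -/
lemma HasExpansionAt.exists_isBigO {f : ℂ → ℂ} {z₀ : ℂ} {κ : ℝ} (h : HasExpansionAt f z₀ κ)
    (h1 : -2 < κ) (h2 : κ < 2) : ∃ η : ℝ, -2 < -2 * η - κ ∧
      f =O[𝓝[≠] z₀] fun z => ‖z - z₀‖ ^ (-η) := by
  obtain ⟨r, hr, α, β, hα, hβ, hf⟩ := h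
  have hb : Metric.ball z₀ r ∈ 𝓝 z₀ := Metric.ball_mem_nhds z₀ hr
  have bd : ∀ {γ : ℂ → ℂ}, ContDiffOn ℝ ∞ γ (Metric.ball z₀ r) →
      γ =O[𝓝[≠] z₀] fun _ => (1 : ℝ) := fun hγ =>
    ((hγ.continuousOn.continuousAt hb).isBigO_one ℝ).mono nhdsWithin_le_nhds
  have hS : ∃ η : ℝ, 0 ≤ η ∧ -2 < -2 * η - κ ∧
      (fun z => ((if κ = 0 then Real.log ‖z - z₀‖ else ‖z - z₀‖ ^ κ : ℝ) : ℂ)) =O[𝓝[≠] z₀]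
        fun z => ‖z - z₀‖ ^ (-η) := by
    have hev : ∀ᶠ z in 𝓝[≠] z₀, 0 < ‖z - z₀‖ ∧ ‖z - z₀‖ ≤ 1 := by
      filter_upwards [self_mem_nhdsWithin, nhdsWithin_le_nhds (Metric.ball_mem_nhds z₀ one_pos)]
        with z hz hz1
      exact ⟨norm_pos_iff.2 (sub_ne_zero.2 hz), (mem_ball_iff_norm.1 hz1).le⟩
    rcases lt_trichotomy κ 0 with hκ | hκ | hκ
    · refine ⟨-κ, by linarith, by linarith, ?_⟩
      simp only [hκ.ne, if_false, neg_neg]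
      refine Asymptotics.IsBigO.of_bound 1 (Filter.Eventually.of_forall fun z => ?_)
      simp
    · refine ⟨1 / 2, by norm_num, by linarith, ?_⟩
      simp only [hκ, if_true]
      obtain ⟨C, hC⟩ : ∃ C : ℝ, ∀ t : ℝ, 0 < t → t ≤ 1 → t ^ (1 / 2 : ℝ) * |Real.log t| ^ 1 ≤ C :=
        ⟨_, fun t ht ht1 => rpow_mul_abs_log_pow_le (by norm_num) 1 ht ht1⟩
      refine Asymptotics.IsBigO.of_bound C ?_
      filter_upwards [hev] with z hz
      have h := hC _ hz.1 hz.2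
      rw [Complex.norm_real, Real.norm_eq_abs, Real.norm_eq_abs,
        abs_of_pos (Real.rpow_pos_of_pos hz.1 _), Real.rpow_neg hz.1.le, ← div_eq_mul_inv,
        le_div_iff₀ (Real.rpow_pos_of_pos hz.1 _), mul_comm]
      rw [pow_one] at h
      exact h
    · refine ⟨0, le_rfl, by linarith, ?_⟩
      simp only [hκ.ne', if_false, neg_zero, Real.rpow_zero]
      refine Asymptotics.IsBigO.of_bound 1 ?_
      filter_upwards [hev] with z hz
      rw [Complex.norm_real, Real.norm_eq_abs, abs_of_pos (Real.rpow_pos_of_pos hz.1 _)]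
      simpa using Real.rpow_le_one hz.1.le hz.2 hκ.le
  obtain ⟨η, h0, h3, h4⟩ := hS
  refine ⟨η, h3, ?_⟩
  have h5 : (fun _ : ℂ => (1 : ℝ)) =O[𝓝[≠] z₀] fun z => ‖z - z₀‖ ^ (-η) := by
    refine Asymptotics.IsBigO.of_bound 1 ?_
    filter_upwards [self_mem_nhdsWithin, nhdsWithin_le_nhds (Metric.ball_mem_nhds z₀ one_pos)]
      with z hz hz1
    have p := norm_pos_iff.2 (sub_ne_zero.2 hz)
    have p1 : ‖z - z₀‖ ≤ 1 := (mem_ball_iff_norm.1 hz1).le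
    rw [Real.norm_eq_abs (‖z - z₀‖ ^ (-η)), abs_of_pos (Real.rpow_pos_of_pos p _)]
    simpa using Real.one_le_rpow_of_pos_of_le_one_of_nonpos p p1 (by linarith)
  have h6 := ((bd hα).trans h5).add (((bd hβ).mul h4).congr_right fun z => one_mul _)
  refine h6.congr' ?_ Filter.EventuallyEq.rfl
  filter_upwards [self_mem_nhdsWithin, nhdsWithin_le_nhds hb] with z hz hz1
  exact (hf z hz1 hz).symm

lemma integrableAtFilter_of_isBigO {f : ℂ → ℂ} {z₀ : ℂ} {κ η : ℝ} (hη : -2 < -2 * η - κ)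
    (h : f =O[𝓝[≠] z₀] fun z => ‖z - z₀‖ ^ (-η)) {g W : ℂ → ℝ} (hg : ContinuousAt g z₀)
    (hW : ∀ z, W z = ‖z - z₀‖ ^ (-κ) * g z)
    (hm : AEStronglyMeasurable (fun z => ‖f z‖ ^ 2 * W z)) :
    IntegrableAtFilter (fun z => ‖f z‖ ^ 2 * W z) (𝓝 z₀) := by
  have h1 : (fun z => ‖f z‖ ^ 2 * W z) =O[𝓝[≠] z₀] fun z => ‖z - z₀‖ ^ (-2 * η - κ) := by
    have h2 := (h.norm_left.pow 2).mul ((Asymptotics.isBigO_refl (fun z => ‖z - z₀‖ ^ (-κ))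
      (𝓝[≠] z₀)).mul ((hg.isBigO_one ℝ).mono nhdsWithin_le_nhds))
    refine h2.congr' (Filter.Eventually.of_forall fun z => by dsimp only; rw [hW]) ?_
    filter_upwards [self_mem_nhdsWithin] with z hz
    have p := norm_pos_iff.2 (sub_ne_zero.2 hz)
    rw [← Real.rpow_natCast, ← Real.rpow_mul p.le, mul_one, ← Real.rpow_add p]
    congr 1
    push_cast; ring
  have h3 : IntegrableAtFilter (fun z : ℂ => ‖z - z₀‖ ^ (-2 * η - κ)) (𝓝[≠] z₀) := by
    refine ⟨Metric.closedBall z₀ 1, nhdsWithin_le_nhds (Metric.closedBall_mem_nhds z₀ one_pos), ?_⟩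
    have h4 := integrableOn_norm_rpow hη 1
    rw [← integrable_indicator_iff Metric.isClosed_closedBall.measurableSet] at h4 ⊢
    refine (h4.comp_sub_right z₀).congr (Filter.Eventually.of_forall fun z => ?_)
    simp only [Set.indicator, Metric.mem_closedBall, dist_eq_norm, sub_zero]
  have : (𝓝[≠] z₀).IsMeasurablyGenerated :=
    (measurableSet_singleton z₀).compl.nhdsWithin_isMeasurablyGenerated z₀
  obtain ⟨s, hs, hi⟩ := h1.integrableAtFilter hm.stronglyMeasurableAtFilter h3
  refine ⟨insert z₀ s, ?_, ?_⟩
  · rw [mem_nhdsWithin_iff_eventually] at hs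
    filter_upwards [hs] with z hz
    by_cases hzz : z = z₀
    · exact Or.inl hzz
    · exact Or.inr (hz hzz)
  · refine (IntegrableOn.union ?_ hi).mono_set (Set.insert_eq z₀ s).le
    rw [IntegrableOn, Measure.restrict_eq_zero.2 (measure_singleton z₀)]
    exact integrable_zero_measure

lemma integrableAtFilter_inv_sq_log :
    IntegrableAtFilter (fun z : ℂ => ‖z‖ ^ (-2 : ℝ) * ((Real.log ‖z‖)⁻¹) ^ 2)
      (Bornology.cobounded ℂ) := by
  refine ⟨{z | 2 < ‖z‖}, tendsto_norm_cobounded_atTop.eventually_gt_atTop 2, ?_⟩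
  have hms : MeasurableSet {z : ℂ | 2 < ‖z‖} := (isOpen_lt continuous_const continuous_norm).measurableSet
  have h : Integrable (fun z : ℂ => (Set.Ioi (2 : ℝ)).indicator
      (fun y => y ^ (-2 : ℝ) * ((Real.log y)⁻¹) ^ 2) ‖z‖) := by
    rw [integrable_fun_norm_addHaar (μ := (volume : Measure ℂ)) (f := (Set.Ioi (2 : ℝ)).indicator
      (fun y => y ^ (-2 : ℝ) * ((Real.log y)⁻¹) ^ 2)), Complex.finrank_real_complex]
    -- In polar coordinates the integrand is 1/(y log² y), with antiderivative -1/log y.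
    have hd : IntegrableOn (fun y : ℝ => (y * Real.log y ^ 2)⁻¹) (Set.Ioi 2) := by
      refine integrableOn_Ioi_deriv_of_nonneg' (g := fun y => -(Real.log y)⁻¹) (l := 0) ?_ ?_ ?_
      · intro y hy
        have hy' : (2 : ℝ) ≤ y := hy
        have hl := (Real.log_pos (by linarith : (1 : ℝ) < y)).ne'
        refine ((Real.hasDerivAt_log (by linarith : y ≠ 0)).inv hl).neg.congr_deriv ?_
        field_simp
      · intro y hy
        have hy' : (2 : ℝ) < y := hy
        positivity
      · simpa using (tendsto_inv_atTop_zero.comp Real.tendsto_log_atTop).neg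
    have h2 := (integrable_indicator_iff measurableSet_Ioi).2 hd
    refine h2.integrableOn.congr (Filter.Eventually.of_forall fun y => ?_)
    by_cases hy : y ∈ Set.Ioi (2 : ℝ)
    · have hy' : (0 : ℝ) < y := lt_trans two_pos hy
      simp only [Set.indicator_of_mem hy, smul_eq_mul]
      rw [Real.rpow_neg hy'.le, Real.rpow_two]
      field_simp
      norm_num
    · simp [Set.indicator_of_notMem hy]
  rw [← integrable_indicator_iff hms]
  exact h.congr (Filter.Eventually.of_forall fun z => rfl)

lemma isBigO_rpow_norm_one_sub (c : ℝ) :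
    (fun z : ℂ => ‖1 - z‖ ^ c) =O[Bornology.cobounded ℂ] fun z => ‖z‖ ^ c := by
  refine Asymptotics.IsBigO.of_bound (2 ^ |c|) ?_
  filter_upwards [tendsto_norm_cobounded_atTop.eventually_gt_atTop 2] with z hz
  have h1 : ‖1 - z‖ ≤ 2 * ‖z‖ := by
    have := norm_sub_le 1 z
    rw [norm_one] at this; linarith
  have h2 : ‖z‖ / 2 ≤ ‖1 - z‖ := by
    have := norm_sub_norm_le z 1
    rw [norm_one, norm_sub_rev] at this; linarith
  have p : 0 < ‖z‖ := by linarith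
  have p1 : 0 < ‖1 - z‖ := by linarith
  rw [Real.norm_eq_abs, Real.norm_eq_abs, abs_of_pos (Real.rpow_pos_of_pos p _),
    abs_of_pos (Real.rpow_pos_of_pos p1 _)]
  rcases le_total 0 c with hc | hc
  · rw [abs_of_nonneg hc, ← Real.mul_rpow two_pos.le p.le]
    exact Real.rpow_le_rpow p1.le h1 hc
  · rw [abs_of_nonpos hc]
    calc _ ≤ (‖z‖ / 2) ^ c := Real.rpow_le_rpow_of_nonpos (by linarith) h2 hc
      _ = _ := by
        rw [Real.div_rpow p.le two_pos.le, Real.rpow_neg two_pos.le]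
        ring

section
variable {a b : ℝ} (hab : InSquare a b) {F : ℤ × ℝ → ℂ} (hF : F ∈ EvenTestFunctions)
include hab hF

/-- Integrability is checked locally and at infinity. The weight behaves like |z|^(4a-2) at infinity
and exactly compensates the decay |z|^(-4a) of the square up to the critical |z|⁻², so one power of
the logarithm in the decay estimate is needed. At 0 and 1 the weight is the singular power with
exponent -κ. -/
theorem memLp_adjointJ : MemLp (adjointJ a b F) 2 (muMeasure a b) := by
  obtain ⟨b1, b2, b3, b4⟩ := id hab
  have ho : IsOpen dotC := isOpen_ne.inter isOpen_ne
  have hc : ContinuousOn (adjointJ a b F) dotC := (contDiffOn_adjointJ hab hF).continuousOn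
  have hmf : AEStronglyMeasurable (adjointJ a b F) := by
    have h := hc.aestronglyMeasurable (μ := volume) ho.measurableSet
    rwa [Measure.restrict_eq_self_of_ae_mem] at h
    filter_upwards [compl_mem_ae_iff.2 (measure_singleton (0 : ℂ)),
      compl_mem_ae_iff.2 (measure_singleton (1 : ℂ))] with z h0 h1 using ⟨h0, h1⟩
  set W : ℂ → ℝ := fun z => ‖z‖ ^ (2 * a + 2 * b - 2) * ‖1 - z‖ ^ (2 * a - 2 * b) with hW
  have hWm : Measurable W := (measurable_norm.pow_const _).mul
    ((measurable_const.sub measurable_id).norm.pow_const _)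
  have hm : AEStronglyMeasurable fun z => ‖adjointJ a b F z‖ ^ 2 * W z :=
    (hmf.norm.pow 2).mul hWm.aestronglyMeasurable
  have hW0 : ∀ z, 0 ≤ W z := fun z => by positivity
  rw [muMeasure, memLp_two_iff_integrable_sq_norm (hmf.mono_ac (withDensity_absolutelyContinuous _ _)),
    integrable_withDensity_iff hWm.ennreal_ofReal
      (Filter.Eventually.of_forall fun _ => ENNReal.ofReal_lt_top)]
  simp only [ENNReal.toReal_ofReal (hW0 _)]
  rw [integrable_iff_integrableAtFilter_cocompact, ← Metric.cobounded_eq_cocompact]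
  constructor
  · have h := ((isBigO_iterate_adjointJ hab hF 0 0 1).norm_left.pow 2).mul
      ((Asymptotics.isBigO_refl (fun z : ℂ => ‖z‖ ^ (2 * a + 2 * b - 2)) _).mul
        (isBigO_rpow_norm_one_sub (2 * a - 2 * b)))
    have : (Bornology.cobounded ℂ).IsMeasurablyGenerated := by
      rw [Metric.cobounded_eq_cocompact]; infer_instance
    refine Asymptotics.IsBigO.integrableAtFilter ?_ hm.stronglyMeasurableAtFilter
      integrableAtFilter_inv_sq_log
    refine h.congr' Filter.EventuallyEq.rfl ?_
    filter_upwards [tendsto_norm_cobounded_atTop.eventually_gt_atTop 2] with z hz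
    have p : 0 < ‖z‖ := by linarith
    have e : ‖z‖ ^ (-2 : ℝ) = ‖z‖ ^ (-2 * a) * ‖z‖ ^ (-2 * a) * (‖z‖ ^ (2 * a + 2 * b - 2) *
        ‖z‖ ^ (2 * a - 2 * b)) := by
      rw [← Real.rpow_add p, ← Real.rpow_add p, ← Real.rpow_add p]
      congr 1; ring
    rw [e]
    simp only [Nat.cast_zero, sub_zero, pow_one]
    ring
  · intro z
    by_cases hz0 : z = 0
    · subst hz0
      obtain ⟨η, h1, h2⟩ := (hasExpansionAt_adjointJ hab hF).1.exists_isBigO (by linarith)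
        (by linarith)
      refine integrableAtFilter_of_isBigO h1 h2 (g := fun z => ‖1 - z‖ ^ (2 * a - 2 * b)) ?_ ?_ hm
      · exact ((continuousAt_const.sub continuousAt_id).norm).rpow_const (Or.inl (by simp))
      · intro z
        rw [hW, sub_zero]
        dsimp only
        congr 2; ring
    by_cases hz1 : z = 1
    · subst hz1
      obtain ⟨η, h1, h2⟩ := (hasExpansionAt_adjointJ hab hF).2.exists_isBigO (by linarith)
        (by linarith)
      refine integrableAtFilter_of_isBigO h1 h2 (g := fun z => ‖z‖ ^ (2 * a + 2 * b - 2)) ?_ ?_ hm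
      · exact continuousAt_id.norm.rpow_const (Or.inl (by simp))
      · intro z
        rw [hW, norm_sub_rev z 1]
        dsimp only
        rw [mul_comm (‖z‖ ^ _)]
        congr 2; ring
    · have hcz : ContinuousOn (fun z => ‖adjointJ a b F z‖ ^ 2 * W z) dotC := by
        refine (hc.norm.pow 2).mul fun x hx => ContinuousAt.continuousWithinAt ?_
        exact (continuousAt_id.norm.rpow_const (Or.inl (norm_ne_zero_iff.2 hx.1))).mul
          ((continuousAt_const.sub continuousAt_id).norm.rpow_const
            (Or.inl (norm_ne_zero_iff.2 (sub_ne_zero.2 (Ne.symm hx.2)))))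
      have h := hcz.locallyIntegrableOn (μ := volume) ho.measurableSet z ⟨hz0, hz1⟩
      rwa [ho.nhdsWithin_eq ⟨hz0, hz1⟩] at h

end


end ComplexHypergeometric

end

open ComplexHypergeometric in
theorem mainTheorem6 (a b : ℝ) (hab : InSquare a b)
    (F : ℤ × ℝ → ℂ) (hF : F ∈ EvenTestFunctions) :
    (∀ z ∈ dotC, ∀ (k : ℤ) (s : ℝ), (k, s) ≠ (0, 0) →
        ∃ G : ℂ × ℂ → ℂ, IsKernelContinuation z k s G) ∧
    (∀ z ∈ dotC, ∀ k : ℤ, MeasureTheory.Integrable (adjointIntegrand a b F z k)) ∧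
    adjointJ a b F ∈ SpaceR a b :=
  ⟨fun _ hz k s _ => exists_isKernelContinuation hz k s,
    fun _ hz k => (interior_smooth hab hF k hz).1, memLp_adjointJ hab hF,
    contDiffOn_adjointJ hab hF, (hasExpansionAt_adjointJ hab hF).1,
    (hasExpansionAt_adjointJ hab hF).2, isBigO_iterate_adjointJ hab hF⟩
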